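/- Conventions. Let $\overline{\mathbb C}$ be the Riemann sphere. For a complex polynomial $p$ with exactly $d\ge 3$ distinct roots (of arbitrary multiplicities), its Newton map is $f_p(z)=z-p(z)/p'(z)$, viewed as a holomorphic self-map of $\overline{\mathbb C}$; it has degree $d$, its finite fixed points are the roots of $p$, and it fixes $\infty$. The space of Newton maps of degree $d$ carries the topology of uniform convergence on $\overline{\mathbb C}$. For a Newton map $f$ with finite fixed points $a_1,\dots,a_d$, let $B_i$ be the immediate basin of $a_i$ (the component containing $a_i$ of $\{z: f^n(z)\to a_i\}$), and call $\mathcal B_f=\bigcup_{n\ge0}f^{-n}(B_1\cup\dots\cup B_d)$ the roots-basin. The map $f$ is roots-basin postcritically-finite if every critical point of $f$ in $\mathcal B_f$ is eventually mapped to one of $a_1,\dots,a_d$. In that case each $B_i$ has a Böttcher coordinate, i.e. a conformal isomorphism $\phi_i:B_i\to\mathbb D$ with $\phi_i\circ f\circ\phi_i^{-1}(w)=w^{m_i}$, $m_i=\deg(f|_{B_i})$; the internal rays in $B_i$ are the sets $\phi_i^{-1}(\{r\zeta:0\le r<1\})$, $|\zeta|=1$. Let $\Delta_0$ be the union of $\{\infty\}$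 and of all internal rays $R$ in $B_1,\dots,B_d$ with $f(R)=R$. For $n\ge 0$ the Newton graph of $f$ of level $n$ is the connected component of $f^{-n}(\Delta_0)$ containing $\infty$; it is mapped into itself by $f$. A Julia critical point is a critical point in the Julia set, and $\deg(g|_z)$ denotes the local degree of $g$ at $z$. Proposition 3.1. Let $d\ge3$, let $f$ be a roots-basin postcritically-finite Newton map of degree $d$, let $k\ge0$, and let $\Delta$ be the Newton graph of $f$ of level $k$. There is a neighborhood $N$ of $f$ in the space of Newton maps of degree $d$ such that the following holds. Let $\Lambda\subseteq N$ be a connected set containing $f$, all of whose elements are roots-basin postcritically-finite. Suppose that for each Julia critical point $c\in\Delta$ of $f$ there is a continuous map $\mathbf c:\Lambda\to\mathbb C$ with $\mathbf c(f)=c$, such that 1. $\deg(g|_{\mathbf c(g)})=\deg(f|_c)$ for all $g\in\Lambda$ and every Julia critical point $c\in\Delta$; 2. if $c_i,c_j\in\Delta$ are Julia critical points and $f^n(c_i)=c_j$ for some $n\ge 0$, then $g^n(\mathbf c_i(g))=\mathbf c_j(g)$ for all $g\in\Lambda$; 3. if $c\in\Delta$ is a Julia critical point and $f^n(c)=\infty$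 for some $n\ge 0$, then $g^n(\mathbf c(g))=\infty$ for all $g\in\Lambda$. Then there is a continuous map $h:\Lambda\times\Delta\to\overline{\mathbb C}$, $(g,z)\mapsto h_g(z)$, such that for every $g\in\Lambda$ the map $h_g:\Delta\to\overline{\mathbb C}$ is injective, its image $h_g(\Delta)$ is the Newton graph of $g$ of level $k$, and $h_g\circ f=g\circ h_g$ on $\Delta$. -/

import Mathlib

open Polynomial Topology Set

noncomputable section

/-- The Riemann sphere. -/
abbrev Sphere : Type := OnePoint ℂ

/-- The Newton map `z ↦ z - p z / p' z` as a self-map of the Riemann sphere. It fixes every root of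
`p` (a multiple root is a removable singularity of the formula) and `∞`, and it sends the zeros of
`p'` that are not roots of `p` to `∞`. -/
def newtonFun (p : ℂ[X]) : Sphere → Sphere
  | OnePoint.infty => OnePoint.infty
  | OnePoint.some z =>
      if p.eval z = 0 then ((z : ℂ) : Sphere)
      else if p.derivative.eval z = 0 then OnePoint.infty
      else ((z - p.eval z / p.derivative.eval z : ℂ) : Sphere)

/-- The Newton maps of degree `d`: the degree of the Newton map of `p` is the number of distinct
roots of `p`. They carry the topology of uniform convergence on the sphere (the compact-open
topology), which is the usual topology on rational maps of a given degree. -/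
abbrev NewtonMap (d : ℕ) : Type :=
  {g : C(Sphere, Sphere) // ∃ p : ℂ[X], p ≠ 0 ∧ p.roots.toFinset.card = d ∧ ⇑g = newtonFun p}

/-- The `n`-th iterate, as a continuous map. -/
def iter (g : C(Sphere, Sphere)) (n : ℕ) : C(Sphere, Sphere) :=
  ⟨g^[n], g.continuous.iterate n⟩

/-! ### Local degree and critical points -/

/-- A local coordinate centred at `b`: `w ↦ w - b` if `b` is finite, `w ↦ 1 / w` if `b = ∞`.
(Values far from `b` are irrelevant.) -/
def localCoord : Sphere → Sphere → ℂ
  | OnePoint.infty, OnePoint.infty => 0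
  | OnePoint.infty, OnePoint.some w => w⁻¹
  | OnePoint.some _, OnePoint.infty => 0
  | OnePoint.some b, OnePoint.some w => w - b

/-- The local parametrization inverse to `localCoord b`, sending `0` to `b`. -/
def localParam : Sphere → ℂ → Sphere
  | OnePoint.infty, t => if t = 0 then OnePoint.infty else ((t⁻¹ : ℂ) : Sphere)
  | OnePoint.some b, t => ((b + t : ℂ) : Sphere)

/-- The local degree of `g` at `z`: the order of vanishing at `0` of `g` written in local
coordinates centred at `z` and at `g z`. -/
def localDegree (g : C(Sphere, Sphere)) (z : Sphere) : ℕ∞ :=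
  analyticOrderAt (fun t : ℂ => localCoord (g z) (g (localParam z t))) 0

/-- The critical points of `g`. -/
def criticalPoints (g : C(Sphere, Sphere)) : Set Sphere :=
  {z | 2 ≤ localDegree g z}

/-! ### Julia set -/

/-- The Fatou set: the points with an open neighbourhood `U` on which the iterates of `g` form a
normal family, i.e. a relatively compact set for locally uniform convergence on `U`. -/
def fatouSet (g : C(Sphere, Sphere)) : Set Sphere :=
  {z | ∃ U : Set Sphere, IsOpen U ∧ z ∈ U ∧
    IsCompact (closure (range fun n : ℕ => (iter g n).restrict U))}

/-- The Julia set. -/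
def juliaSet (g : C(Sphere, Sphere)) : Set Sphere := (fatouSet g)ᶜ

/-! ### The basins of the roots -/

/-- For the Newton map of `p`, the finite fixed points are exactly the roots of `p`. -/
def rootPoints (g : C(Sphere, Sphere)) : Set Sphere :=
  {a | a ≠ OnePoint.infty ∧ g a = a}

/-- The immediate basin of a fixed point `a`: the connected component containing `a` of the set of
points whose orbit converges to `a`. -/
def immediateBasin (g : C(Sphere, Sphere)) (a : Sphere) : Set Sphere :=
  connectedComponentIn {z | Filter.Tendsto (fun n : ℕ => g^[n] z) Filter.atTop (𝓝 a)} a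

/-- The roots-basin: all iterated preimages of the immediate basins of the roots. -/
def rootsBasin (g : C(Sphere, Sphere)) : Set Sphere :=
  ⋃ n : ℕ, g^[n] ⁻¹' (⋃ a ∈ rootPoints g, immediateBasin g a)

/-- Roots-basin postcritically-finite: every critical point in the roots-basin is eventually
mapped to a root. -/
def RootsBasinPCF (g : C(Sphere, Sphere)) : Prop :=
  ∀ z ∈ rootsBasin g, z ∈ criticalPoints g → ∃ n : ℕ, g^[n] z ∈ rootPoints g

/-! ### Internal rays and Newton graphs -/

/-- `ψ` is the inverse of a Böttcher coordinate of the immediate basin of `a`: a conformal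
isomorphism from the unit disc onto the basin that conjugates a power map `w ↦ w ^ m` to `g`
(`m` is then necessarily the degree of `g` on the basin). -/
def IsInverseBottcher (g : C(Sphere, Sphere)) (a : Sphere) (ψ : ℂ → ℂ) : Prop :=
  DifferentiableOn ℂ ψ (Metric.ball 0 1) ∧ InjOn ψ (Metric.ball 0 1) ∧
  (fun w : ℂ => ((ψ w : ℂ) : Sphere)) '' Metric.ball 0 1 = immediateBasin g a ∧
  ∃ m : ℕ, ∀ w ∈ Metric.ball (0 : ℂ) 1, g (ψ w : ℂ) = ((ψ (w ^ m) : ℂ) : Sphere)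

/-- `R` is an internal ray in the immediate basin of `a`: the set corresponding to a radius
`{r ζ : 0 ≤ r < 1}`, `|ζ| = 1`, of the unit disc under a Böttcher coordinate. -/
def IsInternalRay (g : C(Sphere, Sphere)) (a : Sphere) (R : Set Sphere) : Prop :=
  ∃ ψ : ℂ → ℂ, IsInverseBottcher g a ψ ∧ ∃ ζ : ℂ, ‖ζ‖ = 1 ∧
    R = (fun r : ℝ => ((ψ ((r : ℂ) * ζ) : ℂ) : Sphere)) '' Ico 0 1

/-- The Newton graph at level `0`: the fixed internal rays in the immediate basins of the roots,
together with `∞`. -/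
def newtonGraphZero (g : C(Sphere, Sphere)) : Set Sphere :=
  insert OnePoint.infty
    (⋃₀ {R : Set Sphere | ∃ a ∈ rootPoints g, IsInternalRay g a R ∧ g '' R = R})

/-- The Newton graph at level `n`: the connected component containing `∞` of the `n`-th iterated
preimage of the Newton graph at level `0`. -/
def newtonGraph (g : C(Sphere, Sphere)) (n : ℕ) : Set Sphere :=
  connectedComponentIn (g^[n] ⁻¹' newtonGraphZero g) OnePoint.infty

/-- The Julia critical points in the Newton graph at level `n`. -/
def graphJuliaCritical (g : C(Sphere, Sphere)) (n : ℕ) : Set Sphere :=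
  {c | c ∈ newtonGraph g n ∧ c ∈ juliaSet g ∧ c ∈ criticalPoints g}

/-- A Newton map sends each of its Newton graphs into itself. -/
theorem mapsTo_newtonGraph {d : ℕ} (f : NewtonMap d) (n : ℕ) :
    MapsTo f.1 (newtonGraph f.1 n) (newtonGraph f.1 n) := by
  have hinf : f.1 OnePoint.infty = OnePoint.infty := by
    obtain ⟨p, -, -, hp⟩ := f.2
    rw [hp]; rfl
  have h0 : ∀ z ∈ newtonGraphZero f.1, f.1 z ∈ newtonGraphZero f.1 := by
    rintro z (rfl | ⟨R, ⟨a, ha, hR, hRR⟩, hz⟩)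
    · rw [hinf]; exact Or.inl rfl
    · exact Or.inr ⟨R, ⟨a, ha, hR, hRR⟩, hRR ▸ mem_image_of_mem _ hz⟩
  have hmem : OnePoint.infty ∈ (f.1)^[n] ⁻¹' newtonGraphZero f.1 := by
    have : (f.1)^[n] OnePoint.infty = OnePoint.infty := Function.iterate_fixed hinf n
    rw [mem_preimage, this]
    exact Or.inl rfl
  rw [mapsTo_iff_image_subset]
  refine IsPreconnected.subset_connectedComponentIn
    (isPreconnected_connectedComponentIn.image _ f.1.continuous.continuousOn)
    ⟨_, mem_connectedComponentIn hmem, hinf⟩ ?_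
  rintro _ ⟨z, hz, rfl⟩
  have hz' := connectedComponentIn_subset _ _ hz
  rw [mem_preimage, ← Function.iterate_succ_apply, Function.iterate_succ_apply']
  exact h0 _ hz'

/-- The action of a Newton map on its Newton graph at level `n`. -/
def graphMap {d : ℕ} (f : NewtonMap d) (n : ℕ) : newtonGraph f.1 n → newtonGraph f.1 n :=
  (mapsTo_newtonGraph f n).restrict _ _ _

end

/-!
Near `f` the Newton graph is moved by matching points that play the same dynamical role. The
coefficients of the polynomials never enter: the evaluation `(g, z) ↦ g z` is jointly continuous, so
maps near `f` are uniformly close to `f` in charts, and Cauchy's estimates, applied on discs of uniform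
radius, give the persistence of zeros, of local degrees and of normal forms.

*Level zero.* The roots of nearby maps are followed in attracting discs (`exists_rootTracking`). Of
these only the superattracting ones carry internal rays. For a roots-basin postcritically finite
map the critical points that might split off a superattracting root would stay in its basin, so the
local degree there is constant. Hence Böttcher coordinates exist and depend continuously on the
map: on a small disc as a fixed point of a contraction (`exists_log_bottcher`), on the unit disc by
lifting through a covering and by normality (`IsBottcherOn.extend`, `exists_bottcherSystem`). The
rays fixed by `w ↦ w ^ m` land at `∞` (`RootTracking.tendsto_ray`), a repelling fixed point whose
multiplier `D / (D - 1)` takes discrete values and is therefore the same for all nearby maps. Thus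
the rays land uniformly (`eventually_ray_mem`), and corresponding points on them have a ratio close
to `1` near `∞` (`eventually_ray_ratio`). Matching points with the same Böttcher coordinate is
the motion of the level zero graph (`BottcherSystem.graphMotion`).

*From one level to the next.* A `GraphMotion` of `X` is a continuous equivariant motion that is
asymptotic, at each point, to a translation in the local coordinate. Suppose that a point `z` with
`f z ∈ X` can be followed to a point `c g` with `g (c g) = H g (f z)` and the same local degree
`δ`. In charts at `z` and `f z`, the equation `g x = H g (f z')` for the moved point `x` of a point
`z'` near `z` is then a small perturbation of `u ^ δ = 1` for the ratio `u` of `x - c g` and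
`z' - z`, and it has one solution with `u` near `1` (`exists_power_lift`, `exists_liftRel`). This
also shows that the lift is again asymptotically a translation, so that the construction can be
iterated. The local lifts glue by uniqueness (`exists_glued`) to a motion of any relatively open
and closed part of the preimage of `X`, and over such a part no point of the preimage for `g` is
missed (`GraphMotion.lift`).

*Following points of the preimage.* Noncritical points persist. A critical point in the graph is
eventually mapped to `∞` or to a superattracting root (`BottcherSystem.iterate_critical`). In the
second case all critical points of `g` near it lie in the roots-basin; being eventually mapped to a
root, they must be mapped to the moved point (`eventually_exists_of_root`), and a map all of whose
critical points near `z` have the same value has a point of full multiplicity there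
(`exists_multiple_point`). In the first case the critical point is a Julia point
(`mem_juliaSet_of_iterate`), and its marking provides the point: by connectedness of `Λ` the marked
point cannot leave a neighbourhood in which the critical point is the only preimage of `∞`
(`GraphMotion.eventually_marking`).

The component of `∞` is matched with the component of `∞` because the lift also moves a whole
relatively open and closed neighbourhood `Y` of that component (`image_component`). Only the
finitely many critical points inside `Y` have to be followed, and `Y` can be chosen so that all of
them belong to the component itself (`exists_separation_component`).
-/

open scoped OnePoint
open Filter (Tendsto)
open Metric (ball closedBall isOpen_ball ball_mem_nhds closedBall_mem_nhds ball_subset_ball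
  mem_ball_self ball_subset_closedBall closedBall_subset_ball mem_ball sphere)

variable {d : ℕ} {f : NewtonMap d}

/-! ### Charts of the sphere -/

@[simp] lemma localParam_zero (z : Sphere) : localParam z 0 = z := by
  induction z using OnePoint.rec with
  | infty => simp [localParam]
  | coe b => simp [localParam]

lemma localParam_infty_of_ne {t : ℂ} (ht : t ≠ 0) :
    localParam ∞ t = ((t⁻¹ : ℂ) : Sphere) := by
  simp [localParam, ht]

@[simp] lemma localParam_coe (b t : ℂ) : localParam (b : Sphere) t = ((b + t : ℂ) : Sphere) := rfl

@[simp] lemma localCoord_coe_coe (b w : ℂ) : localCoord (b : Sphere) (w : Sphere) = w - b := rfl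

@[simp] lemma localCoord_infty_infty : localCoord ∞ ∞ = 0 := rfl

@[simp] lemma localCoord_infty_coe (w : ℂ) : localCoord ∞ (w : Sphere) = w⁻¹ := rfl

@[simp] lemma localCoord_localParam (z : Sphere) (t : ℂ) : localCoord z (localParam z t) = t := by
  induction z using OnePoint.rec with
  | infty =>
    by_cases ht : t = 0
    · simp [ht]
    · simp [localParam_infty_of_ne ht]
  | coe b => simp

@[simp] lemma localCoord_self (z : Sphere) : localCoord z z = 0 := by
  simpa using localCoord_localParam z 0

/-- The domain of the chart centred at `z`: the sphere minus one point. -/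
def chartDom (z : Sphere) : Set Sphere := range (localParam z)

lemma mem_chartDom_localParam (z : Sphere) (t : ℂ) : localParam z t ∈ chartDom z :=
  mem_range_self t

@[simp] lemma mem_chartDom_self (z : Sphere) : z ∈ chartDom z := ⟨0, by simp⟩

lemma localParam_localCoord {z y : Sphere} (hy : y ∈ chartDom z) :
    localParam z (localCoord z y) = y := by
  obtain ⟨t, rfl⟩ := hy
  simp

lemma localParam_injective (z : Sphere) : Function.Injective (localParam z) :=
  Function.LeftInverse.injective (localCoord_localParam z)

@[simp] lemma mem_chartDom_coe {b : ℂ} {y : Sphere} :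
    y ∈ chartDom (b : Sphere) ↔ y ≠ ∞ := by
  constructor
  · rintro ⟨t, rfl⟩
    simp
  · intro h
    obtain ⟨w, rfl⟩ := OnePoint.ne_infty_iff_exists.1 h
    exact ⟨w - b, by simp⟩

@[simp] lemma mem_chartDom_infty {y : Sphere} :
    y ∈ chartDom ∞ ↔ y ≠ ((0 : ℂ) : Sphere) := by
  constructor
  · rintro ⟨t, rfl⟩
    by_cases ht : t = 0
    · simp [ht]
    · simp [localParam_infty_of_ne ht, ht]
  · intro h
    induction y using OnePoint.rec with
    | infty => exact mem_chartDom_self _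
    | coe w =>
      have hw : w ≠ 0 := by simpa using h
      exact ⟨w⁻¹, by simp [localParam_infty_of_ne (inv_ne_zero hw)]⟩

lemma continuous_localParam (z : Sphere) : Continuous (localParam z) := by
  induction z using OnePoint.rec with
  | infty =>
    rw [continuous_iff_continuousAt]
    intro t
    by_cases ht : t = 0
    · subst ht
      rw [continuousAt_iff_punctured_nhds, localParam_zero]
      have h1 : Tendsto (fun t : ℂ => ((t⁻¹ : ℂ) : Sphere)) (𝓝[≠] 0)
          (𝓝 ∞) := by
        have := OnePoint.tendsto_coe_infty (X := ℂ)
        refine this.comp ?_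
        rw [Filter.coclosedCompact_eq_cocompact, ← Metric.cobounded_eq_cocompact]
        exact Filter.tendsto_inv₀_nhdsNE_zero
      refine h1.congr' ?_
      filter_upwards [self_mem_nhdsWithin] with t ht
      rw [localParam_infty_of_ne ht]
    · have h1 : ContinuousAt (fun t : ℂ => ((t⁻¹ : ℂ) : Sphere)) t :=
        (OnePoint.continuous_coe.continuousAt).comp (continuousAt_inv₀ ht)
      refine h1.congr ?_
      filter_upwards [isOpen_ne.mem_nhds ht] with t ht
      rw [localParam_infty_of_ne ht]
  | coe b =>
    have : localParam (b : Sphere) = fun t => ((b + t : ℂ) : Sphere) := rfl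
    rw [this]
    exact OnePoint.continuous_coe.comp (by fun_prop)

lemma isOpen_chartDom (z : Sphere) : IsOpen (chartDom z) := by
  induction z using OnePoint.rec with
  | infty =>
    have : chartDom ∞ = {((0 : ℂ) : Sphere)}ᶜ := by
      ext y; simp
    rw [this]; exact isOpen_compl_singleton
  | coe b =>
    have : chartDom (b : Sphere) = {∞}ᶜ := by
      ext y; simp
    rw [this]; exact isOpen_compl_singleton

lemma isOpenEmbedding_localParam (z : Sphere) : IsOpenEmbedding (localParam z) := by
  induction z using OnePoint.rec with
  | infty =>
    refine IsOpenEmbedding.of_continuous_injective_isOpenMap (continuous_localParam _)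
      (localParam_injective _) ?_
    -- a set is open in the sphere once its image under the inversion chart is, away from `∞`
    -- by the usual chart and at `∞` by properness
    rw [isOpenMap_iff_nhds_le]
    intro t
    by_cases ht : t = 0
    · subst ht
      rw [localParam_zero]
      intro s hs
      rw [Filter.mem_map] at hs
      obtain ⟨ε, hε, hs⟩ := Metric.mem_nhds_iff.1 hs
      rw [OnePoint.hasBasis_nhds_infty.mem_iff]
      refine ⟨closedBall 0 (2 / ε), ⟨Metric.isClosed_closedBall, isCompact_closedBall _ _⟩,
        ?_⟩
      rintro y (⟨w, hw, rfl⟩ | rfl)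
      · have hw' : 2 / ε < ‖w‖ := by simpa using hw
        have hpos : 0 < ‖w‖ := lt_trans (by positivity) hw'
        have hw0 : w ≠ 0 := norm_pos_iff.1 hpos
        have : w⁻¹ ∈ ball (0 : ℂ) ε := by
          rw [mem_ball_zero_iff, norm_inv, inv_lt_comm₀ hpos hε]
          refine lt_trans ?_ hw'
          rw [inv_eq_one_div]
          gcongr
          norm_num
        have h2 := hs this
        rwa [mem_preimage, localParam_infty_of_ne (inv_ne_zero hw0), inv_inv] at h2
      · have h2 := hs (mem_ball_self hε)
        rwa [mem_preimage, localParam_zero] at h2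
    · have h1 : Filter.map (localParam ∞) (𝓝 t)
          = Filter.map (fun t : ℂ => ((t⁻¹ : ℂ) : Sphere)) (𝓝 t) := by
        refine Filter.map_congr ?_
        filter_upwards [isOpen_ne.mem_nhds ht] with t ht
        rw [localParam_infty_of_ne ht]
      rw [h1, localParam_infty_of_ne ht, OnePoint.nhds_coe_eq]
      have h2 : (fun t : ℂ => ((t⁻¹ : ℂ) : Sphere)) = ((↑) : ℂ → Sphere) ∘ Inv.inv := rfl
      rw [h2, ← Filter.map_map]
      refine Filter.map_mono ?_
      have h3 : (𝓝 t⁻¹) = Filter.map Inv.inv (Filter.map Inv.inv (𝓝 t⁻¹)) := by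
        rw [Filter.map_map]
        simp
      rw [h3]
      refine Filter.map_mono ?_
      have h4 : ContinuousAt (Inv.inv : ℂ → ℂ) t⁻¹ := continuousAt_inv₀ (inv_ne_zero ht)
      have := h4.tendsto
      rwa [inv_inv] at this
  | coe b =>
    have : localParam (b : Sphere) = ((↑) : ℂ → Sphere) ∘ (Homeomorph.addLeft b) := rfl
    rw [this]
    exact OnePoint.isOpenEmbedding_coe.comp (Homeomorph.isOpenEmbedding _)

lemma nhds_eq_map_localParam (z : Sphere) : 𝓝 z = Filter.map (localParam z) (𝓝 0) := by
  rw [(isOpenEmbedding_localParam z).map_nhds_eq, localParam_zero]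

lemma continuousAt_localCoord {z y : Sphere} (hy : y ∈ chartDom z) :
    ContinuousAt (localCoord z) y := by
  obtain ⟨t, rfl⟩ := hy
  rw [ContinuousAt, localCoord_localParam, ← (isOpenEmbedding_localParam z).map_nhds_eq,
    Filter.tendsto_map'_iff]
  have : localCoord z ∘ localParam z = id := by ext t; simp
  rw [this]
  exact Filter.tendsto_id

lemma localCoord_injOn (z : Sphere) : InjOn (localCoord z) (chartDom z) := by
  rintro _ ⟨s, rfl⟩ _ ⟨t, rfl⟩ h
  simp only [localCoord_localParam] at h
  rw [h]

lemma localCoord_eq_zero_iff {z y : Sphere} (hy : y ∈ chartDom z) :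
    localCoord z y = 0 ↔ y = z := by
  refine ⟨fun h => localCoord_injOn z hy (mem_chartDom_self z) (by rw [h, localCoord_self]), ?_⟩
  rintro rfl; simp

lemma tendsto_localCoord (z : Sphere) : Tendsto (localCoord z) (𝓝 z) (𝓝 0) := by
  have := (continuousAt_localCoord (mem_chartDom_self z)).tendsto
  rwa [localCoord_self] at this

/-- The image under the chart parametrization at `z` of the closed disc of radius `r`. -/
lemma isCompact_image_closedBall (z : Sphere) (r : ℝ) :
    IsCompact (localParam z '' closedBall 0 r) :=
  (isCompact_closedBall 0 r).image (continuous_localParam z)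

lemma image_closedBall_mem_nhds (z : Sphere) {r : ℝ} (hr : 0 < r) :
    localParam z '' closedBall 0 r ∈ 𝓝 z := by
  rw [nhds_eq_map_localParam]
  exact Filter.image_mem_map (closedBall_mem_nhds 0 hr)

/-! ### Newton maps as rational maps -/

lemma NewtonMap.map_infty (g : NewtonMap d) : g.1 ∞ = ∞ := by
  obtain ⟨p, -, -, hp⟩ := g.2
  rw [hp]; rfl

/-- A Newton map of degree `d` is `z ↦ z - R z / S z`, where `R` is the monic polynomial with
simple zeros at the `d` roots and `S = R · p' / p`. The quotient `R' / S` at a root is the inverse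
of its multiplicity, and the leading coefficient of `S` is the number `D ≥ d` of all roots. -/
structure NewtonRep (g : NewtonMap d) where
  /-- the monic polynomial vanishing simply at the roots -/
  R : ℂ[X]
  /-- the denominator -/
  S : ℂ[X]
  /-- the roots -/
  Z : Finset ℂ
  /-- the multiplicities -/
  e : ℂ → ℕ
  card_Z : Z.card = d
  R_eq : R = ∏ a ∈ Z, (X - C a)
  S_eq : S = ∑ a ∈ Z, C (e a : ℂ) * ∏ b ∈ Z.erase a, (X - C b)
  one_le : ∀ a ∈ Z, 1 ≤ e a
  apply_coe : ∀ z : ℂ, g.1 (z : Sphere) =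
    if S.eval z = 0 then ∞ else ((z - R.eval z / S.eval z : ℂ) : Sphere)

lemma exists_newtonRep (g : NewtonMap d) : Nonempty (NewtonRep g) := by
  classical
  obtain ⟨p, hp0, hcard, hp⟩ := g.2
  set Z := p.roots.toFinset with hZ
  set e : ℂ → ℕ := fun a => p.rootMultiplicity a with he
  set R : ℂ[X] := ∏ a ∈ Z, (X - C a) with hR
  set S : ℂ[X] := ∑ a ∈ Z, C (e a : ℂ) * ∏ b ∈ Z.erase a, (X - C b) with hS
  have h1 : ∀ a ∈ Z, 1 ≤ e a := by
    intro a ha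
    rw [hZ, Multiset.mem_toFinset] at ha
    have := (rootMultiplicity_pos hp0).2 ((mem_roots hp0).1 ha)
    exact this
  have hpfac : p = C p.leadingCoeff * ∏ a ∈ Z, (X - C a) ^ e a := by
    have h := (IsAlgClosed.splits p).eq_prod_roots
    conv_lhs => rw [h]
    congr 1
    rw [Finset.prod_multiset_map_count]
    refine Finset.prod_congr rfl fun a _ => ?_
    rw [count_roots]
  have hlead : p.leadingCoeff ≠ 0 := leadingCoeff_ne_zero.2 hp0
  -- the logarithmic derivative identity, cleared of denominators
  have hrel : R * derivative p = S * p := by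
    conv_lhs => rw [hpfac]
    conv_rhs => rw [hpfac]
    rw [derivative_C_mul, derivative_prod_finset, hS, hR, Finset.sum_mul, Finset.mul_sum,
      Finset.mul_sum]
    refine Finset.sum_congr rfl fun a ha => ?_
    rw [← Finset.mul_prod_erase Z (fun a => (X - C a : ℂ[X])) ha,
      ← Finset.mul_prod_erase Z (fun a => (X - C a : ℂ[X]) ^ e a) ha]
    rw [derivative_pow]
    have h2 : (X - C a : ℂ[X]) ^ e a = (X - C a) * (X - C a) ^ (e a - 1) := by
      rw [← pow_succ']
      congr 1
      have := h1 a ha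
      omega
    rw [h2]
    simp
    ring
  have hpz : ∀ z, p.eval z = 0 ↔ z ∈ Z := by
    intro z
    rw [hZ, Multiset.mem_toFinset, mem_roots hp0, IsRoot.def]
  have hRz : ∀ z, R.eval z = 0 ↔ z ∈ Z := by
    intro z
    rw [hR, eval_prod, Finset.prod_eq_zero_iff]
    simp only [eval_sub, eval_X, eval_C, sub_eq_zero]
    constructor
    · rintro ⟨a, ha, rfl⟩; exact ha
    · intro h; exact ⟨z, h, rfl⟩
  have hSz : ∀ z ∈ Z, S.eval z ≠ 0 := by
    intro z hz
    rw [hS, eval_finsetSum, Finset.sum_eq_single z]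
    · rw [eval_mul, eval_C, eval_prod]
      refine mul_ne_zero ?_ (Finset.prod_ne_zero_iff.2 fun b hb => ?_)
      · have := h1 z hz
        exact_mod_cast (by omega : e z ≠ 0)
      · simp only [eval_sub, eval_X, eval_C]
        exact sub_ne_zero.2 (Finset.ne_of_mem_erase hb).symm
    · intro a ha haz
      rw [eval_mul, eval_prod, Finset.prod_eq_zero (i := z)]
      · simp
      · exact Finset.mem_erase.2 ⟨haz.symm, hz⟩
      · simp
    · intro h; exact absurd hz h
  refine ⟨⟨R, S, Z, e, hcard, hR, hS, h1, fun z => ?_⟩⟩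
  rw [hp]
  change (if p.eval z = 0 then ((z : ℂ) : Sphere)
      else if p.derivative.eval z = 0 then ∞
      else ((z - p.eval z / p.derivative.eval z : ℂ) : Sphere)) = _
  by_cases hz : p.eval z = 0
  · have hzZ := (hpz z).1 hz
    rw [if_pos hz, if_neg (hSz z hzZ), (hRz z).2 hzZ]
    simp
  · rw [if_neg hz]
    have hev : R.eval z * p.derivative.eval z = S.eval z * p.eval z := by
      rw [← eval_mul, ← eval_mul, hrel]
    have hR0 : R.eval z ≠ 0 := fun h => hz ((hpz z).2 ((hRz z).1 h))
    by_cases hz' : p.derivative.eval z = 0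
    · rw [if_pos hz', if_pos]
      rw [hz', mul_zero] at hev
      exact (mul_eq_zero.1 hev.symm).resolve_right hz
    · have hS0 : S.eval z ≠ 0 := by
        intro h
        rw [h, zero_mul] at hev
        exact (mul_ne_zero hR0 hz') hev
      rw [if_neg hz', if_neg hS0]
      congr 2
      rw [div_eq_div_iff hz' hS0]
      linear_combination -hev

namespace NewtonRep

lemma eval_R_eq_zero_iff {g : NewtonMap d} (r : NewtonRep g) {z : ℂ} :
    r.R.eval z = 0 ↔ z ∈ r.Z := by
  rw [r.R_eq, eval_prod, Finset.prod_eq_zero_iff]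
  simp only [eval_sub, eval_X, eval_C, sub_eq_zero]
  constructor
  · rintro ⟨a, ha, rfl⟩; exact ha
  · intro h; exact ⟨z, h, rfl⟩

lemma eval_S_of_mem {g : NewtonMap d} (r : NewtonRep g) {z : ℂ} (hz : z ∈ r.Z) :
    r.S.eval z = r.e z * ∏ b ∈ r.Z.erase z, (z - b) := by
  rw [r.S_eq, eval_finsetSum, Finset.sum_eq_single z]
  · rw [eval_mul, eval_C, eval_prod]
    simp
  · intro a ha haz
    rw [eval_mul, eval_prod, Finset.prod_eq_zero (i := z)]
    · simp
    · exact Finset.mem_erase.2 ⟨haz.symm, hz⟩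
    · simp
  · intro h; exact absurd hz h

lemma prod_erase_ne_zero {g : NewtonMap d} (r : NewtonRep g) (z : ℂ) :
    ∏ b ∈ r.Z.erase z, (z - b) ≠ 0 :=
  Finset.prod_ne_zero_iff.2 fun _ hb => sub_ne_zero.2 (Finset.ne_of_mem_erase hb).symm

lemma eval_S_ne_zero {g : NewtonMap d} (r : NewtonRep g) {z : ℂ} (hz : z ∈ r.Z) :
    r.S.eval z ≠ 0 := by
  rw [r.eval_S_of_mem hz]
  refine mul_ne_zero ?_ (r.prod_erase_ne_zero z)
  have := r.one_le z hz
  exact_mod_cast (by omega : r.e z ≠ 0)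

lemma eval_deriv_R {g : NewtonMap d} (r : NewtonRep g) {z : ℂ} (hz : z ∈ r.Z) :
    r.R.derivative.eval z = ∏ b ∈ r.Z.erase z, (z - b) := by
  rw [r.R_eq, derivative_prod_finset, eval_finsetSum, Finset.sum_eq_single z]
  · simp [eval_prod]
  · intro a ha haz
    rw [eval_mul, eval_prod, Finset.prod_eq_zero (i := z)]
    · simp
    · exact Finset.mem_erase.2 ⟨haz.symm, hz⟩
    · simp
  · intro h; exact absurd hz h

lemma apply_of_ne {g : NewtonMap d} (r : NewtonRep g) {z : ℂ} (hz : r.S.eval z ≠ 0) :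
    g.1 (z : Sphere) = ((z - r.R.eval z / r.S.eval z : ℂ) : Sphere) := by
  rw [r.apply_coe, if_neg hz]

lemma apply_eq_infty_iff {g : NewtonMap d} (r : NewtonRep g) {z : ℂ} :
    g.1 (z : Sphere) = ∞ ↔ r.S.eval z = 0 := by
  rw [r.apply_coe]
  split_ifs with h <;> simp [h]

lemma fixed_iff {g : NewtonMap d} (r : NewtonRep g) {z : ℂ} :
    g.1 (z : Sphere) = (z : Sphere) ↔ z ∈ r.Z := by
  rw [r.apply_coe, ← r.eval_R_eq_zero_iff]
  split_ifs with h
  · simp only [OnePoint.infty_ne_coe, false_iff]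
    intro h0
    exact r.eval_S_ne_zero (r.eval_R_eq_zero_iff.1 h0) h
  · simp [h]

lemma rootPoints_eq {g : NewtonMap d} (r : NewtonRep g) :
    rootPoints g.1 = ((↑) : ℂ → Sphere) '' r.Z := by
  ext y
  induction y using OnePoint.rec with
  | infty => simp [rootPoints]
  | coe z => simp [rootPoints, r.fixed_iff]

/-- The total number `D` of roots, counted with multiplicity. -/
def deg {g : NewtonMap d} (r : NewtonRep g) : ℕ := ∑ a ∈ r.Z, r.e a

lemma le_deg {g : NewtonMap d} (r : NewtonRep g) : d ≤ r.deg := by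
  calc d = ∑ _a ∈ r.Z, 1 := by simp [r.card_Z]
    _ ≤ r.deg := Finset.sum_le_sum fun a ha => r.one_le a ha

/-- The map at a finite point in the chart at infinity of the target. -/
lemma localCoord_infty_apply {g : NewtonMap d} (r : NewtonRep g) (z : ℂ) :
    localCoord ∞ (g.1 (z : Sphere)) =
      r.S.eval z / (z * r.S.eval z - r.R.eval z) := by
  rw [r.apply_coe]
  split_ifs with h
  · simp [h]
  · rw [localCoord_infty_coe, inv_eq_one_div]
    rcases eq_or_ne (z * r.S.eval z - r.R.eval z) 0 with h0 | h0
    · have : z - r.R.eval z / r.S.eval z = 0 := by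
        field_simp
        linear_combination h0
      rw [this, h0]; simp
    · have : z - r.R.eval z / r.S.eval z ≠ 0 := by
        intro h1
        apply h0
        field_simp at h1
        linear_combination h1
      field_simp

/-- The denominator `S` in the coordinate `1/z`. -/
noncomputable def revS {g : NewtonMap d} (r : NewtonRep g) (t : ℂ) : ℂ :=
  ∑ a ∈ r.Z, (r.e a : ℂ) * ∏ b ∈ r.Z.erase a, (1 - b * t)

/-- The polynomial `R` in the coordinate `1/z`. -/
noncomputable def revR {g : NewtonMap d} (r : NewtonRep g) (t : ℂ) : ℂ :=
  ∏ a ∈ r.Z, (1 - a * t)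

lemma eval_R_inv {g : NewtonMap d} (r : NewtonRep g) {t : ℂ} (ht : t ≠ 0) :
    t ^ d * r.R.eval t⁻¹ = r.revR t := by
  have hc : t ^ d = ∏ _a ∈ r.Z, t := by rw [Finset.prod_const, r.card_Z]
  rw [r.R_eq, eval_prod, revR, hc, ← Finset.prod_mul_distrib]
  refine Finset.prod_congr rfl fun a _ => ?_
  simp only [eval_sub, eval_X, eval_C]
  field_simp

lemma eval_S_inv {g : NewtonMap d} (r : NewtonRep g) {t : ℂ} (ht : t ≠ 0) :
    t ^ d * (t⁻¹ * r.S.eval t⁻¹) = r.revS t := by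
  rw [r.S_eq, eval_finsetSum, revS, Finset.mul_sum, Finset.mul_sum]
  refine Finset.sum_congr rfl fun a ha => ?_
  rw [eval_mul, eval_C, eval_prod]
  have hc : (r.Z.erase a).card + 1 = d := by rw [Finset.card_erase_add_one ha, r.card_Z]
  have h : t ^ d = t * ∏ _b ∈ r.Z.erase a, t := by
    rw [Finset.prod_const, ← pow_succ', hc]
  have h2 : ∏ b ∈ r.Z.erase a, (1 - b * t) = (∏ _b ∈ r.Z.erase a, t) *
      ∏ b ∈ r.Z.erase a, eval t⁻¹ (X - C b) := by
    rw [← Finset.prod_mul_distrib]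
    refine Finset.prod_congr rfl fun b _ => ?_
    simp only [eval_sub, eval_X, eval_C]
    field_simp
  rw [h, h2]
  field_simp

lemma revS_zero {g : NewtonMap d} (r : NewtonRep g) : r.revS 0 = r.deg := by
  simp [revS, deg]

lemma revR_zero {g : NewtonMap d} (r : NewtonRep g) : r.revR 0 = 1 := by
  simp [revR]

lemma differentiable_revS {g : NewtonMap d} (r : NewtonRep g) :
    Differentiable ℂ r.revS := by
  unfold revS; fun_prop

lemma differentiable_revR {g : NewtonMap d} (r : NewtonRep g) :
    Differentiable ℂ r.revR := by
  unfold revR; fun_prop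

end NewtonRep

/-- The expression of `g` in the charts centred at `z` (source) and `v` (target). -/
noncomputable def locRep (g : C(Sphere, Sphere)) (z v : Sphere) (t : ℂ) : ℂ :=
  localCoord v (g (localParam z t))

lemma localDegree_eq (g : C(Sphere, Sphere)) (z : Sphere) :
    localDegree g z = analyticOrderAt (locRep g z (g z)) 0 := rfl

lemma localParam_locRep {g : C(Sphere, Sphere)} {z v : Sphere} {t : ℂ}
    (h : g (localParam z t) ∈ chartDom v) :
    localParam v (locRep g z v t) = g (localParam z t) := localParam_localCoord h

lemma NewtonRep.locRep_infty {g : NewtonMap d} (r : NewtonRep g) (t : ℂ) :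
    locRep g.1 ∞ ∞ t = t * (r.revS t / (r.revS t - r.revR t)) := by
  rcases eq_or_ne t 0 with rfl | ht
  · simp [locRep, g.map_infty]
  · rw [locRep, localParam_infty_of_ne ht, r.localCoord_infty_apply, ← r.eval_R_inv ht,
      ← r.eval_S_inv ht, ← mul_sub, mul_div_mul_left _ _ (pow_ne_zero _ ht)]
    field_simp

/-- In the coordinate `1/z` the fixed point at infinity has multiplier `D / (D - 1)`. -/
lemma NewtonRep.hasDerivAt_locRep_infty {g : NewtonMap d} (r : NewtonRep g)
    (hd : 3 ≤ d) :
    HasDerivAt (locRep g.1 ∞ ∞) ((r.deg : ℂ) / (r.deg - 1)) 0 := by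
  have h1 : locRep g.1 ∞ ∞ =
      fun t => t * (r.revS t / (r.revS t - r.revR t)) := funext r.locRep_infty
  have hD : (r.deg : ℂ) - 1 ≠ 0 := by
    have := r.le_deg
    rw [sub_ne_zero]
    exact_mod_cast (by omega : r.deg ≠ 1)
  have h2 : DifferentiableAt ℂ (fun t => r.revS t / (r.revS t - r.revR t)) 0 := by
    refine DifferentiableAt.div (r.differentiable_revS 0)
      ((r.differentiable_revS 0).sub (r.differentiable_revR 0)) ?_
    rwa [r.revS_zero, r.revR_zero]
  have h3 := (hasDerivAt_id (0 : ℂ)).mul h2.hasDerivAt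
  rw [h1]
  refine h3.congr_deriv ?_
  simp [r.revS_zero, r.revR_zero]

/-- A root of multiplicity `e` is a fixed point of multiplier `1 - 1 / e`. -/
lemma NewtonRep.hasDerivAt_root {g : NewtonMap d} (r : NewtonRep g) {a : ℂ}
    (ha : a ∈ r.Z) :
    HasDerivAt (locRep g.1 (a : Sphere) (a : Sphere)) (1 - 1 / (r.e a : ℂ)) 0 := by
  have hS := r.eval_S_ne_zero ha
  have hR := r.eval_R_eq_zero_iff.2 ha
  have h1 : HasDerivAt (fun x : ℂ => x - r.R.eval x / r.S.eval x) (1 - 1 / (r.e a : ℂ)) a := by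
    have h2 := (hasDerivAt_id a).sub
      ((r.R.hasDerivAt a).div (r.S.hasDerivAt a) hS)
    refine h2.congr_deriv ?_
    rw [hR, r.eval_deriv_R ha, r.eval_S_of_mem ha]
    have h3 := r.prod_erase_ne_zero a
    have h4 : (r.e a : ℂ) ≠ 0 := by
      have := r.one_le a ha
      exact_mod_cast (by omega : r.e a ≠ 0)
    field_simp
    simp
    ring
  have h2 : HasDerivAt (fun t : ℂ => (a + t) - r.R.eval (a + t) / r.S.eval (a + t) - a)
      (1 - 1 / (r.e a : ℂ)) 0 := by
    have h3 : HasDerivAt (fun t : ℂ => a + t) 1 0 := (hasDerivAt_id (0 : ℂ)).const_add a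
    have h1' : HasDerivAt (fun x : ℂ => x - r.R.eval x / r.S.eval x) (1 - 1 / (r.e a : ℂ))
        (a + 0) := by simpa using h1
    have := (h1'.comp (0 : ℂ) h3).sub_const a
    simpa [Function.comp_def] using this
  refine h2.congr_of_eventuallyEq ?_
  have hc : ContinuousAt (fun t : ℂ => r.S.eval (a + t)) 0 := by fun_prop
  have : ∀ᶠ t in 𝓝 (0 : ℂ), r.S.eval (a + t) ≠ 0 := hc.eventually_ne (by simpa using hS)
  filter_upwards [this] with t ht
  simp [locRep, r.apply_of_ne ht]

/-- A Newton map is holomorphic in the charts. -/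
lemma analyticAt_locRep (hd : 3 ≤ d) (g : NewtonMap d) {z v : Sphere} {t : ℂ}
    (h : g.1 (localParam z t) ∈ chartDom v) : AnalyticAt ℂ (locRep g.1 z v) t := by
  obtain ⟨r⟩ := exists_newtonRep g
  -- at a finite point
  have key : ∀ x : ℂ, g.1 (x : Sphere) ∈ chartDom v →
      AnalyticAt ℂ (fun x : ℂ => localCoord v (g.1 (x : Sphere))) x := by
    intro x hx
    have hRa : AnalyticAt ℂ (fun x => r.R.eval x) x := r.R.differentiable.analyticAt x
    have hSa : AnalyticAt ℂ (fun x => r.S.eval x) x := r.S.differentiable.analyticAt x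
    induction v using OnePoint.rec with
    | infty =>
      have h1 : (fun x : ℂ => localCoord ∞ (g.1 (x : Sphere))) =
        fun x => r.S.eval x / (x * r.S.eval x - r.R.eval x) := funext r.localCoord_infty_apply
      rw [h1]
      refine hSa.div ((analyticAt_id.mul hSa).sub hRa) ?_
      intro h0
      rw [mem_chartDom_infty] at hx
      by_cases hS : r.S.eval x = 0
      · have hR : r.R.eval x = 0 := by rw [hS] at h0; simpa using h0
        exact r.eval_S_ne_zero (r.eval_R_eq_zero_iff.1 hR) hS
      · apply hx
        rw [r.apply_of_ne hS]
        congr 1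
        field_simp
        linear_combination h0
    | coe b =>
      rw [mem_chartDom_coe, Ne, r.apply_eq_infty_iff] at hx
      have h1 : AnalyticAt ℂ (fun x : ℂ => x - r.R.eval x / r.S.eval x - b) x :=
        (analyticAt_id.sub (hRa.div hSa hx)).sub analyticAt_const
      refine h1.congr ?_
      filter_upwards [hSa.continuousAt.eventually_ne hx] with y hy
      rw [r.apply_of_ne hy]
      simp
  induction z using OnePoint.rec with
  | coe b =>
    have h1 : AnalyticAt ℂ (fun t : ℂ => b + t) t := analyticAt_const.add analyticAt_id
    exact (key (b + t) h).comp h1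
  | infty =>
    rcases eq_or_ne t 0 with rfl | ht
    · induction v using OnePoint.rec with
      | coe b => simp [g.map_infty] at h
      | infty =>
        rw [show locRep g.1 ∞ ∞ =
          fun t => t * (r.revS t / (r.revS t - r.revR t)) from funext r.locRep_infty]
        refine analyticAt_id.mul ((r.differentiable_revS.analyticAt 0).div
          ((r.differentiable_revS.analyticAt 0).sub (r.differentiable_revR.analyticAt 0)) ?_)
        rw [r.revS_zero, r.revR_zero, sub_ne_zero]
        have := r.le_deg
        exact_mod_cast (by omega : r.deg ≠ 1)
    · rw [localParam_infty_of_ne ht] at h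
      have h1 := (key t⁻¹ h).comp (analyticAt_inv ht)
      refine h1.congr ?_
      filter_upwards [isOpen_ne.mem_nhds ht] with s hs
      simp [locRep, localParam_infty_of_ne hs]

/-- Joint continuity in the map and the point, in charts. -/
lemma continuousAt_locRep {g : NewtonMap d} {z v : Sphere} {t : ℂ}
    (h : g.1 (localParam z t) ∈ chartDom v) :
    ContinuousAt (fun q : NewtonMap d × ℂ => locRep q.1.1 z v q.2) (g, t) := by
  have h1 : ContinuousAt (fun q : NewtonMap d × ℂ => q.1.1 (localParam z q.2)) (g, t) := by
    refine Continuous.continuousAt ?_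
    exact (continuous_subtype_val.comp continuous_fst).eval
      ((continuous_localParam z).comp continuous_snd)
  exact (continuousAt_localCoord h).comp_of_eq h1 rfl

lemma continuous_newton_eval :
    Continuous fun q : NewtonMap d × Sphere => q.1.1 q.2 :=
  (continuous_subtype_val.comp continuous_fst).eval continuous_snd

lemma continuous_newton_iterate (n : ℕ) :
    Continuous fun q : NewtonMap d × Sphere => (q.1.1)^[n] q.2 := by
  induction n with
  | zero => exact continuous_snd
  | succ n ih =>
    simp only [Function.iterate_succ_apply']
    exact continuous_newton_eval.comp (continuous_fst.prodMk ih)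

/-- A Newton map is a nonconstant rational map, so its fibres are zero sets of polynomials, up to
`∞`. -/
lemma finite_fiber (hd : 3 ≤ d) (g : NewtonMap d) (w : Sphere) : (g.1 ⁻¹' {w}).Finite := by
  obtain ⟨r⟩ := exists_newtonRep g
  have hD : 3 ≤ r.deg := hd.trans r.le_deg
  have hD' : (r.deg : ℂ) ≠ 1 := by exact_mod_cast (by omega : r.deg ≠ 1)
  have hD0 : (r.deg : ℂ) ≠ 0 := by exact_mod_cast (by omega : r.deg ≠ 0)
  have key : ∀ c e : ℂ, (c = 1 ∧ e = -1 ∨ c = 0 ∧ e = 0) → ∀ w : ℂ,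
      {z : ℂ | (c * z - w) * r.S.eval z + e * r.R.eval z = 0 ∧ (c = 0 → w = 1)}.Finite := by
    intro c e hce w
    by_cases hw : c = 0 → w = 1
    swap
    · refine Set.finite_empty.subset fun z hz => hw hz.2
    have hne : (C c * X - C w) * r.S + C e * r.R ≠ 0 := by
      intro h0
      have hev : ∀ z, (c * z - w) * r.S.eval z + e * r.R.eval z = 0 := by
        intro z
        have := congrArg (Polynomial.eval z) h0
        simpa using this
      have hc : ∀ t : ℂ, t ≠ 0 → (c - w * t) * r.revS t + e * r.revR t = 0 := by
        intro t ht
        rw [← r.eval_R_inv ht, ← r.eval_S_inv ht]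
        have := hev t⁻¹
        linear_combination t ^ d * this +
          (-w * t ^ d * r.S.eval t⁻¹) * (mul_inv_cancel₀ ht)
      have hcont : Continuous fun t : ℂ => (c - w * t) * r.revS t + e * r.revR t := by
        have h1 := r.differentiable_revS.continuous
        have h2 := r.differentiable_revR.continuous
        fun_prop
      have hall : ∀ t : ℂ, (c - w * t) * r.revS t + e * r.revR t = 0 := by
        have hcl : IsClosed {t : ℂ | (c - w * t) * r.revS t + e * r.revR t = 0} :=
          isClosed_eq hcont continuous_const
        have hd : Dense {t : ℂ | t ≠ 0} := dense_compl_singleton 0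
        intro t
        exact hcl.closure_subset_iff.2 hc (hd t)
      rcases hce with ⟨rfl, rfl⟩ | ⟨rfl, rfl⟩
      · have := hall 0
        rw [r.revS_zero, r.revR_zero] at this
        apply hD'
        linear_combination this
      · have hw1 := hw rfl
        subst hw1
        have h3 : ∀ z, r.S.eval z = 0 := by
          intro z
          have := hev z
          simpa using this
        have hZ : r.Z.Nonempty := by
          rw [← Finset.card_pos, r.card_Z]; omega
        obtain ⟨a, ha⟩ := hZ
        exact r.eval_S_ne_zero ha (h3 a)
    refine ((Polynomial.finite_setOfPred_isRoot hne)).subset fun z hz => ?_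
    have := hz.1
    simpa [IsRoot.def] using this
  have hfin : ∀ T : Set ℂ, T.Finite →
      (∀ z : ℂ, g.1 (z : Sphere) = w → z ∈ T) → (g.1 ⁻¹' {w}).Finite := by
    intro T hT h
    refine ((hT.image ((↑) : ℂ → Sphere)).insert ∞).subset ?_
    intro y hy
    induction y using OnePoint.rec with
    | infty => exact Or.inl rfl
    | coe z => exact Or.inr ⟨z, h z hy, rfl⟩
  induction w using OnePoint.rec with
  | infty =>
    refine hfin _ (key 0 0 (Or.inr ⟨rfl, rfl⟩) 1) fun z hz => ⟨?_, fun _ => rfl⟩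
    rw [r.apply_eq_infty_iff.1 hz]; simp
  | coe w =>
    refine hfin _ (key 1 (-1) (Or.inl ⟨rfl, rfl⟩) w) fun z hz => ⟨?_, fun h => absurd h one_ne_zero⟩
    have hS : r.S.eval z ≠ 0 := by
      intro h
      rw [r.apply_eq_infty_iff.2 h] at hz
      exact OnePoint.infty_ne_coe _ hz
    rw [r.apply_of_ne hS, OnePoint.coe_eq_coe] at hz
    field_simp at hz
    linear_combination hz

/-- `g` is not locally constant. -/
lemma frequently_apply_ne (hd : 3 ≤ d) (g : NewtonMap d) (z w : Sphere) :
    ∀ᶠ t in 𝓝[≠] (localCoord z z), g.1 (localParam z t) ≠ w := by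
  rw [localCoord_self]
  have hfin : {t : ℂ | g.1 (localParam z t) = w}.Finite :=
    (finite_fiber hd g w).preimage (localParam_injective z).injOn
  have h2 : ({t : ℂ | g.1 (localParam z t) = w} \ {0})ᶜ ∈ 𝓝 (0 : ℂ) :=
    (hfin.subset sdiff_subset).isClosed.isOpen_compl.mem_nhds (by simp)
  filter_upwards [nhdsWithin_le_nhds h2, self_mem_nhdsWithin] with t ht ht0 h
  exact ht ⟨h, ht0⟩

lemma locRep_zero (g : C(Sphere, Sphere)) (z : Sphere) : locRep g z (g z) 0 = 0 := by
  simp [locRep]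

lemma analyticAt_locRep_zero (hd : 3 ≤ d) (g : NewtonMap d) (z : Sphere) :
    AnalyticAt ℂ (locRep g.1 z (g.1 z)) 0 := analyticAt_locRep hd g (by simp)

lemma localDegree_ne_zero (hd : 3 ≤ d) (g : NewtonMap d) (z : Sphere) :
    localDegree g.1 z ≠ 0 := by
  rw [localDegree_eq, (analyticAt_locRep_zero hd g z).analyticOrderAt_ne_zero]
  exact locRep_zero _ _

lemma localDegree_ne_top (hd : 3 ≤ d) (g : NewtonMap d) (z : Sphere) :
    localDegree g.1 z ≠ ⊤ := by
  rw [localDegree_eq, Ne, analyticOrderAt_eq_top]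
  intro h
  have h1 := frequently_apply_ne hd g z (g.1 z)
  rw [localCoord_self] at h1
  have hc : ContinuousAt (fun t => g.1 (localParam z t)) 0 :=
    (g.1.continuous.comp (continuous_localParam z)).continuousAt
  have h2 : ∀ᶠ t in 𝓝 (0 : ℂ), g.1 (localParam z t) ∈ chartDom (g.1 z) :=
    hc.eventually_mem ((isOpen_chartDom _).mem_nhds (by simp))
  obtain ⟨t, ht⟩ := (((h.filter_mono nhdsWithin_le_nhds).and
    (h2.filter_mono nhdsWithin_le_nhds)).and h1).exists
  exact ht.2 ((localCoord_eq_zero_iff ht.1.2).1 ht.1.1)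

/-- The local degree can be read off in charts centred at nearby points, provided the point at
infinity only occurs as the centre of its chart. -/
lemma localDegree_eq_order {g : NewtonMap d} {z v : Sphere} {τ : ℂ}
    (hz : z = ∞ → τ = 0) (hv : v = ∞ → g.1 (localParam z τ) = v)
    (h : g.1 (localParam z τ) ∈ chartDom v) :
    localDegree g.1 (localParam z τ) =
      analyticOrderAt (fun t => locRep g.1 z v t - locRep g.1 z v τ) τ := by
  have h1 : (fun t => locRep g.1 z v t - locRep g.1 z v τ) =ᶠ[𝓝 τ]
      (locRep g.1 (localParam z τ) (g.1 (localParam z τ))) ∘ fun t => t - τ := by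
    have hc : ContinuousAt (fun t => g.1 (localParam z t)) τ :=
      (g.1.continuous.comp (continuous_localParam z)).continuousAt
    filter_upwards [hc.eventually_mem ((isOpen_chartDom _).mem_nhds h)] with t ht
    have hp : localParam (localParam z τ) (t - τ) = localParam z t := by
      induction z using OnePoint.rec with
      | infty => simp [hz rfl]
      | coe b => simp
    simp only [Function.comp, locRep, hp]
    induction v using OnePoint.rec with
    | infty => rw [hv rfl]; simp
    | coe b =>
      rw [mem_chartDom_coe] at h ht
      obtain ⟨y, hy⟩ := OnePoint.ne_infty_iff_exists.1 h
      obtain ⟨x, hx⟩ := OnePoint.ne_infty_iff_exists.1 ht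
      rw [← hx, ← hy]
      simp
  rw [analyticOrderAt_congr h1, localDegree_eq]
  have h2 := analyticOrderAt_comp_of_deriv_ne_zero (𝕜 := ℂ)
    (f := locRep g.1 (localParam z τ) (g.1 (localParam z τ))) (g := fun t => t - τ) (z₀ := τ)
    (by fun_prop) (by simp)
  rw [h2]
  simp

/-! ### Perturbations of holomorphic functions -/

/-- Uniformly close holomorphic functions have close derivatives. -/
lemma exists_deriv_close {F₀ : ℂ → ℂ} {u₀ : ℂ} {R κ : ℝ} (hR : 0 < R) (hκ : 0 < κ)
    (hF₀ : DifferentiableOn ℂ F₀ (ball u₀ R)) :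
    ∃ ε₀ > 0, ε₀ < R ∧ ∃ η₀ > 0, ∀ F : ℂ → ℂ, DifferentiableOn ℂ F (ball u₀ R) →
      (∀ u ∈ ball u₀ R, ‖F u - F₀ u‖ ≤ η₀) →
      ∀ u ∈ closedBall u₀ ε₀, ‖deriv F u - deriv F₀ u₀‖ ≤ κ := by
  have hcont : ContinuousAt (deriv F₀) u₀ :=
    ((hF₀.deriv isOpen_ball).continuousOn).continuousAt (ball_mem_nhds _ hR)
  obtain ⟨ε₁, hε₁, h1⟩ := Metric.continuousAt_iff.1 hcont (κ / 2) (by positivity)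
  refine ⟨min (ε₁ / 2) (R / 4), by positivity, ?_, κ * R / 8, by positivity, ?_⟩
  · exact (min_le_right _ _).trans_lt (by linarith)
  intro F hF hclose u hu
  have hu1 : dist u u₀ < ε₁ := by
    have := (Metric.mem_closedBall.1 hu).trans (min_le_left _ _)
    linarith
  have hu2 : dist u u₀ ≤ R / 4 := (Metric.mem_closedBall.1 hu).trans (min_le_right _ _)
  have hsub : closedBall u (R / 4) ⊆ ball u₀ R := by
    intro w hw
    rw [mem_ball]
    have := dist_triangle w u u₀
    have := Metric.mem_closedBall.1 hw
    linarith
  have hu3 : u ∈ ball u₀ R := hsub (Metric.mem_closedBall_self (by positivity))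
  have hnhds := Metric.isOpen_ball.mem_nhds hu3
  have h2 : ‖deriv (fun w => F w - F₀ w) u‖ ≤ κ * R / 8 / (R / 4) := by
    refine Complex.norm_deriv_le_of_forall_mem_sphere_norm_le (by positivity) ?_ ?_
    · exact ((hF.sub hF₀).mono ((Metric.closure_ball_subset_closedBall).trans hsub)).diffContOnCl
    · intro z hz
      exact hclose z (hsub (Metric.sphere_subset_closedBall hz))
  rw [deriv_fun_sub (hF.differentiableAt hnhds) (hF₀.differentiableAt hnhds)] at h2
  have h3 : κ * R / 8 / (R / 4) = κ / 2 := by field_simp; norm_num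
  have h4 := h1 hu1
  rw [dist_eq_norm] at h4
  calc ‖deriv F u - deriv F₀ u₀‖ = ‖(deriv F u - deriv F₀ u) + (deriv F₀ u - deriv F₀ u₀)‖ := by
        congr 1; ring
    _ ≤ κ / 2 + κ / 2 := (norm_add_le _ _).trans (add_le_add (h2.trans h3.le) h4.le)
    _ = κ := by ring

/-- A function whose derivative is close to `c` is close to affine. -/
lemma norm_sub_sub_mul_le {F : ℂ → ℂ} {u₀ c : ℂ} {ε κ : ℝ}
    (hF : ∀ u ∈ closedBall u₀ ε, DifferentiableAt ℂ F u)
    (hder : ∀ u ∈ closedBall u₀ ε, ‖deriv F u - c‖ ≤ κ) {u w : ℂ}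
    (hu : u ∈ closedBall u₀ ε) (hw : w ∈ closedBall u₀ ε) :
    ‖F u - F w - c * (u - w)‖ ≤ κ * ‖u - w‖ := by
  have h := (convex_closedBall u₀ ε).norm_image_sub_le_of_norm_hasDerivWithin_le
    (f := fun x => F x - c * x) (f' := fun x => deriv F x - c) (C := κ)
    (fun x hx => by
      have := (hF x hx).hasDerivAt.fun_sub ((hasDerivAt_id' x).const_mul c)
      rw [mul_one] at this
      exact this.hasDerivWithinAt) hder hw hu
  refine le_of_eq_of_le ?_ h
  congr 1
  ring

/-- Persistence of a simple zero: functions close to `F₀` have exactly one zero near a simple zero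
of `F₀`. -/
lemma exists_simple_zero {F₀ : ℂ → ℂ} {u₀ : ℂ} {R : ℝ} (hR : 0 < R)
    (hF₀ : DifferentiableOn ℂ F₀ (ball u₀ R)) (h0 : F₀ u₀ = 0) (hd : deriv F₀ u₀ ≠ 0) :
    ∃ ε₀ > 0, ε₀ < R ∧
      (∃ η₀ > 0, ∀ F : ℂ → ℂ, DifferentiableOn ℂ F (ball u₀ R) →
        (∀ u ∈ ball u₀ R, ‖F u - F₀ u‖ ≤ η₀) →
        InjOn F (closedBall u₀ ε₀) ∧ ∀ u ∈ closedBall u₀ ε₀, deriv F u ≠ 0) ∧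
      ∀ ε > 0, ε ≤ ε₀ → ∃ η > 0, ∀ F : ℂ → ℂ, DifferentiableOn ℂ F (ball u₀ R) →
        (∀ u ∈ ball u₀ R, ‖F u - F₀ u‖ ≤ η) → ∃ u ∈ closedBall u₀ ε, F u = 0 := by
  set c := deriv F₀ u₀ with hc
  have hcpos : 0 < ‖c‖ := norm_pos_iff.2 hd
  obtain ⟨ε₀, hε₀, hε₀R, η₀, hη₀, H⟩ := exists_deriv_close (κ := ‖c‖ / 2) hR (by positivity) hF₀
  have hdiff : ∀ F : ℂ → ℂ, DifferentiableOn ℂ F (ball u₀ R) →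
      ∀ u ∈ closedBall u₀ ε₀, DifferentiableAt ℂ F u := fun F hF u hu =>
    hF.differentiableAt (Metric.isOpen_ball.mem_nhds (closedBall_subset_ball hε₀R hu))
  have hlow : ∀ F : ℂ → ℂ, DifferentiableOn ℂ F (ball u₀ R) →
      (∀ u ∈ ball u₀ R, ‖F u - F₀ u‖ ≤ η₀) → ∀ u ∈ closedBall u₀ ε₀,
      ∀ w ∈ closedBall u₀ ε₀, ‖c‖ / 2 * ‖u - w‖ ≤ ‖F u - F w‖ := by
    intro F hF hcl u hu w hw
    have h1 := norm_sub_sub_mul_le (hdiff F hF) (H F hF hcl) hu hw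
    have h2 : ‖c * (u - w)‖ ≤ ‖F u - F w‖ + ‖F u - F w - c * (u - w)‖ := by
      calc ‖c * (u - w)‖ = ‖(F u - F w) - (F u - F w - c * (u - w))‖ := by congr 1; ring
        _ ≤ _ := norm_sub_le _ _
    rw [norm_mul] at h2
    linarith
  refine ⟨ε₀, hε₀, hε₀R, ⟨η₀, hη₀, fun F hF hcl => ⟨fun u hu w hw huw => ?_, fun u hu h => ?_⟩⟩, ?_⟩
  · have := hlow F hF hcl u hu w hw
    rw [huw, sub_self, norm_zero] at this
    have h3 : ‖u - w‖ ≤ 0 := by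
      by_contra h
      push Not at h
      nlinarith
    exact sub_eq_zero.1 (norm_le_zero_iff.1 h3)
  · have := H F hF hcl u hu
    rw [h, zero_sub, norm_neg] at this
    linarith
  · intro ε hε hεε₀
    refine ⟨min η₀ (‖c‖ * ε / 8), by positivity, fun F hF hcl => ?_⟩
    have hcl' : ∀ u ∈ ball u₀ R, ‖F u - F₀ u‖ ≤ η₀ := fun u hu =>
      (hcl u hu).trans (min_le_left _ _)
    have hu₀ : u₀ ∈ closedBall u₀ ε₀ := Metric.mem_closedBall_self hε₀.le
    have hsub : closedBall u₀ ε ⊆ closedBall u₀ ε₀ :=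
      Metric.closedBall_subset_closedBall hεε₀
    have hopen : ball (F u₀) (‖c‖ / 2 * ε / 2) ⊆ F '' closedBall u₀ ε := by
      refine DiffContOnCl.ball_subset_image_closedBall ?_ hε ?_ ?_
      · exact (DifferentiableOn.mono hF (Metric.closure_ball_subset_closedBall.trans
          (hsub.trans (closedBall_subset_ball hε₀R)))).diffContOnCl
      · intro z hz
        have := hlow F hF hcl' z (hsub (Metric.sphere_subset_closedBall hz)) u₀ hu₀
        rwa [← dist_eq_norm, Metric.mem_sphere.1 hz] at this
      · have h5 : ∀ᶠ z in 𝓝[≠] u₀, F z ≠ F u₀ := by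
          filter_upwards [nhdsWithin_le_nhds (closedBall_mem_nhds u₀ hε₀),
            self_mem_nhdsWithin] with z hz hz' h
          have := hlow F hF hcl' z hz u₀ hu₀
          rw [h, sub_self, norm_zero] at this
          have h6 : 0 < ‖z - u₀‖ := norm_pos_iff.2 (sub_ne_zero.2 hz')
          nlinarith
        exact h5.frequently.filter_mono nhdsWithin_le_nhds
    have hmem : (0 : ℂ) ∈ ball (F u₀) (‖c‖ / 2 * ε / 2) := by
      have := (hcl u₀ (mem_ball_self hR)).trans (min_le_right _ _)
      rw [h0, sub_zero] at this
      rw [mem_ball, dist_comm, dist_zero_right]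
      have h7 : 0 < ‖c‖ * ε := by positivity
      linarith
    obtain ⟨u, hu, hu0⟩ := hopen hmem
    exact ⟨u, hu, hu0⟩

/-- The equation `u ^ δ * A (τ + s u) = B`, with `A` and `B` close to a nonzero constant, has a
unique solution `u` near `1`. -/
lemma exists_power_lift {δ : ℕ} (hδ : 1 ≤ δ) {A₀ : ℂ} (hA₀ : A₀ ≠ 0) :
    ∃ ε₀ > 0, ε₀ < 1 ∧ ∀ ε > 0, ε ≤ ε₀ → ∃ η > 0, ∀ (A : ℂ → ℂ) (r : ℝ) (τ s B : ℂ),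
      DifferentiableOn ℂ A (ball 0 r) → (∀ t ∈ ball 0 r, ‖A t - A₀‖ ≤ η) →
      ‖τ‖ + 2 * ‖s‖ < r → ‖B - A₀‖ ≤ η →
      ∃! u, u ∈ closedBall (1 : ℂ) ε ∧ u ^ δ * A (τ + s * u) = B := by
  have hF₀ : DifferentiableOn ℂ (fun u : ℂ => u ^ δ - 1) (ball 1 1) := by fun_prop
  have hd : deriv (fun u : ℂ => u ^ δ - 1) 1 ≠ 0 := by
    simp
    omega
  obtain ⟨ε₀, hε₀, hε₀R, ⟨η₀, hη₀, Hinj⟩, Hex⟩ :=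
    exists_simple_zero one_pos hF₀ (by simp) hd
  refine ⟨ε₀, hε₀, hε₀R, fun ε hε hεε₀ => ?_⟩
  obtain ⟨η₁, hη₁, Hex⟩ := Hex ε hε hεε₀
  have hApos : 0 < ‖A₀‖ := norm_pos_iff.2 hA₀
  set η := min η₀ η₁ * ‖A₀‖ / (2 ^ δ + 1) with hη
  have hηpos : 0 < η := by positivity
  refine ⟨η, hηpos, fun A r τ s B hA hAc hr hB => ?_⟩
  set F : ℂ → ℂ := fun u => (u ^ δ * A (τ + s * u) - B) / A₀ with hF
  have hmem : ∀ u ∈ ball (1 : ℂ) 1, τ + s * u ∈ ball (0 : ℂ) r := by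
    intro u hu
    have hu2 : ‖u‖ ≤ 2 := by
      have : ‖u - 1‖ < 1 := by simpa [dist_eq_norm] using hu
      calc ‖u‖ = ‖(u - 1) + 1‖ := by congr 1; ring
        _ ≤ ‖u - 1‖ + ‖(1 : ℂ)‖ := norm_add_le _ _
        _ ≤ 2 := by rw [norm_one]; linarith
    rw [mem_ball_zero_iff]
    calc ‖τ + s * u‖ ≤ ‖τ‖ + ‖s‖ * ‖u‖ := (norm_add_le _ _).trans (by rw [norm_mul])
      _ ≤ ‖τ‖ + 2 * ‖s‖ := by nlinarith [norm_nonneg s]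
      _ < r := hr
  have hFd : DifferentiableOn ℂ F (ball 1 1) := by
    have h1 : DifferentiableOn ℂ (fun u : ℂ => A (τ + s * u)) (ball 1 1) :=
      hA.comp (by fun_prop) hmem
    exact ((DifferentiableOn.mul (by fun_prop) h1).sub_const B).div_const A₀
  have hFc : ∀ u ∈ ball (1 : ℂ) 1, ‖F u - (u ^ δ - 1)‖ ≤ min η₀ η₁ := by
    intro u hu
    have hu2 : ‖u‖ ≤ 2 := by
      have : ‖u - 1‖ < 1 := by simpa [dist_eq_norm] using hu
      calc ‖u‖ = ‖(u - 1) + 1‖ := by congr 1; ring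
        _ ≤ ‖u - 1‖ + ‖(1 : ℂ)‖ := norm_add_le _ _
        _ ≤ 2 := by rw [norm_one]; linarith
    have h1 : F u - (u ^ δ - 1) = (u ^ δ * (A (τ + s * u) - A₀) - (B - A₀)) / A₀ := by
      simp only [hF]
      field_simp
      ring
    rw [h1, norm_div, div_le_iff₀ hApos]
    calc ‖u ^ δ * (A (τ + s * u) - A₀) - (B - A₀)‖
        ≤ ‖u‖ ^ δ * ‖A (τ + s * u) - A₀‖ + ‖B - A₀‖ := by
          refine (norm_sub_le _ _).trans ?_
          rw [norm_mul, norm_pow]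
      _ ≤ 2 ^ δ * η + η := by
          have := hAc _ (hmem u hu)
          gcongr
      _ = min η₀ η₁ * ‖A₀‖ := by
          rw [hη]; field_simp
  obtain ⟨hinj, -⟩ := Hinj F hFd fun u hu => (hFc u hu).trans (min_le_left _ _)
  obtain ⟨u, hu, hu0⟩ := Hex F hFd fun u hu => (hFc u hu).trans (min_le_right _ _)
  have hiff : ∀ u, F u = 0 ↔ u ^ δ * A (τ + s * u) = B := by
    intro u
    simp only [hF, div_eq_zero_iff, hA₀, or_false, sub_eq_zero]
  refine ⟨u, ⟨hu, (hiff u).1 hu0⟩, fun w hw => ?_⟩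
  refine hinj (Metric.closedBall_subset_closedBall hεε₀ hw.1)
    (Metric.closedBall_subset_closedBall hεε₀ hu) ?_
  rw [hu0, (hiff w).2 hw.2]

/-- Let `G` be close to `G₀ = t ^ δ * A₀ t`. If `G` takes its value at a point `τ` near `0` with
multiplicity at least `δ`, then `G t - G τ = (t - τ) ^ δ * A t` with `A` close to `A₀ 0`. -/
lemma exists_factor_of_order {G₀ A₀ : ℂ → ℂ} {R : ℝ} {δ : ℕ} (hR : 0 < R)
    (hG₀d : DifferentiableOn ℂ G₀ (ball 0 R)) (hδ : 1 ≤ δ)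
    (hA₀ : ContinuousAt A₀ 0) (hG₀ : ∀ t ∈ ball (0 : ℂ) R, G₀ t = t ^ δ * A₀ t)
    {η : ℝ} (hη : 0 < η) :
    ∃ r > 0, r < R ∧ ∃ κ > 0, κ < r ∧ ∀ G : ℂ → ℂ, DifferentiableOn ℂ G (ball 0 R) →
      (∀ t ∈ ball (0 : ℂ) R, ‖G t - G₀ t‖ ≤ κ) → ∀ τ : ℂ, ‖τ‖ ≤ κ →
      (δ : ℕ∞) ≤ analyticOrderAt (fun t => G t - G τ) τ →
      ∃ A : ℂ → ℂ, DifferentiableOn ℂ A (ball 0 r) ∧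
        (∀ t ∈ ball (0 : ℂ) r, G t - G τ = (t - τ) ^ δ * A t) ∧
        ∀ t ∈ ball (0 : ℂ) r, ‖A t - A₀ 0‖ ≤ η := by
  obtain ⟨r₁, hr₁, h1⟩ := Metric.continuousAt_iff.1 hA₀ (η / 2) (by positivity)
  set r := min (r₁ / 2) (R / 2) with hr
  have hrpos : 0 < r := by positivity
  have hrR : r < R := (min_le_right _ _).trans_lt (by linarith)
  have hrr₁ : r < r₁ := (min_le_left _ _).trans_lt (by linarith)
  have hA₀c : ∀ t ∈ sphere (0 : ℂ) r, ‖A₀ t - A₀ 0‖ ≤ η / 2 := by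
    intro t ht
    have : dist t 0 < r₁ := by rw [Metric.mem_sphere.1 ht]; exact hrr₁
    have := h1 this
    rw [dist_eq_norm] at this
    exact this.le
  set M := ‖A₀ 0‖ + η with hM
  have hG₀0 : G₀ 0 = 0 := by
    rw [hG₀ 0 (mem_ball_self hR), zero_pow (by omega), zero_mul]
  have hG₀cont : ContinuousAt G₀ 0 :=
    (hG₀d.differentiableAt (ball_mem_nhds _ hR)).continuousAt
  set ε := η / 2 * (r / 2) ^ δ with hε
  have hεpos : 0 < ε := by positivity
  have h2 : ∀ᶠ τ in 𝓝 (0 : ℂ), ∀ t ∈ sphere (0 : ℂ) r,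
      ‖t ^ δ - (t - τ) ^ δ‖ * M + ‖G₀ τ‖ < ε / 2 := by
    refine (isCompact_sphere (0 : ℂ) r).eventually_forall_of_forall_eventually fun t _ => ?_
    have hc : ContinuousAt (fun q : ℂ × ℂ => ‖q.2 ^ δ - (q.2 - q.1) ^ δ‖ * M + ‖G₀ q.1‖) (0, t) := by
      refine ContinuousAt.add (by fun_prop) ?_
      exact (ContinuousAt.comp_of_eq (f := fun q : ℂ × ℂ => q.1) hG₀cont continuousAt_fst rfl).norm
    refine hc.eventually_lt continuousAt_const ?_
    simp [hG₀0]
    positivity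
  obtain ⟨κ₁, hκ₁, h3⟩ := Metric.eventually_nhds_iff.1 h2
  set κ := min (min (κ₁ / 2) (r / 2)) (ε / 4) with hκ
  have hκpos : 0 < κ := by positivity
  refine ⟨r, hrpos, hrR, κ, hκpos, ?_, fun G hG hcl τ hτ hord => ?_⟩
  · exact ((min_le_left _ _).trans (min_le_right _ _)).trans_lt (by linarith)
  have hτ1 : ‖τ‖ < κ₁ := hτ.trans_lt (((min_le_left _ _).trans (min_le_left _ _)).trans_lt
    (by linarith))
  have hτ2 : ‖τ‖ ≤ r / 2 := hτ.trans ((min_le_left _ _).trans (min_le_right _ _))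
  have hκε : κ ≤ ε / 4 := min_le_right _ _
  have hτR : τ ∈ ball (0 : ℂ) R := by rw [mem_ball_zero_iff]; linarith
  have hGan : AnalyticAt ℂ (fun t => G t - G τ) τ :=
    ((hG.analyticAt (Metric.isOpen_ball.mem_nhds hτR))).sub analyticAt_const
  obtain ⟨a, ha, hae⟩ := (natCast_le_analyticOrderAt hGan).1 hord
  classical
  set A : ℂ → ℂ := fun t => if t = τ then a τ else (G t - G τ) / (t - τ) ^ δ with hA
  have hAeq : ∀ t, G t - G τ = (t - τ) ^ δ * A t := by
    intro t
    by_cases h : t = τ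
    · simp only [h, sub_self, zero_pow (show δ ≠ 0 by omega), zero_mul]
    · simp only [hA, if_neg h]
      rw [mul_div_cancel₀]
      exact pow_ne_zero _ (sub_ne_zero.2 h)
  have hAd : DifferentiableOn ℂ A (ball 0 R) := by
    intro t ht
    refine DifferentiableAt.differentiableWithinAt ?_
    by_cases h : t = τ
    · subst h
      refine ha.differentiableAt.congr_of_eventuallyEq ?_
      filter_upwards [hae] with w hw
      by_cases hwt : w = t
      · simp [hA, hwt]
      · simp only [hA, if_neg hwt, hw, smul_eq_mul]
        rw [mul_div_cancel_left₀]
        exact pow_ne_zero _ (sub_ne_zero.2 hwt)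
    · have h5 : DifferentiableAt ℂ (fun t => (G t - G τ) / (t - τ) ^ δ) t := by
        refine DifferentiableAt.div ((hG.differentiableAt
          (Metric.isOpen_ball.mem_nhds ht)).sub_const _) (by fun_prop) ?_
        exact pow_ne_zero _ (sub_ne_zero.2 h)
      refine h5.congr_of_eventuallyEq ?_
      filter_upwards [isOpen_ne.mem_nhds h] with w hw
      simp only [hA, if_neg hw]
  have hsphere : ∀ t ∈ sphere (0 : ℂ) r, ‖A t - A₀ 0‖ ≤ η := by
    intro t ht
    have htr : ‖t‖ = r := by simpa using ht
    have htR : t ∈ ball (0 : ℂ) R := by rw [mem_ball_zero_iff, htr]; exact hrR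
    have hlow : r / 2 ≤ ‖t - τ‖ := by
      have := norm_sub_norm_le t τ
      linarith
    have hlow' : (r / 2) ^ δ ≤ ‖t - τ‖ ^ δ := by gcongr
    have e1 : (t - τ) ^ δ * (A t - A₀ t) =
        (G t - G₀ t) - (G τ - G₀ τ) + ((t ^ δ - (t - τ) ^ δ) * A₀ t - G₀ τ) := by
      rw [mul_sub, ← hAeq, hG₀ t htR]
      ring
    have hA₀M : ‖A₀ t‖ ≤ M := by
      have := norm_sub_norm_le (A₀ t) (A₀ 0)
      have := hA₀c t ht
      rw [hM]; linarith
    have e2 : ‖(t - τ) ^ δ * (A t - A₀ t)‖ ≤ ε := by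
      rw [e1]
      have h6 := hcl t htR
      have h7 := hcl τ hτR
      have h8 := h3 (show dist τ 0 < κ₁ by rwa [dist_zero_right]) t ht
      have h9 : ‖(t ^ δ - (t - τ) ^ δ) * A₀ t - G₀ τ‖ ≤ ‖t ^ δ - (t - τ) ^ δ‖ * M + ‖G₀ τ‖ := by
        refine (norm_sub_le _ _).trans ?_
        rw [norm_mul]
        gcongr
      have h10 := norm_add_le ((G t - G₀ t) - (G τ - G₀ τ)) ((t ^ δ - (t - τ) ^ δ) * A₀ t - G₀ τ)
      have h11 := norm_sub_le (G t - G₀ t) (G τ - G₀ τ)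
      linarith
    have e3 : ‖A t - A₀ t‖ ≤ η / 2 := by
      rw [norm_mul, norm_pow] at e2
      have h12 : (r / 2) ^ δ * ‖A t - A₀ t‖ ≤ η / 2 * (r / 2) ^ δ :=
        (mul_le_mul_of_nonneg_right hlow' (norm_nonneg _)).trans e2
      have h13 : 0 < (r / 2) ^ δ := by positivity
      nlinarith
    calc ‖A t - A₀ 0‖ = ‖(A t - A₀ t) + (A₀ t - A₀ 0)‖ := by congr 1; ring
      _ ≤ η / 2 + η / 2 := (norm_add_le _ _).trans (add_le_add e3 (hA₀c t ht))
      _ = η := by ring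
  refine ⟨A, hAd.mono (ball_subset_ball hrR.le), fun t _ => hAeq t, fun t ht => ?_⟩
  refine Complex.norm_le_of_forall_mem_frontier_norm_le (U := ball (0 : ℂ) r)
    (f := fun t => A t - A₀ 0) Metric.isBounded_ball ?_ ?_ (subset_closure ht)
  · exact ((hAd.sub_const _).mono (Metric.closure_ball_subset_closedBall.trans
      (closedBall_subset_ball hrR))).diffContOnCl
  · rw [frontier_ball (0 : ℂ) hrpos.ne']
    exact hsphere

/-- If `G - ω` vanishes to order `n ≥ 1` at `x`, the quotient `(G - ω) / G'` extends over `x` by `0`,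
with derivative `1 / n` there. -/
lemma hasDerivAt_div_deriv {G : ℂ → ℂ} {x ω : ℂ} {n : ℕ} (hn : 1 ≤ n) (hG : AnalyticAt ℂ G x)
    (hord : analyticOrderAt (fun t => G t - ω) x = n) :
    HasDerivAt (fun t => if deriv G t = 0 then 0 else (G t - ω) / deriv G t) (1 / (n : ℂ)) x := by
  have hGω : AnalyticAt ℂ (fun t => G t - ω) x := hG.sub analyticAt_const
  obtain ⟨a, ha, ha0, hae⟩ := hGω.analyticOrderAt_eq_natCast.1 hord
  have hn0 : (n : ℂ) ≠ 0 := by exact_mod_cast (by omega : n ≠ 0)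
  have hda : AnalyticAt ℂ (deriv a) x := ha.deriv
  set q : ℂ → ℂ := fun t => n * a t + (t - x) * deriv a t with hq
  have hqa : AnalyticAt ℂ q x :=
    (analyticAt_const.mul ha).add ((analyticAt_id.sub analyticAt_const).mul hda)
  have hq0 : q x ≠ 0 := by simp [hq, hn0, ha0]
  have hder : ∀ᶠ t in 𝓝 x, deriv G t = (t - x) ^ (n - 1) * q t := by
    filter_upwards [hae.eventually_nhds, ha.eventually_analyticAt] with t ht hat
    have h1 : HasDerivAt (fun t => (t - x) ^ n * a t)
        (n * (t - x) ^ (n - 1) * a t + (t - x) ^ n * deriv a t) t := by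
      have h2 : HasDerivAt (fun t : ℂ => (t - x) ^ n) (n * (t - x) ^ (n - 1)) t := by
        have := ((hasDerivAt_id' t).sub_const x).fun_pow n
        simpa using this
      exact h2.mul hat.differentiableAt.hasDerivAt
    have h3 : HasDerivAt (fun t => G t - ω)
        (n * (t - x) ^ (n - 1) * a t + (t - x) ^ n * deriv a t) t := by
      refine h1.congr_of_eventuallyEq ?_
      filter_upwards [ht] with s hs
      rw [hs, smul_eq_mul]
    have h4 := h3.add_const ω
    simp only [sub_add_cancel] at h4
    rw [h4.deriv, hq]
    obtain ⟨k, rfl⟩ : ∃ k, n = k + 1 := ⟨n - 1, by omega⟩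
    simp only [Nat.add_sub_cancel]
    ring
  have heq : (fun t => if deriv G t = 0 then 0 else (G t - ω) / deriv G t) =ᶠ[𝓝 x]
      fun t => (t - x) * (a t / q t) := by
    filter_upwards [hae, hder, hqa.continuousAt.eventually_ne hq0] with t ht hdt hqt
    by_cases htx : t = x
    · subst htx
      rw [sub_self, zero_mul]
      split_ifs with h
      · rfl
      · rw [ht, sub_self, zero_pow (by omega), zero_smul, zero_div]
    · have htx' := sub_ne_zero.2 htx
      have hne : deriv G t ≠ 0 := by
        rw [hdt]; exact mul_ne_zero (pow_ne_zero _ htx') hqt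
      rw [if_neg hne, ht, hdt, smul_eq_mul]
      obtain ⟨k, rfl⟩ : ∃ k, n = k + 1 := ⟨n - 1, by omega⟩
      simp only [Nat.add_sub_cancel]
      have := pow_ne_zero k htx'
      field_simp
      ring
  refine HasDerivAt.congr_of_eventuallyEq ?_ heq
  have hquot : DifferentiableAt ℂ (fun t => a t / q t) x :=
    ha.differentiableAt.div hqa.differentiableAt hq0
  have h5 := ((hasDerivAt_id' x).sub_const x).fun_mul hquot.hasDerivAt
  refine h5.congr_deriv ?_
  simp [hq]
  field_simp

/-- Let `G` be close to `G₀ = t ^ δ * A₀ t`, and suppose that all critical points of `G` near `0`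
have the same value `ω`. Then `G` takes the value `ω` at some point near `0` with multiplicity
exactly `δ`. The function `(G - ω) / G'` is then holomorphic, hence close to `G₀ / G₀'`, which has
a simple zero with derivative `1 / δ` at `0`; its zero `τ` is simple with derivative the inverse of
the multiplicity. -/
lemma exists_multiple_point {G₀ A₀ : ℂ → ℂ} {R : ℝ} {δ : ℕ} (hR : 0 < R)
    (hG₀d : DifferentiableOn ℂ G₀ (ball 0 R)) (hδ : 1 ≤ δ)
    (hA₀ : AnalyticAt ℂ A₀ 0) (hA₀0 : A₀ 0 ≠ 0)
    (hG₀ : ∀ᶠ t in 𝓝 (0 : ℂ), G₀ t = t ^ δ * A₀ t) {ρ : ℝ} (hρ : 0 < ρ) (hρR : ρ ≤ R) :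
    ∃ κ > 0, ∀ G : ℂ → ℂ, DifferentiableOn ℂ G (ball 0 R) →
      (∀ t ∈ ball (0 : ℂ) R, ‖G t - G₀ t‖ ≤ κ) → ∀ ω : ℂ, ‖ω‖ ≤ κ →
      (∀ t ∈ ball (0 : ℂ) ρ, deriv G t = 0 → G t = ω) →
      ∃ τ ∈ ball (0 : ℂ) ρ, G τ = ω ∧ analyticOrderAt (fun t => G t - ω) τ = δ := by
  have hδ0 : (δ : ℂ) ≠ 0 := by exact_mod_cast (by omega : δ ≠ 0)
  have hG₀an : AnalyticAt ℂ G₀ 0 := hG₀d.analyticAt (ball_mem_nhds _ hR)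
  have hord₀ : analyticOrderAt (fun t => G₀ t - 0) 0 = δ := by
    simp only [sub_zero]
    refine hG₀an.analyticOrderAt_eq_natCast.2 ⟨A₀, hA₀, hA₀0, ?_⟩
    filter_upwards [hG₀] with t ht
    simp [ht]
  set T₀ : ℂ → ℂ := fun t => if deriv G₀ t = 0 then 0 else (G₀ t - 0) / deriv G₀ t with hT₀
  have hT₀' : HasDerivAt T₀ (1 / (δ : ℂ)) 0 := hasDerivAt_div_deriv hδ hG₀an hord₀
  have hT₀0 : T₀ 0 = 0 := by
    have h1 : G₀ 0 = 0 := by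
      have := hG₀.self_of_nhds
      rwa [zero_pow (by omega), zero_mul] at this
    simp [hT₀, h1]
  -- away from `0`, neither `G₀` nor its derivative vanishes
  have hG₀nz : ∀ᶠ t in 𝓝[≠] (0 : ℂ), G₀ t ≠ 0 := by
    rcases hG₀an.eventually_eq_zero_or_eventually_ne_zero with h | h
    · exfalso
      have : analyticOrderAt (fun t => G₀ t - 0) 0 = ⊤ := by
        rw [analyticOrderAt_eq_top]; simpa using h
      rw [hord₀] at this
      exact ENat.natCast_ne_top _ this
    · exact h
  have hG₀'nz : ∀ᶠ t in 𝓝[≠] (0 : ℂ), deriv G₀ t ≠ 0 := by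
    rcases hG₀an.deriv.eventually_eq_zero_or_eventually_ne_zero with h | h
    · exfalso
      have h1 : T₀ =ᶠ[𝓝 0] fun _ => 0 := by
        filter_upwards [h] with t ht
        simp [hT₀, ht]
      have h2 := (hT₀'.congr_of_eventuallyEq h1.symm).unique (hasDerivAt_const 0 0)
      exact one_div_ne_zero hδ0 h2
    · exact h
  have hboth := hG₀nz.and hG₀'nz
  rw [eventually_nhdsWithin_iff, Metric.eventually_nhds_iff_ball] at hboth
  obtain ⟨r₁, hr₁, hnz⟩ := hboth
  set r := min (ρ / 2) (r₁ / 2) with hr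
  have hrpos : 0 < r := by positivity
  have hrρ : r < ρ := (min_le_left _ _).trans_lt (by linarith)
  have hrr₁ : r < r₁ := (min_le_right _ _).trans_lt (by linarith)
  have hrR : r < R := hrρ.trans_le hρR
  have hT₀d : DifferentiableOn ℂ T₀ (ball 0 (min ρ r₁)) := by
    intro t ht
    refine DifferentiableAt.differentiableWithinAt ?_
    have htr₁ : t ∈ ball (0 : ℂ) r₁ := ball_subset_ball (min_le_right _ _) ht
    have htR : t ∈ ball (0 : ℂ) R :=
      ball_subset_ball ((min_le_left _ _).trans hρR) ht
    by_cases h0 : t = 0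
    · rw [h0]; exact hT₀'.differentiableAt
    · have hne := (hnz t htr₁ h0).2
      have hda : DifferentiableAt ℂ (deriv G₀) t :=
        (hG₀d.deriv isOpen_ball).differentiableAt (Metric.isOpen_ball.mem_nhds htR)
      have h1 : DifferentiableAt ℂ (fun t => (G₀ t - 0) / deriv G₀ t) t :=
        ((hG₀d.differentiableAt (Metric.isOpen_ball.mem_nhds htR)).sub_const 0).div hda hne
      refine h1.congr_of_eventuallyEq ?_
      filter_upwards [hda.continuousAt.eventually_ne hne] with s hs
      simp [hT₀, hs]
  have hrmin : r < min ρ r₁ := lt_min hrρ hrr₁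
  -- the zero of a small perturbation of `T₀`
  obtain ⟨ε₁, hε₁, hε₁r, η₁, hη₁, Hder⟩ := exists_deriv_close (κ := 1 / (2 * (δ * (δ + 1)) : ℝ))
    hrpos (by positivity) (hT₀d.mono (ball_subset_ball hrmin.le))
  obtain ⟨ε₂, hε₂, hε₂r, -, Hex⟩ := exists_simple_zero hrpos
    (hT₀d.mono (ball_subset_ball hrmin.le)) hT₀0
    (by rw [hT₀'.deriv]; exact one_div_ne_zero hδ0)
  obtain ⟨η₂, hη₂, Hex⟩ := Hex (min ε₁ ε₂) (by positivity) (min_le_right _ _)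
  set ε := min η₁ η₂ with hε
  have hεpos : 0 < ε := by positivity
  -- lower and upper bounds on the circle of radius `r`
  have hsph : sphere (0 : ℂ) r ⊆ ball 0 R := fun t ht => by
    rw [mem_ball_zero_iff]; rw [mem_sphere_zero_iff_norm] at ht; linarith
  have hsph0 : ∀ t ∈ sphere (0 : ℂ) r, G₀ t ≠ 0 ∧ deriv G₀ t ≠ 0 := by
    intro t ht
    rw [mem_sphere_zero_iff_norm] at ht
    refine hnz t (by rw [mem_ball_zero_iff]; linarith) ?_
    intro h
    rw [mem_singleton_iff] at h
    rw [h, norm_zero] at ht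
    linarith
  have hcG₀ : ContinuousOn G₀ (sphere 0 r) := hG₀d.continuousOn.mono hsph
  have hcG₀' : ContinuousOn (deriv G₀) (sphere 0 r) :=
    (hG₀d.deriv isOpen_ball).continuousOn.mono hsph
  -- joint continuity of the quotient in small perturbations of numerator and denominator
  have hpert : ∀ᶠ p in 𝓝 (0 : ℂ × ℂ), ∀ t ∈ sphere (0 : ℂ) r,
      deriv G₀ t + p.2 ≠ 0 ∧ p.1 ≠ - G₀ t ∧
      ‖(G₀ t + p.1) / (deriv G₀ t + p.2) - G₀ t / deriv G₀ t‖ < ε := by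
    obtain ⟨m, hm, hmle⟩ : ∃ m > 0, ∀ t ∈ sphere (0 : ℂ) r,
        m ≤ ‖G₀ t‖ ∧ m ≤ ‖deriv G₀ t‖ := by
      have hne : (sphere (0 : ℂ) r).Nonempty := NormedSpace.sphere_nonempty.2 hrpos.le
      obtain ⟨t₁, ht₁, h1⟩ := (isCompact_sphere (0 : ℂ) r).exists_isMinOn hne hcG₀.norm
      obtain ⟨t₂, ht₂, h2⟩ := (isCompact_sphere (0 : ℂ) r).exists_isMinOn hne hcG₀'.norm
      refine ⟨min ‖G₀ t₁‖ ‖deriv G₀ t₂‖, ?_, fun t ht => ⟨(min_le_left _ _).trans (h1 ht),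
        (min_le_right _ _).trans (h2 ht)⟩⟩
      exact lt_min (norm_pos_iff.2 (hsph0 t₁ ht₁).1) (norm_pos_iff.2 (hsph0 t₂ ht₂).2)
    obtain ⟨M, hM⟩ := (isCompact_sphere (0 : ℂ) r).exists_bound_of_continuousOn hcG₀
    have hMpos : 0 ≤ |M| := abs_nonneg M
    obtain ⟨M', hM'⟩ := (isCompact_sphere (0 : ℂ) r).exists_bound_of_continuousOn hcG₀'
    have hMpos' : 0 ≤ |M'| := abs_nonneg M'
    have hlim : Tendsto (fun p : ℂ × ℂ => ‖p.1‖ * |M'| + ‖p.2‖ * |M|) (𝓝 0) (𝓝 0) := by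
      have : Continuous fun p : ℂ × ℂ => ‖p.1‖ * |M'| + ‖p.2‖ * |M| := by fun_prop
      simpa using this.tendsto 0
    have hn1 : ∀ᶠ p in 𝓝 (0 : ℂ × ℂ), ‖p.1‖ < m :=
      (continuous_fst.norm.tendsto (0 : ℂ × ℂ)).eventually_lt_const (by simpa using hm)
    have hn2 : ∀ᶠ p in 𝓝 (0 : ℂ × ℂ), ‖p.2‖ < m / 2 :=
      (continuous_snd.norm.tendsto (0 : ℂ × ℂ)).eventually_lt_const (by simpa using hm)
    filter_upwards [hlim.eventually_lt_const (show (0 : ℝ) < ε * (m / 2 * m) by positivity),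
      hn1, hn2] with p hp hp1 hp2 t ht
    obtain ⟨hm1, hm2⟩ := hmle t ht
    have hb : m / 2 ≤ ‖deriv G₀ t + p.2‖ := by
      have := norm_sub_le_norm_add (deriv G₀ t) p.2
      linarith
    have hb0 : deriv G₀ t + p.2 ≠ 0 := norm_pos_iff.1 (by linarith)
    have hb0' := (hsph0 t ht).2
    refine ⟨hb0, ?_, ?_⟩
    · intro h
      rw [h, norm_neg] at hp1
      linarith
    · rw [div_sub_div _ _ hb0 hb0', norm_div, norm_mul, div_lt_iff₀ (by positivity)]
      calc ‖(G₀ t + p.1) * deriv G₀ t - (deriv G₀ t + p.2) * G₀ t‖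
          = ‖p.1 * deriv G₀ t - p.2 * G₀ t‖ := by congr 1; ring
        _ ≤ ‖p.1‖ * ‖deriv G₀ t‖ + ‖p.2‖ * ‖G₀ t‖ := by
          refine (norm_sub_le _ _).trans ?_
          rw [norm_mul, norm_mul]
        _ ≤ ‖p.1‖ * |M'| + ‖p.2‖ * |M| := by
          have := (hM t ht).trans (le_abs_self M)
          have := (hM' t ht).trans (le_abs_self M')
          gcongr
        _ < ε * (m / 2 * m) := hp
        _ ≤ ε * (‖deriv G₀ t + p.2‖ * ‖deriv G₀ t‖) := by gcongr
  obtain ⟨κ₁, hκ₁, Hpert⟩ := Metric.eventually_nhds_iff.1 hpert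
  set s := R - r with hs
  have hspos : 0 < s := by linarith
  refine ⟨min (κ₁ / 4) (κ₁ * s / 4), by positivity, fun G hG hcl ω hω hcrit => ?_⟩
  have hκa : min (κ₁ / 4) (κ₁ * s / 4) ≤ κ₁ / 4 := min_le_left _ _
  have hκb : min (κ₁ / 4) (κ₁ * s / 4) ≤ κ₁ * s / 4 := min_le_right _ _
  set T : ℂ → ℂ := fun t => if deriv G t = 0 then 0 else (G t - ω) / deriv G t with hT
  have hder_close : ∀ t ∈ sphere (0 : ℂ) r, ‖deriv G t - deriv G₀ t‖ ≤ κ₁ / 2 := by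
    intro t ht
    have htr : ‖t‖ = r := by simpa using ht
    have hsub : closedBall t (s / 2) ⊆ ball 0 R := by
      intro w hw
      rw [mem_ball_zero_iff]
      rw [Metric.mem_closedBall, dist_eq_norm] at hw
      have := norm_sub_norm_le w t
      linarith
    have htR := Metric.isOpen_ball.mem_nhds (hsph ht)
    rw [← deriv_fun_sub (hG.differentiableAt htR) (hG₀d.differentiableAt htR)]
    have h1 : ‖deriv (fun w => G w - G₀ w) t‖ ≤ κ₁ * s / 4 / (s / 2) := by
      refine Complex.norm_deriv_le_of_forall_mem_sphere_norm_le (by positivity) ?_ ?_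
      · exact ((hG.sub hG₀d).mono
          (Metric.closure_ball_subset_closedBall.trans hsub)).diffContOnCl
      · intro z hz
        exact (hcl z (hsub (Metric.sphere_subset_closedBall hz))).trans hκb
    refine h1.trans (le_of_eq ?_)
    field_simp; norm_num
  have hpt : ∀ t ∈ sphere (0 : ℂ) r, deriv G t ≠ 0 ∧ G t ≠ ω ∧ ‖T t - T₀ t‖ ≤ ε := by
    intro t ht
    have h1 := Hpert (y := (G t - ω - G₀ t, deriv G t - deriv G₀ t)) (by
      rw [dist_zero_right, Prod.norm_def]
      refine max_lt ?_ ?_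
      · have h2 := hcl t (hsph ht)
        calc ‖G t - ω - G₀ t‖ = ‖(G t - G₀ t) - ω‖ := by congr 1; ring
          _ ≤ ‖G t - G₀ t‖ + ‖ω‖ := norm_sub_le _ _
          _ < κ₁ := by linarith
      · have := hder_close t ht
        simp only
        linarith) t ht
    simp only [add_sub_cancel] at h1
    refine ⟨h1.1, fun h => h1.2.1 (by rw [h]; ring), ?_⟩
    simp only [hT, hT₀, if_neg h1.1, if_neg (hsph0 t ht).2, sub_zero]
    exact h1.2.2.le
  -- the order of `G - ω` is finite
  have hGan : ∀ x ∈ ball (0 : ℂ) R, AnalyticAt ℂ G x := fun x hx =>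
    hG.analyticAt (Metric.isOpen_ball.mem_nhds hx)
  have hfin : ∀ x ∈ ball (0 : ℂ) R, analyticOrderAt (fun t => G t - ω) x ≠ ⊤ := by
    intro x hx htop
    have hGan' : AnalyticOnNhd ℂ (fun t => G t - ω) (ball 0 R) := fun y hy =>
      (hGan y hy).sub analyticAt_const
    have := hGan'.eqOn_zero_of_preconnected_of_eventuallyEq_zero
      (convex_ball (0 : ℂ) R).isPreconnected hx (analyticOrderAt_eq_top.1 htop)
    obtain ⟨t, ht⟩ : (sphere (0 : ℂ) r).Nonempty := NormedSpace.sphere_nonempty.2 hrpos.le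
    exact (hpt t ht).2.1 (sub_eq_zero.1 (this (hsph ht)))
  have hTω : ∀ x ∈ ball (0 : ℂ) ρ, G x = ω → ∃ n : ℕ, 1 ≤ n ∧
      analyticOrderAt (fun t => G t - ω) x = n ∧ HasDerivAt T (1 / (n : ℂ)) x := by
    intro x hx hxω
    have hxR := ball_subset_ball hρR hx
    obtain ⟨n, hn⟩ := ENat.ne_top_iff_exists.1 (hfin x hxR)
    have hn1 : 1 ≤ n := by
      by_contra h
      have : n = 0 := by omega
      rw [this] at hn
      have h2 : AnalyticAt ℂ (fun t => G t - ω) x := (hGan x hxR).sub analyticAt_const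
      exact (h2.analyticOrderAt_eq_zero.1 hn.symm) (by simp [hxω])
    exact ⟨n, hn1, hn.symm, hasDerivAt_div_deriv hn1 (hGan x hxR) hn.symm⟩
  have hTd : DifferentiableOn ℂ T (ball 0 ρ) := by
    intro x hx
    refine DifferentiableAt.differentiableWithinAt ?_
    by_cases hxω : G x = ω
    · obtain ⟨n, -, -, h⟩ := hTω x hx hxω
      exact h.differentiableAt
    · have hne : deriv G x ≠ 0 := fun h => hxω (hcrit x hx h)
      have hxR := Metric.isOpen_ball.mem_nhds (ball_subset_ball hρR hx)
      have hda : DifferentiableAt ℂ (deriv G) x :=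
        (hG.deriv isOpen_ball).differentiableAt hxR
      have h1 : DifferentiableAt ℂ (fun t => (G t - ω) / deriv G t) x :=
        ((hG.differentiableAt hxR).sub_const ω).div hda hne
      refine h1.congr_of_eventuallyEq ?_
      filter_upwards [hda.continuousAt.eventually_ne hne] with t ht
      simp [hT, ht]
  have hTc : ∀ t ∈ ball (0 : ℂ) r, ‖T t - T₀ t‖ ≤ ε := by
    intro t ht
    refine Complex.norm_le_of_forall_mem_frontier_norm_le (U := ball (0 : ℂ) r)
      (f := fun t => T t - T₀ t) Metric.isBounded_ball ?_ ?_ (subset_closure ht)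
    · refine (DifferentiableOn.sub (hTd.mono ?_) (hT₀d.mono ?_)).diffContOnCl
      · exact Metric.closure_ball_subset_closedBall.trans (closedBall_subset_ball hrρ)
      · exact Metric.closure_ball_subset_closedBall.trans (closedBall_subset_ball hrmin)
    · rw [frontier_ball (0 : ℂ) hrpos.ne']
      exact fun t ht => (hpt t ht).2.2
  have hTdr : DifferentiableOn ℂ T (ball 0 r) := hTd.mono (ball_subset_ball hrρ.le)
  obtain ⟨τ, hτ, hTτ⟩ := Hex T hTdr fun t ht => (hTc t ht).trans (min_le_right _ _)
  have hτ1 : τ ∈ closedBall (0 : ℂ) ε₁ :=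
    Metric.closedBall_subset_closedBall (min_le_left _ _) hτ
  have hτρ : τ ∈ ball (0 : ℂ) ρ := closedBall_subset_ball (hε₁r.trans hrρ) hτ1
  have hclose := Hder T hTdr (fun t ht => (hTc t ht).trans (min_le_left _ _)) τ hτ1
  have hGτ : G τ = ω := by
    by_cases h : deriv G τ = 0
    · exact hcrit τ hτρ h
    · simp only [hT, if_neg h, div_eq_zero_iff, h, or_false, sub_eq_zero] at hTτ
      exact hTτ
  obtain ⟨n, hn1, hn, hTn⟩ := hTω τ hτρ hGτ
  refine ⟨τ, hτρ, hGτ, ?_⟩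
  rw [hn]
  rw [hTn.deriv, hT₀'.deriv] at hclose
  -- two inverses of integers that are this close are equal
  have hreal : |1 / (n : ℝ) - 1 / (δ : ℝ)| ≤ 1 / (2 * (δ * (δ + 1))) := by
    have : ((1 / (n : ℝ) - 1 / (δ : ℝ) : ℝ) : ℂ) = 1 / (n : ℂ) - 1 / (δ : ℂ) := by push_cast; rfl
    rw [← this, Complex.norm_real] at hclose
    exact hclose
  have hnpos : (0 : ℝ) < n := by exact_mod_cast hn1
  have hδpos : (0 : ℝ) < δ := by exact_mod_cast hδ
  have hδ1 : (1 : ℝ) ≤ δ := by exact_mod_cast hδ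
  rw [abs_le] at hreal
  obtain ⟨hl, hu⟩ := hreal
  rw [div_sub_div _ _ hnpos.ne' hδpos.ne'] at hl hu
  rw [div_le_div_iff₀ (by positivity) (by positivity)] at hu
  rw [neg_le_iff_add_nonneg, div_add_div _ _ (by positivity) (by positivity)] at hl
  have hl' := (div_nonneg_iff.1 hl).resolve_right (fun h => by
    have : (0 : ℝ) < n * δ * (2 * (δ * (δ + 1))) := by positivity
    linarith [h.2])
  have hnδ : n = δ := by
    rcases lt_trichotomy n δ with h | h | h
    · exfalso
      have h' : (n : ℝ) + 1 ≤ δ := by exact_mod_cast h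
      have e1 : δ * (n * 1) ≤ δ * (δ * (δ : ℝ)) := by
        have : n * 1 ≤ δ * (δ : ℝ) := by nlinarith
        exact mul_le_mul_of_nonneg_left this hδpos.le
      have e2 : (δ : ℝ) * (2 * (δ + 1) * (δ - n)) ≤ δ * n := by nlinarith
      have e3 : (2 * (δ + 1) * (δ - n) : ℝ) ≤ n := le_of_mul_le_mul_left e2 hδpos
      nlinarith
    · exact h
    · exfalso
      have h' : (δ : ℝ) + 1 ≤ n := by exact_mod_cast h
      have e2 : (δ : ℝ) * (2 * (δ + 1) * (n - δ)) ≤ δ * n := by nlinarith [hl'.1]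
      have e3 : (2 * (δ + 1) * (n - δ) : ℝ) ≤ n := le_of_mul_le_mul_left e2 hδpos
      nlinarith
  rw [hnδ]

/-! ### Local Böttcher coordinates in families -/

/-- A bounded holomorphic function is Lipschitz on the disc of half the radius. -/
lemma norm_sub_le_of_bounded {F : ℂ → ℂ} {r M : ℝ} (hr : 0 < r)
    (hF : DifferentiableOn ℂ F (ball 0 r)) (hM : ∀ t ∈ ball (0 : ℂ) r, ‖F t‖ ≤ M)
    {x y : ℂ} (hx : x ∈ ball (0 : ℂ) (r / 2)) (hy : y ∈ ball (0 : ℂ) (r / 2)) :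
    ‖F x - F y‖ ≤ M / (r / 2) * ‖x - y‖ := by
  -- Cauchy's estimate on discs of radius slightly less than `r / 2`
  have hder : ∀ t ∈ ball (0 : ℂ) (r / 2), ‖deriv F t‖ ≤ M / (r / 2) := by
    intro t ht
    rw [mem_ball_zero_iff] at ht
    have key : ∀ s ∈ Ioo 0 (r / 2), ‖deriv F t‖ ≤ M / s := by
      intro s hs
      have hsub : closedBall t s ⊆ ball 0 r := by
        intro w hw
        rw [mem_ball_zero_iff]
        rw [Metric.mem_closedBall, dist_eq_norm] at hw
        have := norm_sub_norm_le w t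
        linarith [hs.2]
      refine Complex.norm_deriv_le_of_forall_mem_sphere_norm_le hs.1
        (hF.mono (Metric.closure_ball_subset_closedBall.trans hsub)).diffContOnCl ?_
      exact fun z hz => hM z (hsub (Metric.sphere_subset_closedBall hz))
    have hlim : Tendsto (fun s : ℝ => M / s) (𝓝[<] (r / 2)) (𝓝 (M / (r / 2))) := by
      refine Filter.Tendsto.mono_left ?_ nhdsWithin_le_nhds
      exact (continuousAt_const.div continuousAt_id (by simpa using hr.ne')).tendsto
    refine ge_of_tendsto hlim ?_
    filter_upwards [Ioo_mem_nhdsLT (show (0 : ℝ) < r / 2 by positivity)] with s hs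
    exact key s hs
  refine (convex_ball (0 : ℂ) (r / 2)).norm_image_sub_le_of_norm_deriv_le ?_ hder hy hx
  intro t ht
  exact hF.differentiableAt (Metric.isOpen_ball.mem_nhds
    (ball_subset_ball (by linarith) ht))

lemma norm_exp_sub_exp_le {M : ℝ} {u v : ℂ} (hu : ‖u‖ ≤ M) (hv : ‖v‖ ≤ M) :
    ‖Complex.exp u - Complex.exp v‖ ≤ Real.exp M * ‖u - v‖ := by
  refine (convex_closedBall (0 : ℂ) M).norm_image_sub_le_of_norm_deriv_le
    (f := Complex.exp) (fun t _ => Complex.differentiableAt_exp) ?_ (by simpa using hv)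
    (by simpa using hu)
  intro t ht
  rw [Complex.deriv_exp, Complex.norm_exp]
  gcongr
  exact (Complex.re_le_norm t).trans (by simpa using ht)

/-- Picard iterates for the functional equation `m * u w + ℓ (w * exp (u w)) = u (w ^ m)`. -/
noncomputable def bottcherIter {P : Type*} (m : ℕ) (ℓ : P → ℂ → ℂ) : ℕ → P → ℂ → ℂ
  | 0, _, _ => 0
  | n + 1, p, w => (bottcherIter m ℓ n p (w ^ m) -
      ℓ p (w * Complex.exp (bottcherIter m ℓ n p w))) / m

/-- Solution of the logarithmic form of Böttcher's functional equation, holomorphic in the variable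
and continuous in parameters. The right-hand side of `u w = (u (w ^ m) - ℓ (w * exp (u w))) / m` is a
contraction on the functions bounded by `M`. -/
lemma exists_log_bottcher {m : ℕ} (hm : 2 ≤ m) {r M : ℝ} (hr : 0 < r) (hM : 0 ≤ M) :
    ∃ ρ > 0, ρ < 1 ∧ ρ * Real.exp M < r ∧ ∀ (P : Type) [TopologicalSpace P] (ℓ : P → ℂ → ℂ),
      (∀ p, DifferentiableOn ℂ (ℓ p) (ball 0 r)) →
      (∀ p, ∀ t ∈ ball (0 : ℂ) r, ‖ℓ p t‖ ≤ M) →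
      ContinuousOn (Function.uncurry ℓ) (univ ×ˢ ball (0 : ℂ) r) →
      ∃ u : P → ℂ → ℂ, (∀ p, DifferentiableOn ℂ (u p) (ball 0 ρ)) ∧
        (∀ p, ∀ w ∈ ball (0 : ℂ) ρ, ‖u p w‖ ≤ M) ∧
        ContinuousOn (Function.uncurry u) (univ ×ˢ ball (0 : ℂ) ρ) ∧
        ∀ p, ∀ w ∈ ball (0 : ℂ) ρ,
          m * u p w + ℓ p (w * Complex.exp (u p w)) = u p (w ^ m) := by
  have hE := Real.exp_pos M
  set ρ := min (1 / 2) (r / (4 * (M + 1) * Real.exp M)) with hρ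
  have hρpos : 0 < ρ := by positivity
  have hρ2 : ρ ≤ 1 / 2 := min_le_left _ _
  have hρE : ρ * Real.exp M ≤ r / (4 * (M + 1)) := by
    calc ρ * Real.exp M ≤ r / (4 * (M + 1) * Real.exp M) * Real.exp M := by
          gcongr; exact min_le_right _ _
      _ = r / (4 * (M + 1)) := by field_simp
  have hρE' : ρ * Real.exp M ≤ r / 4 := by
    refine hρE.trans ?_
    gcongr
    linarith
  have hm0 : (0 : ℝ) < m := by exact_mod_cast (by omega : 0 < m)
  have hm2 : (2 : ℝ) ≤ m := by exact_mod_cast hm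
  have hmC : (m : ℂ) ≠ 0 := by exact_mod_cast (by omega : m ≠ 0)
  refine ⟨ρ, hρpos, by linarith, by linarith, fun P _ ℓ hd hb hc => ?_⟩
  set U := bottcherIter m ℓ with hU
  have hpow : ∀ w ∈ ball (0 : ℂ) ρ, w ^ m ∈ ball (0 : ℂ) ρ := by
    intro w hw
    rw [mem_ball_zero_iff] at hw ⊢
    rw [norm_pow]
    calc ‖w‖ ^ m ≤ ‖w‖ ^ 1 := pow_le_pow_of_le_one (norm_nonneg _) (by linarith) (by omega)
      _ < ρ := by rwa [pow_one]
  have harg : ∀ w ∈ ball (0 : ℂ) ρ, ∀ c : ℂ, ‖c‖ ≤ M →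
      w * Complex.exp c ∈ ball (0 : ℂ) (r / 2) := by
    intro w hw c hcM
    rw [mem_ball_zero_iff] at hw ⊢
    rw [norm_mul]
    have h1 : ‖Complex.exp c‖ ≤ Real.exp M := by
      rw [Complex.norm_exp]
      gcongr
      exact (Complex.re_le_norm c).trans hcM
    calc ‖w‖ * ‖Complex.exp c‖ ≤ ρ * Real.exp M := by gcongr
      _ < r / 2 := by linarith
  have hhalf : ball (0 : ℂ) (r / 2) ⊆ ball 0 r := ball_subset_ball (by linarith)
  have hbound : ∀ n p, ∀ w ∈ ball (0 : ℂ) ρ, ‖U n p w‖ ≤ M := by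
    intro n
    induction n with
    | zero => intro p w _; simpa [hU, bottcherIter] using hM
    | succ n ih =>
      intro p w hw
      change ‖(U n p (w ^ m) - ℓ p (w * Complex.exp (U n p w))) / m‖ ≤ M
      rw [norm_div, Complex.norm_natCast, div_le_iff₀ hm0]
      calc ‖U n p (w ^ m) - ℓ p (w * Complex.exp (U n p w))‖ ≤ M + M :=
            (norm_sub_le _ _).trans (add_le_add (ih p _ (hpow w hw))
              (hb p _ (hhalf (harg w hw _ (ih p w hw)))))
        _ ≤ M * m := by nlinarith
  -- the contraction estimate
  have hcontr : ∀ p, ∀ w ∈ ball (0 : ℂ) ρ, ∀ a b : ℂ, ‖a‖ ≤ M → ‖b‖ ≤ M →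
      ‖ℓ p (w * Complex.exp a) - ℓ p (w * Complex.exp b)‖ ≤ 1 / 2 * ‖a - b‖ := by
    intro p w hw a b ha hb'
    have h1 := norm_sub_le_of_bounded hr (hd p) (hb p) (harg w hw a ha) (harg w hw b hb')
    have h2 : ‖w * Complex.exp a - w * Complex.exp b‖ ≤ ρ * (Real.exp M * ‖a - b‖) := by
      rw [← mul_sub, norm_mul]
      have := norm_exp_sub_exp_le ha hb'
      rw [mem_ball_zero_iff] at hw
      gcongr
    refine h1.trans ((mul_le_mul_of_nonneg_left h2 (by positivity)).trans ?_)
    calc M / (r / 2) * (ρ * (Real.exp M * ‖a - b‖))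
        = M / (r / 2) * (ρ * Real.exp M) * ‖a - b‖ := by ring
      _ ≤ M / (r / 2) * (r / (4 * (M + 1))) * ‖a - b‖ := by gcongr
      _ = M / (M + 1) * (1 / 2) * ‖a - b‖ := by field_simp; norm_num
      _ ≤ 1 * (1 / 2) * ‖a - b‖ := by
          gcongr
          rw [div_le_one (by linarith)]
          linarith
      _ = 1 / 2 * ‖a - b‖ := by ring
  have hgeom : ∀ n p, ∀ w ∈ ball (0 : ℂ) ρ,
      dist (U n p w) (U (n + 1) p w) ≤ M * (3 / 4) ^ n := by
    intro n
    induction n with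
    | zero =>
      intro p w hw
      have h0 : U 0 p w = 0 := rfl
      rw [h0, dist_zero_left, pow_zero, mul_one]
      exact hbound 1 p w hw
    | succ n ih =>
      intro p w hw
      have e : U (n + 1) p w - U (n + 1 + 1) p w =
          ((U n p (w ^ m) - U (n + 1) p (w ^ m)) - (ℓ p (w * Complex.exp (U n p w)) -
            ℓ p (w * Complex.exp (U (n + 1) p w)))) / m := by
        change (U n p (w ^ m) - ℓ p (w * Complex.exp (U n p w))) / m -
          (U (n + 1) p (w ^ m) - ℓ p (w * Complex.exp (U (n + 1) p w))) / m = _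
        ring
      rw [dist_eq_norm, e, norm_div, Complex.norm_natCast, div_le_iff₀ hm0]
      have h1 := ih p _ (hpow w hw)
      have h2 := ih p w hw
      have h3 := hcontr p w hw _ _ (hbound n p w hw) (hbound (n + 1) p w hw)
      rw [dist_eq_norm] at h1 h2
      refine (norm_sub_le _ _).trans ?_
      have h4 : 0 ≤ M * (3 / 4 : ℝ) ^ n := by positivity
      rw [pow_succ]
      nlinarith
  have hcau : ∀ p, ∀ w ∈ ball (0 : ℂ) ρ, ∃ l, Tendsto (fun n => U n p w)
      Filter.atTop (𝓝 l) := fun p w hw =>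
    cauchySeq_tendsto_of_complete (cauchySeq_of_le_geometric (3 / 4) M (by norm_num)
      fun n => hgeom n p w hw)
  classical
  choose! u hu using hcau
  have hunif : TendstoUniformlyOn (fun n => Function.uncurry (U n)) (Function.uncurry u)
      Filter.atTop (univ ×ˢ ball (0 : ℂ) ρ) := by
    rw [Metric.tendstoUniformlyOn_iff]
    intro ε hε
    have hlim : Tendsto (fun n : ℕ => M * (3 / 4 : ℝ) ^ n / (1 - 3 / 4)) Filter.atTop
        (𝓝 0) := by
      have := ((tendsto_pow_atTop_nhds_zero_of_lt_one (r := (3 / 4 : ℝ)) (by norm_num)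
        (by norm_num)).const_mul M).div_const (1 - 3 / 4)
      simpa using this
    filter_upwards [hlim.eventually_lt_const hε] with n hn q hq
    rw [dist_comm]
    exact (dist_le_of_le_geometric_of_tendsto (3 / 4) M (by norm_num)
      (fun n => hgeom n q.1 q.2 hq.2) (hu q.1 q.2 hq.2) n).trans_lt hn
  have hUd : ∀ n p, DifferentiableOn ℂ (U n p) (ball 0 ρ) := by
    intro n
    induction n with
    | zero => intro p; exact differentiableOn_const 0
    | succ n ih =>
      intro p
      refine DifferentiableOn.div_const (DifferentiableOn.sub ?_ ?_) _
      · exact (ih p).comp (by fun_prop) hpow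
      · exact (hd p).comp (DifferentiableOn.mul differentiableOn_id (ih p).cexp)
          fun w hw => hhalf (harg w hw _ (hbound n p w hw))
  have hUc : ∀ n, ContinuousOn (Function.uncurry (U n)) (univ ×ˢ ball (0 : ℂ) ρ) := by
    intro n
    induction n with
    | zero => exact continuousOn_const
    | succ n ih =>
      have h1 : ContinuousOn (fun q : P × ℂ => Function.uncurry (U n) (q.1, q.2 ^ m))
          (univ ×ˢ ball (0 : ℂ) ρ) :=
        ih.comp (by fun_prop) fun q hq => ⟨mem_univ _, hpow q.2 hq.2⟩
      have h2 : ContinuousOn (fun q : P × ℂ => Function.uncurry ℓ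
          (q.1, q.2 * Complex.exp (Function.uncurry (U n) q)))
          (univ ×ˢ ball (0 : ℂ) ρ) := by
        refine hc.comp (continuousOn_fst.prodMk (continuousOn_snd.mul ih.cexp)) fun q hq =>
          ⟨mem_univ _, hhalf (harg q.2 hq.2 _ (hbound n q.1 q.2 hq.2))⟩
      exact (h1.sub h2).div_const _
  have hub : ∀ p, ∀ w ∈ ball (0 : ℂ) ρ, ‖u p w‖ ≤ M := fun p w hw =>
    le_of_tendsto (hu p w hw).norm (Filter.Eventually.of_forall fun n => hbound n p w hw)
  refine ⟨u, fun p => ?_, hub, hunif.continuousOn (Filter.Frequently.of_forall hUc),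
    fun p w hw => ?_⟩
  · have h1 : TendstoUniformlyOn (fun n => U n p) (u p) Filter.atTop (ball (0 : ℂ) ρ) := by
      rw [Metric.tendstoUniformlyOn_iff] at hunif ⊢
      intro ε hε
      filter_upwards [hunif ε hε] with n hn w hw
      exact hn (p, w) ⟨mem_univ _, hw⟩
    exact h1.tendstoLocallyUniformlyOn.differentiableOn (Filter.Eventually.of_forall fun n =>
      hUd n p) isOpen_ball
  · have hℓc : ContinuousAt (ℓ p) (w * Complex.exp (u p w)) :=
      ((hd p).differentiableAt (Metric.isOpen_ball.mem_nhds
        (hhalf (harg w hw _ (hub p w hw))))).continuousAt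
    have h1 : Tendsto (fun n => ℓ p (w * Complex.exp (U n p w))) Filter.atTop
        (𝓝 (ℓ p (w * Complex.exp (u p w)))) :=
      hℓc.tendsto.comp (((hu p w hw).cexp).const_mul w)
    have h2 : Tendsto (fun n => U (n + 1) p w) Filter.atTop
        (𝓝 ((u p (w ^ m) - ℓ p (w * Complex.exp (u p w))) / m)) :=
      ((hu p _ (hpow w hw)).sub h1).div_const _
    have h3 := tendsto_nhds_unique ((hu p w hw).comp (Filter.tendsto_add_atTop_nat 1)) h2
    rw [eq_div_iff hmC] at h3
    linear_combination h3

/-- Local inverse Böttcher coordinates for a family `t ↦ t ^ m * A p t` of superattracting germs,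
on a disc of uniform radius, jointly continuous in the parameter and the point. -/
lemma exists_local_bottcher {m : ℕ} (hm : 2 ≤ m) {r : ℝ} (hr : 0 < r) {α : ℂ} (hα : α ≠ 0) :
    ∃ ρ > 0, ρ < 1 ∧ ∀ (P : Type) [TopologicalSpace P] (A : P → ℂ → ℂ),
      (∀ p, DifferentiableOn ℂ (A p) (ball 0 r)) →
      (∀ p, ∀ t ∈ ball (0 : ℂ) r, ‖A p t - α‖ ≤ ‖α‖ / 2) →
      ContinuousOn (Function.uncurry A) (univ ×ˢ ball (0 : ℂ) r) →
      ∃ ψ : P → ℂ → ℂ, (∀ p, DifferentiableOn ℂ (ψ p) (ball 0 ρ)) ∧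
        (∀ p, InjOn (ψ p) (ball 0 ρ)) ∧ (∀ p, ψ p 0 = 0) ∧
        (∀ p, ∀ w ∈ ball (0 : ℂ) ρ, ψ p w ∈ ball (0 : ℂ) r) ∧
        (∀ p, ∀ w ∈ ball (0 : ℂ) ρ, ψ p w ^ m * A p (ψ p w) = ψ p (w ^ m)) ∧
        ContinuousOn (Function.uncurry ψ) (univ ×ˢ ball (0 : ℂ) ρ) := by
  set M : ℝ := 1 + ‖Complex.log α‖ with hM
  have hM0 : 0 ≤ M := by positivity
  obtain ⟨ρ, hρ, hρ1, hρE, H⟩ := exists_log_bottcher hm hr hM0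
  set ρ' := ρ / (8 * (M + 1)) with hρ'
  have hρ'pos : 0 < ρ' := by positivity
  have hρ'le : ρ' ≤ ρ / 8 := by
    rw [hρ']
    gcongr
    linarith
  have hρ'M : 4 * M / ρ * ρ' ≤ 1 / 2 := by
    rw [hρ']
    have : 4 * M / ρ * (ρ / (8 * (M + 1))) = (M / (M + 1)) * (1 / 2) := by field_simp; ring
    rw [this]
    have : M / (M + 1) ≤ 1 := by rw [div_le_one (by linarith)]; linarith
    linarith
  refine ⟨ρ', hρ'pos, by linarith, fun P _ A hd hc hcont => ?_⟩
  have hαn : 0 < ‖α‖ := norm_pos_iff.2 hα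
  have hquot : ∀ p, ∀ t ∈ ball (0 : ℂ) r, ‖A p t / α - 1‖ ≤ 1 / 2 := by
    intro p t ht
    have : A p t / α - 1 = (A p t - α) / α := by field_simp
    rw [this, norm_div, div_le_iff₀ hαn]
    linarith [hc p t ht]
  have hslit : ∀ p, ∀ t ∈ ball (0 : ℂ) r, A p t / α ∈ Complex.slitPlane := by
    intro p t ht
    refine Complex.ball_one_subset_slitPlane ?_
    rw [mem_ball, dist_eq_norm]
    linarith [hquot p t ht]
  set ℓ : P → ℂ → ℂ := fun p t => Complex.log (A p t / α) + Complex.log α with hℓ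
  have hexp : ∀ p, ∀ t ∈ ball (0 : ℂ) r, Complex.exp (ℓ p t) = A p t := by
    intro p t ht
    rw [hℓ]
    simp only
    rw [Complex.exp_add, Complex.exp_log (Complex.slitPlane_ne_zero (hslit p t ht)),
      Complex.exp_log hα]
    field_simp
  obtain ⟨u, hud, hub, huc, hueq⟩ := H P ℓ
    (fun p => (((hd p).div_const α).clog (hslit p)).add_const _)
    (fun p t ht => by
      have h1 := Complex.norm_log_one_add_half_le_self (hquot p t ht)
      rw [add_sub_cancel] at h1
      have h2 := hquot p t ht
      calc ‖ℓ p t‖ ≤ ‖Complex.log (A p t / α)‖ + ‖Complex.log α‖ := norm_add_le _ _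
        _ ≤ M := by rw [hM]; linarith)
    (by
      refine ContinuousOn.add ?_ continuousOn_const
      exact ContinuousOn.clog (hcont.div_const α) fun q hq => hslit q.1 q.2 hq.2)
  have hsub : ball (0 : ℂ) ρ' ⊆ ball 0 ρ := ball_subset_ball (by linarith)
  have hsub2 : ball (0 : ℂ) ρ' ⊆ ball 0 (ρ / 2) :=
    ball_subset_ball (by linarith)
  have hmem : ∀ p, ∀ w ∈ ball (0 : ℂ) ρ', w * Complex.exp (u p w) ∈ ball (0 : ℂ) r := by
    intro p w hw
    have h1 := hub p w (hsub hw)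
    rw [mem_ball_zero_iff] at hw ⊢
    rw [norm_mul, Complex.norm_exp]
    calc ‖w‖ * Real.exp (u p w).re ≤ ρ * Real.exp M := by
          gcongr
          · linarith
          · exact (Complex.re_le_norm _).trans h1
      _ < r := hρE
  refine ⟨fun p w => w * Complex.exp (u p w), fun p => ?_, fun p => ?_, fun p => by simp,
    hmem, fun p w hw => ?_, ?_⟩
  · exact differentiableOn_id.mul ((hud p).mono hsub).cexp
  · intro w₁ hw₁ w₂ hw₂ h
    simp only at h
    by_contra hne
    have hlip := norm_sub_le_of_bounded hρ (hud p) (hub p) (hsub2 hw₂) (hsub2 hw₁)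
    rw [mem_ball_zero_iff] at hw₁ hw₂
    have hdiff : ‖w₂ - w₁‖ ≤ 2 * ρ' := by
      have := norm_sub_le w₂ w₁
      linarith
    have h1 : ‖u p w₂ - u p w₁‖ ≤ 1 := by
      refine hlip.trans ?_
      have : M / (ρ / 2) * ‖w₂ - w₁‖ ≤ M / (ρ / 2) * (2 * ρ') := by gcongr
      refine this.trans ?_
      have e : M / (ρ / 2) * (2 * ρ') = 4 * M / ρ * ρ' := by field_simp; ring
      rw [e]; linarith
    have h2 := Complex.norm_exp_sub_one_le h1
    have h3 : w₁ - w₂ = w₂ * (Complex.exp (u p w₂ - u p w₁) - 1) := by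
      rw [Complex.exp_sub]
      have := Complex.exp_ne_zero (u p w₁)
      field_simp
      linear_combination h
    have h4 : ‖w₁ - w₂‖ ≤ 1 / 2 * ‖w₁ - w₂‖ := by
      calc ‖w₁ - w₂‖ = ‖w₂‖ * ‖Complex.exp (u p w₂ - u p w₁) - 1‖ := by rw [h3, norm_mul]
        _ ≤ ρ' * (2 * (M / (ρ / 2) * ‖w₂ - w₁‖)) := by
            gcongr
            exact h2.trans (by gcongr)
        _ = 4 * M / ρ * ρ' * ‖w₁ - w₂‖ := by rw [norm_sub_rev w₂ w₁]; field_simp; ring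
        _ ≤ 1 / 2 * ‖w₁ - w₂‖ := by gcongr
    have h5 : 0 < ‖w₁ - w₂‖ := norm_pos_iff.2 (sub_ne_zero.2 hne)
    linarith
  · rw [← hexp p _ (hmem p w hw), mul_pow, ← Complex.exp_nat_mul, mul_assoc, ← Complex.exp_add,
      hueq p w (hsub hw)]
  · exact continuousOn_snd.mul (huc.mono (prod_mono le_rfl hsub)).cexp

/-! ### Injective holomorphic functions and critical points -/

/-- An injective holomorphic function has no critical points. -/
lemma deriv_ne_zero_of_injOn {F : ℂ → ℂ} {U : Set ℂ} (hU : IsOpen U) (hF : DifferentiableOn ℂ F U)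
    (hinj : InjOn F U) {x : ℂ} (hx : x ∈ U) : deriv F x ≠ 0 := by
  intro hd
  have han : AnalyticAt ℂ F x := hF.analyticAt (hU.mem_nhds hx)
  have hani : AnalyticAt ℂ (fun t => F t - F x) x := han.sub analyticAt_const
  have hord := han.analyticOrderAt_deriv_add_one
  have hne : analyticOrderAt (fun t => F t - F x) x ≠ ⊤ := by
    intro h
    rw [analyticOrderAt_eq_top] at h
    have h2 : ∀ᶠ t in 𝓝[≠] x, F t - F x = 0 ∧ t ∈ U :=
      (h.and (hU.mem_nhds hx)).filter_mono nhdsWithin_le_nhds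
    obtain ⟨t, ht, htx⟩ := (h2.and self_mem_nhdsWithin).exists
    exact htx (hinj ht.2 hx (sub_eq_zero.1 ht.1))
  obtain ⟨n, hn⟩ := ENat.ne_top_iff_exists.1 hne
  have hn2 : 2 ≤ n := by
    have h1 : analyticOrderAt (deriv F) x ≠ 0 := han.deriv.analyticOrderAt_ne_zero.2 hd
    rw [← hn] at hord
    have h2 : (1 : ℕ∞) ≤ analyticOrderAt (deriv F) x := Order.one_le_iff_ne_zero.2 h1
    have h3 : (2 : ℕ∞) ≤ n := by
      rw [← hord, ← one_add_one_eq_two]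
      gcongr
    exact_mod_cast h3
  obtain ⟨a, ha, ha0, hae⟩ := hani.analyticOrderAt_eq_natCast.1 hn.symm
  obtain ⟨ε₀, hε₀, -, H⟩ := exists_power_lift (show 1 ≤ n by omega) ha0
  -- a nontrivial root of unity
  set ζ := Complex.exp (2 * Real.pi * Complex.I / n) with hζ
  have hprim : IsPrimitiveRoot ζ n := Complex.isPrimitiveRoot_exp n (by omega)
  have hζn : ζ ^ n = 1 := hprim.pow_eq_one
  have hζ1 : ζ ≠ 1 := hprim.ne_one (by omega)
  have hζnorm : ‖ζ‖ = 1 := Complex.norm_eq_one_of_pow_eq_one hζn (by omega)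
  have hζpos : 0 < ‖ζ - 1‖ := norm_pos_iff.2 (sub_ne_zero.2 hζ1)
  obtain ⟨η, hη, H⟩ := H (min ε₀ (‖ζ - 1‖ / 2)) (by positivity) (min_le_left _ _)
  -- a disc on which everything is under control
  have hev : ∀ᶠ t in 𝓝 x, F t - F x = (t - x) ^ n • a t ∧ t ∈ U ∧ ‖a t - a x‖ < η ∧
      AnalyticAt ℂ a t := by
    refine hae.and ((hU.eventually_mem hx).and (Filter.Eventually.and ?_
      ha.eventually_analyticAt))
    have : ContinuousAt (fun t => ‖a t - a x‖) x := (ha.continuousAt.sub continuousAt_const).norm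
    exact this.eventually_lt_const (by simpa using hη)
  obtain ⟨r, hr, hball⟩ := Metric.eventually_nhds_iff_ball.1 hev
  have hmem : ∀ t ∈ ball (0 : ℂ) r, x + t ∈ ball x r := by
    intro t ht
    simpa [dist_eq_norm] using ht
  set s : ℂ := ((r / 4 : ℝ) : ℂ) with hs
  have hsn : ‖s‖ = r / 4 := by rw [hs, Complex.norm_real, Real.norm_of_nonneg (by positivity)]
  have hs0 : s ≠ 0 := norm_pos_iff.1 (by rw [hsn]; positivity)
  have hsr : s ∈ ball (0 : ℂ) r := by rw [mem_ball_zero_iff, hsn]; linarith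
  obtain ⟨u, ⟨hu1, hu2⟩, -⟩ := H (fun t => a (x + t)) r 0 (s * ζ) (a (x + s)) (by
      intro t ht
      refine DifferentiableAt.differentiableWithinAt ?_
      exact ((hball _ (hmem t ht)).2.2.2.differentiableAt).comp t (by fun_prop))
    (fun t ht => (hball _ (hmem t ht)).2.2.1.le)
    (by rw [norm_mul, hζnorm, hsn, norm_zero]; linarith)
    (hball _ (hmem s hsr)).2.2.1.le
  simp only [zero_add] at hu2
  rw [Metric.mem_closedBall, dist_eq_norm] at hu1
  have hu1' : ‖u - 1‖ ≤ ‖ζ - 1‖ / 2 := hu1.trans (min_le_right _ _)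
  have hζ2 : ‖ζ - 1‖ ≤ 2 := by
    have := norm_sub_le ζ 1
    rw [hζnorm, norm_one] at this
    linarith
  have hunorm : ‖u‖ ≤ 2 := by
    calc ‖u‖ = ‖(u - 1) + 1‖ := by congr 1; ring
      _ ≤ ‖u - 1‖ + ‖(1 : ℂ)‖ := norm_add_le _ _
      _ ≤ 2 := by rw [norm_one]; linarith
  have htr : s * ζ * u ∈ ball (0 : ℂ) r := by
    rw [mem_ball_zero_iff, norm_mul, norm_mul, hζnorm, hsn]
    nlinarith
  have h1 := hball _ (hmem _ hsr)
  have h2 := hball _ (hmem _ htr)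
  have heq : F (x + s * ζ * u) = F (x + s) := by
    have e1 := h1.1
    have e2 := h2.1
    simp only [add_sub_cancel_left, smul_eq_mul] at e1 e2
    have e3 : (s * ζ * u) ^ n * a (x + s * ζ * u) = s ^ n * a (x + s) := by
      rw [← hu2, mul_pow, mul_pow, hζn]; ring
    linear_combination e2 - e1 + e3
  have hpt := hinj h2.2.1 h1.2.1 heq
  have h3 : ζ * u = 1 := by
    have : s * (ζ * u) = s * 1 := by linear_combination hpt
    exact mul_left_cancel₀ hs0 this
  have h4 : ‖ζ - 1‖ = ‖u - 1‖ := by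
    have : ζ * (u - 1) = -(ζ - 1) := by linear_combination h3
    have h5 := congrArg norm this
    rw [norm_mul, hζnorm, one_mul, norm_neg] at h5
    exact h5.symm
  linarith

/-- Injective holomorphic functions are open. -/
lemma isOpen_image_of_injOn {F : ℂ → ℂ} {U V : Set ℂ} (hU : IsOpen U)
    (hF : DifferentiableOn ℂ F U) (hinj : InjOn F U) (hV : IsOpen V) (hVU : V ⊆ U) :
    IsOpen (F '' V) := by
  rw [isOpen_iff_mem_nhds]
  rintro _ ⟨x, hx, rfl⟩
  have han : AnalyticAt ℂ F x := hF.analyticAt (hU.mem_nhds (hVU hx))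
  have h1 := (han.hasStrictDerivAt).map_nhds_eq (deriv_ne_zero_of_injOn hU hF hinj (hVU hx))
  rw [← h1]
  exact Filter.image_mem_map (hV.mem_nhds hx)

/-- Comparison of two injective holomorphic functions with nested images. -/
lemma exists_holomorphic_factor {F₁ F₂ : ℂ → ℂ} {U₁ U₂ : Set ℂ} (hU₁ : IsOpen U₁)
    (hU₂ : IsOpen U₂) (h₁ : DifferentiableOn ℂ F₁ U₁) (h₂ : DifferentiableOn ℂ F₂ U₂)
    (hinj : InjOn F₂ U₂) (himg : F₁ '' U₁ ⊆ F₂ '' U₂) :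
    ∃ σ : ℂ → ℂ, DifferentiableOn ℂ σ U₁ ∧ MapsTo σ U₁ U₂ ∧ ∀ w ∈ U₁, F₂ (σ w) = F₁ w := by
  have hex : ∀ w ∈ U₁, ∃ v, v ∈ U₂ ∧ F₂ v = F₁ w := fun w hw => himg ⟨w, hw, rfl⟩
  choose! σ hσU hσ using hex
  refine ⟨σ, fun w hw => ?_, hσU, hσ⟩
  refine DifferentiableAt.differentiableWithinAt ?_
  have hv := hσU w hw
  have han : AnalyticAt ℂ F₂ (σ w) := h₂.analyticAt (hU₂.mem_nhds hv)
  have hd := deriv_ne_zero_of_injOn hU₂ h₂ hinj hv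
  have hs := han.hasStrictDerivAt
  -- near `w`, `σ` is the local inverse of `F₂` composed with `F₁`
  have hloc := hs.to_localInverse hd
  rw [hσ w hw] at hloc
  have hF₁ : DifferentiableAt ℂ F₁ w := h₁.differentiableAt (hU₁.mem_nhds hw)
  have hcomp : DifferentiableAt ℂ
      (fun w' => HasStrictDerivAt.localInverse F₂ _ (σ w) hs hd (F₁ w')) w :=
    hloc.hasDerivAt.differentiableAt.comp w hF₁
  refine hcomp.congr_of_eventuallyEq ?_
  have hr := hs.eventually_right_inverse hd
  rw [hσ w hw] at hr
  have hr' := hF₁.continuousAt.eventually hr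
  have hmem : ∀ᶠ w' in 𝓝 w, HasStrictDerivAt.localInverse F₂ _ (σ w) hs hd (F₁ w') ∈ U₂ := by
    refine hcomp.continuousAt.eventually_mem (hU₂.mem_nhds ?_)
    have : HasStrictDerivAt.localInverse F₂ _ (σ w) hs hd (F₁ w) = σ w := by
      have := (hs.eventually_left_inverse hd).self_of_nhds
      rwa [hσ w hw] at this
    rwa [this]
  filter_upwards [hr', hmem, hU₁.mem_nhds hw] with w' hw' hm hU
  exact hinj (hσU w' hU) hm (by rw [hσ w' hU, hw'])

/-- The expression of `g` in the standard chart of the plane. -/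
noncomputable def finRep (g : C(Sphere, Sphere)) : ℂ → ℂ :=
  locRep g ((0 : ℂ) : Sphere) ((0 : ℂ) : Sphere)

lemma coe_finRep {g : C(Sphere, Sphere)} {x : ℂ} (hx : g (x : Sphere) ≠ ∞) :
    ((finRep g x : ℂ) : Sphere) = g (x : Sphere) := by
  have h := localParam_locRep (g := g) (z := ((0 : ℂ) : Sphere)) (v := ((0 : ℂ) : Sphere)) (t := x)
    (by simpa using hx)
  simpa [finRep] using h

lemma finRep_eq {g : C(Sphere, Sphere)} {x y : ℂ} (h : g (x : Sphere) = (y : Sphere)) :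
    finRep g x = y := by
  rw [← OnePoint.coe_eq_coe, coe_finRep (by rw [h]; exact OnePoint.coe_ne_infty y), h]

lemma analyticAt_finRep (hd : 3 ≤ d) (g : NewtonMap d) {x : ℂ}
    (hx : g.1 (x : Sphere) ≠ ∞) : AnalyticAt ℂ (finRep g.1) x :=
  analyticAt_locRep hd g (by simpa using hx)

lemma localDegree_coe (g : NewtonMap d) {x : ℂ}
    (hx : g.1 (x : Sphere) ≠ ∞) :
    localDegree g.1 (x : Sphere) = analyticOrderAt (fun t => finRep g.1 t - finRep g.1 x) x := by
  have := localDegree_eq_order (g := g) (z := ((0 : ℂ) : Sphere)) (v := ((0 : ℂ) : Sphere)) (τ := x)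
    (by simp) (by simp) (by simpa using hx)
  simpa [finRep] using this

lemma mem_criticalPoints_iff_deriv (hd : 3 ≤ d) (g : NewtonMap d) {x : ℂ}
    (hx : g.1 (x : Sphere) ≠ ∞) :
    (x : Sphere) ∈ criticalPoints g.1 ↔ deriv (finRep g.1) x = 0 := by
  have han := analyticAt_finRep hd g hx
  rw [criticalPoints, mem_ofPred_eq, localDegree_coe g hx, ← han.analyticOrderAt_deriv_add_one,
    ← han.deriv.analyticOrderAt_ne_zero, ← Order.one_le_iff_ne_zero, ← one_add_one_eq_two]
  exact ENat.add_le_add_iff_right (by simp)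

/-- Away from critical points and poles a Newton map is a local homeomorphism. As the sphere is
compact, it is then a covering over each set whose preimage avoids these points. -/
lemma isLocalHomeomorphOn_newton (hd : 3 ≤ d) (g : NewtonMap d) {T : Set Sphere}
    (hT : ∀ y ∈ T, ∃ x : ℂ, y = (x : Sphere) ∧ g.1 (x : Sphere) ≠ ∞ ∧
      (x : Sphere) ∉ criticalPoints g.1) :
    IsLocalHomeomorphOn g.1 T := by
  refine IsLocalHomeomorphOn.mk _ _ fun y hy => ?_
  obtain ⟨x, rfl, hx, hcrit⟩ := hT y hy
  have han := analyticAt_finRep hd g hx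
  rw [mem_criticalPoints_iff_deriv hd g hx] at hcrit
  set e₀ := (han.hasStrictDerivAt.hasStrictFDerivAt_equiv hcrit).toOpenPartialHomeomorph
    (finRep g.1) with he₀
  have hx₀ : x ∈ e₀.source :=
    (han.hasStrictDerivAt.hasStrictFDerivAt_equiv hcrit).mem_toOpenPartialHomeomorph_source
  set V : Set ℂ := {t : ℂ | g.1 (t : Sphere) ≠ ∞} with hV
  have hVo : IsOpen V := by
    have : Continuous fun t : ℂ => g.1 (t : Sphere) :=
      g.1.continuous.comp OnePoint.continuous_coe
    exact isOpen_ne.preimage this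
  set emb := (OnePoint.isOpenEmbedding_coe (X := ℂ)).toOpenPartialHomeomorph with hemb
  have hembc : ∀ t : ℂ, emb t = (t : Sphere) := fun t => rfl
  have hembs : emb.source = univ := rfl
  have hsymm : ∀ t : ℂ, emb.symm (t : Sphere) = t := fun t => by
    rw [← hembc, emb.left_inv (by rw [hembs]; trivial)]
  have htarget : emb.target = range ((↑) : ℂ → Sphere) := by
    rw [hemb, IsOpenEmbedding.toOpenPartialHomeomorph_target]
  refine ⟨emb.symm.trans ((e₀.restrOpen V hVo).trans emb), ?_, ?_⟩
  · simp only [OpenPartialHomeomorph.trans_source, OpenPartialHomeomorph.symm_source, htarget,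
      OpenPartialHomeomorph.restrOpen_source, hembs, mem_inter_iff, mem_preimage, hsymm]
    exact ⟨⟨x, rfl⟩, ⟨hx₀, hx⟩, trivial⟩
  · intro y hy
    simp only [OpenPartialHomeomorph.trans_source, OpenPartialHomeomorph.symm_source, htarget,
      OpenPartialHomeomorph.restrOpen_source, hembs, mem_inter_iff, mem_preimage] at hy
    obtain ⟨⟨t, rfl⟩, ⟨ht1, ht2⟩, -⟩ := hy
    rw [hsymm] at ht1 ht2
    change g.1 (t : Sphere) = emb (e₀ (emb.symm (t : Sphere)))
    rw [hsymm, hembc]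
    exact (coe_finRep ht2).symm

/-! ### Extension of Böttcher coordinates to the unit disc -/

/-- `ψ` is an injective holomorphic semiconjugacy on the disc of radius `r` from the power map
`w ↦ w ^ m` to `g`. -/
def IsBottcherOn (g : C(Sphere, Sphere)) (m : ℕ) (r : ℝ) (ψ : ℂ → ℂ) : Prop :=
  DifferentiableOn ℂ ψ (ball 0 r) ∧ InjOn ψ (ball 0 r) ∧
    ∀ w ∈ ball (0 : ℂ) r, g (ψ w : Sphere) = ((ψ (w ^ m) : ℂ) : Sphere)

lemma pow_mem_ball_zero {m : ℕ} (hm : 1 ≤ m) {r : ℝ} (hr1 : r ≤ 1) {w : ℂ}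
    (hw : w ∈ ball (0 : ℂ) r) : w ^ m ∈ ball (0 : ℂ) r := by
  rw [mem_ball_zero_iff] at hw ⊢
  rw [norm_pow]
  calc ‖w‖ ^ m ≤ ‖w‖ ^ 1 := pow_le_pow_of_le_one (norm_nonneg _) (by linarith) hm
    _ < r := by rwa [pow_one]

lemma IsBottcherOn.iterate {g : C(Sphere, Sphere)} {m : ℕ} {r : ℝ} {ψ : ℂ → ℂ}
    (h : IsBottcherOn g m r ψ) (hm : 1 ≤ m) (hr1 : r ≤ 1) (n : ℕ) {w : ℂ}
    (hw : w ∈ ball (0 : ℂ) r) :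
    g^[n] (ψ w : Sphere) = ((ψ (w ^ m ^ n) : ℂ) : Sphere) := by
  induction n generalizing w with
  | zero => simp
  | succ n ih =>
    rw [Function.iterate_succ_apply, h.2.2 w hw, ih (pow_mem_ball_zero hm hr1 hw), ← pow_mul, pow_succ']

lemma IsBottcherOn.continuousAt {g : C(Sphere, Sphere)} {m : ℕ} {r : ℝ} {ψ : ℂ → ℂ}
    (h : IsBottcherOn g m r ψ) {w : ℂ} (hw : w ∈ ball (0 : ℂ) r) : ContinuousAt ψ w :=
  (h.1.differentiableAt (Metric.isOpen_ball.mem_nhds hw)).continuousAt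

lemma tendsto_pow_pow {m : ℕ} (hm : 2 ≤ m) {w : ℂ} (hw : ‖w‖ < 1) :
    Tendsto (fun n : ℕ => w ^ m ^ n) Filter.atTop (𝓝 0) :=
  (tendsto_pow_atTop_nhds_zero_of_norm_lt_one hw).comp
    (tendsto_pow_atTop_atTop_of_one_lt (by omega : 1 < m))

lemma IsBottcherOn.tendsto {g : C(Sphere, Sphere)} {m : ℕ} {r : ℝ} {ψ : ℂ → ℂ}
    (h : IsBottcherOn g m r ψ) (hm : 2 ≤ m) (hr1 : r ≤ 1) {w : ℂ}
    (hw : w ∈ ball (0 : ℂ) r) :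
    Tendsto (fun n => g^[n] (ψ w : Sphere)) Filter.atTop (𝓝 ((ψ 0 : ℂ) : Sphere)) := by
  have hr : 0 < r := (norm_nonneg w).trans_lt (by simpa using hw)
  have h1 : ContinuousAt (fun w => ((ψ w : ℂ) : Sphere)) 0 :=
    OnePoint.continuous_coe.continuousAt.comp (h.continuousAt (mem_ball_self hr))
  have h2 := h1.tendsto.comp (tendsto_pow_pow hm (w := w)
    ((mem_ball_zero_iff.1 hw).trans_le hr1))
  refine h2.congr fun n => ?_
  rw [h.iterate (by omega) hr1 n hw]
  rfl

lemma IsBottcherOn.image_subset_immediateBasin {g : C(Sphere, Sphere)} {m : ℕ} {r : ℝ}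
    {ψ : ℂ → ℂ} (h : IsBottcherOn g m r ψ) (hm : 2 ≤ m) (hr : 0 < r) (hr1 : r ≤ 1) :
    (fun w : ℂ => ((ψ w : ℂ) : Sphere)) '' ball 0 r ⊆
      immediateBasin g ((ψ 0 : ℂ) : Sphere) := by
  refine IsPreconnected.subset_connectedComponentIn ?_
    ⟨0, mem_ball_self hr, rfl⟩ ?_
  · refine (convex_ball (0 : ℂ) r).isPreconnected.image _ ?_
    exact OnePoint.continuous_coe.comp_continuousOn h.1.continuousOn
  · rintro _ ⟨w, hw, rfl⟩
    exact h.tendsto hm hr1 hw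

lemma immediateBasin_subset_rootsBasin {g : C(Sphere, Sphere)} {a : Sphere}
    (ha : a ∈ rootPoints g) (n : ℕ) {x : Sphere} (hx : g^[n] x ∈ immediateBasin g a) :
    x ∈ rootsBasin g :=
  mem_iUnion.2 ⟨n, mem_biUnion ha hx⟩

/-- In a roots-basin postcritically finite map no critical point is mapped into the punctured
domain of a Böttcher coordinate, since orbits in the latter never reach a root. -/
lemma IsBottcherOn.not_critical {g : C(Sphere, Sphere)} {m : ℕ} {r : ℝ}
    {ψ : ℂ → ℂ} (h : IsBottcherOn g m r ψ) (hm : 2 ≤ m) (hr1 : r ≤ 1)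
    (ha : ((ψ 0 : ℂ) : Sphere) ∈ rootPoints g) (hpcf : RootsBasinPCF g) {x : Sphere} {w : ℂ}
    (hw : w ∈ ball (0 : ℂ) r) (hw0 : w ≠ 0) (hx : g x = (ψ w : Sphere)) :
    x ∉ criticalPoints g := by
  intro hcrit
  have hr : 0 < r := (norm_nonneg w).trans_lt (by simpa using hw)
  have hxb : x ∈ rootsBasin g := immediateBasin_subset_rootsBasin ha 1 (by
    rw [Function.iterate_one, hx]
    exact h.image_subset_immediateBasin hm hr hr1 ⟨w, hw, rfl⟩)
  obtain ⟨n, -, hn⟩ := hpcf x hxb hcrit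
  have h1 : g^[n + 1] x = ((ψ (w ^ m ^ n) : ℂ) : Sphere) := by
    rw [Function.iterate_succ_apply, hx, h.iterate (by omega) hr1 n hw]
  have h2 : g^[n + 2] x = ((ψ (w ^ m ^ (n + 1)) : ℂ) : Sphere) := by
    rw [Function.iterate_succ_apply, hx, h.iterate (by omega) hr1 (n + 1) hw]
  have h3 : g^[n + 2] x = g^[n + 1] x := by
    rw [Function.iterate_succ_apply' g (n + 1), Function.iterate_succ_apply' g n, hn, hn]
  rw [h1, h2, OnePoint.coe_eq_coe] at h3
  have hmem : ∀ k : ℕ, w ^ m ^ k ∈ ball (0 : ℂ) r := fun k =>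
    pow_mem_ball_zero (Nat.one_le_pow _ _ (by omega)) hr1 hw
  have h4 := h.2.1 (hmem (n + 1)) (hmem n) h3
  have h5 := congrArg norm h4
  rw [norm_pow, norm_pow] at h5
  have hwlt : ‖w‖ < 1 := (mem_ball_zero_iff.1 hw).trans_le hr1
  have := pow_lt_pow_right_of_lt_one₀ (norm_pos_iff.2 hw0) hwlt
    (Nat.pow_lt_pow_right (show 1 < m by omega) (Nat.lt_succ_self n))
  exact absurd h5 this.ne

/-- Uniqueness of lifts through a Newton map on simply connected domains. -/
lemma eq_of_lifts {g : C(Sphere, Sphere)} {T : Set Sphere} (cov : IsCoveringMapOn g T)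
    {A : Set ℂ} (hA : Convex ℝ A) {F₁ F₂ : A → Sphere} (h₁ : Continuous F₁) (h₂ : Continuous F₂)
    (hT : ∀ s, g (F₁ s) ∈ T) (heq : ∀ s, g (F₁ s) = g (F₂ s)) {s₀ : A} (h₀ : F₁ s₀ = F₂ s₀) :
    F₁ = F₂ := by
  have : ContractibleSpace A := hA.contractibleSpace ⟨s₀.1, s₀.2⟩
  have : LocallyPathConnectedSpace A := hA.locallyPathConnectedSpace
  obtain ⟨F, -, hF⟩ := cov.existsUnique_continuousMap_lifts
    (⟨fun s => g (F₁ s), g.continuous.comp h₁⟩ : C(A, Sphere)) (a₀ := s₀) (e₀ := F₁ s₀) rfl hT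
  have e1 := hF ⟨F₁, h₁⟩ ⟨rfl, rfl⟩
  have e2 := hF ⟨F₂, h₂⟩ ⟨h₀.symm, by ext s; simp [heq]⟩
  have := e1.trans e2.symm
  exact congrArg DFunLike.coe this

lemma convex_re_lt (c : ℝ) : Convex ℝ {s : ℂ | s.re < c} :=
  convex_halfSpace_re_lt c

/-- A Böttcher coordinate on the disc of radius `r = r' ^ m` extends to the disc of radius `r'`:
`s ↦ ψ (exp (m s))` lifts through `g`, which is a covering over the punctured domain of `ψ`. -/
lemma IsBottcherOn.extend (hd : 3 ≤ d) {g : NewtonMap d} {m : ℕ} {r' : ℝ}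
    {ψ : ℂ → ℂ} (hm : 2 ≤ m) (hr' : 0 < r') (hr1 : r' < 1) (h : IsBottcherOn g.1 m (r' ^ m) ψ)
    (ha : ((ψ 0 : ℂ) : Sphere) ∈ rootPoints g.1) (hpcf : RootsBasinPCF g.1) :
    ∃ ψ' : ℂ → ℂ, IsBottcherOn g.1 m r' ψ' ∧ EqOn ψ' ψ (ball 0 (r' ^ m)) := by
  set r := r' ^ m with hr
  have hrpos : 0 < r := by positivity
  have hrr' : r < r' := by
    rw [hr]
    calc r' ^ m < r' ^ 1 := pow_lt_pow_right_of_lt_one₀ hr' hr1 (by omega)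
      _ = r' := pow_one _
  have hrle : r ≤ 1 := by linarith
  set T : Set Sphere := (fun w : ℂ => ((ψ w : ℂ) : Sphere)) '' (ball 0 r \ {0}) with hT
  have hinfty : g.1 ∞ = ∞ := g.map_infty
  have cov : IsCoveringMapOn g.1 T := by
    refine IsCoveringMapOn.of_isLocalHomeomorphOn g.1.continuous
      (isLocalHomeomorphOn_newton hd g ?_)
    rintro y ⟨w, ⟨hw, hw0⟩, hy⟩
    simp only at hy
    have hyinf : y ≠ ∞ := by
      rintro rfl
      rw [hinfty] at hy
      exact OnePoint.coe_ne_infty _ hy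
    obtain ⟨x, rfl⟩ := OnePoint.ne_infty_iff_exists.1 hyinf
    exact ⟨x, rfl, by rw [← hy]; exact OnePoint.coe_ne_infty _,
      h.not_critical hm hrle ha hpcf hw hw0 hy.symm⟩
  have hexp : ∀ s : ℂ, ‖Complex.exp s‖ = Real.exp s.re := Complex.norm_exp
  -- the half-plane of logarithms of the big punctured disc
  set A : Set ℂ := {s : ℂ | s.re < Real.log r'} with hA
  have hAc : Convex ℝ A := convex_re_lt _
  have hlog : Real.log r = m * Real.log r' := by rw [hr, Real.log_pow]
  have hAmem : ∀ s : ℂ, s ∈ A ↔ Complex.exp s ∈ ball (0 : ℂ) r' := by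
    intro s
    rw [mem_ball_zero_iff, hexp, ← Real.lt_log_iff_exp_lt hr']
    rfl
  have hpowmem : ∀ w : ℂ, w ∈ ball (0 : ℂ) r' → w ^ m ∈ ball (0 : ℂ) r := by
    intro w hw
    rw [mem_ball_zero_iff] at hw ⊢
    rw [norm_pow, hr]
    exact pow_lt_pow_left₀ hw (norm_nonneg _) (by omega)
  have hfT : ∀ s ∈ A, ((ψ (Complex.exp s ^ m) : ℂ) : Sphere) ∈ T := fun s hs =>
    ⟨_, ⟨hpowmem _ ((hAmem s).1 hs), pow_ne_zero _ (Complex.exp_ne_zero s)⟩, rfl⟩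
  have hψc : ContinuousOn (fun w : ℂ => ((ψ w : ℂ) : Sphere)) (ball 0 r) :=
    OnePoint.continuous_coe.comp_continuousOn h.1.continuousOn
  have hfc : Continuous fun s : A => ((ψ (Complex.exp s ^ m) : ℂ) : Sphere) :=
    hψc.comp_continuous (by fun_prop) fun s => hpowmem _ ((hAmem s).1 s.2)
  set A' : Set ℂ := {s : ℂ | s.re < Real.log r} with hA'
  have hA'c : Convex ℝ A' := convex_re_lt _
  have hA'mem : ∀ s : ℂ, s ∈ A' ↔ Complex.exp s ∈ ball (0 : ℂ) r := by
    intro s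
    rw [mem_ball_zero_iff, hexp, ← Real.lt_log_iff_exp_lt hrpos]
    rfl
  have hA'A : A' ⊆ A := fun s hs =>
    (hAmem s).2 (ball_subset_ball hrr'.le ((hA'mem s).1 hs))
  set s₀ : ℂ := ((Real.log r - 1 : ℝ) : ℂ) with hs₀
  have hs₀A' : s₀ ∈ A' := by
    change s₀.re < _
    rw [hs₀, Complex.ofReal_re]; linarith
  have hcontr : ContractibleSpace A := hAc.contractibleSpace ⟨s₀, hA'A hs₀A'⟩
  have hlpc : LocallyPathConnectedSpace A := hAc.locallyPathConnectedSpace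
  obtain ⟨F, ⟨hF0, hFg⟩, -⟩ := cov.existsUnique_continuousMap_lifts
    (⟨_, hfc⟩ : C(A, Sphere)) (a₀ := ⟨s₀, hA'A hs₀A'⟩)
    (e₀ := ((ψ (Complex.exp s₀) : ℂ) : Sphere))
    (h.2.2 _ ((hA'mem _).1 hs₀A')) (fun s => hfT s s.2)
  have hFg' : ∀ s : A, g.1 (F s) = ((ψ (Complex.exp s ^ m) : ℂ) : Sphere) := fun s =>
    congrFun hFg s
  have hTinf : ∀ s : A, F s ≠ ∞ := by
    intro s hs
    have := hFg' s
    rw [hs, hinfty] at this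
    exact OnePoint.infty_ne_coe _ this
  -- on the smaller half-plane the lift is `ψ ∘ exp`
  have hFψ : ∀ s (hs : s ∈ A'), F ⟨s, hA'A hs⟩ = ((ψ (Complex.exp s) : ℂ) : Sphere) := by
    have := eq_of_lifts cov hA'c (F₁ := fun s => F ⟨s, hA'A s.2⟩)
      (F₂ := fun s => ((ψ (Complex.exp s) : ℂ) : Sphere))
      (F.continuous.comp (by fun_prop))
      (hψc.comp_continuous (by fun_prop) fun s => (hA'mem _).1 s.2)
      (fun s => by rw [hFg']; exact hfT s (hA'A s.2))
      (fun s => by rw [hFg', h.2.2 _ ((hA'mem _).1 s.2)]) (s₀ := ⟨s₀, hs₀A'⟩) hF0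
    intro s hs
    exact congrFun this ⟨s, hs⟩
  -- translates of the lift along the imaginary axis
  have htrans : ∀ (c : ℂ), c.re = 0 → Complex.exp c ^ m = 1 →
      ∀ s₁ : ℂ, ∀ (hs₁ : s₁ ∈ A) (hs₁' : s₁ + c ∈ A), F ⟨s₁ + c, hs₁'⟩ = F ⟨s₁, hs₁⟩ →
      ∀ s (hs : s ∈ A) (hs' : s + c ∈ A), F ⟨s + c, hs'⟩ = F ⟨s, hs⟩ := by
    intro c hc hcm s₁ hs₁ hs₁' heq s hs hs'
    have hAadd : ∀ s ∈ A, s + c ∈ A := by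
      intro s hs
      change (s + c).re < _
      rw [Complex.add_re, hc, add_zero]
      exact hs
    have := eq_of_lifts cov hAc (F₁ := fun s => F ⟨s + c, hAadd s s.2⟩) (F₂ := F)
      (F.continuous.comp (by fun_prop)) F.continuous
      (fun s => by rw [hFg']; exact hfT _ (hAadd s s.2))
      (fun s => by rw [hFg', hFg', Complex.exp_add, mul_pow, hcm, mul_one])
      (s₀ := ⟨s₁, hs₁⟩) heq
    exact congrFun this ⟨s, hs⟩
  have hper : ∀ s₁ (hs₁ : s₁ ∈ A) s₂ (hs₂ : s₂ ∈ A), Complex.exp s₁ = Complex.exp s₂ →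
      F ⟨s₁, hs₁⟩ = F ⟨s₂, hs₂⟩ := by
    intro s₁ hs₁ s₂ hs₂ he
    obtain ⟨n, hn⟩ := Complex.exp_eq_exp_iff_exists_int.1 he
    set c : ℂ := n * (2 * Real.pi * Complex.I) with hc
    have hcre : c.re = 0 := by simp [hc]
    have hcexp : Complex.exp c = 1 := Complex.exp_int_mul_two_pi_mul_I n
    have hsc : s₀ + c ∈ A' := by
      change (s₀ + c).re < _
      rw [Complex.add_re, hcre, add_zero]
      exact hs₀A'
    subst hn
    refine htrans c hcre (by rw [hcexp, one_pow]) s₀ (hA'A hs₀A') (hA'A hsc) ?_ s₂ hs₂ hs₁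
    rw [hFψ _ hsc, hFψ _ hs₀A', Complex.exp_add, hcexp, mul_one]
  classical
  -- the extension
  set ψ' : ℂ → ℂ := fun w => if w = 0 then ψ 0 else
    if hw : Complex.log w ∈ A then localCoord ((0 : ℂ) : Sphere) (F ⟨Complex.log w, hw⟩) else 0
    with hψ'
  have hcoord : ∀ y : Sphere, y ≠ ∞ →
      ((localCoord ((0 : ℂ) : Sphere) y : ℂ) : Sphere) = y := by
    intro y hy
    obtain ⟨x, rfl⟩ := OnePoint.ne_infty_iff_exists.1 hy
    simp
  have hψ'exp : ∀ s (hs : s ∈ A), ((ψ' (Complex.exp s) : ℂ) : Sphere) = F ⟨s, hs⟩ := by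
    intro s hs
    have he : Complex.exp (Complex.log (Complex.exp s)) = Complex.exp s :=
      Complex.exp_log (Complex.exp_ne_zero s)
    have hl : Complex.log (Complex.exp s) ∈ A := by
      rw [hAmem, he, ← hAmem]; exact hs
    simp only [hψ', if_neg (Complex.exp_ne_zero s), dif_pos hl]
    rw [hcoord _ (hTinf _)]
    exact hper _ _ _ _ he
  have hexA : ∀ w ∈ ball (0 : ℂ) r', w ≠ 0 → ∃ s ∈ A, Complex.exp s = w := by
    intro w hw hw0
    have he := Complex.exp_log hw0
    exact ⟨Complex.log w, (hAmem _).2 (by rwa [he]), he⟩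
  have hEq : EqOn ψ' ψ (ball 0 r) := by
    intro w hw
    by_cases hw0 : w = 0
    · simp [hψ', hw0]
    · obtain ⟨s, hs, rfl⟩ := hexA w (ball_subset_ball hrr'.le hw) hw0
      have hs' : s ∈ A' := (hA'mem s).2 hw
      rw [← OnePoint.coe_eq_coe, hψ'exp s hs, hFψ s hs']
  have hfun : ∀ w ∈ ball (0 : ℂ) r', g.1 (ψ' w : Sphere) = ((ψ (w ^ m) : ℂ) : Sphere) := by
    intro w hw
    by_cases hw0 : w = 0
    · rw [hw0, hEq (mem_ball_self hrpos), h.2.2 _ (mem_ball_self hrpos)]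
    · obtain ⟨s, hs, rfl⟩ := hexA w hw hw0
      rw [hψ'exp s hs, hFg']
  refine ⟨ψ', ⟨?_, ?_, ?_⟩, hEq⟩
  · intro w hw
    refine DifferentiableAt.differentiableWithinAt ?_
    by_cases hw0 : w = 0
    · subst hw0
      refine (h.1.differentiableAt (ball_mem_nhds 0 hrpos)).congr_of_eventuallyEq ?_
      filter_upwards [ball_mem_nhds (0 : ℂ) hrpos] with v hv using hEq hv
    · -- near `w`, `ψ'` is continuous and is the local inverse of `g` applied to `ψ (w ^ m)`
      have hnc : (ψ' w : Sphere) ∉ criticalPoints g.1 :=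
        h.not_critical hm hrle ha hpcf (hpowmem w hw) (pow_ne_zero m hw0) (hfun w hw)
      have hfin : g.1 (ψ' w : Sphere) ≠ ∞ := by
        rw [hfun w hw]; exact OnePoint.coe_ne_infty _
      have han := analyticAt_finRep hd g hfin
      rw [mem_criticalPoints_iff_deriv hd g hfin] at hnc
      have hs := han.hasStrictDerivAt
      have hval : ∀ v ∈ ball (0 : ℂ) r', finRep g.1 (ψ' v) = ψ (v ^ m) := fun v hv =>
        finRep_eq (hfun v hv)
      -- continuity, through a branch of the logarithm near `w`
      have hcont : ContinuousAt ψ' w := by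
        set L : ℂ → ℂ := fun v => Complex.log (v / w) + Complex.log w with hL
        have hLc : ContinuousAt L w := by
          refine ContinuousAt.add (ContinuousAt.clog (by fun_prop) ?_) continuousAt_const
          rw [div_self hw0]; exact Complex.one_mem_slitPlane
        have hLexp : ∀ v, v ≠ 0 → Complex.exp (L v) = v := by
          intro v hv
          rw [hL]
          simp only
          rw [Complex.exp_add, Complex.exp_log (div_ne_zero hv hw0), Complex.exp_log hw0]
          field_simp
        have hAo : IsOpen A := isOpen_lt Complex.continuous_re continuous_const
        have hLw : L w ∈ A := (hAmem _).2 (by rwa [hLexp w hw0])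
        have hc1 : ContinuousAt (fun v => ((ψ' v : ℂ) : Sphere)) w := by
          have hFc : ContinuousOn (fun s => ((ψ' (Complex.exp s) : ℂ) : Sphere)) A := by
            rw [continuousOn_iff_continuous_domRestrict]
            refine F.continuous.congr fun s => ?_
            exact (hψ'exp s s.2).symm
          have hc2 : ContinuousAt (fun v => ((ψ' (Complex.exp (L v)) : ℂ) : Sphere)) w :=
            ContinuousAt.comp (f := L) (g := fun s => ((ψ' (Complex.exp s) : ℂ) : Sphere))
              (hFc.continuousAt (hAo.mem_nhds hLw)) hLc
          refine hc2.congr ?_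
          filter_upwards [isOpen_ne.mem_nhds hw0] with v hv
          rw [hLexp v hv]
        exact (OnePoint.isOpenEmbedding_coe (X := ℂ)).isInducing.continuousAt_iff.2 hc1
      have hpd : DifferentiableAt ℂ (fun v => ψ (v ^ m)) w :=
        DifferentiableAt.comp w
          (h.1.differentiableAt (Metric.isOpen_ball.mem_nhds (hpowmem w hw))) (by fun_prop)
      have hloc := hs.to_localInverse hnc
      rw [hval w hw] at hloc
      have hcomp : DifferentiableAt ℂ (fun v => HasStrictDerivAt.localInverse (finRep g.1) _
          (ψ' w) hs hnc (ψ (v ^ m))) w :=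
        DifferentiableAt.comp w (g := HasStrictDerivAt.localInverse (finRep g.1) _
          (ψ' w) hs hnc) hloc.hasDerivAt.differentiableAt hpd
      refine hcomp.congr_of_eventuallyEq ?_
      filter_upwards [hcont.eventually (hs.eventually_left_inverse hnc),
        Metric.isOpen_ball.mem_nhds hw] with v hv hvb
      rw [← hval v hvb]
      exact hv.symm
  · intro w₁ hw₁ w₂ hw₂ heq
    have hpw : w₁ ^ m = w₂ ^ m := by
      refine h.2.1 (hpowmem _ hw₁) (hpowmem _ hw₂) ?_
      rw [← OnePoint.coe_eq_coe, ← hfun _ hw₁, ← hfun _ hw₂, heq]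
    by_cases hw₁0 : w₁ = 0
    · rw [hw₁0, zero_pow (by omega)] at hpw
      rw [hw₁0]
      exact (pow_eq_zero_iff (by omega)).1 hpw.symm |>.symm
    have hw₂0 : w₂ ≠ 0 := by
      rintro rfl
      rw [zero_pow (by omega), pow_eq_zero_iff (by omega)] at hpw
      exact hw₁0 hpw
    obtain ⟨s₁, hs₁, rfl⟩ := hexA w₁ hw₁ hw₁0
    set c := Complex.log (w₂ / Complex.exp s₁) with hc
    have hquot : Complex.exp c = w₂ / Complex.exp s₁ :=
      Complex.exp_log (div_ne_zero hw₂0 hw₁0)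
    have hcm : Complex.exp c ^ m = 1 := by
      rw [hquot, div_pow, hpw, div_self (pow_ne_zero _ hw₂0)]
    have hcre : c.re = 0 := by
      have h1 : ‖Complex.exp c‖ = 1 := Complex.norm_eq_one_of_pow_eq_one hcm (by omega)
      rw [hexp] at h1
      exact Real.exp_eq_one_iff _ |>.1 h1
    have hw₂' : Complex.exp (s₁ + c) = w₂ := by
      rw [Complex.exp_add, hquot]
      field_simp
    have hs₂ : s₁ + c ∈ A := (hAmem _).2 (by rwa [hw₂'])
    have hsc : s₀ + c ∈ A' := by
      change (s₀ + c).re < _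
      rw [Complex.add_re, hcre, add_zero]
      exact hs₀A'
    have h1 := htrans c hcre hcm s₁ hs₁ hs₂
      (by rw [← hψ'exp, ← hψ'exp, hw₂', ← heq]) s₀ (hA'A hs₀A') (hA'A hsc)
    rw [hFψ _ hsc, hFψ _ hs₀A', OnePoint.coe_eq_coe] at h1
    have h2 := h.2.1 ((hA'mem _).1 hsc) ((hA'mem _).1 hs₀A') h1
    rw [Complex.exp_add] at h2
    have h3 : Complex.exp c = 1 := by
      have := Complex.exp_ne_zero s₀
      field_simp at h2
      exact h2
    rw [← hw₂', Complex.exp_add, h3, mul_one]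
  · intro w hw
    rw [hfun w hw, hEq (hpowmem w hw)]

/-- Extension of a local Böttcher coordinate to the whole unit disc. -/
lemma IsBottcherOn.exists_disc (hd : 3 ≤ d) {g : NewtonMap d} {m : ℕ} {ρ : ℝ}
    {ψ₀ : ℂ → ℂ} (hm : 2 ≤ m) (hρ : 0 < ρ) (hρ1 : ρ < 1) (h : IsBottcherOn g.1 m ρ ψ₀)
    (ha : ((ψ₀ 0 : ℂ) : Sphere) ∈ rootPoints g.1) (hpcf : RootsBasinPCF g.1) :
    ∃ ψ : ℂ → ℂ, IsBottcherOn g.1 m 1 ψ ∧ EqOn ψ ψ₀ (ball 0 ρ) := by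
  have hm0 : (m : ℝ) ≠ 0 := by positivity
  set r : ℕ → ℝ := fun n => ρ ^ (((m : ℝ) ^ n)⁻¹) with hr
  have hrpos : ∀ n, 0 < r n := fun n => Real.rpow_pos_of_pos hρ _
  have hr1 : ∀ n, r n < 1 := fun n => Real.rpow_lt_one hρ.le hρ1 (by positivity)
  have hrm : ∀ n, r (n + 1) ^ m = r n := by
    intro n
    rw [hr]
    simp only
    rw [← Real.rpow_natCast, ← Real.rpow_mul hρ.le]
    congr 1
    rw [pow_succ]
    field_simp
  have hr0 : r 0 = ρ := by simp [hr]
  have hmono : StrictMono r := by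
    refine strictMono_nat_of_lt_succ fun n => ?_
    rw [← hrm n]
    calc r (n + 1) ^ m < r (n + 1) ^ 1 :=
          pow_lt_pow_right_of_lt_one₀ (hrpos _) (hr1 _) (by omega)
      _ = r (n + 1) := pow_one _
  have hlim : Tendsto r Filter.atTop (𝓝 1) := by
    have h1 : Tendsto (fun n : ℕ => ((m : ℝ) ^ n)⁻¹) Filter.atTop (𝓝 0) :=
      (tendsto_pow_atTop_atTop_of_one_lt (by exact_mod_cast (by omega : 1 < m))).inv_tendsto_atTop
    have h2 := (Real.continuousAt_const_rpow (a := ρ) (b := 0) hρ.ne').tendsto.comp h1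
    rwa [Real.rpow_zero] at h2
  -- the extensions to the discs of radius `r n`
  let Q : ℕ → Type := fun n => {ψ : ℂ → ℂ // IsBottcherOn g.1 m (r n) ψ ∧ ψ 0 = ψ₀ 0}
  have hstep : ∀ n (φ : Q n), ∃ φ' : Q (n + 1), EqOn φ'.1 φ.1 (ball 0 (r n)) := by
    rintro n ⟨φ, hφ, hφ0⟩
    have hφ' : IsBottcherOn g.1 m (r (n + 1) ^ m) φ := by rwa [hrm n]
    obtain ⟨φ', h1, h2⟩ := IsBottcherOn.extend hd hm (hrpos (n + 1)) (hr1 (n + 1)) hφ'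
      (by rwa [hφ0]) hpcf
    rw [hrm n] at h2
    exact ⟨⟨φ', h1, by rw [h2 (mem_ball_self (hrpos n)), hφ0]⟩, h2⟩
  choose next hnext using hstep
  let φ : ∀ n, Q n := fun n => Nat.rec (motive := Q) ⟨ψ₀, by rwa [hr0], rfl⟩ next n
  have hφs : ∀ n, EqOn (φ (n + 1)).1 (φ n).1 (ball 0 (r n)) := fun n => hnext n (φ n)
  have hφ : ∀ n k, EqOn (φ (n + k)).1 (φ n).1 (ball 0 (r n)) := by
    intro n k
    induction k with
    | zero => exact fun _ _ => rfl
    | succ k ih =>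
      intro w hw
      rw [← add_assoc, hφs (n + k) (ball_subset_ball (hmono.monotone (by omega)) hw), ih hw]
  have hφ' : ∀ n k w, w ∈ ball (0 : ℂ) (r n) → w ∈ ball (0 : ℂ) (r k) →
      (φ n).1 w = (φ k).1 w := by
    intro n k w hn hk
    rcases le_total n k with hle | hle
    · obtain ⟨j, rfl⟩ := Nat.exists_eq_add_of_le hle
      exact (hφ n j hn).symm
    · obtain ⟨j, rfl⟩ := Nat.exists_eq_add_of_le hle
      exact hφ k j hk
  have hex : ∀ w ∈ ball (0 : ℂ) 1, ∃ n, w ∈ ball (0 : ℂ) (r n) := by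
    intro w hw
    rw [mem_ball_zero_iff] at hw
    obtain ⟨n, hn⟩ := (hlim.eventually (lt_mem_nhds hw)).exists
    exact ⟨n, by simpa using hn⟩
  choose! n hn using hex
  set ψ : ℂ → ℂ := fun w => (φ (n w)).1 w with hψ
  have hsub : ∀ k, ball (0 : ℂ) (r k) ⊆ ball 0 1 := fun k =>
    ball_subset_ball (hr1 k).le
  have hψφ : ∀ k, EqOn ψ (φ k).1 (ball 0 (r k)) := fun k w hw =>
    hφ' _ _ _ (hn w (hsub k hw)) hw
  refine ⟨ψ, ⟨?_, ?_, ?_⟩, ?_⟩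
  · intro w hw
    have h1 := (φ (n w)).2.1.1.differentiableAt (Metric.isOpen_ball.mem_nhds (hn w hw))
    refine (h1.congr_of_eventuallyEq ?_).differentiableWithinAt
    filter_upwards [Metric.isOpen_ball.mem_nhds (hn w hw)] with v hv using hψφ _ hv
  · intro w₁ hw₁ w₂ hw₂ heq
    have e₁ : w₁ ∈ ball (0 : ℂ) (r (max (n w₁) (n w₂))) :=
      ball_subset_ball (hmono.monotone (le_max_left _ _)) (hn w₁ hw₁)
    have e₂ : w₂ ∈ ball (0 : ℂ) (r (max (n w₁) (n w₂))) :=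
      ball_subset_ball (hmono.monotone (le_max_right _ _)) (hn w₂ hw₂)
    rw [hψφ _ e₁, hψφ _ e₂] at heq
    exact (φ _).2.1.2.1 e₁ e₂ heq
  · intro w hw
    rw [hψφ _ (hn w hw), (φ (n w)).2.1.2.2 w (hn w hw),
      hψφ _ (pow_mem_ball_zero (by omega) (hr1 _).le (hn w hw))]
  · rw [← hr0]; exact hψφ 0

/-- The Böttcher coordinate on the unit disc fills the immediate basin. -/
lemma IsBottcherOn.image_eq_immediateBasin {g : C(Sphere, Sphere)} {m : ℕ} {ψ : ℂ → ℂ}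
    (h : IsBottcherOn g m 1 ψ) (hm : 2 ≤ m) :
    (fun w : ℂ => ((ψ w : ℂ) : Sphere)) '' ball 0 1 =
      immediateBasin g ((ψ 0 : ℂ) : Sphere) := by
  refine Subset.antisymm (h.image_subset_immediateBasin hm one_pos le_rfl) ?_
  have hopen : ∀ s ≤ (1 : ℝ), IsOpen ((fun w : ℂ => ((ψ w : ℂ) : Sphere)) '' ball 0 s) := by
    intro s hs
    rw [← Function.comp_def (fun z : ℂ => (z : Sphere)) ψ, image_comp]
    exact (OnePoint.isOpenEmbedding_coe (X := ℂ)).isOpenMap _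
      (isOpen_image_of_injOn isOpen_ball h.1 h.2.1 isOpen_ball
        (ball_subset_ball hs))
  have hcont : ContinuousOn (fun w : ℂ => ((ψ w : ℂ) : Sphere)) (ball 0 1) :=
    OnePoint.continuous_coe.comp_continuousOn h.1.continuousOn
  have h0 : ((ψ 0 : ℂ) : Sphere) ∈ immediateBasin g ((ψ 0 : ℂ) : Sphere) :=
    h.image_subset_immediateBasin hm one_pos le_rfl ⟨0, by simp, rfl⟩
  refine IsPreconnected.subset_of_closure_inter_subset isPreconnected_connectedComponentIn
    (hopen 1 le_rfl) ⟨_, h0, 0, by simp, rfl⟩ ?_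
  rintro x ⟨hxc, hxb⟩
  have hxt := connectedComponentIn_subset _ _ hxb
  set V := (fun w : ℂ => ((ψ w : ℂ) : Sphere)) '' ball 0 (1 / 2) with hV
  have hVo : IsOpen V := hopen _ (by norm_num)
  obtain ⟨n, hn⟩ := (hxt.eventually (hVo.mem_nhds ⟨0, by simp, rfl⟩)).exists
  set K : Set ℂ := {w | ‖w‖ ^ m ^ n ≤ 1 / 2} with hK
  have hmn : m ^ n ≠ 0 := by positivity
  have hK1 : K ⊆ ball 0 1 := by
    intro w hw
    rw [mem_ball_zero_iff]
    by_contra hcon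
    have := one_le_pow₀ (not_lt.1 hcon) (n := m ^ n)
    have hw' : ‖w‖ ^ m ^ n ≤ 1 / 2 := hw
    linarith
  have hKc : IsCompact K := by
    refine Metric.isCompact_of_isClosed_isBounded
      (isClosed_le (by fun_prop) continuous_const) ?_
    exact Metric.isBounded_ball.subset hK1
  have hKcl : IsClosed ((fun w : ℂ => ((ψ w : ℂ) : Sphere)) '' K) :=
    (hKc.image_of_continuousOn (hcont.mono hK1)).isClosed
  have hW : IsOpen (g^[n] ⁻¹' V) := hVo.preimage (g.continuous.iterate n)
  have hx2 : x ∈ closure (g^[n] ⁻¹' V ∩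
      (fun w : ℂ => ((ψ w : ℂ) : Sphere)) '' ball 0 1) :=
    hW.inter_closure ⟨hn, hxc⟩
  refine image_mono hK1 (hKcl.closure_subset_iff.2 ?_ hx2)
  rintro _ ⟨hy, w, hw, rfl⟩
  refine ⟨w, ?_, rfl⟩
  obtain ⟨v, hv, hvy⟩ := hy
  simp only at hvy
  rw [h.iterate (by omega) le_rfl n hw, OnePoint.coe_eq_coe] at hvy
  have hvw := h.2.1 (ball_subset_ball (by norm_num) hv)
    (pow_mem_ball_zero (Nat.one_le_pow _ _ (by omega)) le_rfl hw) hvy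
  rw [hvw, mem_ball_zero_iff, norm_pow] at hv
  exact hv.le

lemma infinite_ball_zero {r : ℝ} (hr : 0 < r) : (ball (0 : ℂ) r).Infinite :=
  infinite_of_mem_nhds 0 (ball_mem_nhds 0 hr)

/-- The inverse Böttcher coordinates of the definition are the injective semiconjugacies on the
unit disc from a power map of exponent at least two. -/
lemma isInverseBottcher_iff (hd : 3 ≤ d) {g : NewtonMap d} {a : Sphere}
    (ha : a ∈ rootPoints g.1) {ψ : ℂ → ℂ} :
    IsInverseBottcher g.1 a ψ ↔
      ∃ m : ℕ, 2 ≤ m ∧ IsBottcherOn g.1 m 1 ψ ∧ ((ψ 0 : ℂ) : Sphere) = a := by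
  constructor
  · rintro ⟨h1, h2, h3, m, hm⟩
    have hinf : ((fun w : ℂ => ((ψ w : ℂ) : Sphere)) '' ball 0 1).Infinite := by
      refine (infinite_ball_zero one_pos).image fun x hx y hy hxy => h2 hx hy ?_
      simpa using hxy
    have hm2 : 2 ≤ m := by
      by_contra hcon
      have : m = 0 ∨ m = 1 := by omega
      rcases this with rfl | rfl
      · refine hinf ((finite_fiber hd g ((ψ 1 : ℂ) : Sphere)).subset ?_)
        rintro _ ⟨w, hw, rfl⟩
        have := hm w hw
        rw [pow_zero] at this
        exact this
      · obtain ⟨r⟩ := exists_newtonRep g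
        refine hinf (((r.Z.finite_toSet).image ((↑) : ℂ → Sphere)).subset ?_)
        rintro _ ⟨w, hw, rfl⟩
        have := hm w hw
        rw [pow_one] at this
        exact ⟨ψ w, r.fixed_iff.1 this, rfl⟩
    have hB : IsBottcherOn g.1 m 1 ψ := ⟨h1, h2, hm⟩
    refine ⟨m, hm2, hB, ?_⟩
    have h0 : ((ψ 0 : ℂ) : Sphere) ∈ immediateBasin g.1 a := h3 ▸ ⟨0, by simp, rfl⟩
    have ht : Tendsto _ _ _ := connectedComponentIn_subset _ _ h0
    exact tendsto_nhds_unique (hB.tendsto hm2 le_rfl (by simp : (0 : ℂ) ∈ ball 0 1)) ht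
  · rintro ⟨m, hm2, hB, rfl⟩
    exact ⟨hB.1, hB.2.1, hB.image_eq_immediateBasin hm2, m, hB.2.2⟩

/-- Two Böttcher coordinates of the same basin differ by a rotation. -/
lemma IsBottcherOn.eq_rotation {g : C(Sphere, Sphere)} {m m' : ℕ} {ψ ψ' : ℂ → ℂ}
    (hm : 2 ≤ m) (hm' : 2 ≤ m') (h : IsBottcherOn g m 1 ψ) (h' : IsBottcherOn g m' 1 ψ')
    (h0 : ψ' 0 = ψ 0) :
    m' = m ∧ ∃ c : ℂ, ‖c‖ = 1 ∧ ∀ w ∈ ball (0 : ℂ) 1, ψ' w = ψ (c * w) := by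
  have hcoe : ∀ F : ℂ → ℂ, (fun w : ℂ => ((F w : ℂ) : Sphere)) '' ball 0 1 =
      ((↑) : ℂ → Sphere) '' (F '' ball 0 1) := fun F => by rw [image_image]
  have himg : ψ' '' ball 0 1 = ψ '' ball 0 1 := by
    refine (OnePoint.coe_injective (X := ℂ)).image_injective ?_
    rw [← hcoe, ← hcoe, h.image_eq_immediateBasin hm, h'.image_eq_immediateBasin hm', h0]
  obtain ⟨σ, hσd, hσm, hσ⟩ := exists_holomorphic_factor isOpen_ball isOpen_ball
    h'.1 h.1 h.2.1 himg.subset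
  obtain ⟨τ, hτd, hτm, hτ⟩ := exists_holomorphic_factor isOpen_ball isOpen_ball
    h.1 h'.1 h'.2.1 himg.symm.subset
  have z0 : (0 : ℂ) ∈ ball (0 : ℂ) 1 := by simp
  have hσ0 : σ 0 = 0 := h.2.1 (hσm z0) z0 (by rw [hσ 0 z0, h0])
  have hτ0 : τ 0 = 0 := h'.2.1 (hτm z0) z0 (by rw [hτ 0 z0, h0])
  have hnσ : ∀ w ∈ ball (0 : ℂ) 1, ‖σ w‖ ≤ ‖w‖ := fun w hw =>
    Complex.norm_le_norm_of_mapsTo_ball hσd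
      (hσm.mono_right ball_subset_closedBall) hσ0 (by simpa using hw)
  have hnτ : ∀ w ∈ ball (0 : ℂ) 1, ‖τ w‖ ≤ ‖w‖ := fun w hw =>
    Complex.norm_le_norm_of_mapsTo_ball hτd
      (hτm.mono_right ball_subset_closedBall) hτ0 (by simpa using hw)
  have hinv : ∀ w ∈ ball (0 : ℂ) 1, τ (σ w) = w := fun w hw =>
    h'.2.1 (hτm (hσm hw)) hw (by rw [hτ _ (hσm hw), hσ w hw])
  have hnorm : ∀ w ∈ ball (0 : ℂ) 1, ‖σ w‖ = ‖w‖ := fun w hw =>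
    le_antisymm (hnσ w hw) (by simpa [hinv w hw] using hnτ _ (hσm hw))
  have hhalf : (1 / 2 : ℂ) ∈ ball (0 : ℂ) 1 := by simp; norm_num
  have haff := Complex.affine_of_mapsTo_ball_of_norm_dslope_eq_div hσd
    (c := 0) (z₀ := 1 / 2) (R₁ := 1) (R₂ := 1)
    (by rw [hσ0]; exact hσm.mono_right ball_subset_closedBall) hhalf (by
      rw [dslope_of_ne _ (by norm_num), slope_def_field, hσ0, sub_zero, sub_zero, norm_div,
        hnorm _ hhalf]
      norm_num)
  set c := dslope σ 0 (1 / 2) with hc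
  have hσc : ∀ w ∈ ball (0 : ℂ) 1, σ w = c * w := by
    intro w hw
    have := haff hw
    simpa [hσ0, mul_comm] using this
  have hc1 : ‖c‖ = 1 := by
    have := hnorm _ hhalf
    rw [hσc _ hhalf, norm_mul] at this
    have h2 : ‖(1 / 2 : ℂ)‖ ≠ 0 := by simp
    exact mul_right_cancel₀ h2 (by rw [this, one_mul])
  refine ⟨?_, c, hc1, fun w hw => by rw [← hσ w hw, hσc w hw]⟩
  have hp := pow_mem_ball_zero (m := m') (by omega) le_rfl hhalf
  have e1 : g (ψ' (1 / 2) : Sphere) = ((ψ (σ ((1 / 2) ^ m')) : ℂ) : Sphere) := by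
    rw [h'.2.2 _ hhalf, hσ _ hp]
  rw [← hσ _ hhalf, h.2.2 _ (hσm hhalf), OnePoint.coe_eq_coe] at e1
  have e2 := h.2.1 (pow_mem_ball_zero (by omega) le_rfl (hσm hhalf)) (hσm hp) e1
  have e3 := congrArg norm e2
  rw [norm_pow, hnorm _ hhalf, hnorm _ hp, norm_pow] at e3
  have h2 : ‖(1 / 2 : ℂ)‖ = 1 / 2 := by norm_num
  rw [h2] at e3
  exact (pow_right_injective₀ (by norm_num : (0 : ℝ) < 1 / 2) (by norm_num) e3).symm

/-- The radial set `{r ζ : 0 ≤ r < 1}` seen through `ψ`. -/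
def radialSet (ψ : ℂ → ℂ) (ζ : ℂ) : Set Sphere :=
  (fun r : ℝ => ((ψ ((r : ℂ) * ζ) : ℂ) : Sphere)) '' Ico 0 1

lemma ofReal_mul_mem_ball {ζ : ℂ} (hζ : ‖ζ‖ = 1) {r : ℝ} (hr : r ∈ Ico (0 : ℝ) 1) :
    (r : ℂ) * ζ ∈ ball (0 : ℂ) 1 := by
  rw [mem_ball_zero_iff, norm_mul, hζ, mul_one, Complex.norm_real, Real.norm_of_nonneg hr.1]
  exact hr.2

lemma IsBottcherOn.image_radialSet {g : C(Sphere, Sphere)} {m : ℕ} {ψ : ℂ → ℂ}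
    (hm : 2 ≤ m) (h : IsBottcherOn g m 1 ψ) {ζ : ℂ} (hζ : ‖ζ‖ = 1) :
    g '' radialSet ψ ζ = radialSet ψ (ζ ^ m) := by
  have key : ∀ r ∈ Ico (0 : ℝ) 1, g ((ψ ((r : ℂ) * ζ) : ℂ) : Sphere) =
      ((ψ (((r ^ m : ℝ) : ℂ) * ζ ^ m) : ℂ) : Sphere) := by
    intro r hr
    rw [h.2.2 _ (ofReal_mul_mem_ball hζ hr), mul_pow, Complex.ofReal_pow]
  ext x
  constructor
  · rintro ⟨_, ⟨r, hr, rfl⟩, rfl⟩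
    exact ⟨r ^ m, ⟨pow_nonneg hr.1 _, pow_lt_one₀ hr.1 hr.2 (by omega)⟩, (key r hr).symm⟩
  · rintro ⟨r, hr, rfl⟩
    have hroot : (r ^ ((m : ℝ)⁻¹)) ^ m = r := Real.rpow_inv_natCast_pow hr.1 (by omega)
    have hmem : r ^ ((m : ℝ)⁻¹) ∈ Ico (0 : ℝ) 1 :=
      ⟨Real.rpow_nonneg hr.1 _, Real.rpow_lt_one hr.1 hr.2 (by positivity)⟩
    refine ⟨_, ⟨_, hmem, rfl⟩, ?_⟩
    simp only
    rw [key _ hmem, hroot]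

lemma radialSet_eq_iff {ψ : ℂ → ℂ} (hψ : InjOn ψ (ball 0 1)) {ζ ξ : ℂ} (hζ : ‖ζ‖ = 1)
    (hξ : ‖ξ‖ = 1) : radialSet ψ ζ = radialSet ψ ξ ↔ ζ = ξ := by
  refine ⟨fun h => ?_, fun h => by rw [h]⟩
  have hh : (1 / 2 : ℝ) ∈ Ico (0 : ℝ) 1 := by constructor <;> norm_num
  have h1 : ((ψ (((1 / 2 : ℝ) : ℂ) * ζ) : ℂ) : Sphere) ∈ radialSet ψ ξ := h ▸ ⟨_, hh, rfl⟩
  obtain ⟨r, hr, hr'⟩ := h1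
  simp only [OnePoint.coe_eq_coe] at hr'
  have h2 := hψ (ofReal_mul_mem_ball hξ hr) (ofReal_mul_mem_ball hζ hh) hr'
  have h3 := congrArg norm h2
  rw [norm_mul, norm_mul, hζ, hξ, mul_one, mul_one, Complex.norm_real, Complex.norm_real,
    Real.norm_of_nonneg hr.1, Real.norm_of_nonneg hh.1] at h3
  rw [h3] at h2
  exact (mul_left_cancel₀ (by norm_num) h2).symm

/-- The fixed internal rays, in terms of one Böttcher coordinate. -/
lemma IsBottcherOn.fixed_ray_iff (hd : 3 ≤ d) {g : NewtonMap d} {m : ℕ} {ψ : ℂ → ℂ}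
    (hm : 2 ≤ m) (h : IsBottcherOn g.1 m 1 ψ) (ha : ((ψ 0 : ℂ) : Sphere) ∈ rootPoints g.1)
    {R : Set Sphere} :
    (IsInternalRay g.1 ((ψ 0 : ℂ) : Sphere) R ∧ g.1 '' R = R) ↔
      ∃ ζ : ℂ, ‖ζ‖ = 1 ∧ ζ ^ m = ζ ∧ R = radialSet ψ ζ := by
  constructor
  · rintro ⟨⟨ψ', hψ', ζ, hζ, rfl⟩, hfix⟩
    obtain ⟨m', hm', h', h0⟩ := (isInverseBottcher_iff hd ha).1 hψ'
    obtain ⟨rfl, c, hc, hrot⟩ := h.eq_rotation hm hm' h' (by simpa using h0)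
    have hR : (fun r : ℝ => ((ψ' ((r : ℂ) * ζ) : ℂ) : Sphere)) '' Ico 0 1 =
        radialSet ψ (c * ζ) := by
      refine image_congr fun r hr => ?_
      rw [hrot _ (ofReal_mul_mem_ball hζ hr)]
      congr 2
      ring
    have hcζ : ‖c * ζ‖ = 1 := by rw [norm_mul, hc, hζ, mul_one]
    refine ⟨c * ζ, hcζ, ?_, hR⟩
    rw [hR, h.image_radialSet hm hcζ] at hfix
    exact (radialSet_eq_iff h.2.1 (by rw [norm_pow, hcζ, one_pow]) hcζ).1 hfix
  · rintro ⟨ζ, hζ, hfix, rfl⟩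
    exact ⟨⟨ψ, (isInverseBottcher_iff hd ha).2 ⟨m, hm, h, rfl⟩, ζ, hζ, rfl⟩,
      by rw [h.image_radialSet hm hζ, hfix]⟩

/-- In a roots-basin postcritically finite map, the only critical point in the immediate basin of
a superattracting root is the root. -/
lemma IsBottcherOn.eq_zero_of_critical {g : C(Sphere, Sphere)} {m : ℕ} {ψ : ℂ → ℂ}
    (h : IsBottcherOn g m 1 ψ) (hm : 2 ≤ m)
    (ha : ((ψ 0 : ℂ) : Sphere) ∈ rootPoints g) (hpcf : RootsBasinPCF g) {x : Sphere}
    (hx : x ∈ immediateBasin g ((ψ 0 : ℂ) : Sphere)) (hc : x ∈ criticalPoints g) :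
    x = ((ψ 0 : ℂ) : Sphere) := by
  rw [← h.image_eq_immediateBasin hm] at hx
  obtain ⟨w, hw, rfl⟩ := hx
  by_cases hw0 : w = 0
  · rw [hw0]
  · exact absurd hc (h.not_critical hm le_rfl ha hpcf
      (pow_mem_ball_zero (by omega) le_rfl hw) (pow_ne_zero m hw0) (h.2.2 w hw))

/-- Orbits in the punctured basin never reach a root. -/
lemma IsBottcherOn.eq_zero_of_iterate_root {g : C(Sphere, Sphere)} {m : ℕ} {ψ : ℂ → ℂ}
    (h : IsBottcherOn g m 1 ψ) (hm : 2 ≤ m) {w : ℂ} (hw : w ∈ ball (0 : ℂ) 1) {n : ℕ}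
    (hn : g^[n] ((ψ w : ℂ) : Sphere) ∈ rootPoints g) : w = 0 := by
  by_contra hw0
  have hmem : ∀ k : ℕ, w ^ m ^ k ∈ ball (0 : ℂ) 1 := fun k =>
    pow_mem_ball_zero (Nat.one_le_pow _ _ (by omega)) le_rfl hw
  have h2 := hn.2
  rw [← Function.iterate_succ_apply' g n, h.iterate (by omega) le_rfl _ hw,
    h.iterate (by omega) le_rfl _ hw, OnePoint.coe_eq_coe] at h2
  have h5 := congrArg norm (h.2.1 (hmem (n + 1)) (hmem n) h2)
  rw [norm_pow, norm_pow] at h5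
  have := pow_lt_pow_right_of_lt_one₀ (norm_pos_iff.2 hw0) (mem_ball_zero_iff.1 hw)
    (Nat.pow_lt_pow_right (show 1 < m by omega) (Nat.lt_succ_self n))
  exact absurd h5 this.ne

/-! ### Roots of nearby Newton maps -/

/-- A selection with values in a compact set converges as soon as all other points of the set are
locally excluded. -/
lemma tendsto_of_compact_unique {P Y : Type*} [TopologicalSpace Y] {l : Filter P} {K : Set Y}
    (hK : IsCompact K) {s : P → Y} (hs : ∀ᶠ p in l, s p ∈ K) {y₀ : Y}
    (h : ∀ y ∈ K, y ≠ y₀ → ∀ᶠ q : P × Y in l ×ˢ 𝓝 y, s q.1 ≠ q.2) :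
    Tendsto s l (𝓝 y₀) := by
  refine hK.tendsto_nhds_of_unique_mapClusterPt hs fun y hy hc => ?_
  by_contra hne
  obtain ⟨U, hU, V, hV, hUV⟩ := Filter.mem_prod_iff.1 (h y hy hne)
  obtain ⟨p, hp1, hp2⟩ := ((mapClusterPt_iff_frequently.1 hc V hV).and_eventually hU).exists
  exact hUV (mk_mem_prod hp2 hp1 : (p, s p) ∈ U ×ˢ V) rfl

lemma eventually_locRep_close {z v : Sphere} {K : Set ℂ}
    (hK : IsCompact K) (hf : ∀ t ∈ K, f.1 (localParam z t) ∈ chartDom v) {η : ℝ} (hη : 0 < η) :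
    ∀ᶠ g : NewtonMap d in 𝓝 f, ∀ t ∈ K, g.1 (localParam z t) ∈ chartDom v ∧
      ‖locRep g.1 z v t - locRep f.1 z v t‖ ≤ η := by
  refine hK.eventually_forall_of_forall_eventually fun t ht => ?_
  have h1 : ContinuousAt (fun q : NewtonMap d × ℂ => q.1.1 (localParam z q.2)) (f, t) := by
    have : Continuous (fun q : NewtonMap d × ℂ => q.1.1 (localParam z q.2)) :=
      continuous_newton_eval.comp
        (continuous_fst.prodMk ((continuous_localParam z).comp continuous_snd))
    exact this.continuousAt
  have h2 : ContinuousAt (fun q : NewtonMap d × ℂ => locRep q.1.1 z v q.2 - locRep f.1 z v q.2)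
      (f, t) := by
    refine (continuousAt_locRep (hf t ht)).sub ?_
    exact ContinuousAt.comp (g := fun q : NewtonMap d × ℂ => locRep q.1.1 z v q.2)
      (f := fun q : NewtonMap d × ℂ => (f, q.2)) (continuousAt_locRep (hf t ht)) (by fun_prop)
  have h3 := h2.norm
  simp only [ContinuousAt, sub_self, norm_zero] at h3
  filter_upwards [h1.eventually ((isOpen_chartDom v).mem_nhds (hf t ht)),
    h3.eventually (ge_mem_nhds hη)] with q hq1 hq2 using ⟨hq1, hq2⟩

/-- Uniform convergence of the local representations on a disc. -/
lemma exists_locRep_radius (hd : 3 ≤ d) (f : NewtonMap d) {z v : Sphere} {t₀ : ℂ}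
    (h : f.1 (localParam z t₀) ∈ chartDom v) {R₁ : ℝ} (hR₁ : 0 < R₁) :
    ∃ R > 0, R ≤ R₁ ∧ ∀ η > 0, ∀ᶠ g : NewtonMap d in 𝓝 f,
      DifferentiableOn ℂ (locRep g.1 z v) (ball t₀ R) ∧
      ∀ t ∈ ball t₀ R, g.1 (localParam z t) ∈ chartDom v ∧
        ‖locRep g.1 z v t - locRep f.1 z v t‖ ≤ η := by
  have hopen : IsOpen {t : ℂ | f.1 (localParam z t) ∈ chartDom v} :=
    (isOpen_chartDom v).preimage (f.1.continuous.comp (continuous_localParam z))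
  obtain ⟨R, hR, hRs⟩ := Metric.nhds_basis_closedBall.mem_iff.1 (hopen.mem_nhds h)
  refine ⟨min R R₁, lt_min hR hR₁, min_le_right _ _, fun η hη => ?_⟩
  filter_upwards [eventually_locRep_close (isCompact_closedBall t₀ R) (fun t ht => hRs ht) hη]
    with g hg
  have hsub : ball t₀ (min R R₁) ⊆ closedBall t₀ R :=
    (ball_subset_ball (min_le_left _ _)).trans ball_subset_closedBall
  exact ⟨fun t ht => (analyticAt_locRep hd g (hg t (hsub ht)).1).differentiableAt.differentiableWithinAt,
    fun t ht => hg t (hsub ht)⟩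

lemma chartDom_zero_iff {y : Sphere} : y ∈ chartDom ((0 : ℂ) : Sphere) ↔ y ≠ ∞ := by
  simp

lemma locRep_zero_eq (g : C(Sphere, Sphere)) (x : ℂ) :
    locRep g ((0 : ℂ) : Sphere) ((0 : ℂ) : Sphere) x = finRep g x := rfl

/-- `NewtonRep.hasDerivAt_root` in the standard chart of the plane. -/
lemma hasDerivAt_finRep_root (r : NewtonRep f) {a : ℂ} (ha : a ∈ r.Z) :
    HasDerivAt (finRep f.1) (1 - 1 / (r.e a : ℂ)) a := by
  have h1 := (r.hasDerivAt_root ha)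
  have h2 : HasDerivAt (fun x => a + locRep f.1 (a : Sphere) (a : Sphere) (x - a))
      (1 - 1 / (r.e a : ℂ)) a := by
    refine HasDerivAt.const_add a ?_
    have h3 : HasDerivAt (fun x : ℂ => x - a) 1 a := (hasDerivAt_id a).sub_const a
    have h1' : HasDerivAt (locRep f.1 (a : Sphere) (a : Sphere)) (1 - 1 / (r.e a : ℂ)) (a - a) := by
      rwa [sub_self]
    exact (HasDerivAt.comp (h := fun x : ℂ => x - a) a h1' h3).congr_deriv (mul_one _)
  refine h2.congr_of_eventuallyEq ?_
  have hc : Continuous fun x : ℂ => f.1 (x : Sphere) := f.1.continuous.comp OnePoint.continuous_coe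
  have hfa : f.1 (a : Sphere) ≠ ∞ := by
    rw [r.fixed_iff.2 ha]; exact OnePoint.coe_ne_infty a
  filter_upwards [hc.continuousAt.eventually (isOpen_ne.mem_nhds hfa)] with x hx
  have h4 : localParam (a : Sphere) (x - a) = (x : Sphere) := by simp
  obtain ⟨y, hy⟩ := OnePoint.ne_infty_iff_exists.1 hx
  rw [locRep, h4, ← hy, finRep_eq hy.symm]
  simp

/-- The multiplier `1 - 1 / e` at a root takes discrete values: it vanishes at a simple root, which
is then critical, and is at least `1 / 2` otherwise. -/
lemma root_multiplier (hd : 3 ≤ d) {a : ℂ}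
    (ha : (a : Sphere) ∈ rootPoints f.1) :
    ∃ ℓ : ℝ, 0 ≤ ℓ ∧ ℓ < 1 ∧ deriv (finRep f.1) a = ℓ ∧ (ℓ = 0 ∨ 1 / 2 ≤ ℓ) ∧
      ((a : Sphere) ∈ criticalPoints f.1 ↔ ℓ = 0) := by
  obtain ⟨r⟩ := exists_newtonRep f
  have haZ : a ∈ r.Z := r.fixed_iff.1 ha.2
  have hder := (hasDerivAt_finRep_root r haZ).deriv
  have he := r.one_le a haZ
  have he' : (1 : ℝ) ≤ r.e a := by exact_mod_cast he
  have hinv : 1 / (r.e a : ℝ) ≤ 1 := by rw [div_le_one (by linarith)]; exact he'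
  have hpos : 0 < 1 / (r.e a : ℝ) := by positivity
  have hcast : deriv (finRep f.1) a = ((1 - 1 / (r.e a : ℝ) : ℝ) : ℂ) := by
    rw [hder]; push_cast; ring
  refine ⟨1 - 1 / (r.e a : ℝ), by linarith, by linarith, hcast, ?_, ?_⟩
  · rcases he.eq_or_lt with h | h
    · left; rw [← h]; norm_num
    · right
      have h2 : (2 : ℝ) ≤ r.e a := by exact_mod_cast h
      have : 1 / (r.e a : ℝ) ≤ 1 / 2 := one_div_le_one_div_of_le (by norm_num) h2
      linarith
  · rw [mem_criticalPoints_iff_deriv hd f (by rw [ha.2]; exact ha.1), hcast]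
    exact Complex.ofReal_eq_zero

/-- The root `b` of `g` lies in the disc of radius `ε` about the root `a` of `f`, the disc is
invariant under `g` and contained in the immediate basin of `b`, and `b` is superattracting if and
only if `a` is. -/
def TracksRoot (f : NewtonMap d) (a : ℂ) (ε : ℝ) (g : NewtonMap d) (b : ℂ) : Prop :=
  b ∈ closedBall a ε ∧ g.1 (b : Sphere) = (b : Sphere) ∧
    (∀ x ∈ closedBall a ε, ∃ y ∈ closedBall a ε, g.1 (x : Sphere) = (y : Sphere)) ∧
    (∀ x ∈ closedBall a ε, (x : Sphere) ∈ immediateBasin g.1 (b : Sphere)) ∧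
    ((b : Sphere) ∈ criticalPoints g.1 ↔ (a : Sphere) ∈ criticalPoints f.1)

/-- Every root is the centre of arbitrarily small discs on which all nearby Newton maps are
contractions; such a disc lies in the immediate basin of the unique root that it contains. -/
lemma exists_attracting_disc (hd : 3 ≤ d) (f : NewtonMap d) {a : ℂ}
    (ha : (a : Sphere) ∈ rootPoints f.1) {ε₁ : ℝ} (hε₁ : 0 < ε₁) :
    ∃ ε > 0, ε ≤ ε₁ ∧ ∀ᶠ g : NewtonMap d in 𝓝 f, ∃ b, TracksRoot f a ε g b := by
  obtain ⟨ℓ, hℓ0, hℓ1, hder, hℓ, hcrit⟩ := root_multiplier hd ha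
  have hfa : f.1 (localParam ((0 : ℂ) : Sphere) a) ∈ chartDom ((0 : ℂ) : Sphere) := by
    simp [ha.2]
  obtain ⟨R, hR, -, hRg⟩ := exists_locRep_radius hd f hfa one_pos
  simp only [localParam_coe, zero_add, chartDom_zero_iff, locRep_zero_eq] at hRg
  set κ := min ((1 - ℓ) / 4) (1 / 8) with hκ
  have hκpos : 0 < κ := lt_min (by linarith) (by norm_num)
  have g₁ : DifferentiableOn ℂ (finRep f.1) (ball a R) := (hRg 1 one_pos).self_of_nhds.1
  obtain ⟨ε₀, hε₀, hε₀R, η₀, hη₀, hclose⟩ := exists_deriv_close hR hκpos g₁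
  set ε := min ε₀ ε₁ with hε
  have hεpos : 0 < ε := lt_min hε₀ hε₁
  have hκ1 : κ ≤ (1 - ℓ) / 4 := min_le_left _ _
  have hκ2 : κ ≤ 1 / 8 := min_le_right _ _
  set θ := ℓ + κ with hθ
  have hθ1 : θ < 1 := by linarith
  have hθ0 : 0 ≤ θ := by linarith
  refine ⟨ε, hεpos, min_le_right _ _, ?_⟩
  have hη : 0 < min η₀ ((1 - θ) * ε) := lt_min hη₀ (mul_pos (by linarith) hεpos)
  filter_upwards [hRg _ hη] with g hg
  have hsubR : closedBall a ε ⊆ ball a R :=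
    closedBall_subset_ball ((min_le_left _ _).trans_lt hε₀R)
  have hd1 : ∀ x ∈ closedBall a ε, ‖deriv (finRep g.1) x - ℓ‖ ≤ κ := by
    intro x hx
    have := hclose (finRep g.1) hg.1 (fun u hu => ((hg.2 u hu).2.trans (min_le_left _ _))) x
      (Metric.closedBall_subset_closedBall (min_le_left _ _) hx)
    rwa [hder] at this
  have hfin : ∀ x ∈ closedBall a ε, g.1 (x : Sphere) ≠ ∞ := fun x hx =>
    (hg.2 x (hsubR hx)).1
  have hcoe : ∀ x ∈ closedBall a ε, g.1 (x : Sphere) = (finRep g.1 x : Sphere) :=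
    fun x hx => (coe_finRep (hfin x hx)).symm
  have hlip : ∀ x ∈ closedBall a ε, ∀ y ∈ closedBall a ε,
      ‖finRep g.1 y - finRep g.1 x‖ ≤ θ * ‖y - x‖ := by
    intro x hx y hy
    refine (convex_closedBall a ε).norm_image_sub_le_of_norm_deriv_le (fun u hu => ?_)
      (fun u hu => ?_) hx hy
    · exact hg.1.differentiableAt (Metric.isOpen_ball.mem_nhds (hsubR hu))
    · have h1 := hd1 u hu
      have h2 : ‖deriv (finRep g.1) u‖ ≤ ‖deriv (finRep g.1) u - ℓ‖ + ‖(ℓ : ℂ)‖ := by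
        simpa using norm_add_le (deriv (finRep g.1) u - ℓ) (ℓ : ℂ)
      rw [Complex.norm_real, Real.norm_of_nonneg hℓ0] at h2
      linarith
  have haa : a ∈ closedBall a ε := Metric.mem_closedBall_self hεpos.le
  have hfaa : finRep f.1 a = a := finRep_eq ha.2
  have hmaps : MapsTo (finRep g.1) (closedBall a ε) (closedBall a ε) := by
    intro x hx
    have h1 := hlip a haa x hx
    have h2 := (hg.2 a (hsubR haa)).2.trans (min_le_right _ _)
    rw [hfaa] at h2
    rw [mem_closedBall_iff_norm] at hx ⊢
    calc ‖finRep g.1 x - a‖ = ‖(finRep g.1 x - finRep g.1 a) + (finRep g.1 a - a)‖ := by ring_nf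
      _ ≤ θ * ‖x - a‖ + (1 - θ) * ε := (norm_add_le _ _).trans (add_le_add h1 h2)
      _ ≤ θ * ε + (1 - θ) * ε := by gcongr
      _ = ε := by ring
  -- Banach's fixed point theorem
  have hcontr : ContractingWith ⟨θ, hθ0⟩ (hmaps.restrict (finRep g.1) _ _) := by
    refine ⟨by exact_mod_cast hθ1, LipschitzWith.of_dist_le_mul fun x y => ?_⟩
    rw [Subtype.dist_eq, Subtype.dist_eq, dist_eq_norm, dist_eq_norm]
    exact hlip y y.2 x x.2
  obtain ⟨b, hb, hbfix, -, -⟩ := hcontr.exists_fixedPoint' Metric.isClosed_closedBall.isComplete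
    hmaps haa (edist_ne_top _ _)
  have hconv : ∀ x ∈ closedBall a ε,
      Tendsto (fun n => g.1^[n] (x : Sphere)) Filter.atTop (𝓝 (b : Sphere)) := by
    intro x hx
    obtain ⟨b', hb', hb'fix, hb'lim, -⟩ := hcontr.exists_fixedPoint'
      Metric.isClosed_closedBall.isComplete hmaps hx (edist_ne_top _ _)
    have hbb : b' = b := by
      have h1 := hlip b hb b' hb'
      rw [hb'fix, hbfix] at h1
      have h2 : ‖b' - b‖ = 0 := by
        have := norm_nonneg (b' - b)
        nlinarith
      exact sub_eq_zero.1 (norm_eq_zero.1 h2)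
    rw [hbb] at hb'lim
    have hit : ∀ n, (finRep g.1)^[n] x ∈ closedBall a ε ∧
        g.1^[n] (x : Sphere) = (((finRep g.1)^[n] x : ℂ) : Sphere) := by
      intro n
      induction n with
      | zero => exact ⟨hx, rfl⟩
      | succ n ih =>
        rw [Function.iterate_succ_apply', Function.iterate_succ_apply', ih.2]
        exact ⟨hmaps ih.1, hcoe _ ih.1⟩
    have h3 := (OnePoint.continuous_coe (X := ℂ)).continuousAt.tendsto.comp hb'lim
    refine h3.congr fun n => ?_
    rw [(hit n).2]; rfl
  have hgb : g.1 (b : Sphere) = (b : Sphere) := by rw [hcoe b hb, hbfix]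
  refine ⟨b, hb, hgb, fun x hx => ⟨_, hmaps hx, hcoe x hx⟩, fun x hx => ?_, ?_⟩
  · have hpre : IsPreconnected (((↑) : ℂ → Sphere) '' closedBall a ε) :=
      (convex_closedBall a ε).isPreconnected.image _ OnePoint.continuous_coe.continuousOn
    refine hpre.subset_connectedComponentIn ⟨b, hb, rfl⟩ ?_ ⟨x, hx, rfl⟩
    rintro _ ⟨y, hy, rfl⟩
    exact hconv y hy
  · obtain ⟨ℓ', hℓ'0, -, hder', hℓ', hcrit'⟩ :=
      root_multiplier hd (f := g) (a := b) ⟨OnePoint.coe_ne_infty b, hgb⟩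
    have h1 := hd1 b hb
    rw [hder', ← Complex.ofReal_sub, Complex.norm_real, Real.norm_eq_abs, abs_le] at h1
    rw [hcrit, hcrit']
    constructor
    · intro h; rcases hℓ with h' | h'
      · exact h'
      · linarith
    · intro h; rcases hℓ' with h' | h'
      · exact h'
      · linarith

/-- Root points of the maps near `f`: the root `α a g` of `g` close to the root `a` of `f`. -/
structure RootTracking (f : NewtonMap d) where
  /-- The neighbourhood of `f` on which the roots are followed. -/
  N : Set (NewtonMap d)
  /-- The roots of `f`. -/
  Z : Finset ℂ
  /-- The radius of an attracting disc about each root. -/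
  ε : ℂ → ℝ
  /-- The root of `g` in the attracting disc of `a`. -/
  α : ℂ → NewtonMap d → ℂ
  N_mem : N ∈ 𝓝 f
  rootPoints_eq : rootPoints f.1 = ((↑) : ℂ → Sphere) '' Z
  card_Z : Z.card = d
  ε_pos : ∀ a, 0 < ε a
  disjoint : ∀ a ∈ Z, ∀ a' ∈ Z, a ≠ a' →
    Disjoint (closedBall a (ε a)) (closedBall a' (ε a'))
  α_mem : ∀ a ∈ Z, ∀ g ∈ N, α a g ∈ closedBall a (ε a)
  fixed : ∀ a ∈ Z, ∀ g ∈ N, g.1 (α a g : Sphere) = (α a g : Sphere)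
  basin : ∀ a ∈ Z, ∀ g ∈ N, ∀ x ∈ closedBall a (ε a),
    (x : Sphere) ∈ immediateBasin g.1 (α a g : Sphere)
  crit : ∀ a ∈ Z, ∀ g ∈ N, ((α a g : Sphere) ∈ criticalPoints g.1 ↔ (a : Sphere) ∈ criticalPoints f.1)

namespace RootTracking

lemma mem_self (T : RootTracking f) : f ∈ T.N := mem_of_mem_nhds T.N_mem

lemma root_mem (T : RootTracking f) {a : ℂ} (ha : a ∈ T.Z)
    {g : NewtonMap d} (hg : g ∈ T.N) : (T.α a g : Sphere) ∈ rootPoints g.1 :=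
  ⟨OnePoint.coe_ne_infty _, T.fixed a ha g hg⟩

lemma eq_of_fixed (T : RootTracking f) {a : ℂ} (ha : a ∈ T.Z)
    {g : NewtonMap d} (hg : g ∈ T.N) {x : ℂ} (hx : x ∈ closedBall a (T.ε a))
    (hfix : g.1 (x : Sphere) = (x : Sphere)) : x = T.α a g := by
  have h1 : Tendsto (fun n => g.1^[n] (x : Sphere)) Filter.atTop (𝓝 (T.α a g : Sphere)) :=
    connectedComponentIn_subset _ _ (T.basin a ha g hg x hx)
  have h2 : Tendsto (fun n => g.1^[n] (x : Sphere)) Filter.atTop (𝓝 (x : Sphere)) := by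
    simp only [Function.iterate_fixed hfix]
    exact tendsto_const_nhds
  exact OnePoint.coe_injective (tendsto_nhds_unique h2 h1)

lemma α_self (T : RootTracking f) {a : ℂ} (ha : a ∈ T.Z) :
    T.α a f = a := by
  have h : (a : Sphere) ∈ rootPoints f.1 := T.rootPoints_eq ▸ ⟨a, ha, rfl⟩
  exact (T.eq_of_fixed ha T.mem_self (Metric.mem_closedBall_self (T.ε_pos a).le) h.2).symm

lemma α_inj (T : RootTracking f) {a a' : ℂ} (ha : a ∈ T.Z)
    (ha' : a' ∈ T.Z) {g : NewtonMap d} (hg : g ∈ T.N) (h : T.α a g = T.α a' g) : a = a' := by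
  by_contra hne
  exact disjoint_left.1 (T.disjoint a ha a' ha' hne) (T.α_mem a ha g hg)
    (h ▸ T.α_mem a' ha' g hg)

/-- All roots of the maps near `f` are accounted for, since there are `d` of them. -/
lemma exists_of_root (T : RootTracking f) {g : NewtonMap d}
    (hg : g ∈ T.N) {b : Sphere} (hb : b ∈ rootPoints g.1) : ∃ a ∈ T.Z, b = (T.α a g : Sphere) := by
  obtain ⟨r⟩ := exists_newtonRep g
  rw [r.rootPoints_eq] at hb
  obtain ⟨b, hb, rfl⟩ := hb
  obtain ⟨a, ha, h⟩ := Finset.surj_on_of_inj_on_of_card_le (s := T.Z) (t := r.Z)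
    (fun a _ => T.α a g) (fun a ha => r.fixed_iff.1 (T.fixed a ha g hg))
    (fun a a' ha ha' h => T.α_inj ha ha' hg h) (by rw [T.card_Z, r.card_Z]) b hb
  exact ⟨a, ha, by rw [h]⟩

lemma continuousOn_α (T : RootTracking f) {a : ℂ} (ha : a ∈ T.Z) :
    ContinuousOn (T.α a) T.N := by
  intro g₀ hg₀
  refine tendsto_of_compact_unique (isCompact_closedBall a (T.ε a))
    (eventually_mem_nhdsWithin.mono fun g hg => T.α_mem a ha g hg) fun y hy hne => ?_
  have hy' : g₀.1 (y : Sphere) ≠ (y : Sphere) := fun h => hne (T.eq_of_fixed ha hg₀ hy h)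
  have hopen : IsOpen {q : NewtonMap d × ℂ | q.1.1 (q.2 : Sphere) ≠ (q.2 : Sphere)} := by
    refine isOpen_ne_fun ?_ ?_
    · exact continuous_newton_eval.comp
        (continuous_fst.prodMk (OnePoint.continuous_coe.comp continuous_snd))
    · exact OnePoint.continuous_coe.comp continuous_snd
  have h1 : ∀ᶠ q : NewtonMap d × ℂ in 𝓝[T.N] g₀ ×ˢ 𝓝 y, q.1.1 (q.2 : Sphere) ≠ (q.2 : Sphere) := by
    have : ∀ᶠ q : NewtonMap d × ℂ in 𝓝 g₀ ×ˢ 𝓝 y, q.1.1 (q.2 : Sphere) ≠ (q.2 : Sphere) := by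
      rw [← nhds_prod_eq]
      exact hopen.mem_nhds hy'
    exact this.filter_mono (Filter.prod_mono_left _ nhdsWithin_le_nhds)
  have h2 : ∀ᶠ q : NewtonMap d × ℂ in 𝓝[T.N] g₀ ×ˢ 𝓝 y, q.1 ∈ T.N :=
    Filter.Eventually.prod_inl (eventually_mem_nhdsWithin) _
  filter_upwards [h1, h2] with q hq1 hq2 heq
  rw [← heq] at hq1
  exact hq1 (T.fixed a ha _ hq2)

end RootTracking

/-- The attracting discs are taken pairwise disjoint; as each of them contains a root of `g` and `g`
has `d` roots, they contain all of them. -/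
lemma exists_rootTracking (hd : 3 ≤ d) (f : NewtonMap d) : Nonempty (RootTracking f) := by
  classical
  obtain ⟨r⟩ := exists_newtonRep f
  -- a lower bound on the mutual distances of the roots
  obtain ⟨δ, hδ, hsep⟩ : ∃ δ > 0, ∀ a ∈ r.Z, ∀ a' ∈ r.Z, a ≠ a' → δ ≤ dist a a' := by
    have h1 : ∀ q ∈ (r.Z ×ˢ r.Z).filter (fun q => q.1 ≠ q.2), 0 < dist q.1 q.2 := by
      intro q hq
      exact dist_pos.2 (Finset.mem_filter.1 hq).2
    by_cases hne : ((r.Z ×ˢ r.Z).filter (fun q => q.1 ≠ q.2)).Nonempty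
    · obtain ⟨q, hq, hmin⟩ := Finset.exists_min_image _ (fun q : ℂ × ℂ => dist q.1 q.2) hne
      refine ⟨_, h1 q hq, fun a ha a' ha' haa => hmin (a, a') ?_⟩
      simp [ha, ha', haa]
    · refine ⟨1, one_pos, fun a ha a' ha' haa => absurd ⟨(a, a'), ?_⟩ hne⟩
      simp [ha, ha', haa]
  have hex : ∀ a : ℂ, ∃ ε > 0, ε ≤ δ / 3 ∧ (a ∈ r.Z → ∀ᶠ g : NewtonMap d in 𝓝 f,
      ∃ b, TracksRoot f a ε g b) := by
    intro a
    by_cases ha : a ∈ r.Z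
    · obtain ⟨ε, h1, h2, h3⟩ := exists_attracting_disc hd f (a := a)
        (by rw [r.rootPoints_eq]; exact ⟨a, ha, rfl⟩) (ε₁ := δ / 3) (by positivity)
      exact ⟨ε, h1, h2, fun _ => h3⟩
    · exact ⟨δ / 3, by positivity, le_rfl, fun h => absurd h ha⟩
  choose ε hε hεδ hev using hex
  have hall := (Filter.eventually_all_finset r.Z).2 fun a ha => hev a ha
  have hch : ∀ (a : ℂ) (g : NewtonMap d), ∃ b : ℂ,
      (∀ a ∈ r.Z, ∃ b, TracksRoot f a (ε a) g b) → a ∈ r.Z → TracksRoot f a (ε a) g b := by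
    intro a g
    by_cases h : (∀ a ∈ r.Z, ∃ b, TracksRoot f a (ε a) g b) ∧ a ∈ r.Z
    · obtain ⟨b, hb⟩ := h.1 a h.2
      exact ⟨b, fun _ _ => hb⟩
    · exact ⟨0, fun h1 h2 => absurd ⟨h1, h2⟩ h⟩
  choose α hα using hch
  refine ⟨⟨_, r.Z, ε, α, hall, r.rootPoints_eq, r.card_Z, hε, ?_, fun a ha g hg => (hα a g hg ha).1,
    fun a ha g hg => (hα a g hg ha).2.1,
    fun a ha g hg => (hα a g hg ha).2.2.2.1, fun a ha g hg => (hα a g hg ha).2.2.2.2⟩⟩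
  intro a ha a' ha' hne
  refine Metric.closedBall_disjoint_closedBall ?_
  have := hsep a ha a' ha' hne
  linarith [hεδ a, hεδ a']

/-! ### Böttcher coordinates of nearby maps -/

lemma continuousOn_uncurry_of_subtype {X Y Z : Type*} [TopologicalSpace X] [TopologicalSpace Y]
    [TopologicalSpace Z] {S : Set X} {B : Set Y} {F : X → Y → Z}
    (h : ContinuousOn (fun q : S × Y => F q.1 q.2) (univ ×ˢ B)) :
    ContinuousOn (Function.uncurry F) (S ×ˢ B) := by
  rw [continuousOn_iff_continuous_domRestrict]
  exact h.comp_continuous (f := fun q : ↥(S ×ˢ B) => ((⟨q.1.1, q.2.1⟩ : S), q.1.2))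
    (by fun_prop) fun q => ⟨mem_univ _, q.2.2⟩

lemma continuousOn_of_lipschitz_family {P : Type*} [TopologicalSpace P] {A : P → ℂ → ℂ} {r K : ℝ}
    (hL : ∀ p, ∀ x ∈ ball (0 : ℂ) r, ∀ y ∈ ball (0 : ℂ) r,
      ‖A p x - A p y‖ ≤ K * ‖x - y‖)
    (hc : ∀ p₀, ∀ t ∈ ball (0 : ℂ) r, t ≠ 0 → ContinuousAt (fun p => A p t) p₀) :
    ContinuousOn (Function.uncurry A) (univ ×ˢ ball (0 : ℂ) r) := by
  rintro ⟨p₀, t₀⟩ ⟨-, ht₀⟩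
  refine ContinuousAt.continuousWithinAt ?_
  rw [ContinuousAt, Metric.tendsto_nhds]
  intro e he
  have hK : 0 < 4 * (|K| + 1) := by positivity
  have hpos : 0 < e / (4 * (|K| + 1)) := by positivity
  obtain ⟨t₁, ⟨ht₁, ht₁r⟩, ht₁0⟩ := (dense_compl_singleton (0 : ℂ)).inter_open_nonempty
    (ball t₀ (e / (4 * (|K| + 1))) ∩ ball 0 r)
    (Metric.isOpen_ball.inter isOpen_ball) ⟨t₀, mem_ball_self hpos, ht₀⟩
  have h1 := (hc p₀ t₁ ht₁r ht₁0).eventually (ball_mem_nhds _ (by positivity : 0 < e / 4))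
  have h2 : ∀ᶠ t in 𝓝 t₀, t ∈ ball t₀ (e / (4 * (|K| + 1))) ∩ ball 0 r :=
    (Metric.isOpen_ball.inter isOpen_ball).mem_nhds ⟨mem_ball_self hpos, ht₀⟩
  rw [nhds_prod_eq]
  filter_upwards [h1.prod_inl (𝓝 t₀), h2.prod_inr (𝓝 p₀)] with q hq1 hq2
  have hbd : ∀ p, ∀ x ∈ ball (0 : ℂ) r, ∀ y ∈ ball (0 : ℂ) r,
      ‖x - y‖ ≤ 2 * (e / (4 * (|K| + 1))) → ‖A p x - A p y‖ ≤ e / 2 := by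
    intro p x hx y hy hxy
    calc ‖A p x - A p y‖ ≤ K * ‖x - y‖ := hL p x hx y hy
      _ ≤ (|K| + 1) * ‖x - y‖ := by gcongr; linarith [le_abs_self K]
      _ ≤ (|K| + 1) * (2 * (e / (4 * (|K| + 1)))) := by gcongr
      _ = e / 2 := by field_simp; norm_num
  have hbd' : ∀ p, ∀ x ∈ ball (0 : ℂ) r, ∀ y ∈ ball (0 : ℂ) r,
      ‖x - y‖ < e / (4 * (|K| + 1)) → ‖A p x - A p y‖ ≤ e / 4 := by
    intro p x hx y hy hxy
    calc ‖A p x - A p y‖ ≤ K * ‖x - y‖ := hL p x hx y hy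
      _ ≤ (|K| + 1) * ‖x - y‖ := by gcongr; linarith [le_abs_self K]
      _ ≤ (|K| + 1) * (e / (4 * (|K| + 1))) := by gcongr
      _ = e / 4 := by field_simp
  rw [mem_ball_iff_norm] at ht₁
  rw [dist_eq_norm] at hq1
  have h3 : ‖q.2 - t₁‖ ≤ 2 * (e / (4 * (|K| + 1))) := by
    have := mem_ball_iff_norm.1 hq2.1
    calc ‖q.2 - t₁‖ = ‖(q.2 - t₀) - (t₁ - t₀)‖ := by ring_nf
      _ ≤ ‖q.2 - t₀‖ + ‖t₁ - t₀‖ := norm_sub_le _ _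
      _ ≤ _ := by linarith
  have e1 := hbd q.1 q.2 hq2.2 t₁ ht₁r h3
  have e2 := hbd' p₀ t₁ ht₁r t₀ ht₀ ht₁
  have hsum : Function.uncurry A q - Function.uncurry A (p₀, t₀) =
      (A q.1 q.2 - A q.1 t₁) + (A q.1 t₁ - A p₀ t₁) + (A p₀ t₁ - A p₀ t₀) := by
    simp only [Function.uncurry]; ring
  rw [dist_eq_norm, hsum]
  calc _ ≤ ‖A q.1 q.2 - A q.1 t₁‖ + ‖A q.1 t₁ - A p₀ t₁‖ + ‖A p₀ t₁ - A p₀ t₀‖ := norm_add₃_le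
    _ < e := by linarith

/-- A local representation at a point of finite local degree `δ` factors as `t ^ δ` times a
nonvanishing function. -/
lemma exists_locRep_factor (hd : 3 ≤ d) (f : NewtonMap d) (z : Sphere) :
    ∃ δ : ℕ, 1 ≤ δ ∧ localDegree f.1 z = δ ∧ ∃ A₀ : ℂ → ℂ, AnalyticAt ℂ A₀ 0 ∧ A₀ 0 ≠ 0 ∧
      ∀ᶠ t in 𝓝 (0 : ℂ), locRep f.1 z (f.1 z) t = t ^ δ * A₀ t := by
  obtain ⟨δ, hδ⟩ := ENat.ne_top_iff_exists.1 (localDegree_ne_top hd f z)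
  have h0 := localDegree_ne_zero hd f z
  rw [← hδ] at h0
  refine ⟨δ, ?_, hδ.symm, ?_⟩
  · rcases Nat.eq_zero_or_pos δ with h | h
    · exact absurd (by simp [h]) h0
    · exact h
  · have h1 : analyticOrderAt (locRep f.1 z (f.1 z)) 0 = δ := by rw [← localDegree_eq, hδ]
    obtain ⟨A₀, hA, hA0, hev⟩ := ((analyticAt_locRep_zero hd f z).analyticOrderAt_eq_natCast).1 h1
    exact ⟨A₀, hA, hA0, by simpa using hev⟩

/-- Local Böttcher coordinates depending continuously on the map, for families in which the local
degree at the root does not drop. -/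
lemma RootTracking.exists_local_bottcher (hd : 3 ≤ d)
    (T : RootTracking f) {a : ℂ} (ha : a ∈ T.Z) (hcrit : (a : Sphere) ∈ criticalPoints f.1) :
    ∃ m : ℕ, 2 ≤ m ∧ localDegree f.1 (a : Sphere) = m ∧ ∃ ρ > 0, ρ < 1 ∧ ∃ N ∈ 𝓝 f, N ⊆ T.N ∧
      ∀ S ⊆ N, (∀ g ∈ S, (m : ℕ∞) ≤ localDegree g.1 (T.α a g : Sphere)) →
        ∃ ψ : NewtonMap d → ℂ → ℂ,
          (∀ g ∈ S, IsBottcherOn g.1 m ρ (ψ g) ∧ ψ g 0 = T.α a g) ∧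
          ContinuousOn (Function.uncurry ψ) (S ×ˢ ball 0 ρ) := by
  have hroot : (a : Sphere) ∈ rootPoints f.1 := T.rootPoints_eq ▸ ⟨a, ha, rfl⟩
  obtain ⟨m, -, hm, A₀, hA₀, hA₀0, hA₀ev⟩ := exists_locRep_factor hd f (a : Sphere)
  rw [hroot.2] at hA₀ev
  have hm2 : 2 ≤ m := by
    have : 2 ≤ localDegree f.1 (a : Sphere) := hcrit
    rw [hm] at this
    exact_mod_cast this
  refine ⟨m, hm2, hm, ?_⟩
  obtain ⟨R₁, hR₁, hR₁s⟩ := Metric.eventually_nhds_iff_ball.1 hA₀ev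
  obtain ⟨R, hR, hRR₁, hRg⟩ := exists_locRep_radius hd f (z := (a : Sphere)) (v := (a : Sphere))
    (t₀ := 0) (by simp [hroot.2]) hR₁
  have hαpos : 0 < ‖A₀ 0‖ := norm_pos_iff.2 hA₀0
  obtain ⟨r, hr, hrR, κ, hκ, hκr, hFL⟩ := exists_factor_of_order hR
    (hRg 1 one_pos).self_of_nhds.1 (by omega : 1 ≤ m) hA₀.continuousAt
    (fun t ht => hR₁s t (ball_subset_ball hRR₁ ht)) (half_pos hαpos)
  set r' := (r - κ) / 2 with hr'
  have hr'pos : 0 < r' := by rw [hr']; linarith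
  obtain ⟨ρ, hρ, hρ1, hB⟩ := _root_.exists_local_bottcher hm2 hr'pos hA₀0
  refine ⟨ρ, hρ, hρ1, ?_⟩
  have hαc : ∀ᶠ g in 𝓝 f, ‖T.α a g - a‖ ≤ κ := by
    have h1 := ((T.continuousOn_α ha).continuousAt T.N_mem).tendsto
    rw [T.α_self ha] at h1
    filter_upwards [h1.eventually (closedBall_mem_nhds a hκ)] with g hg
    exact mem_closedBall_iff_norm.1 hg
  refine ⟨_, Filter.inter_mem T.N_mem ((hRg κ hκ).and hαc), inter_subset_left, fun S hS hdeg => ?_⟩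
  set τ : NewtonMap d → ℂ := fun g => T.α a g - a with hτ
  have hατ : ∀ g, T.α a g = a + τ g := fun g => by simp [hτ]
  have hSN : ∀ g ∈ S, g ∈ T.N := fun g hg => (hS hg).1
  have hκS : ∀ g ∈ S, ‖τ g‖ ≤ κ := fun g hg => (hS hg).2.2
  have hGτ : ∀ g ∈ S, locRep g.1 (a : Sphere) (a : Sphere) (τ g) = τ g := by
    intro g hg
    rw [locRep, localParam_coe, ← hατ, T.fixed a ha g (hSN g hg)]
    simp [hτ]
  have hfac : ∀ g : S, ∃ A : ℂ → ℂ, DifferentiableOn ℂ A (ball 0 r) ∧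
      (∀ t ∈ ball (0 : ℂ) r, locRep g.1.1 (a : Sphere) (a : Sphere) t - τ g =
        (t - τ g) ^ m * A t) ∧
      ∀ t ∈ ball (0 : ℂ) r, ‖A t - A₀ 0‖ ≤ ‖A₀ 0‖ / 2 := by
    rintro ⟨g, hg⟩
    have h1 := hFL (locRep g.1 (a : Sphere) (a : Sphere)) (hS hg).2.1.1
      (fun t ht => ((hS hg).2.1.2 t ht).2) (τ g) (hκS g hg) (by
        have h2 := localDegree_eq_order (g := g) (z := (a : Sphere)) (v := (a : Sphere)) (τ := τ g)
          (by simp) (by simp) (by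
            rw [localParam_coe, ← hατ, T.fixed a ha g (hSN g hg)]; simp)
        rw [← h2, localParam_coe, ← hατ]
        exact hdeg g hg)
    rwa [hGτ g hg] at h1
  choose A hAd hAf hAb using hfac
  have hshift : ∀ g : S, ∀ t ∈ ball (0 : ℂ) (2 * r'), t + τ g ∈ ball (0 : ℂ) r := by
    intro g t ht
    rw [mem_ball_zero_iff] at ht ⊢
    have := norm_add_le t (τ g)
    have := hκS g g.2
    rw [hr'] at ht
    linarith
  have hsub : ball (0 : ℂ) r' ⊆ ball 0 (2 * r') :=
    ball_subset_ball (by linarith)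
  set A' : S → ℂ → ℂ := fun g t => A g (t + τ g) with hA'
  have hA'd : ∀ g, DifferentiableOn ℂ (A' g) (ball 0 (2 * r')) := fun g t ht =>
    (DifferentiableAt.comp t ((hAd g).differentiableAt
      (Metric.isOpen_ball.mem_nhds (hshift g t ht))) (by fun_prop)).differentiableWithinAt
  have hA'b : ∀ g, ∀ t ∈ ball (0 : ℂ) (2 * r'), ‖A' g t - A₀ 0‖ ≤ ‖A₀ 0‖ / 2 :=
    fun g t ht => hAb g _ (hshift g t ht)
  have hτc : Continuous fun g : S => τ g := by
    have h1 : ContinuousOn τ S := ((T.continuousOn_α ha).mono hSN).sub continuousOn_const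
    exact continuousOn_iff_continuous_domRestrict.1 h1
  have hA'f : ∀ g : S, ∀ t ∈ ball (0 : ℂ) (2 * r'),
      locRep g.1.1 (a : Sphere) (a : Sphere) (t + τ g) = τ g + t ^ m * A' g t := by
    intro g t ht
    have := hAf g _ (hshift g t ht)
    rw [add_sub_cancel_right] at this
    rw [hA', ← this]
    ring
  have hcont : ContinuousOn (Function.uncurry A') (univ ×ˢ ball (0 : ℂ) r') := by
    refine continuousOn_of_lipschitz_family (K := (2 * ‖A₀ 0‖) / (2 * r' / 2)) ?_ ?_
    · intro g x hx y hy
      refine norm_sub_le_of_bounded (by positivity) (hA'd g) (fun t ht => ?_)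
        (by rwa [mul_div_cancel_left₀ _ two_ne_zero])
        (by rwa [mul_div_cancel_left₀ _ two_ne_zero])
      have h1 := hA'b g t ht
      have h2 : ‖A' g t‖ ≤ ‖A' g t - A₀ 0‖ + ‖A₀ 0‖ := by
        simpa using norm_add_le (A' g t - A₀ 0) (A₀ 0)
      linarith
    · intro g₀ t ht ht0
      have ht' := hsub ht
      have hdom : ∀ g : S, ∀ t ∈ ball (0 : ℂ) (2 * r'),
          g.1.1 (localParam (a : Sphere) (t + τ g)) ∈ chartDom (a : Sphere) := fun g t ht =>
        ((hS g.2).2.1.2 _ (ball_subset_ball hrR.le (hshift g t ht))).1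
      have h1 : ContinuousAt (fun g : S => locRep g.1.1 (a : Sphere) (a : Sphere) (t + τ g)) g₀ :=
        ContinuousAt.comp (g := fun q : NewtonMap d × ℂ => locRep q.1.1 (a : Sphere) (a : Sphere) q.2)
          (f := fun g : S => (g.1, t + τ g)) (continuousAt_locRep (hdom g₀ t ht'))
          (continuous_subtype_val.prodMk (continuous_const.add hτc)).continuousAt
      have h2 : ContinuousAt (fun g : S =>
          (locRep g.1.1 (a : Sphere) (a : Sphere) (t + τ g) - τ g) / t ^ m) g₀ :=
        (h1.sub hτc.continuousAt).div_const _
      refine h2.congr (Filter.Eventually.of_forall fun g => ?_)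
      simp only
      rw [hA'f g t ht']
      field_simp
      ring
  obtain ⟨ψ, hψd, hψi, hψ0, hψm, hψe, hψc⟩ := hB S A'
    (fun g => (hA'd g).mono hsub) (fun g t ht => hA'b g t (hsub ht)) hcont
  classical
  refine ⟨fun g w => if h : g ∈ S then T.α a g + ψ ⟨g, h⟩ w else 0, fun g hg => ?_, ?_⟩
  · simp only [dif_pos hg]
    refine ⟨⟨(hψd ⟨g, hg⟩).const_add _, fun x hx y hy hxy => hψi ⟨g, hg⟩ hx hy
      (add_left_cancel hxy), fun w hw => ?_⟩, by rw [hψ0, add_zero]⟩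
    have h1 := hψm ⟨g, hg⟩ w hw
    have h2 := hA'f ⟨g, hg⟩ _ (hsub h1)
    have h3 : g.1 (localParam (a : Sphere) (ψ ⟨g, hg⟩ w + τ g)) ∈ chartDom (a : Sphere) :=
      ((hS hg).2.1.2 _ (ball_subset_ball hrR.le (hshift ⟨g, hg⟩ _ (hsub h1)))).1
    have h4 := localParam_locRep h3
    rw [h2, hψe _ w hw, localParam_coe, localParam_coe] at h4
    simp only [hατ, add_assoc]
    rw [add_comm (τ g), ← h4]
  · refine continuousOn_uncurry_of_subtype ?_
    have : ContinuousOn (fun q : S × ℂ => T.α a q.1 + ψ q.1 q.2) (univ ×ˢ ball 0 ρ) := by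
      refine ContinuousOn.add (Continuous.continuousOn ?_) hψc
      have h1 : Continuous fun g : S => T.α a g := by
        simp only [hατ]; exact continuous_const.add hτc
      exact h1.comp continuous_fst
    refine this.congr fun q _ => ?_
    simp only [dif_pos q.1.2]

/-- Existence of a Böttcher coordinate at a superattracting root. -/
lemma exists_bottcher (hd : 3 ≤ d) (hpcf : RootsBasinPCF f.1) {a : ℂ}
    (ha : (a : Sphere) ∈ rootPoints f.1) (hcrit : (a : Sphere) ∈ criticalPoints f.1) :
    ∃ (m : ℕ) (ψ : ℂ → ℂ), 2 ≤ m ∧ IsBottcherOn f.1 m 1 ψ ∧ ψ 0 = a := by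
  obtain ⟨T⟩ := exists_rootTracking hd f
  have haZ : a ∈ T.Z := by
    rw [T.rootPoints_eq] at ha
    obtain ⟨b, hb, h⟩ := ha
    rwa [← OnePoint.coe_injective h]
  obtain ⟨m, hm, hdeg, ρ, hρ, hρ1, N, hN, -, hS⟩ := T.exists_local_bottcher hd haZ hcrit
  obtain ⟨ψ, hψ, -⟩ := hS {f} (singleton_subset_iff.2 (mem_of_mem_nhds hN)) (by
    rintro g rfl
    rw [T.α_self haZ, hdeg])
  obtain ⟨h1, h2⟩ := hψ f rfl
  rw [T.α_self haZ] at h2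
  obtain ⟨ψ', h3, h4⟩ := h1.exists_disc hd hm hρ hρ1 (by rwa [h2]) hpcf
  exact ⟨m, ψ', hm, h3, by rw [h4 (mem_ball_self hρ), h2]⟩

/-- In a roots-basin postcritically finite map, the only critical point in the immediate basin of
a superattracting root is the root. -/
lemma eq_root_of_critical (hd : 3 ≤ d) (hpcf : RootsBasinPCF f.1) {a : ℂ}
    (ha : (a : Sphere) ∈ rootPoints f.1) (hcrit : (a : Sphere) ∈ criticalPoints f.1) {x : Sphere}
    (hx : x ∈ immediateBasin f.1 (a : Sphere)) (hxc : x ∈ criticalPoints f.1) :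
    x = (a : Sphere) := by
  obtain ⟨m, ψ, hm, hB, rfl⟩ := exists_bottcher hd hpcf ha hcrit
  exact hB.eq_zero_of_critical hm ha hpcf hx hxc

/-- For roots-basin postcritically finite maps near `f` the local degree at a superattracting root
is the same as for `f`: the critical points that bifurcate from the root stay in its basin. -/
lemma RootTracking.localDegree_eq (hd : 3 ≤ d)
    (T : RootTracking f) {a : ℂ} (ha : a ∈ T.Z) (hcrit : (a : Sphere) ∈ criticalPoints f.1) :
    ∀ᶠ g : NewtonMap d in 𝓝 f, RootsBasinPCF g.1 →
      localDegree g.1 (T.α a g : Sphere) = localDegree f.1 (a : Sphere) := by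
  have hroot : (a : Sphere) ∈ rootPoints f.1 := T.rootPoints_eq ▸ ⟨a, ha, rfl⟩
  obtain ⟨m, -, hm, A₀, hA₀, hA₀0, hA₀ev⟩ := exists_locRep_factor hd f (a : Sphere)
  rw [hroot.2] at hA₀ev
  have hm2 : 2 ≤ m := by
    have : 2 ≤ localDegree f.1 (a : Sphere) := hcrit
    rw [hm] at this
    exact_mod_cast this
  obtain ⟨R, hR, -, hRg⟩ := exists_locRep_radius hd f (z := (a : Sphere)) (v := (a : Sphere))
    (t₀ := 0) (by simp [hroot.2]) one_pos
  have hρpos : 0 < min R (T.ε a) := lt_min hR (T.ε_pos a)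
  obtain ⟨κ, hκ, hFC⟩ := exists_multiple_point hR (hRg 1 one_pos).self_of_nhds.1
    (by omega : 1 ≤ m) hA₀ hA₀0 hA₀ev hρpos (min_le_left _ _)
  have hαc : ∀ᶠ g in 𝓝 f, ‖T.α a g - a‖ ≤ κ := by
    have h1 := ((T.continuousOn_α ha).continuousAt T.N_mem).tendsto
    rw [T.α_self ha] at h1
    filter_upwards [h1.eventually (closedBall_mem_nhds a hκ)] with g hg
    exact mem_closedBall_iff_norm.1 hg
  filter_upwards [hRg κ hκ, hαc, T.N_mem] with g hg hgα hgN hpcf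
  have hgroot := T.root_mem ha hgN
  have hgcrit := (T.crit a ha g hgN).2 hcrit
  have hsubR : ball (0 : ℂ) (min R (T.ε a)) ⊆ ball 0 R :=
    ball_subset_ball (min_le_left _ _)
  have hdom : ∀ t ∈ ball (0 : ℂ) (min R (T.ε a)),
      g.1 (localParam (a : Sphere) t) ∈ chartDom (a : Sphere) := fun t ht => (hg.2 t (hsubR ht)).1
  have hcp : ∀ t ∈ ball (0 : ℂ) (min R (T.ε a)),
      (2 : ℕ∞) ≤ analyticOrderAt (fun s => locRep g.1 (a : Sphere) (a : Sphere) s -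
        locRep g.1 (a : Sphere) (a : Sphere) t) t → a + t = T.α a g := by
    intro t ht hord
    have h1 := localDegree_eq_order (g := g) (z := (a : Sphere)) (v := (a : Sphere)) (τ := t)
      (by simp) (by simp) (hdom t ht)
    rw [← h1, localParam_coe] at hord
    refine OnePoint.coe_injective (eq_root_of_critical hd hpcf hgroot hgcrit
      (T.basin a ha g hgN _ ?_) hord)
    rw [mem_closedBall_iff_norm, add_sub_cancel_left]
    exact ((mem_ball_zero_iff.1 ht).trans_le (min_le_right _ _)).le
  have hval : ∀ t, a + t = T.α a g →
      locRep g.1 (a : Sphere) (a : Sphere) t = T.α a g - a := by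
    intro t ht
    rw [locRep, localParam_coe, ht, T.fixed a ha g hgN]
    simp
  obtain ⟨τ, hτ, hGτ, hord⟩ := hFC _ hg.1 (fun t ht => (hg.2 t ht).2) (T.α a g - a) hgα (by
    intro t ht hder
    refine hval t (hcp t ht ?_)
    have han := analyticAt_locRep hd g (hdom t ht)
    rw [← han.analyticOrderAt_deriv_add_one, ← one_add_one_eq_two]
    gcongr
    rw [Order.one_le_iff_ne_zero, han.deriv.analyticOrderAt_ne_zero]
    exact hder)
  have hord' : analyticOrderAt (fun s => locRep g.1 (a : Sphere) (a : Sphere) s -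
        locRep g.1 (a : Sphere) (a : Sphere) τ) τ = m := by rw [hGτ]; exact hord
  have hτα : a + τ = T.α a g := hcp τ hτ (by rw [hord']; exact_mod_cast hm2)
  rw [hm, ← hord', ← hτα]
  have := localDegree_eq_order (g := g) (z := (a : Sphere)) (v := (a : Sphere)) (τ := τ)
    (by simp) (by simp) (hdom τ hτ)
  rwa [localParam_coe] at this

/-- A property that holds locally near each point of a compact set holds uniformly on it. -/
lemma eventually_forall_compact {X Y : Type*} [TopologicalSpace Y] {l : Filter X} {K : Set Y}
    (hK : IsCompact K) {P : X → Y → Prop} (h : ∀ y ∈ K, ∀ᶠ q : X × Y in l ×ˢ 𝓝[K] y, P q.1 q.2) :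
    ∀ᶠ x in l, ∀ y ∈ K, P x y := by
  refine hK.induction_on (p := fun s => ∀ᶠ x in l, ∀ y ∈ s, P x y) (by simp)
    (fun s t hst ht => ht.mono fun x hx y hy => hx y (hst hy))
    (fun s t hs ht => ?_) (fun y hy => ?_)
  · filter_upwards [hs, ht] with x h1 h2 y hy using hy.elim (h1 y) (h2 y)
  · obtain ⟨U, hU, V, hV, hUV⟩ := Filter.mem_prod_iff.1 (h y hy)
    exact ⟨V, hV, Filter.mem_of_superset hU fun x hx y hy =>
      hUV (mk_mem_prod hx hy : (x, y) ∈ U ×ˢ V)⟩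

/-- For a bounded family of holomorphic functions on the unit disc, continuity in the parameter
near the origin propagates to the whole disc, through the Taylor coefficients. -/
lemma continuousOn_of_bounded_family {P : Type*} [TopologicalSpace P] {S : Set P}
    {y : P → ℂ → ℂ} {M ρ : ℝ} (hρ : 0 < ρ) (hρ1 : ρ < 1)
    (hd : ∀ p ∈ S, DifferentiableOn ℂ (y p) (ball 0 1))
    (hM : ∀ p ∈ S, ∀ w ∈ ball (0 : ℂ) 1, ‖y p w‖ ≤ M)
    (hc : ContinuousOn (Function.uncurry y) (S ×ˢ ball 0 ρ)) :
    ContinuousOn (Function.uncurry y) (S ×ˢ ball 0 1) := by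
  rintro ⟨p₀, w₀⟩ ⟨hp₀, hw₀⟩
  simp only at hp₀ hw₀
  have h01 : ball (0 : ℂ) 1 ∈ 𝓝 0 := ball_mem_nhds 0 one_pos
  have hcd : ∀ p ∈ S, ∀ n : ℕ, ContDiffAt ℂ n (y p) 0 := fun p hp n =>
    ((hd p hp).analyticAt h01).contDiffAt
  have hsub : closedBall (0 : ℂ) (ρ / 2) ⊆ ball 0 1 :=
    closedBall_subset_ball (by linarith)
  have hsub' : closedBall (0 : ℂ) (ρ / 2) ⊆ ball 0 ρ :=
    closedBall_subset_ball (by linarith)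
  have hclose : ∀ η > 0, ∀ᶠ p in 𝓝[S] p₀, ∀ w ∈ closedBall (0 : ℂ) (ρ / 2),
      ‖y p w - y p₀ w‖ ≤ η := by
    intro η hη
    refine eventually_forall_compact (isCompact_closedBall (0 : ℂ) (ρ / 2)) fun w hw => ?_
    have h1 : ContinuousWithinAt (fun q : P × ℂ => y q.1 q.2 - y p₀ q.2)
        (S ×ˢ closedBall 0 (ρ / 2)) (p₀, w) := by
      refine ContinuousWithinAt.sub ?_ ?_
      · exact (hc (p₀, w) ⟨hp₀, hsub' hw⟩).mono (prod_mono_right hsub')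
      · have : ContinuousAt (y p₀) w :=
          ((hd p₀ hp₀).differentiableAt (Metric.isOpen_ball.mem_nhds (hsub hw))).continuousAt
        exact (ContinuousAt.comp (f := fun q : P × ℂ => q.2) (x := (p₀, w)) this
          continuousAt_snd).continuousWithinAt
    have h2 := h1.norm
    rw [ContinuousWithinAt, nhdsWithin_prod_eq] at h2
    simp only [sub_self, norm_zero] at h2
    exact h2.eventually (ge_mem_nhds hη)
  -- continuity of the Taylor coefficients
  have hcoef : ∀ n : ℕ, Tendsto (fun p => iteratedDeriv n (y p) 0) (𝓝[S] p₀)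
      (𝓝 (iteratedDeriv n (y p₀) 0)) := by
    intro n
    rw [Metric.tendsto_nhds]
    intro e he
    have hc0 : 0 < (n.factorial : ℝ) / (ρ / 2) ^ n := by positivity
    filter_upwards [hclose (e / 2 / ((n.factorial : ℝ) / (ρ / 2) ^ n)) (by positivity),
      self_mem_nhdsWithin] with p hp hpS
    have h1 := Complex.norm_iteratedDeriv_le_of_forall_mem_sphere_norm_le (c := 0)
      (f := fun w => y p w - y p₀ w) n (half_pos hρ)
      (DifferentiableOn.diffContOnCl (by
        refine ((hd p hpS).sub (hd p₀ hp₀)).mono ?_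
        rw [closure_ball _ (half_pos hρ).ne']
        exact hsub)) (fun w hw => hp w (Metric.sphere_subset_closedBall hw))
    rw [iteratedDeriv_fun_sub (hcd p hpS n) (hcd p₀ hp₀ n)] at h1
    rw [dist_eq_norm]
    calc _ ≤ _ := h1
      _ = e / 2 := by field_simp
      _ < e := by linarith
  -- Cauchy bounds
  obtain ⟨s, hws, hs1⟩ := exists_between (mem_ball_zero_iff.1 hw₀)
  obtain ⟨s', hss', hs'1⟩ := exists_between hs1
  have hs0 : 0 < s := (norm_nonneg _).trans_lt hws
  have hbound : ∀ p ∈ S, ∀ n : ℕ, ‖iteratedDeriv n (y p) 0‖ ≤ n.factorial * M / s' ^ n := by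
    intro p hp n
    refine Complex.norm_iteratedDeriv_le_of_forall_mem_sphere_norm_le n (by linarith)
      (DifferentiableOn.diffContOnCl ((hd p hp).mono ?_)) fun w hw => hM p hp w ?_
    · rw [closure_ball _ (by linarith)]
      exact closedBall_subset_ball hs'1
    · exact closedBall_subset_ball hs'1 (Metric.sphere_subset_closedBall hw)
  have htay : ∀ p ∈ S, ∀ w ∈ ball (0 : ℂ) 1,
      ∑' n : ℕ, ((n.factorial : ℂ)⁻¹ • (w - 0) ^ n • iteratedDeriv n (y p) 0) = y p w :=
    fun p hp w hw => (Complex.hasSum_taylorSeries_on_ball (hd p hp) hw).tsum_eq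
  have key : Tendsto (fun q : P × ℂ => ∑' n : ℕ, ((n.factorial : ℂ)⁻¹ • (q.2 - 0) ^ n •
      iteratedDeriv n (y q.1) 0)) (𝓝[S] p₀ ×ˢ 𝓝[ball 0 1] w₀)
      (𝓝 (∑' n : ℕ, ((n.factorial : ℂ)⁻¹ • (w₀ - 0) ^ n • iteratedDeriv n (y p₀) 0))) := by
    refine tendsto_tsum_of_dominated_convergence (bound := fun n => M * (s / s') ^ n)
      ((summable_geometric_of_lt_one (div_nonneg hs0.le (hs0.trans hss').le)
        ((div_lt_one (by linarith)).2 hss')).mul_left M) (fun n => ?_) ?_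
    · refine Filter.Tendsto.const_smul ?_ _
      refine Filter.Tendsto.smul ?_ ((hcoef n).comp Filter.tendsto_fst)
      have h1 : Tendsto (fun w : ℂ => (w - 0) ^ n) (𝓝[ball 0 1] w₀)
          (𝓝 ((w₀ - 0) ^ n)) :=
        ((by fun_prop : Continuous fun w : ℂ => (w - 0) ^ n).tendsto w₀).mono_left
          nhdsWithin_le_nhds
      exact h1.comp Filter.tendsto_snd
    · have h1 : ∀ᶠ p in 𝓝[S] p₀, p ∈ S := self_mem_nhdsWithin
      have h2 : ∀ᶠ w in 𝓝[ball (0 : ℂ) 1] w₀, ‖w‖ < s :=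
        (continuous_norm.continuousAt.eventually (gt_mem_nhds hws)).filter_mono nhdsWithin_le_nhds
      filter_upwards [h1.prod_inl _, h2.prod_inr _] with q hq1 hq2 n
      have hb := hbound q.1 hq1 n
      have hf : (0 : ℝ) < n.factorial := by positivity
      rw [norm_smul, norm_smul, norm_inv, norm_pow, sub_zero, Complex.norm_natCast]
      calc (n.factorial : ℝ)⁻¹ * (‖q.2‖ ^ n * ‖iteratedDeriv n (y q.1) 0‖)
          ≤ (n.factorial : ℝ)⁻¹ * (s ^ n * (n.factorial * M / s' ^ n)) := by gcongr
        _ = M * (s / s') ^ n := by rw [div_pow]; field_simp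
  rw [ContinuousWithinAt, nhdsWithin_prod_eq]
  simp only [Function.uncurry]
  rw [htay p₀ hp₀ w₀ hw₀] at key
  refine key.congr' ?_
  have h1 : ∀ᶠ p in 𝓝[S] p₀, p ∈ S := self_mem_nhdsWithin
  have h2 : ∀ᶠ w in 𝓝[ball (0 : ℂ) 1] w₀, w ∈ ball (0 : ℂ) 1 := self_mem_nhdsWithin
  filter_upwards [h1.prod_inl _, h2.prod_inr _] with q hq1 hq2 using htay _ hq1 _ hq2

lemma RootTracking.exists_other (hd : 3 ≤ d) (T : RootTracking f)
    (a : ℂ) : ∃ b ∈ T.Z, b ≠ a := by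
  have h : 1 < T.Z.card := by rw [T.card_Z]; omega
  exact Finset.exists_mem_ne h a

/-- The basin of a root stays away from the attracting disc of another root. -/
lemma RootTracking.lt_norm_sub (T : RootTracking f) {a b : ℂ}
    (ha : a ∈ T.Z) (hb : b ∈ T.Z) (hba : b ≠ a) {g : NewtonMap d} (hg : g ∈ T.N) {m : ℕ}
    (hm : 2 ≤ m) {ψ : ℂ → ℂ} (hB : IsBottcherOn g.1 m 1 ψ) (h0 : ψ 0 = T.α a g) {w : ℂ}
    (hw : w ∈ ball (0 : ℂ) 1) : T.ε b < ‖ψ w - b‖ := by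
  by_contra hcon
  have h1 : Tendsto (fun n => g.1^[n] (ψ w : Sphere)) Filter.atTop
      (𝓝 (T.α b g : Sphere)) :=
    connectedComponentIn_subset _ _ (T.basin b hb g hg _ (mem_closedBall_iff_norm.2
      (not_lt.1 hcon)))
  have h2 := hB.tendsto hm le_rfl hw
  rw [h0] at h2
  exact hba (T.α_inj hb ha hg (OnePoint.coe_injective (tendsto_nhds_unique h1 h2)))

/-- Böttcher coordinates on the unit disc depend continuously on the map, among roots-basin
postcritically finite maps near `f`. -/
lemma RootTracking.exists_bottcher_family (hd : 3 ≤ d)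
    (T : RootTracking f) {a : ℂ} (ha : a ∈ T.Z) (hcrit : (a : Sphere) ∈ criticalPoints f.1) :
    ∃ m : ℕ, 2 ≤ m ∧ localDegree f.1 (a : Sphere) = m ∧ ∃ N ∈ 𝓝 f, N ⊆ T.N ∧
      ∃ ψ : NewtonMap d → ℂ → ℂ,
        (∀ g ∈ N, RootsBasinPCF g.1 → IsBottcherOn g.1 m 1 (ψ g) ∧ ψ g 0 = T.α a g ∧
          localDegree g.1 (T.α a g : Sphere) = m) ∧
        ContinuousOn (Function.uncurry ψ)
          ((N ∩ {g | RootsBasinPCF g.1}) ×ˢ ball 0 1) := by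
  obtain ⟨m, hm, hdeg, ρ, hρ, hρ1, N, hN, hNT, hS⟩ := T.exists_local_bottcher hd ha hcrit
  refine ⟨m, hm, hdeg, _, Filter.inter_mem hN (T.localDegree_eq hd ha hcrit),
    inter_subset_left.trans hNT, ?_⟩
  set N' := N ∩ {g | RootsBasinPCF g.1 → localDegree g.1 (T.α a g : Sphere) =
    localDegree f.1 (a : Sphere)} with hN'
  set S := N' ∩ {g | RootsBasinPCF g.1} with hSdef
  have hdS : ∀ g ∈ S, localDegree g.1 (T.α a g : Sphere) = m := fun g hg => by
    rw [hg.1.2 hg.2, hdeg]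
  have hST : ∀ g ∈ S, g ∈ T.N := fun g hg => hNT hg.1.1
  obtain ⟨ψ₀, hψ₀, hψ₀c⟩ := hS S (fun g hg => hg.1.1) (fun g hg => (hdS g hg).ge)
  have hext : ∀ g, ∃ ψ : ℂ → ℂ, g ∈ S → IsBottcherOn g.1 m 1 ψ ∧
      EqOn ψ (ψ₀ g) (ball 0 ρ) := by
    intro g
    by_cases hg : g ∈ S
    · obtain ⟨ψ, h1, h2⟩ := (hψ₀ g hg).1.exists_disc hd hm hρ hρ1
        (by rw [(hψ₀ g hg).2]; exact T.root_mem ha (hST g hg)) hg.2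
      exact ⟨ψ, fun _ => ⟨h1, h2⟩⟩
    · exact ⟨0, fun h => absurd h hg⟩
  choose ψ hψ using hext
  have hψ0 : ∀ g ∈ S, ψ g 0 = T.α a g := fun g hg => by
    rw [(hψ g hg).2 (mem_ball_self hρ), (hψ₀ g hg).2]
  refine ⟨ψ, fun g hg hp => ⟨(hψ g ⟨hg, hp⟩).1, hψ0 g ⟨hg, hp⟩, hdS g ⟨hg, hp⟩⟩, ?_⟩
  obtain ⟨b, hb, hba⟩ := T.exists_other hd a
  have hlt : ∀ g ∈ S, ∀ w ∈ ball (0 : ℂ) 1, T.ε b < ‖ψ g w - b‖ := fun g hg w hw =>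
    T.lt_norm_sub ha hb hba (hST g hg) hm (hψ g hg).1 (hψ0 g hg) hw
  have hne : ∀ g ∈ S, ∀ w ∈ ball (0 : ℂ) 1, ψ g w - b ≠ 0 := fun g hg w hw =>
    norm_pos_iff.1 ((T.ε_pos b).trans (hlt g hg w hw))
  have hy : ContinuousOn (Function.uncurry fun g w => (ψ g w - b)⁻¹) (S ×ˢ ball 0 1) := by
    refine continuousOn_of_bounded_family (M := (T.ε b)⁻¹) hρ hρ1 (fun g hg => ?_)
      (fun g hg w hw => ?_) ?_
    · exact ((hψ g hg).1.1.sub_const b).inv (fun w hw => hne g hg w hw)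
    · rw [norm_inv]
      exact inv_anti₀ (T.ε_pos b) (hlt g hg w hw).le
    · have h1 : ContinuousOn (fun q : NewtonMap d × ℂ => (ψ₀ q.1 q.2 - b)⁻¹)
          (S ×ˢ ball 0 ρ) := by
        refine (hψ₀c.sub continuousOn_const).inv₀ fun q hq => ?_
        change ψ₀ q.1 q.2 - b ≠ 0
        rw [← (hψ q.1 hq.1).2 hq.2]
        exact hne _ hq.1 _ (ball_subset_ball hρ1.le hq.2)
      refine h1.congr fun q hq => ?_
      simp only [Function.uncurry]
      rw [(hψ q.1 hq.1).2 hq.2]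
  have h2 : ContinuousOn (fun q : NewtonMap d × ℂ => b + ((ψ q.1 q.2 - b)⁻¹)⁻¹)
      (S ×ˢ ball 0 1) :=
    continuousOn_const.add (hy.inv₀ fun q hq => inv_ne_zero (hne _ hq.1 _ hq.2))
  refine h2.congr fun q _ => ?_
  change ψ q.1 q.2 = b + ((ψ q.1 q.2 - b)⁻¹)⁻¹
  rw [inv_inv]
  ring

/-! ### The repelling fixed point at infinity -/

/-- The multiplier `D / (D - 1)` at `∞`, written as `1 + 1 / (D - 1)`. -/
lemma multiplier_infty (hd : 3 ≤ d) (g : NewtonMap d) :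
    ∃ D : ℕ, 3 ≤ D ∧ HasDerivAt (locRep g.1 ∞ ∞)
      (((1 + 1 / ((D : ℝ) - 1) : ℝ)) : ℂ) 0 := by
  obtain ⟨r⟩ := exists_newtonRep g
  have hD : 3 ≤ r.deg := hd.trans r.le_deg
  refine ⟨r.deg, hD, (r.hasDerivAt_locRep_infty hd).congr_deriv ?_⟩
  have h1 : ((r.deg : ℂ) - 1) ≠ 0 := by
    rw [sub_ne_zero]
    exact_mod_cast (by omega : r.deg ≠ 1)
  push_cast
  field_simp
  ring

/-- The multipliers `1 + 1 / (D - 1)` are isolated, so that nearby maps have the same one. -/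
lemma eq_of_inv_close {D D' : ℕ} (hD : 3 ≤ D) (hD' : 3 ≤ D')
    (h : |1 / ((D' : ℝ) - 1) - 1 / ((D : ℝ) - 1)| ≤ 1 / (2 * D * (D - 1))) : D' = D := by
  have h3 : (3 : ℝ) ≤ D := by exact_mod_cast hD
  have h3' : (3 : ℝ) ≤ D' := by exact_mod_cast hD'
  have e : 1 / ((D' : ℝ) - 1) - 1 / ((D : ℝ) - 1) = ((D : ℝ) - D') / ((D' - 1) * (D - 1)) := by
    have : (D : ℝ) - 1 ≠ 0 := by linarith
    have : (D' : ℝ) - 1 ≠ 0 := by linarith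
    field_simp
    ring
  rw [e, abs_div, abs_of_pos (by nlinarith : (0 : ℝ) < (D' - 1) * (D - 1)),
    div_le_div_iff₀ (by nlinarith) (by nlinarith), one_mul] at h
  by_contra hne
  have hint : (1 : ℝ) ≤ |(D : ℝ) - D'| := by
    have : (1 : ℤ) ≤ |(D : ℤ) - D'| := Int.one_le_abs (by omega)
    exact_mod_cast this
  have h5 : |(D : ℝ) - D'| * (2 * D) ≤ D' - 1 := by
    have : 0 < (D : ℝ) - 1 := by linarith
    have : (|(D : ℝ) - D'| * (2 * D)) * (D - 1) ≤ (D' - 1) * (D - 1) := by linarith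
    exact le_of_mul_le_mul_right this (by linarith)
  have h6 : (D' : ℝ) ≤ D + |(D : ℝ) - D'| := by
    have := neg_abs_le ((D : ℝ) - D')
    linarith
  nlinarith

/-- Near `∞`, in the coordinate `t = 1 / z`, all maps near `f` are expanding with the same
multiplier and a uniform second order estimate. -/
lemma exists_repelling (hd : 3 ≤ d) (f : NewtonMap d) :
    ∃ (R c C : ℝ) (μ : ℂ), 0 < R ∧ 1 < c ∧ 0 ≤ C ∧ ∀ᶠ g : NewtonMap d in 𝓝 f,
      ∀ t ∈ closedBall (0 : ℂ) R,
        g.1 (localParam ∞ t) ∈ chartDom ∞ ∧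
        c * ‖t‖ ≤ ‖locRep g.1 ∞ ∞ t‖ ∧
        ‖locRep g.1 ∞ ∞ t - μ * t‖ ≤ C * ‖t‖ ^ 2 := by
  obtain ⟨D, hD, hder⟩ := multiplier_infty hd f
  have h3 : (3 : ℝ) ≤ D := by exact_mod_cast hD
  have hinf : ∀ g : NewtonMap d, g.1 (localParam ∞ 0) = ∞ := fun g => by
    rw [localParam_zero]; exact g.map_infty
  obtain ⟨R, hR, -, hRg⟩ := exists_locRep_radius hd f (z := ∞) (v := ∞)
    (t₀ := 0) (by rw [hinf]; exact mem_chartDom_self _) one_pos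
  set ν : ℝ := 1 / ((D : ℝ) - 1) with hν
  have hνpos : 0 < ν := by rw [hν]; exact one_div_pos.2 (by linarith)
  set κ : ℝ := min (ν / 2) (1 / (2 * D * (D - 1))) with hκ
  have hκpos : 0 < κ := lt_min (by positivity) (one_div_pos.2 (by nlinarith))
  have hκ1 : κ ≤ ν / 2 := min_le_left _ _
  obtain ⟨ε₀, hε₀, hε₀R, η₀, hη₀, hclose⟩ := exists_deriv_close hR hκpos (hRg 1 one_pos).self_of_nhds.1
  rw [hder.deriv] at hclose
  set μ : ℂ := ((1 + ν : ℝ) : ℂ) with hμ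
  have hμn : ‖μ‖ = 1 + ν := by
    rw [hμ, Complex.norm_real, Real.norm_of_nonneg (by linarith)]
  set M : ℝ := 1 + ν + κ with hM
  set C : ℝ := M / (ε₀ / 2) with hC
  have hCnn : 0 ≤ C := by positivity
  refine ⟨ε₀ / 4, 1 + ν / 2, C, μ, by positivity, by linarith, hCnn, ?_⟩
  filter_upwards [hRg η₀ hη₀] with g hg t ht
  set G := locRep g.1 ∞ ∞ with hG
  have hcl := hclose G hg.1 (fun u hu => (hg.2 u hu).2)
  obtain ⟨D', hD', hder'⟩ := multiplier_infty hd g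
  have h0 : (0 : ℂ) ∈ closedBall (0 : ℂ) ε₀ := Metric.mem_closedBall_self hε₀.le
  have hDD : D' = D := by
    refine eq_of_inv_close hD hD' ?_
    have h1 := hcl 0 h0
    rw [hder'.deriv, hμ, ← Complex.ofReal_sub, Complex.norm_real, Real.norm_eq_abs] at h1
    have : 1 + 1 / ((D' : ℝ) - 1) - (1 + ν) = 1 / ((D' : ℝ) - 1) - 1 / ((D : ℝ) - 1) := by
      rw [hν]; ring
    rw [this] at h1
    exact h1.trans (min_le_right _ _)
  rw [hDD] at hder'
  have hder0 : deriv G 0 = μ := hder'.deriv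
  have hG0 : G 0 = 0 := by
    have := locRep_zero g.1 ∞
    rwa [g.map_infty] at this
  rw [mem_closedBall_zero_iff] at ht
  have htR : t ∈ closedBall (0 : ℂ) ε₀ := by
    rw [mem_closedBall_zero_iff]; linarith
  have hdiff : ∀ u ∈ closedBall (0 : ℂ) ε₀, DifferentiableAt ℂ G u := fun u hu =>
    hg.1.differentiableAt (Metric.isOpen_ball.mem_nhds (closedBall_subset_ball hε₀R hu))
  refine ⟨(hg.2 t (closedBall_subset_ball hε₀R htR)).1, ?_, ?_⟩
  · have h1 := norm_sub_sub_mul_le hdiff hcl htR h0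
    rw [hG0, sub_zero, sub_zero] at h1
    have h2 : ‖μ * t‖ ≤ ‖G t‖ + ‖G t - μ * t‖ := by
      have := norm_sub_le (G t) (G t - μ * t)
      simpa using this
    rw [norm_mul, hμn] at h2
    nlinarith [norm_nonneg t]
  · have hd' : DifferentiableOn ℂ (deriv G) (ball 0 ε₀) := by
      refine DifferentiableOn.deriv (hg.1.mono (ball_subset_ball hε₀R.le)) isOpen_ball
    have hb' : ∀ u ∈ ball (0 : ℂ) ε₀, ‖deriv G u‖ ≤ M := by
      intro u hu
      have h1 := hcl u (ball_subset_closedBall hu)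
      have h2 : ‖deriv G u‖ ≤ ‖deriv G u - μ‖ + ‖μ‖ := by
        simpa using norm_add_le (deriv G u - μ) μ
      linarith
    have h1 := norm_sub_sub_mul_le (F := G) (u₀ := 0) (c := μ) (ε := ‖t‖) (κ := C * ‖t‖)
      (fun u hu => hdiff u (Metric.closedBall_subset_closedBall (by linarith) hu))
      (fun u hu => by
        rw [mem_closedBall_zero_iff] at hu
        have h2 := norm_sub_le_of_bounded hε₀ hd' hb' (x := u) (y := 0)
          (by rw [mem_ball_zero_iff]; linarith) (by simpa using hε₀)
        rw [hder0, sub_zero] at h2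
        exact h2.trans (by gcongr))
      (u := t) (w := 0) (by simp) (by simp)
    rw [hG0, sub_zero, sub_zero] at h1
    calc _ ≤ _ := h1
      _ = C * ‖t‖ ^ 2 := by ring

/-! ### Landing of fixed rays -/

/-- For a bounded injective holomorphic function on the disc, `(1 - ‖w‖) ‖y' w‖` tends to `0` at
the boundary: otherwise the images of infinitely many far apart discs would overlap. -/
lemma exists_deriv_mul_le {y : ℂ → ℂ} {M : ℝ} (hd : DifferentiableOn ℂ y (ball 0 1))
    (hinj : InjOn y (ball 0 1)) (hM : ∀ w ∈ ball (0 : ℂ) 1, ‖y w‖ ≤ M) {δ : ℝ}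
    (hδ : 0 < δ) :
    ∃ ρ < (1 : ℝ), ∀ w ∈ ball (0 : ℂ) 1, ρ ≤ ‖w‖ → ‖deriv y w‖ * (1 - ‖w‖) ≤ δ := by
  by_contra! hcon
  have hM0 : 0 ≤ M := (norm_nonneg _).trans (hM 0 (by simp))
  have hseq : ∀ n : ℕ, (1 : ℝ) - 1 / (n + 1) < 1 := fun n => by
    have : (0 : ℝ) < 1 / (n + 1) := by positivity
    linarith
  choose w hw1 hwn hwδ using fun n : ℕ => hcon (1 - 1 / (n + 1)) (hseq n)
  -- a quantitative open mapping property at `w n`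
  set M₁ := 2 * M + 1 with hM₁
  set q := min (δ / (4 * M₁)) (1 / 4) with hq
  have hM₁pos : 0 < M₁ := by positivity
  have hqpos : 0 < q := lt_min (by positivity) (by norm_num)
  have hq1 : q ≤ δ / (4 * M₁) := min_le_left _ _
  have hq2 : q ≤ 1 / 4 := min_le_right _ _
  have hcover : ∀ n, ball (y (w n)) (q * δ / 2 / 2) ⊆
      y '' closedBall (w n) (q * (1 - ‖w n‖)) := by
    intro n
    set s := 1 - ‖w n‖ with hs
    have hspos : 0 < s := by have := mem_ball_zero_iff.1 (hw1 n); linarith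
    have hsub : ball (w n) s ⊆ ball 0 1 := by
      intro u hu
      rw [mem_ball_zero_iff]
      rw [mem_ball_iff_norm] at hu
      have := norm_sub_norm_le u (w n)
      linarith
    have hcs : closedBall (w n) (q * s) ⊆ ball (w n) s :=
      closedBall_subset_ball (by nlinarith)
    have hmaps : MapsTo y (ball (w n) s) (ball (y (w n)) M₁) := by
      intro u hu
      rw [mem_ball_iff_norm]
      have h1 := hM u (hsub hu)
      have h2 := hM _ (hw1 n)
      have := norm_sub_le (y u) (y (w n))
      linarith
    have hds := hd.mono hsub
    have hdsl : DifferentiableOn ℂ (dslope y (w n)) (ball (w n) s) :=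
      (Complex.differentiableOn_dslope (ball_mem_nhds _ hspos)).2 hds
    refine DiffContOnCl.ball_subset_image_closedBall ?_ (by positivity) ?_ ?_
    · refine DifferentiableOn.diffContOnCl ?_
      rw [closure_ball _ (by positivity)]
      exact hds.mono hcs
    · intro u hu
      have hu' : ‖u - w n‖ = q * s := mem_sphere_iff_norm.1 hu
      have h1 := norm_sub_le_of_bounded (F := fun t => dslope y (w n) (w n + t)) (r := s)
        (M := M₁ / s) hspos
        (hdsl.comp (by fun_prop) (fun t ht => by
          rw [mem_ball_iff_norm, add_sub_cancel_left]; simpa using ht))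
        (fun t ht => Complex.norm_dslope_le_div_of_mapsTo_ball hds
          (hmaps.mono_right ball_subset_closedBall) (by
          rw [mem_ball_iff_norm, add_sub_cancel_left]; simpa using ht))
        (x := u - w n) (y := 0) (by rw [mem_ball_zero_iff, hu']; nlinarith)
        (by simpa using hspos)
      simp only [add_sub_cancel, add_zero, dslope_same, sub_zero] at h1
      rw [hu'] at h1
      have h2 : M₁ / s / (s / 2) * (q * s) = 2 * M₁ * q / s := by field_simp
      rw [h2] at h1
      have h3 : δ / s < ‖deriv y (w n)‖ := by
        rw [div_lt_iff₀ hspos]; exact hwδ n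
      have h4 : 2 * M₁ * q / s ≤ δ / 2 / s := by
        gcongr
        calc 2 * M₁ * q ≤ 2 * M₁ * (δ / (4 * M₁)) := by gcongr
          _ = δ / 2 := by field_simp; norm_num
      have h5 : δ / 2 / s ≤ ‖dslope y (w n) u‖ := by
        have := norm_sub_norm_le (deriv y (w n)) (deriv y (w n) - dslope y (w n) u)
        rw [sub_sub_cancel, norm_sub_rev (deriv y (w n))] at this
        have e : δ / s = δ / 2 / s + δ / 2 / s := by ring
        linarith
      have hne : u ≠ w n := by
        intro h
        rw [h, sub_self, norm_zero] at hu'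
        have : 0 < q * s := by positivity
        linarith
      have h6 : y u - y (w n) = (u - w n) * dslope y (w n) u := by
        rw [dslope_of_ne _ hne, slope_def_field, mul_div_cancel₀ _ (sub_ne_zero.2 hne)]
      rw [h6, norm_mul, hu']
      calc q * δ / 2 = q * s * (δ / 2 / s) := by field_simp
        _ ≤ _ := by gcongr
    · have hne : ∀ᶠ z in 𝓝[≠] (w n), y z ≠ y (w n) := by
        filter_upwards [self_mem_nhdsWithin,
          mem_nhdsWithin_of_mem_nhds (Metric.isOpen_ball.mem_nhds (hw1 n))] with z hz1 hz2 h
        exact hz1 (hinj hz2 (hw1 n) h)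
      exact hne.frequently.filter_mono nhdsWithin_le_nhds
  -- infinitely many of the discs share a point
  obtain ⟨b, -, φ, hφ, hlim⟩ := (isCompact_closedBall (0 : ℂ) M).tendsto_subseq
    (x := fun n => y (w n)) (fun n => by simpa using hM _ (hw1 n))
  have hcau := hlim.eventually (ball_mem_nhds b (by positivity : 0 < q * δ / 2 / 2 / 2))
  obtain ⟨k, hk⟩ := hcau.exists
  have hall : ∀ᶠ n in Filter.atTop, 1 - ‖w (φ k)‖ ≤ 2 / ((φ n : ℝ) + 1) := by
    filter_upwards [hcau] with n hn
    have h1 : y (w (φ k)) ∈ ball (y (w (φ n))) (q * δ / 2 / 2) := by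
      rw [mem_ball]
      calc dist (y (w (φ k))) (y (w (φ n))) ≤ dist (y (w (φ k))) b + dist (y (w (φ n))) b :=
            dist_triangle_right _ _ _
        _ < q * δ / 2 / 2 / 2 + q * δ / 2 / 2 / 2 := add_lt_add hk hn
        _ = q * δ / 2 / 2 := by ring
    obtain ⟨u, hu, huy⟩ := hcover _ h1
    have hn1 := hwn (φ n)
    have hspos : 0 < 1 - ‖w (φ n)‖ := by
      have := mem_ball_zero_iff.1 (hw1 (φ n)); linarith
    rw [mem_closedBall_iff_norm] at hu
    have hu1 : u ∈ ball (0 : ℂ) 1 := by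
      rw [mem_ball_zero_iff]
      have := norm_sub_norm_le u (w (φ n))
      nlinarith
    rw [hinj hu1 (hw1 _) huy] at hu
    have h2 := norm_sub_norm_le (w (φ n)) (w (φ k))
    rw [norm_sub_rev] at h2
    have h3 : (2 : ℝ) / (φ n + 1) = 2 * (1 / (φ n + 1)) := by ring
    rw [h3]
    nlinarith
  have hlim2 : Tendsto (fun n => (2 : ℝ) / ((φ n : ℝ) + 1)) Filter.atTop (𝓝 0) := by
    have h1 : Tendsto (fun n : ℕ => (n : ℝ) + 1) Filter.atTop Filter.atTop :=
      Filter.tendsto_atTop_add_const_right _ _ tendsto_natCast_atTop_atTop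
    exact (h1.comp hφ.tendsto_atTop).const_div_atTop 2
  have hle := ge_of_tendsto hlim2 hall
  have := mem_ball_zero_iff.1 (hw1 (φ k))
  linarith

/-- Böttcher coordinates at all superattracting roots, for the roots-basin postcritically finite
maps near `f`. -/
structure BottcherSystem (f : NewtonMap d) extends RootTracking f where
  /-- The neighbourhood of `f` on which the coordinates are defined. -/
  N' : Set (NewtonMap d)
  /-- The local degrees at the superattracting roots. -/
  m : ℂ → ℕ
  /-- The inverse Böttcher coordinates. -/
  ψ : ℂ → NewtonMap d → ℂ → ℂ
  N'_mem : N' ∈ 𝓝 f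
  N'_sub : N' ⊆ N
  two_le : ∀ a ∈ Z, (a : Sphere) ∈ criticalPoints f.1 → 2 ≤ m a
  bottcher : ∀ a ∈ Z, (a : Sphere) ∈ criticalPoints f.1 → ∀ g ∈ N', RootsBasinPCF g.1 →
    IsBottcherOn g.1 (m a) 1 (ψ a g) ∧ ψ a g 0 = α a g ∧
      localDegree g.1 (α a g : Sphere) = m a
  cont : ∀ a ∈ Z, (a : Sphere) ∈ criticalPoints f.1 → ContinuousOn (Function.uncurry (ψ a))
    ((N' ∩ {g | RootsBasinPCF g.1}) ×ˢ ball 0 1)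

/-- The families of Böttcher coordinates at the finitely many superattracting roots, on a common
neighbourhood of `f`. -/
lemma exists_bottcherSystem (hd : 3 ≤ d) (f : NewtonMap d) :
    Nonempty (BottcherSystem f) := by
  obtain ⟨T⟩ := exists_rootTracking hd f
  have hex : ∀ a : ℂ, ∃ (m : ℕ) (N : Set (NewtonMap d)) (ψ : NewtonMap d → ℂ → ℂ), a ∈ T.Z →
      (a : Sphere) ∈ criticalPoints f.1 → 2 ≤ m ∧ N ∈ 𝓝 f ∧
        N ⊆ T.N ∧ (∀ g ∈ N, RootsBasinPCF g.1 → IsBottcherOn g.1 m 1 (ψ g) ∧ ψ g 0 = T.α a g ∧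
          localDegree g.1 (T.α a g : Sphere) = m) ∧
        ContinuousOn (Function.uncurry ψ)
          ((N ∩ {g | RootsBasinPCF g.1}) ×ˢ ball 0 1) := by
    intro a
    by_cases h : a ∈ T.Z ∧ (a : Sphere) ∈ criticalPoints f.1
    · obtain ⟨m, h1, -, N, h3, h4, ψ, h5, h6⟩ := T.exists_bottcher_family hd h.1 h.2
      exact ⟨m, N, ψ, fun _ _ => ⟨h1, h3, h4, h5, h6⟩⟩
    -- the values at the other points are irrelevant
    · exact ⟨0, ∅, 0, fun h1 h2 => absurd ⟨h1, h2⟩ h⟩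
  choose m N ψ hall using hex
  set N' := T.N ∩ {g | ∀ a ∈ T.Z, (a : Sphere) ∈ criticalPoints f.1 → g ∈ N a} with hN'
  have hN'mem : N' ∈ 𝓝 f := by
    refine Filter.inter_mem T.N_mem ((Filter.eventually_all_finset T.Z).2 fun a ha => ?_)
    by_cases hc : (a : Sphere) ∈ criticalPoints f.1
    · filter_upwards [(hall a ha hc).2.1] with g hg _ using hg
    · exact Filter.Eventually.of_forall fun g h => absurd h hc
  exact ⟨{ toRootTracking := T, N' := N', m := m, ψ := ψ, N'_mem := hN'mem,
           N'_sub := inter_subset_left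
           two_le := fun a ha hc => (hall a ha hc).1
           bottcher := fun a ha hc g hg hp => (hall a ha hc).2.2.2.1 g (hg.2 a ha hc) hp
           cont := fun a ha hc => (hall a ha hc).2.2.2.2.mono
             (prod_mono_left fun g hg => ⟨hg.1.2 a ha hc, hg.2⟩) }⟩

/-- The fixed rays land at `∞`. -/
lemma RootTracking.tendsto_ray (hd : 3 ≤ d) (T : RootTracking f) {a : ℂ}
    (ha : a ∈ T.Z) {g : NewtonMap d} (hg : g ∈ T.N) {m : ℕ} (hm : 2 ≤ m) {ψ : ℂ → ℂ}
    (hB : IsBottcherOn g.1 m 1 ψ) (h0 : ψ 0 = T.α a g) {ζ : ℂ} (hζ : ‖ζ‖ = 1) (hζm : ζ ^ m = ζ) :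
    Tendsto (fun r : ℝ => ((ψ ((r : ℂ) * ζ) : ℂ) : Sphere)) (𝓝[<] 1)
      (𝓝 ∞) := by
  obtain ⟨b, hb, hba⟩ := T.exists_other hd a
  have hlt : ∀ w ∈ ball (0 : ℂ) 1, T.ε b < ‖ψ w - b‖ := fun w hw =>
    T.lt_norm_sub ha hb hba hg hm hB h0 hw
  have hne : ∀ w ∈ ball (0 : ℂ) 1, ψ w - b ≠ 0 := fun w hw =>
    norm_pos_iff.1 ((T.ε_pos b).trans (hlt w hw))
  set y : ℂ → ℂ := fun w => (ψ w - b)⁻¹ with hy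
  have hyd : DifferentiableOn ℂ y (ball 0 1) := (hB.1.sub_const b).inv hne
  have hyi : InjOn y (ball 0 1) := fun u hu v hv huv =>
    hB.2.1 hu hv (sub_left_injective (inv_injective huv))
  have hyb : ∀ w ∈ ball (0 : ℂ) 1, ‖y w‖ ≤ (T.ε b)⁻¹ := fun w hw => by
    rw [hy, norm_inv]
    exact inv_anti₀ (T.ε_pos b) (hlt w hw).le
  have hev : ∀ᶠ r : ℝ in 𝓝[<] 1, r ∈ Ico (0 : ℝ) 1 := by
    have : ∀ᶠ r : ℝ in 𝓝[<] 1, 0 ≤ r :=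
      (eventually_ge_nhds one_pos).filter_mono nhdsWithin_le_nhds
    filter_upwards [this, self_mem_nhdsWithin] with r h1 h2 using ⟨h1, h2⟩
  -- consecutive points of the ray get close
  have hclose : Tendsto (fun r : ℝ => y ((r : ℂ) * ζ) - y (((r ^ m : ℝ) : ℂ) * ζ)) (𝓝[<] 1)
      (𝓝 0) := by
    rw [Metric.tendsto_nhds]
    intro e he
    have hm0 : (0 : ℝ) < m := by positivity
    obtain ⟨ρ, hρ, hder⟩ := exists_deriv_mul_le hyd hyi hyb (δ := e / 2 / m) (by positivity)
    have hpow : ∀ᶠ r : ℝ in 𝓝[<] 1, ρ < r ^ m := by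
      have h1 : Tendsto (fun r : ℝ => r ^ m) (𝓝[<] 1) (𝓝 1) := by
        have := ((continuous_pow m).tendsto (1 : ℝ)).mono_left (nhdsWithin_le_nhds (s := Iio 1))
        simpa using this
      exact h1.eventually (lt_mem_nhds hρ)
    filter_upwards [hev, hpow] with r hr hρr
    have hrm : r ^ m ≤ r := pow_le_of_le_one hr.1 hr.2.le (by omega)
    have hrm0 : 0 ≤ r ^ m := pow_nonneg hr.1 m
    have h1r : 0 < 1 - r := by linarith [hr.2]
    have hseg : ∀ x ∈ Icc (r ^ m) r, HasDerivWithinAt (fun s : ℝ => y ((s : ℂ) * ζ))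
        (deriv y ((x : ℂ) * ζ) * ζ) (Icc (r ^ m) r) x := by
      intro x hx
      have hxm : (x : ℂ) * ζ ∈ ball (0 : ℂ) 1 :=
        ofReal_mul_mem_ball hζ ⟨hrm0.trans hx.1, hx.2.trans_lt hr.2⟩
      have h2 : HasDerivAt y (deriv y ((x : ℂ) * ζ)) ((x : ℂ) * ζ) :=
        (hyd.differentiableAt (Metric.isOpen_ball.mem_nhds hxm)).hasDerivAt
      have h3 : HasDerivAt (fun s : ℂ => s * ζ) ζ (x : ℂ) := by
        simpa using (hasDerivAt_id (x : ℂ)).mul_const ζ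
      have h4 : HasDerivAt (fun s : ℂ => y (s * ζ)) (deriv y ((x : ℂ) * ζ) * ζ) (x : ℂ) :=
        HasDerivAt.comp (h := fun s : ℂ => s * ζ) (x : ℂ) h2 h3
      exact h4.comp_ofReal.hasDerivWithinAt
    have hbd : ∀ x ∈ Icc (r ^ m) r, ‖deriv y ((x : ℂ) * ζ) * ζ‖ ≤ e / 2 / m / (1 - r) := by
      intro x hx
      have hx0 : 0 ≤ x := hrm0.trans hx.1
      have hxm : (x : ℂ) * ζ ∈ ball (0 : ℂ) 1 :=
        ofReal_mul_mem_ball hζ ⟨hx0, hx.2.trans_lt hr.2⟩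
      have hxn : ‖(x : ℂ) * ζ‖ = x := by
        rw [norm_mul, hζ, mul_one, Complex.norm_real, Real.norm_of_nonneg hx0]
      have h2 := hder _ hxm (by rw [hxn]; exact (hρr.trans_le hx.1).le)
      rw [hxn] at h2
      rw [norm_mul, hζ, mul_one, le_div_iff₀ h1r]
      refine le_trans ?_ h2
      gcongr
      exact hx.2
    have h5 := (convex_Icc (r ^ m) r).norm_image_sub_le_of_norm_hasDerivWithin_le hseg hbd
      (left_mem_Icc.2 hrm) (right_mem_Icc.2 hrm)
    have hber : 1 - r ^ m ≤ m * (1 - r) := by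
      have := one_add_mul_le_pow (a := r - 1) (by linarith [hr.1]) m
      rw [add_sub_cancel] at this
      linarith
    rw [dist_zero_right]
    have h6 : ‖r - r ^ m‖ ≤ m * (1 - r) := by
      rw [Real.norm_of_nonneg (by linarith)]
      linarith [hr.2]
    calc _ ≤ _ := h5
      _ ≤ e / 2 / m / (1 - r) * (m * (1 - r)) := by gcongr
      _ = e / 2 := by field_simp
      _ < e := by linarith
  refine isCompact_univ.tendsto_nhds_of_unique_mapClusterPt (by simp) fun x _ hx => ?_
  by_contra hxinf
  obtain ⟨x, rfl⟩ := OnePoint.ne_infty_iff_exists.1 hxinf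
  obtain ⟨U, hU, hUx⟩ := mapClusterPt_iff_ultrafilter.1 hx
  have hUx' : Tendsto (fun r : ℝ => ψ ((r : ℂ) * ζ)) U (𝓝 x) :=
    (OnePoint.isOpenEmbedding_coe (X := ℂ)).isInducing.tendsto_nhds_iff.2 hUx
  have hevU := hU hev
  have hxb : T.ε b ≤ ‖x - b‖ := by
    refine ge_of_tendsto (hUx'.sub_const b).norm ?_
    filter_upwards [hevU] with r hr using (hlt _ (ofReal_mul_mem_ball hζ hr)).le
  have hxb0 : x - b ≠ 0 := norm_pos_iff.1 ((T.ε_pos b).trans_le hxb)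
  have h1 : Tendsto (fun r : ℝ => y ((r : ℂ) * ζ)) U (𝓝 (x - b)⁻¹) :=
    (hUx'.sub_const b).inv₀ hxb0
  have h2 : Tendsto (fun r : ℝ => y (((r ^ m : ℝ) : ℂ) * ζ)) U (𝓝 (x - b)⁻¹) := by
    have := h1.sub (hclose.mono_left hU)
    simpa using this
  have h3 : Tendsto (fun r : ℝ => ψ (((r ^ m : ℝ) : ℂ) * ζ)) U (𝓝 x) := by
    have h4 := (h2.inv₀ (inv_ne_zero hxb0)).add_const b
    simpa [hy] using h4
  have h4 : Tendsto (fun r : ℝ => g.1 ((ψ ((r : ℂ) * ζ) : ℂ) : Sphere)) U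
      (𝓝 (g.1 (x : Sphere))) := (g.1.continuous.tendsto _).comp hUx
  have h5 : Tendsto (fun r : ℝ => g.1 ((ψ ((r : ℂ) * ζ) : ℂ) : Sphere)) U
      (𝓝 (x : Sphere)) := by
    refine ((OnePoint.continuous_coe.tendsto x).comp h3).congr' ?_
    filter_upwards [hevU] with r hr
    rw [hB.2.2 _ (ofReal_mul_mem_ball hζ hr), mul_pow, hζm]
    simp
  have hfix : g.1 (x : Sphere) = (x : Sphere) := tendsto_nhds_unique h4 h5
  -- a root is not a limit point of the ray
  have hgt : ∀ᶠ r : ℝ in 𝓝[<] 1, 1 / 2 < r :=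
    (eventually_gt_nhds (by norm_num)).filter_mono nhdsWithin_le_nhds
  have hx0 : x = ψ 0 := by
    obtain ⟨ε, hε, -, hev'⟩ := exists_attracting_disc hd g (a := x)
      ⟨OnePoint.coe_ne_infty x, hfix⟩ one_pos
    obtain ⟨b', -, -, -, hbas, -⟩ := hev'.self_of_nhds
    have hlim : ∀ u ∈ closedBall x ε,
        Tendsto (fun n => g.1^[n] (u : Sphere)) Filter.atTop (𝓝 (b' : Sphere)) :=
      fun u hu => connectedComponentIn_subset _ _ (hbas u hu)
    have hxb' : (x : Sphere) = (b' : Sphere) := by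
      have h7 := hlim x (Metric.mem_closedBall_self hε.le)
      simp only [Function.iterate_fixed hfix] at h7
      exact tendsto_nhds_unique tendsto_const_nhds h7
    obtain ⟨r, hr1, hr⟩ :=
      ((hUx'.eventually (closedBall_mem_nhds x hε)).and hevU).exists
    have h8 := hB.tendsto hm le_rfl (ofReal_mul_mem_ball hζ hr)
    exact OnePoint.coe_injective (hxb'.trans (tendsto_nhds_unique (hlim _ hr1) h8))
  have hopen : IsOpen (ψ '' ball 0 (1 / 2)) :=
    isOpen_image_of_injOn isOpen_ball hB.1 hB.2.1 isOpen_ball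
      (ball_subset_ball (by norm_num))
  have hmem : x ∈ ψ '' ball 0 (1 / 2) := ⟨0, by simp, hx0.symm⟩
  obtain ⟨r, ⟨⟨v, hv, hvr⟩, hr⟩, hr2⟩ :=
    (((hUx'.eventually (hopen.mem_nhds hmem)).and hevU).and (hU hgt)).exists
  have := hB.2.1 (ball_subset_ball (by norm_num) hv) (ofReal_mul_mem_ball hζ hr) hvr
  rw [this, mem_ball_zero_iff, norm_mul, hζ, mul_one, Complex.norm_real,
    Real.norm_of_nonneg hr.1] at hv
  linarith

/-- Induction along a fixed ray, from a fundamental interval towards `1`. -/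
lemma ray_induction {m : ℕ} (hm : 2 ≤ m) {s : ℝ} (hs : 0 < s) {P : ℝ → Prop}
    (base : ∀ r, s ≤ r → r < 1 → r ^ m ≤ s → P r)
    (step : ∀ r, s ≤ r → r < 1 → s < r ^ m → P (r ^ m) → P r) : ∀ r ∈ Ico s 1, P r := by
  have key : ∀ n : ℕ, ∀ r, s ≤ r → r < 1 → r ^ m ^ n < s → P r := by
    intro n
    induction n with
    | zero => intro r h1 _ h3; rw [pow_zero, pow_one] at h3; linarith
    | succ n ih =>
      intro r h1 h2 h3
      rcases le_or_gt (r ^ m) s with h | h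
      · exact base r h1 h2 h
      · refine step r h1 h2 h (ih _ h.le (pow_lt_one₀ (hs.le.trans h1) h2 (by omega)) ?_)
        rw [← pow_mul, ← pow_succ']
        exact h3
  intro r hr
  have h1 : Tendsto (fun n : ℕ => r ^ m ^ n) Filter.atTop (𝓝 0) :=
    (tendsto_pow_atTop_nhds_zero_of_lt_one (hs.le.trans hr.1) hr.2).comp
      (tendsto_pow_atTop_atTop_of_one_lt (by omega : 1 < m))
  obtain ⟨n, hn⟩ := (h1.eventually (gt_mem_nhds hs)).exists
  exact key n r hr.1 hr.2 hn

/-- A ray that enters the expanding disc about `∞` during a fundamental interval stays there. -/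
lemma ray_stays {g : C(Sphere, Sphere)} {m : ℕ} (hm : 2 ≤ m) {R c s : ℝ} (hc : 1 < c) (hs : 0 < s)
    {u : ℝ → Sphere} (hu : ContinuousOn u (Ico 0 1))
    (hgu : ∀ r ∈ Ico (0 : ℝ) 1, g (u r) = u (r ^ m))
    (hexp : ∀ t ∈ closedBall (0 : ℂ) R, c * ‖t‖ ≤ ‖locRep g ∞ ∞ t‖)
    (base : ∀ r, s ≤ r → r < 1 → r ^ m ≤ s →
      u r ∈ localParam ∞ '' ball 0 R) :
    ∀ r ∈ Ico s 1, u r ∈ localParam ∞ '' ball 0 R := by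
  have hmono : ∀ r : ℝ, 0 ≤ r → r < 1 → r ^ m ≤ r := fun r h0 h1 => pow_le_of_le_one h0 h1.le (by omega)
  have hopen : IsOpen (localParam ∞ '' ball 0 R) :=
    (isOpenEmbedding_localParam _).isOpenMap _ isOpen_ball
  have key : ∀ r ∈ Ico s 1, ∀ r' ∈ Icc s r,
      u r' ∈ localParam ∞ '' ball 0 R := by
    refine ray_induction hm hs ?_ ?_
    · intro r h1 h2 h3 r' hr'
      refine base r' hr'.1 (hr'.2.trans_lt h2) (le_trans ?_ h3)
      gcongr
      · exact hs.le.trans hr'.1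
      · exact hr'.2
    · intro r h1 h2 h3 ih
      have hsub : Icc s r ⊆ Ico 0 1 := fun x hx => ⟨hs.le.trans hx.1, hx.2.trans_lt h2⟩
      have himg : u '' Icc s r ⊆ localParam ∞ '' ball 0 R := by
        refine IsPreconnected.subset_of_closure_inter_subset
          (isPreconnected_Icc.image _ (hu.mono hsub)) hopen ?_ ?_
        · refine ⟨u s, ⟨s, ⟨le_rfl, h1⟩, rfl⟩, base s le_rfl (h1.trans_lt h2) ?_⟩
          exact hmono s hs.le (h1.trans_lt h2)
        · rintro _ ⟨hcl, r', hr', rfl⟩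
          rcases le_or_gt (r' ^ m) s with h | h
          · exact base r' hr'.1 (hr'.2.trans_lt h2) h
          · have h4 : u (r' ^ m) ∈ localParam ∞ '' ball 0 R := by
              refine ih _ ⟨h.le, ?_⟩
              gcongr
              · exact hs.le.trans hr'.1
              · exact hr'.2
            have h5 : u r' ∈ localParam ∞ '' closedBall 0 R :=
              (isCompact_image_closedBall ∞ R).isClosed.closure_subset_iff.2
                (image_mono ball_subset_closedBall) hcl
            obtain ⟨t, ht, htu⟩ := h5
            obtain ⟨t', ht', ht'u⟩ := h4
            have h6 := hexp t ht
            rw [locRep, htu, hgu r' (hsub hr'), ← ht'u, localCoord_localParam] at h6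
            refine ⟨t, ?_, htu⟩
            rw [mem_ball_zero_iff] at ht' ⊢
            nlinarith [norm_nonneg t]
      exact fun r' hr' => himg ⟨r', hr', rfl⟩
  exact fun r hr => key r hr r ⟨hr.1, le_rfl⟩

/-! ### The Newton graph of level zero and its motion -/

lemma localDegree_eq_one (hd : 3 ≤ d) (g : NewtonMap d) {z : Sphere}
    (hz : z ∉ criticalPoints g.1) : localDegree g.1 z = 1 := by
  obtain ⟨n, hn⟩ := ENat.ne_top_iff_exists.1 (localDegree_ne_top hd g z)
  have h0 := localDegree_ne_zero hd g z
  have h2 : ¬ 2 ≤ localDegree g.1 z := hz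
  rw [← hn] at h0 h2 ⊢
  have h0' : n ≠ 0 := by exact_mod_cast h0
  have h2' : ¬ 2 ≤ n := by exact_mod_cast h2
  have : n = 1 := by omega
  rw [this]; rfl

lemma localDegree_infty (hd : 3 ≤ d) (g : NewtonMap d) :
    localDegree g.1 ∞ = 1 := by
  obtain ⟨D, hD, hder⟩ := multiplier_infty hd g
  refine localDegree_eq_one hd g fun hcrit => ?_
  have hcrit : (2 : ℕ∞) ≤ analyticOrderAt (locRep g.1 ∞ (g.1 ∞)) 0 := hcrit
  rw [g.map_infty] at hcrit
  have han := analyticAt_locRep_zero hd g ∞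
  rw [g.map_infty] at han
  have h0 := locRep_zero g.1 ∞
  rw [g.map_infty] at h0
  have h1 := han.analyticOrderAt_deriv_add_one
  simp only [h0, sub_zero] at h1
  rw [← h1] at hcrit
  have h2 : analyticOrderAt (deriv (locRep g.1 ∞ ∞)) 0 = 0 := by
    rw [han.deriv.analyticOrderAt_eq_zero, hder.deriv]
    have h3 : (3 : ℝ) ≤ D := by exact_mod_cast hD
    have : 0 < 1 / ((D : ℝ) - 1) := one_div_pos.2 (by linarith)
    exact_mod_cast (by linarith : 1 + 1 / ((D : ℝ) - 1) ≠ 0)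
  rw [h2] at hcrit
  exact absurd hcrit (by norm_num)

lemma finite_fixed_directions {m : ℕ} (hm : 2 ≤ m) : {ζ : ℂ | ‖ζ‖ = 1 ∧ ζ ^ m = ζ}.Finite := by
  have hp : (X ^ m - X : ℂ[X]) ≠ 0 := by
    intro h
    have := congrArg (fun p : ℂ[X] => p.eval 2) h
    simp only [eval_sub, eval_pow, eval_X, eval_zero] at this
    have h2 : (2 : ℂ) ^ m = 2 ^ 1 := by rw [pow_one]; exact sub_eq_zero.1 this
    have h3 : (2 : ℕ) ^ m = 2 ^ 1 := by exact_mod_cast h2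
    have := Nat.pow_right_injective le_rfl h3
    omega
  refine ((X ^ m - X : ℂ[X]).roots.toFinset.finite_toSet).subset ?_
  rintro ζ ⟨-, h⟩
  simp only [Finset.mem_coe, Multiset.mem_toFinset, mem_roots hp, IsRoot.def, eval_sub, eval_pow,
    eval_X, h, sub_self]

namespace BottcherSystem

/-- The pairs of a superattracting root and a direction of a fixed ray. -/
def index (B : BottcherSystem f) : Set (ℂ × ℂ) :=
  {p | p.1 ∈ B.Z ∧ (p.1 : Sphere) ∈ criticalPoints f.1 ∧ ‖p.2‖ = 1 ∧ p.2 ^ B.m p.1 = p.2}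

/-- The maps for which the system provides Böttcher coordinates. -/
def dom (B : BottcherSystem f) : Set (NewtonMap d) :=
  B.N' ∩ {g | RootsBasinPCF g.1}

/-- The fixed ray of `g` of given index. -/
def ray (B : BottcherSystem f) (p : ℂ × ℂ) (g : NewtonMap d) (r : ℝ) :
    Sphere :=
  ((B.ψ p.1 g ((r : ℂ) * p.2) : ℂ) : Sphere)

lemma finite_index (B : BottcherSystem f) : B.index.Finite := by
  classical
  refine (B.Z.finite_toSet.biUnion (t := fun a => {p : ℂ × ℂ | p ∈ B.index ∧ p.1 = a})
    fun a _ => ?_).subset fun p hp => mem_biUnion hp.1 ⟨hp, rfl⟩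
  by_cases ha : a ∈ B.Z ∧ (a : Sphere) ∈ criticalPoints f.1
  · refine ((finite_fixed_directions (B.two_le a ha.1 ha.2)).image fun ζ => (a, ζ)).subset ?_
    rintro ⟨b, ζ⟩ ⟨⟨-, -, h1, h2⟩, rfl⟩
    exact ⟨ζ, ⟨h1, h2⟩, rfl⟩
  · refine finite_empty.subset ?_
    rintro ⟨b, ζ⟩ ⟨⟨h1, h2, -⟩, rfl⟩
    exact ha ⟨h1, h2⟩

lemma mem_N (B : BottcherSystem f) {g : NewtonMap d} (hg : g ∈ B.dom) :
    g ∈ B.N := B.N'_sub hg.1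

lemma self_mem_dom (B : BottcherSystem f) (hf : RootsBasinPCF f.1) :
    f ∈ B.dom := ⟨mem_of_mem_nhds B.N'_mem, hf⟩

lemma apply_ray (B : BottcherSystem f) {g : NewtonMap d} (hg : g ∈ B.dom)
    {p : ℂ × ℂ} (hp : p ∈ B.index) {r : ℝ} (hr : r ∈ Ico (0 : ℝ) 1) :
    g.1 (B.ray p g r) = B.ray p g (r ^ B.m p.1) := by
  rw [ray, (B.bottcher p.1 hp.1 hp.2.1 g hg.1 hg.2).1.2.2 _ (ofReal_mul_mem_ball hp.2.2.1 hr),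
    mul_pow, hp.2.2.2, ray]
  simp

/-- The Newton graph of level zero consists of the fixed rays, with the same index set for all
maps near `f`. -/
lemma newtonGraphZero_eq (hd : 3 ≤ d) (B : BottcherSystem f)
    {g : NewtonMap d} (hg : g ∈ B.dom) :
    newtonGraphZero g.1 = insert ∞ (⋃ p ∈ B.index, B.ray p g '' Ico 0 1) := by
  unfold newtonGraphZero
  congr 1
  ext x
  simp only [mem_sUnion, mem_iUnion, exists_prop]
  constructor
  · rintro ⟨R, ⟨b, hb, hR, hfix⟩, hx⟩
    obtain ⟨a, ha, rfl⟩ := B.exists_of_root (B.mem_N hg) hb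
    obtain ⟨ψ', hψ', ζ', hζ', rfl⟩ := id hR
    obtain ⟨m', hm', h', h0⟩ := (isInverseBottcher_iff hd hb).1 hψ'
    have hcrit : ((B.α a g : ℂ) : Sphere) ∈ criticalPoints g.1 := by
      have hfin : g.1 ((B.α a g : ℂ) : Sphere) ≠ ∞ := by
        rw [hb.2]; exact OnePoint.coe_ne_infty _
      rw [mem_criticalPoints_iff_deriv hd g hfin]
      rw [OnePoint.coe_eq_coe] at h0
      have hz : (0 : ℂ) ∈ ball (0 : ℂ) 1 := by simp
      have h0nhds := Metric.isOpen_ball.mem_nhds hz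
      have hd1 : HasDerivAt ψ' (deriv ψ' 0) 0 := (h'.1.differentiableAt h0nhds).hasDerivAt
      have hd2 : HasDerivAt (finRep g.1) (deriv (finRep g.1) (B.α a g)) (ψ' 0) := by
        rw [h0]; exact (analyticAt_finRep hd g hfin).differentiableAt.hasDerivAt
      have hd3 : HasDerivAt (fun w => finRep g.1 (ψ' w)) _ 0 := hd2.comp 0 hd1
      have hd4 : HasDerivAt (fun w => ψ' (w ^ m')) (deriv ψ' 0 * 0) 0 := by
        have h5 : HasDerivAt (fun w : ℂ => w ^ m') 0 0 := by
          have := hasDerivAt_pow m' (0 : ℂ)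
          rwa [zero_pow (by omega), mul_zero] at this
        have h6 : HasDerivAt ψ' (deriv ψ' 0) ((0 : ℂ) ^ m') := by rwa [zero_pow (by omega)]
        exact HasDerivAt.comp (h := fun w : ℂ => w ^ m') 0 h6 h5
      have heq : (fun w => finRep g.1 (ψ' w)) =ᶠ[𝓝 0] fun w => ψ' (w ^ m') := by
        filter_upwards [h0nhds] with w hw
        exact finRep_eq (h'.2.2 w hw)
      have := hd3.unique (hd4.congr_of_eventuallyEq heq)
      rw [mul_zero] at this
      exact (mul_eq_zero.1 this).resolve_right
        (deriv_ne_zero_of_injOn isOpen_ball h'.1 h'.2.1 hz)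
    have hcf := (B.crit a ha g (B.mem_N hg)).1 hcrit
    obtain ⟨hB, hB0, -⟩ := B.bottcher a ha hcf g hg.1 hg.2
    have hiff := hB.fixed_ray_iff hd (B.two_le a ha hcf) (by rwa [hB0])
      (R := (fun r : ℝ => ((ψ' ((r : ℂ) * ζ') : ℂ) : Sphere)) '' Ico 0 1)
    rw [hB0] at hiff
    obtain ⟨ζ, hζ, hζm, hζR⟩ := hiff.1 ⟨hR, hfix⟩
    rw [hζR] at hx
    exact ⟨(a, ζ), ⟨ha, hcf, hζ, hζm⟩, hx⟩
  · rintro ⟨⟨a, ζ⟩, ⟨ha, hcf, hζ, hζm⟩, hx⟩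
    obtain ⟨hB, hB0, -⟩ := B.bottcher a ha hcf g hg.1 hg.2
    have hroot := B.root_mem ha (B.mem_N hg)
    have hiff := hB.fixed_ray_iff hd (B.two_le a ha hcf) (by rwa [hB0])
      (R := radialSet (B.ψ a g) ζ)
    obtain ⟨h1, h2⟩ := hiff.2 ⟨ζ, hζ, hζm, rfl⟩
    exact ⟨_, ⟨_, by rwa [hB0], h1, h2⟩, hx⟩

lemma continuousOn_ray (B : BottcherSystem f)
    {p : ℂ × ℂ} (hp : p ∈ B.index) :
    ContinuousOn (fun q : NewtonMap d × ℝ => B.ray p q.1 q.2) (B.dom ×ˢ Ico 0 1) := by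
  refine OnePoint.continuous_coe.comp_continuousOn ?_
  exact (B.cont p.1 hp.1 hp.2.1).comp (f := fun q : NewtonMap d × ℝ => (q.1, (q.2 : ℂ) * p.2))
    (by fun_prop) fun q hq => ⟨hq.1, ofReal_mul_mem_ball hp.2.2.1 hq.2⟩

lemma tendsto_ray (hd : 3 ≤ d) (B : BottcherSystem f)
    {g : NewtonMap d} (hg : g ∈ B.dom) {p : ℂ × ℂ} (hp : p ∈ B.index) :
    Tendsto (B.ray p g) (𝓝[<] 1) (𝓝 ∞) := by
  obtain ⟨hB, hB0, -⟩ := B.bottcher p.1 hp.1 hp.2.1 g hg.1 hg.2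
  exact B.toRootTracking.tendsto_ray hd hp.1 (B.mem_N hg) (B.two_le _ hp.1 hp.2.1) hB hB0
    hp.2.2.1 hp.2.2.2

lemma continuousOn_ray_of_mem (B : BottcherSystem f)
    {g : NewtonMap d} (hg : g ∈ B.dom) {p : ℂ × ℂ} (hp : p ∈ B.index) :
    ContinuousOn (B.ray p g) (Ico 0 1) :=
  (B.continuousOn_ray hp).comp (f := fun r : ℝ => (g, r)) (by fun_prop) fun r hr => ⟨hg, hr⟩

/-- A fixed ray with its landing point is a compact connected set. -/
lemma isCompact_isPreconnected_insert_ray (hd : 3 ≤ d)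
    (B : BottcherSystem f) {g : NewtonMap d} (hg : g ∈ B.dom) {p : ℂ × ℂ} (hp : p ∈ B.index) :
    IsCompact (insert ∞ (B.ray p g '' Ico 0 1)) ∧
      IsPreconnected (insert ∞ (B.ray p g '' Ico 0 1)) := by
  classical
  have himg : Function.update (B.ray p g) 1 ∞ '' Icc 0 1 =
      insert ∞ (B.ray p g '' Ico 0 1) := by
    rw [← Ico_insert_right (zero_le_one (α := ℝ)), image_insert_eq, Function.update_self]
    congr 1
    refine image_congr fun r hr => ?_
    rw [Function.update_of_ne hr.2.ne]
  have hc : ContinuousOn (Function.update (B.ray p g) 1 ∞) (Icc 0 1) := by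
    rw [continuousOn_update_iff]
    refine ⟨(B.continuousOn_ray_of_mem hg hp).mono ?_, fun _ => ?_⟩
    · rintro r ⟨hr, hr1⟩
      exact ⟨hr.1, lt_of_le_of_ne hr.2 hr1⟩
    · refine (B.tendsto_ray hd hg hp).mono_left (nhdsWithin_mono _ ?_)
      rintro r ⟨hr, hr1⟩
      exact lt_of_le_of_ne hr.2 hr1
  rw [← himg]
  exact ⟨isCompact_Icc.image_of_continuousOn hc, isPreconnected_Icc.image _ hc⟩

lemma newtonGraphZero_eq_biUnion (hd : 3 ≤ d) (B : BottcherSystem f)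
    {g : NewtonMap d} (hg : g ∈ B.dom) :
    newtonGraphZero g.1 = {∞} ∪
      ⋃ p ∈ B.index, insert ∞ (B.ray p g '' Ico 0 1) := by
  rw [B.newtonGraphZero_eq hd hg]
  ext x
  simp only [mem_insert_iff, mem_iUnion, mem_union, mem_singleton_iff, exists_prop]
  constructor
  · rintro (h | ⟨p, hp, h⟩)
    · exact Or.inl h
    · exact Or.inr ⟨p, hp, Or.inr h⟩
  · rintro (h | ⟨p, hp, h | h⟩)
    · exact Or.inl h
    · exact Or.inl h
    · exact Or.inr ⟨p, hp, h⟩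

lemma isCompact_newtonGraphZero (hd : 3 ≤ d) (B : BottcherSystem f)
    {g : NewtonMap d} (hg : g ∈ B.dom) : IsCompact (newtonGraphZero g.1) := by
  rw [B.newtonGraphZero_eq_biUnion hd hg]
  exact isCompact_singleton.union (B.finite_index.isCompact_biUnion fun p hp =>
    (B.isCompact_isPreconnected_insert_ray hd hg hp).1)

lemma isPreconnected_newtonGraphZero (hd : 3 ≤ d) (B : BottcherSystem f)
    {g : NewtonMap d} (hg : g ∈ B.dom) : IsPreconnected (newtonGraphZero g.1) := by
  rw [B.newtonGraphZero_eq_biUnion hd hg, biUnion_eq_iUnion, ← sUnion_range, ← sUnion_insert]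
  refine isPreconnected_sUnion ∞ _ ?_ ?_
  · rintro s (rfl | ⟨p, rfl⟩)
    · rfl
    · exact mem_insert _ _
  · rintro s (rfl | ⟨p, rfl⟩)
    · exact isPreconnected_singleton
    · exact (B.isCompact_isPreconnected_insert_ray hd hg p.2).2

end BottcherSystem

lemma image_ball_mem_nhds (z : Sphere) {r : ℝ} (hr : 0 < r) :
    localParam z '' ball 0 r ∈ 𝓝 z := by
  rw [nhds_eq_map_localParam]
  exact Filter.image_mem_map (ball_mem_nhds 0 hr)

lemma exists_image_ball_subset {z : Sphere} {W : Set Sphere} (hW : W ∈ 𝓝 z) {R₀ : ℝ} (hR₀ : 0 < R₀) :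
    ∃ R > 0, R ≤ R₀ ∧ localParam z '' ball 0 R ⊆ W := by
  rw [nhds_eq_map_localParam, Filter.mem_map] at hW
  obtain ⟨R, hR, hRW⟩ := Metric.mem_nhds_iff.1 hW
  exact ⟨min R R₀, lt_min hR hR₀, min_le_right _ _,
    image_subset_iff.2 ((ball_subset_ball (min_le_left _ _)).trans hRW)⟩

/-- The points of `[s, 1)` whose `m`-th power is at most `s`. -/
def fundInterval (m : ℕ) (s : ℝ) : Set ℝ := {r | s ≤ r ∧ r ≤ 1 ∧ r ^ m ≤ s}

lemma isCompact_fundInterval (m : ℕ) (s : ℝ) : IsCompact (fundInterval m s) := by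
  have h : fundInterval m s = Icc s 1 ∩ {r | r ^ m ≤ s} := by
    ext r; simp only [fundInterval, mem_inter_iff, mem_Icc, mem_ofPred_eq, and_assoc]
  rw [h]
  exact isCompact_Icc.inter_right (isClosed_le (by fun_prop) continuous_const)

lemma fundInterval_subset {m : ℕ} {s : ℝ} (hs1 : s < 1) :
    fundInterval m s ⊆ Ico s 1 := by
  rintro r ⟨h1, h2, h3⟩
  refine ⟨h1, lt_of_le_of_ne h2 ?_⟩
  rintro rfl
  rw [one_pow] at h3
  linarith

/-- One step of the comparison of two orbits near a repelling fixed point of multiplier `μ`: going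
back from `x', y'` to `x, y` changes the deviation of the ratio from `1` by a factor close to `1`.
The factors of successive steps have a convergent product since `‖x‖` and `‖y‖` decrease
geometrically along backward orbits. -/
lemma abs_ratio_step {x y x' y' μ : ℂ} {c C : ℝ} (hx : x ≠ 0) (hy : y ≠ 0) (hc : 1 < c)
    (hx' : ‖x' - μ * x‖ ≤ C * ‖x‖ ^ 2) (hy' : ‖y' - μ * y‖ ≤ C * ‖y‖ ^ 2)
    (hxc : c * ‖x‖ ≤ ‖x'‖) (hyc : c * ‖y‖ ≤ ‖y'‖) :
    1 + ‖y / x - 1‖ ≤ (1 + ‖y' / x' - 1‖) * (1 + C * (‖x‖ + ‖y‖)) := by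
  have hxp : 0 < ‖x‖ := norm_pos_iff.2 hx
  have hyp : 0 < ‖y‖ := norm_pos_iff.2 hy
  have hx'p : 0 < ‖x'‖ := by nlinarith
  have hy'p : 0 < ‖y'‖ := by nlinarith
  have hx'0 : x' ≠ 0 := norm_pos_iff.1 hx'p
  have hy'0 : y' ≠ 0 := norm_pos_iff.1 hy'p
  have e1 : ‖x' / x - μ‖ ≤ C * ‖x‖ := by
    have : x' / x - μ = (x' - μ * x) / x := by field_simp
    rw [this, norm_div, div_le_iff₀ hxp]
    linarith
  have e2 : ‖y' / y - μ‖ ≤ C * ‖y‖ := by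
    have : y' / y - μ = (y' - μ * y) / y := by field_simp
    rw [this, norm_div, div_le_iff₀ hyp]
    linarith
  have e3 : 1 ≤ ‖y' / y‖ := by
    rw [norm_div, le_div_iff₀ hyp]
    nlinarith
  set θ : ℂ := (x' / x - y' / y) / (y' / y) with hθ
  have hθn : ‖θ‖ ≤ C * (‖x‖ + ‖y‖) := by
    rw [hθ, norm_div]
    refine (div_le_self (norm_nonneg _) e3).trans ?_
    calc ‖x' / x - y' / y‖ = ‖(x' / x - μ) - (y' / y - μ)‖ := by ring_nf
      _ ≤ ‖x' / x - μ‖ + ‖y' / y - μ‖ := norm_sub_le _ _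
      _ ≤ C * (‖x‖ + ‖y‖) := by linarith
  have e4 : y / x - 1 = (y' / x' - 1) * (1 + θ) + θ := by
    rw [hθ]
    field_simp
    ring
  have e5 : ‖y / x - 1‖ ≤ ‖y' / x' - 1‖ * (1 + ‖θ‖) + ‖θ‖ := by
    rw [e4]
    refine (norm_add_le _ _).trans ?_
    rw [norm_mul]
    gcongr
    refine (norm_add_le _ _).trans ?_
    rw [norm_one]
  nlinarith [norm_nonneg (y' / x' - 1), norm_nonneg θ]

namespace BottcherSystem

lemma ray_ne_infty (B : BottcherSystem f) (p : ℂ × ℂ) (g : NewtonMap d)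
    (r : ℝ) : B.ray p g r ≠ ∞ := OnePoint.coe_ne_infty _

/-- The fixed rays land at `∞` locally uniformly with respect to the map. -/
lemma eventually_ray_mem (hd : 3 ≤ d) (B : BottcherSystem f)
    {g₀ : NewtonMap d} (hg₀ : g₀ ∈ B.dom) {p : ℂ × ℂ} (hp : p ∈ B.index) {W : Set Sphere}
    (hW : W ∈ 𝓝 ∞) :
    ∃ s : ℝ, 0 < s ∧ s < 1 ∧ ∀ᶠ g in 𝓝[B.dom] g₀, ∀ r ∈ Ico s 1, B.ray p g r ∈ W := by
  obtain ⟨R₀, c, C, μ, hR₀, hc, hC, hrep⟩ := exists_repelling hd g₀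
  obtain ⟨R, hR, hRR₀, hRW⟩ := exists_image_ball_subset hW hR₀
  have hm := B.two_le p.1 hp.1 hp.2.1
  obtain ⟨s, hs1, hs⟩ := (mem_nhdsLT_iff_exists_mem_Ico_Ioo_subset (zero_lt_one (α := ℝ))).1
    ((B.tendsto_ray hd hg₀ hp).eventually (image_ball_mem_nhds _ hR))
  set s' := (s + 1) / 2 with hs'
  have hss' : s < s' := by rw [hs']; linarith [hs1.2]
  have hs'1 : s' < 1 := by rw [hs']; linarith [hs1.2]
  have hs'0 : 0 < s' := hs1.1.trans_lt hss'
  refine ⟨s', hs'0, hs'1, ?_⟩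
  have hsub : fundInterval (B.m p.1) s' ⊆ Ico 0 1 := fun r hr =>
    ⟨hs'0.le.trans hr.1, (fundInterval_subset hs'1 hr).2⟩
  have hopen : IsOpen (localParam ∞ '' ball 0 R) :=
    (isOpenEmbedding_localParam _).isOpenMap _ isOpen_ball
  have hbase : ∀ᶠ g in 𝓝[B.dom] g₀, ∀ r ∈ fundInterval (B.m p.1) s',
      B.ray p g r ∈ localParam ∞ '' ball 0 R := by
    refine eventually_forall_compact (isCompact_fundInterval _ _) fun r hr => ?_
    have h1 := ((B.continuousOn_ray hp).mono (prod_mono_right hsub)) (g₀, r) ⟨hg₀, hr⟩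
    rw [ContinuousWithinAt, nhdsWithin_prod_eq] at h1
    refine h1.eventually (hopen.mem_nhds (hs ⟨hss'.trans_le hr.1, ?_⟩))
    exact (fundInterval_subset hs'1 hr).2
  filter_upwards [hbase, hrep.filter_mono nhdsWithin_le_nhds, self_mem_nhdsWithin]
    with g hg hgrep hgd r hr
  refine hRW (ray_stays hm hc hs'0 (B.continuousOn_ray_of_mem hgd hp)
    (fun r hr => B.apply_ray hgd hp hr)
    (fun t ht => (hgrep t (Metric.closedBall_subset_closedBall hRR₀ ht)).2.1)
    (fun r h1 h2 h3 => hg r ⟨h1, h2.le, h3⟩) r hr)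

/-- Near `∞` the ratio of corresponding points on fixed rays is close to `1`: it is so on a
fundamental interval, and the common multiplier at `∞` makes the deviation grow by a convergent
product. -/
lemma eventually_ray_ratio (hd : 3 ≤ d) (B : BottcherSystem f)
    (hf : f ∈ B.dom) {p : ℂ × ℂ} (hp : p ∈ B.index) {ε : ℝ} (hε : 0 < ε) :
    ∃ s : ℝ, 0 < s ∧ s < 1 ∧ ∀ᶠ g in 𝓝[B.dom] f, ∀ r ∈ Ico s 1,
      ‖localCoord ∞ (B.ray p g r) - localCoord ∞ (B.ray p f r)‖ ≤
        ε * ‖localCoord ∞ (B.ray p f r)‖ := by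
  wlog hε1 : ε ≤ 1 generalizing ε
  · obtain ⟨s, h1, h2, h3⟩ := this one_pos le_rfl
    refine ⟨s, h1, h2, h3.mono fun g hg r hr => (hg r hr).trans ?_⟩
    gcongr
    exact (not_le.1 hε1).le
  obtain ⟨R₀, c, C, μ, hR₀, hc, hC, hrep⟩ := exists_repelling hd f
  have hm := B.two_le p.1 hp.1 hp.2.1
  set K := C / (c - 1) with hK
  have hK0 : 0 ≤ K := div_nonneg hC (by linarith)
  have hKc : K * (c - 1) = C := div_mul_cancel₀ _ (by linarith)
  obtain ⟨R, hR, hRR₀, hRε⟩ : ∃ R > 0, R ≤ R₀ ∧ Real.exp (K * (2 * R)) ≤ 1 + ε / 3 := by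
    have h1 : Tendsto (fun R : ℝ => Real.exp (K * (2 * R))) (𝓝[>] 0) (𝓝 1) := by
      have h2 : Continuous fun R : ℝ => Real.exp (K * (2 * R)) := by fun_prop
      have := (h2.tendsto 0).mono_left (nhdsWithin_le_nhds (s := Ioi 0))
      simpa using this
    obtain ⟨R, ⟨h2, h3⟩, h5⟩ := (((h1.eventually (ge_mem_nhds (by linarith : 1 < 1 + ε / 3))).and
      (self_mem_nhdsWithin)).and ((eventually_le_nhds hR₀).filter_mono nhdsWithin_le_nhds)).exists
    exact ⟨R, h3, h5, h2⟩
  obtain ⟨s, hs0, hs1, hland⟩ := B.eventually_ray_mem hd hf hp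
    (image_ball_mem_nhds ∞ hR)
  refine ⟨s, hs0, hs1, ?_⟩
  set τ : NewtonMap d → ℝ → ℂ := fun g r => localCoord ∞ (B.ray p g r) with hτ
  have hlandf := hland.self_of_nhdsWithin hf
  have hdom : ∀ {x : Sphere}, x ∈ localParam ∞ '' ball 0 R →
      x ∈ chartDom ∞ := by
    rintro _ ⟨t, -, rfl⟩; exact mem_chartDom_localParam _ t
  have hball : ∀ {x : Sphere}, x ∈ localParam ∞ '' ball 0 R →
      ‖localCoord ∞ x‖ < R := by
    rintro _ ⟨t, ht, rfl⟩; rw [localCoord_localParam]; exact mem_ball_zero_iff.1 ht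
  have hτne : ∀ {g : NewtonMap d} {r : ℝ},
      B.ray p g r ∈ localParam ∞ '' ball 0 R → τ g r ≠ 0 := by
    intro g r h h0
    exact B.ray_ne_infty p g r ((localCoord_eq_zero_iff (hdom h)).1 h0)
  have hsub : fundInterval (B.m p.1) s ⊆ Ico 0 1 := fun r hr =>
    ⟨hs0.le.trans hr.1, (fundInterval_subset hs1 hr).2⟩
  have hbase : ∀ᶠ g in 𝓝[B.dom] f, ∀ r ∈ fundInterval (B.m p.1) s,
      ‖τ g r / τ f r - 1‖ ≤ ε / 3 := by
    refine eventually_forall_compact (isCompact_fundInterval _ _) fun r hr => ?_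
    have hrI := fundInterval_subset hs1 hr
    have hfr := hlandf r hrI
    have h1 := ((B.continuousOn_ray hp).mono (prod_mono_right hsub)) (f, r) ⟨hf, hr⟩
    have h2 : ContinuousWithinAt (fun q : NewtonMap d × ℝ => τ q.1 q.2)
        (B.dom ×ˢ fundInterval (B.m p.1) s) (f, r) :=
      ContinuousAt.comp_continuousWithinAt (f := fun q : NewtonMap d × ℝ => B.ray p q.1 q.2)
        (continuousAt_localCoord (hdom hfr)) h1
    have h3 : ContinuousWithinAt (fun q : NewtonMap d × ℝ => τ f q.2)
        (B.dom ×ˢ fundInterval (B.m p.1) s) (f, r) := by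
      refine ContinuousAt.comp_continuousWithinAt (f := fun q : NewtonMap d × ℝ => B.ray p f q.2)
        (continuousAt_localCoord (hdom hfr)) ?_
      exact ((B.continuousOn_ray_of_mem hf hp).mono hsub r hr).comp
        (f := fun q : NewtonMap d × ℝ => q.2) (x := (f, r)) (by fun_prop) fun q hq => hq.2
    have h4 := ((h2.div h3 (hτne hfr)).sub (continuousWithinAt_const (b := (1 : ℂ)))).norm
    rw [ContinuousWithinAt, nhdsWithin_prod_eq] at h4
    have h5 : Tendsto (fun q : NewtonMap d × ℝ => ‖τ q.1 q.2 / τ f q.2 - 1‖)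
        (𝓝[B.dom] f ×ˢ 𝓝[fundInterval (B.m p.1) s] r) (𝓝 ‖τ f r / τ f r - 1‖) := h4
    rw [div_self (hτne hfr), sub_self, norm_zero] at h5
    exact h5.eventually (ge_mem_nhds (by positivity : 0 < ε / 3))
  have hrepf := hrep.self_of_nhds
  filter_upwards [hbase, hland, hrep.filter_mono nhdsWithin_le_nhds, self_mem_nhdsWithin]
    with g hg hgl hgrep hgd
  have hexp : ∀ r ∈ Ico s 1, 0 ≤ K * (2 * R - ‖τ f r‖ - ‖τ g r‖) := fun r hr =>
    mul_nonneg hK0 (by have := hball (hlandf r hr); have := hball (hgl r hr); simp only [hτ]; linarith)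
  have hstep : ∀ {g' : NewtonMap d}, g' ∈ B.dom → (∀ r ∈ Ico s 1,
      B.ray p g' r ∈ localParam ∞ '' ball 0 R) → ∀ r ∈ Ico s 1,
      locRep g'.1 ∞ ∞ (τ g' r) = τ g' (r ^ B.m p.1) := by
    intro g' hg' hl r hr
    rw [locRep, hτ]
    simp only
    rw [localParam_localCoord (hdom (hl r hr)), B.apply_ray hg' hp ⟨hs0.le.trans hr.1, hr.2⟩]
  have hmem : ∀ {g' : NewtonMap d}, (∀ r ∈ Ico s 1,
      B.ray p g' r ∈ localParam ∞ '' ball 0 R) → ∀ r ∈ Ico s 1,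
      τ g' r ∈ closedBall (0 : ℂ) R₀ := by
    intro g' hl r hr
    rw [mem_closedBall_zero_iff]
    exact (hball (hl r hr)).le.trans hRR₀
  have key : ∀ r ∈ Ico s 1, 1 + ‖τ g r / τ f r - 1‖ ≤
      (1 + ε / 3) * Real.exp (K * (2 * R - ‖τ f r‖ - ‖τ g r‖)) := by
    refine ray_induction (P := fun r => 1 + ‖τ g r / τ f r - 1‖ ≤
      (1 + ε / 3) * Real.exp (K * (2 * R - ‖τ f r‖ - ‖τ g r‖))) hm hs0 ?_ ?_
    · intro r h1 h2 h3
      have h4 := hg r ⟨h1, h2.le, h3⟩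
      have h5 := Real.one_le_exp (hexp r ⟨h1, h2⟩)
      nlinarith
    · intro r h1 h2 h3 ih
      have hr : r ∈ Ico s 1 := ⟨h1, h2⟩
      have hF := hrepf (τ f r) (hmem hlandf r hr)
      have hG := hgrep (τ g r) (hmem hgl r hr)
      rw [hstep hf hlandf r hr] at hF
      rw [hstep hgd hgl r hr] at hG
      have h4 := abs_ratio_step (hτne (hlandf r hr)) (hτne (hgl r hr)) hc hF.2.2 hG.2.2
        hF.2.1 hG.2.1
      have h5 : 1 + C * (‖τ f r‖ + ‖τ g r‖) ≤ Real.exp (C * (‖τ f r‖ + ‖τ g r‖)) := by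
        have := Real.add_one_le_exp (C * (‖τ f r‖ + ‖τ g r‖))
        linarith
      calc 1 + ‖τ g r / τ f r - 1‖ ≤ _ := h4
        _ ≤ ((1 + ε / 3) * Real.exp (K * (2 * R - ‖τ f (r ^ B.m p.1)‖ - ‖τ g (r ^ B.m p.1)‖))) *
            Real.exp (C * (‖τ f r‖ + ‖τ g r‖)) := by gcongr
        _ = (1 + ε / 3) * Real.exp (K * (2 * R - ‖τ f (r ^ B.m p.1)‖ - ‖τ g (r ^ B.m p.1)‖) +
            C * (‖τ f r‖ + ‖τ g r‖)) := by rw [mul_assoc, ← Real.exp_add]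
        _ ≤ _ := by
          gcongr
          have e1 := mul_le_mul_of_nonneg_left hF.2.1 hK0
          have e2 := mul_le_mul_of_nonneg_left hG.2.1 hK0
          rw [← hKc]
          nlinarith
  intro r hr
  have h1 := key r hr
  have hx := hτne (hlandf r hr)
  have h2 : Real.exp (K * (2 * R - ‖τ f r‖ - ‖τ g r‖)) ≤ 1 + ε / 3 := by
    refine le_trans ?_ hRε
    gcongr
    linarith [norm_nonneg (τ f r), norm_nonneg (τ g r)]
  have h3 : ‖τ g r / τ f r - 1‖ ≤ ε := by nlinarith
  have h4 : τ g r - τ f r = (τ g r / τ f r - 1) * τ f r := by field_simp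
  change ‖τ g r - τ f r‖ ≤ ε * ‖τ f r‖
  rw [h4, norm_mul]
  gcongr

end BottcherSystem

/-- A motion of the compact forward invariant set `X`, equivariant for the maps in `𝒢`. Besides
continuity and injectivity it records that the motion is asymptotically a translation in the local
coordinate at each point as the map tends to `f`, and that local degrees persist; these make it
possible to lift the motion to the preimage of `X`. -/
structure GraphMotion (f : NewtonMap d) (X : Set Sphere) (𝒢 : Set (NewtonMap d))
    (H : NewtonMap d → Sphere → Sphere) : Prop where
  closed : IsClosed X
  mem : f ∈ 𝒢
  infty_mem : ∞ ∈ X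
  maps : MapsTo f.1 X X
  cont : ContinuousOn (Function.uncurry H) (𝒢 ×ˢ X)
  base : ∀ z ∈ X, H f z = z
  infty : ∀ g ∈ 𝒢, H g ∞ = ∞
  inj : ∀ g ∈ 𝒢, InjOn (H g) X
  equiv : ∀ g ∈ 𝒢, ∀ z ∈ X, g.1 (H g z) = H g (f.1 z)
  conf : ∀ v ∈ X, ∀ ε > 0, ∀ᶠ q : NewtonMap d × Sphere in 𝓝[𝒢] f ×ˢ 𝓝[X] v,
    ‖localCoord v (H q.1 q.2) - localCoord v (H q.1 v) - localCoord v q.2‖ ≤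
      ε * ‖localCoord v q.2‖
  deg : ∀ v ∈ X, ∀ᶠ g in 𝓝[𝒢] f, localDegree g.1 (H g v) = localDegree f.1 v

variable {X : Set Sphere} {𝒢 : Set (NewtonMap d)} {H : NewtonMap d → Sphere → Sphere}

namespace BottcherSystem

lemma ψ_inj (B : BottcherSystem f) {g : NewtonMap d} (hg : g ∈ B.dom)
    {a a' : ℂ} (ha : a ∈ B.Z) (hc : (a : Sphere) ∈ criticalPoints f.1) (ha' : a' ∈ B.Z)
    (hc' : (a' : Sphere) ∈ criticalPoints f.1) {w w' : ℂ} (hw : w ∈ ball (0 : ℂ) 1)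
    (hw' : w' ∈ ball (0 : ℂ) 1) (h : B.ψ a g w = B.ψ a' g w') : a = a' ∧ w = w' := by
  obtain ⟨hB, h0, -⟩ := B.bottcher a ha hc g hg.1 hg.2
  obtain ⟨hB', h0', -⟩ := B.bottcher a' ha' hc' g hg.1 hg.2
  have h1 := hB.tendsto (B.two_le a ha hc) le_rfl hw
  have h2 := hB'.tendsto (B.two_le a' ha' hc') le_rfl hw'
  rw [h] at h1
  have h3 := OnePoint.coe_injective (tendsto_nhds_unique h1 h2)
  rw [h0, h0'] at h3
  obtain rfl := B.α_inj ha ha' (B.mem_N hg) h3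
  exact ⟨rfl, hB.2.1 hw hw' h⟩

open Classical in
/-- The motion matching points with equal Böttcher coordinates. -/
noncomputable def motionZero (B : BottcherSystem f) (g : NewtonMap d)
    (z : Sphere) : Sphere :=
  if h : ∃ q : ℂ × ℂ, q.1 ∈ B.Z ∧ (q.1 : Sphere) ∈ criticalPoints f.1 ∧
      q.2 ∈ ball (0 : ℂ) 1 ∧ z = ((B.ψ q.1 f q.2 : ℂ) : Sphere)
  then ((B.ψ h.choose.1 g h.choose.2 : ℂ) : Sphere) else ∞

lemma motionZero_infty (B : BottcherSystem f) (g : NewtonMap d) :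
    B.motionZero g ∞ = ∞ := by
  rw [motionZero, dif_neg]
  rintro ⟨q, -, -, -, h⟩
  exact OnePoint.infty_ne_coe _ h

lemma motionZero_apply (B : BottcherSystem f) (hf : f ∈ B.dom)
    (g : NewtonMap d) {a : ℂ} (ha : a ∈ B.Z) (hc : (a : Sphere) ∈ criticalPoints f.1) {w : ℂ}
    (hw : w ∈ ball (0 : ℂ) 1) :
    B.motionZero g ((B.ψ a f w : ℂ) : Sphere) = ((B.ψ a g w : ℂ) : Sphere) := by
  have h : ∃ q : ℂ × ℂ, q.1 ∈ B.Z ∧ (q.1 : Sphere) ∈ criticalPoints f.1 ∧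
      q.2 ∈ ball (0 : ℂ) 1 ∧ ((B.ψ a f w : ℂ) : Sphere) = ((B.ψ q.1 f q.2 : ℂ) : Sphere) :=
    ⟨(a, w), ha, hc, hw, rfl⟩
  rw [motionZero, dif_pos h]
  obtain ⟨h1, h2, h3, h4⟩ := h.choose_spec
  obtain ⟨e1, e2⟩ := B.ψ_inj hf ha hc h1 h2 hw h3 (OnePoint.coe_injective h4)
  rw [← e1, ← e2]

lemma motionZero_ray (B : BottcherSystem f) (hf : f ∈ B.dom)
    (g : NewtonMap d) {p : ℂ × ℂ} (hp : p ∈ B.index) {r : ℝ} (hr : r ∈ Ico (0 : ℝ) 1) :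
    B.motionZero g (B.ray p f r) = B.ray p g r :=
  B.motionZero_apply hf g hp.1 hp.2.1 (ofReal_mul_mem_ball hp.2.2.1 hr)

/-- In the immediate basin of a superattracting root the motion is `ψ_g ∘ ψ_f⁻¹`. -/
lemma exists_motionZero_eq (B : BottcherSystem f) (hf : f ∈ B.dom)
    {a : ℂ} (ha : a ∈ B.Z) (hc : (a : Sphere) ∈ criticalPoints f.1) :
    ∃ (U : Set ℂ) (F : NewtonMap d → ℂ → ℂ), IsOpen U ∧
      (∀ w ∈ ball (0 : ℂ) 1, B.ψ a f w ∈ U) ∧ (∀ x ∈ U, F f x = x) ∧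
      (∀ g ∈ B.dom, DifferentiableOn ℂ (F g) U) ∧
      ContinuousOn (Function.uncurry F) (B.dom ×ˢ U) ∧
      ∀ g, ∀ x ∈ U, B.motionZero g (x : Sphere) = (F g x : Sphere) := by
  obtain ⟨hB, h0, -⟩ := B.bottcher a ha hc f hf.1 hf.2
  set U := B.ψ a f '' ball 0 1 with hU
  have hUo : IsOpen U := isOpen_image_of_injOn isOpen_ball hB.1 hB.2.1 isOpen_ball
    Subset.rfl
  obtain ⟨σ, hσd, hσm, hσ⟩ := exists_holomorphic_factor (F₁ := id) hUo isOpen_ball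
    differentiableOn_id hB.1 hB.2.1 (by rw [image_id])
  refine ⟨U, fun g x => B.ψ a g (σ x), hUo, fun w hw => ⟨w, hw, rfl⟩, hσ, fun g hg => ?_, ?_, ?_⟩
  · exact (B.bottcher a ha hc g hg.1 hg.2).1.1.comp hσd hσm
  · refine (B.cont a ha hc).comp (f := fun q : NewtonMap d × ℂ => (q.1, σ q.2)) ?_
      fun q hq => ⟨hq.1, hσm hq.2⟩
    exact continuousOn_fst.prodMk (hσd.continuousOn.comp continuousOn_snd fun q hq => hq.2)
  · intro g x hx
    have := B.motionZero_apply hf g ha hc (hσm hx)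
    rwa [hσ x hx] at this

/-- Points of the level zero graph near `∞` lie far out on the rays. -/
lemma eventually_far (hd : 3 ≤ d) (B : BottcherSystem f)
    (hf : f ∈ B.dom) {s : ℂ × ℂ → ℝ} (hs : ∀ p ∈ B.index, s p < 1) :
    ∀ᶠ z in 𝓝[newtonGraphZero f.1] ∞, z = ∞ ∨
      ∃ p ∈ B.index, ∃ r ∈ Ico (s p) 1, 0 ≤ r ∧ z = B.ray p f r := by
  have h1 : ∀ p ∈ B.index, ∀ᶠ z in 𝓝 ∞, z ∉ B.ray p f '' Icc 0 (s p) := by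
    intro p hp
    have hc : IsCompact (B.ray p f '' Icc 0 (s p)) :=
      isCompact_Icc.image_of_continuousOn ((B.continuousOn_ray_of_mem hf hp).mono
        fun r hr => ⟨hr.1, hr.2.trans_lt (hs p hp)⟩)
    refine hc.isClosed.isOpen_compl.mem_nhds ?_
    rintro ⟨r, -, hr⟩
    exact B.ray_ne_infty p f r hr
  have h2 := (B.finite_index.eventually_all).2 h1
  filter_upwards [h2.filter_mono nhdsWithin_le_nhds, self_mem_nhdsWithin] with z hz hzX
  rw [B.newtonGraphZero_eq hd hf] at hzX
  rcases hzX with h | h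
  · exact Or.inl h
  · right
    simp only [mem_iUnion] at h
    obtain ⟨p, hp, r, hr, rfl⟩ := h
    refine ⟨p, hp, r, ⟨?_, hr.2⟩, hr.1, rfl⟩
    by_contra hcon
    exact hz p hp ⟨r, ⟨hr.1, (not_le.1 hcon).le⟩, rfl⟩

/-- Continuity at `∞` is the uniform landing of the fixed rays; elsewhere it is the continuity of the
Böttcher coordinates in the map. -/
lemma continuousOn_motionZero (hd : 3 ≤ d) (B : BottcherSystem f)
    (hf : f ∈ B.dom) :
    ContinuousOn (Function.uncurry B.motionZero) (B.dom ×ˢ newtonGraphZero f.1) := by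
  rintro ⟨g₀, z₀⟩ ⟨hg₀, hz₀⟩
  simp only at hg₀ hz₀
  rw [B.newtonGraphZero_eq hd hf] at hz₀
  rcases hz₀ with rfl | h
  · rw [ContinuousWithinAt, nhdsWithin_prod_eq]
    simp only [Function.uncurry_apply_pair, B.motionZero_infty]
    intro W hW
    have hex : ∀ p : ℂ × ℂ, ∃ s : ℝ, p ∈ B.index → 0 < s ∧ s < 1 ∧
        ∀ᶠ g in 𝓝[B.dom] g₀, ∀ r ∈ Ico s 1, B.ray p g r ∈ W := by
      intro p
      by_cases hp : p ∈ B.index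
      · obtain ⟨s, hs⟩ := B.eventually_ray_mem hd hg₀ hp hW
        exact ⟨s, fun _ => hs⟩
      · exact ⟨0, fun h => absurd h hp⟩
    choose s hs using hex
    have h1 := (B.finite_index.eventually_all).2 fun p hp => (hs p hp).2.2
    rw [Filter.mem_map]
    filter_upwards [h1.prod_inl _, (B.eventually_far hd hf (s := s)
      fun p hp => (hs p hp).2.1).prod_inr _] with q hq1 hq2
    rw [mem_preimage, Function.uncurry]
    rcases hq2 with h | ⟨p, hp, r, hr, hr0, h⟩
    · rw [h, B.motionZero_infty]
      exact mem_of_mem_nhds hW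
    · rw [h, B.motionZero_ray hf _ hp ⟨hr0, hr.2⟩]
      exact hq1 p hp r hr
  · simp only [mem_iUnion] at h
    obtain ⟨p, hp, r, hr, rfl⟩ := h
    obtain ⟨U, F, hU, hψU, -, -, hFc, hF⟩ := B.exists_motionZero_eq hf hp.1 hp.2.1
    have hx := hψU _ (ofReal_mul_mem_ball hp.2.2.1 hr)
    set x := B.ψ p.1 f ((r : ℂ) * p.2) with hxdef
    have hray : B.ray p f r = (x : Sphere) := rfl
    rw [hray]
    have hUs : ∀ᶠ z in 𝓝 (x : Sphere), z ∈ ((↑) : ℂ → Sphere) '' U :=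
      ((OnePoint.isOpenEmbedding_coe (X := ℂ)).isOpenMap _ hU).mem_nhds ⟨x, hx, rfl⟩
    -- read the motion in the affine coordinate
    have h1 : ContinuousWithinAt (fun q : NewtonMap d × Sphere =>
        ((F q.1 (localCoord ((0 : ℂ) : Sphere) q.2) : ℂ) : Sphere))
        (B.dom ×ˢ (((↑) : ℂ → Sphere) '' U)) (g₀, (x : Sphere)) := by
      refine OnePoint.continuous_coe.continuousAt.comp_continuousWithinAt ?_
      refine ContinuousWithinAt.comp (g := Function.uncurry F)
        (f := fun q : NewtonMap d × Sphere => (q.1, localCoord ((0 : ℂ) : Sphere) q.2))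
        (t := B.dom ×ˢ U) ?_ ?_ ?_
      · have := hFc (g₀, x) ⟨hg₀, hx⟩
        simpa using this
      · refine continuousWithinAt_fst.prodMk ?_
        exact ((continuousAt_localCoord (by simp)).comp
          (f := fun q : NewtonMap d × Sphere => q.2) (x := (g₀, (x : Sphere)))
          continuousAt_snd).continuousWithinAt
      · rintro ⟨g, _⟩ ⟨hg, y, hy, rfl⟩
        exact ⟨hg, by simpa using hy⟩
    rw [ContinuousWithinAt, nhdsWithin_prod_eq] at h1 ⊢
    have h2 : 𝓝[newtonGraphZero f.1] (x : Sphere) ≤ 𝓝[((↑) : ℂ → Sphere) '' U] (x : Sphere) :=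
      nhdsWithin_le_nhds.trans (nhdsWithin_eq_nhds.2 hUs).ge
    have h3 := h1.mono_left (Filter.prod_mono_right (𝓝[B.dom] g₀) h2)
    rw [Function.uncurry_apply_pair, hF g₀ x hx]
    have h4 : localCoord ((0 : ℂ) : Sphere) (x : Sphere) = x := by simp
    simp only [h4] at h3
    refine h3.congr' ?_
    filter_upwards [(hUs.filter_mono nhdsWithin_le_nhds).prod_inr (𝓝[B.dom] g₀)] with q hq
    obtain ⟨y, hy, hyq⟩ := hq
    rw [Function.uncurry, ← hyq, hF q.1 y hy]
    simp

/-- In a basin the motion is holomorphic in the point and tends to the identity as `g` tends to `f`;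
hence its derivative tends to `1`, and it is asymptotically a translation. -/
lemma conf_motionZero_coe (B : BottcherSystem f)
    (hf : f ∈ B.dom) {a : ℂ} (ha : a ∈ B.Z) (hc : (a : Sphere) ∈ criticalPoints f.1) {w : ℂ}
    (hw : w ∈ ball (0 : ℂ) 1) {ε : ℝ} (hε : 0 < ε) {x : ℂ} (hx : x = B.ψ a f w) :
    ∀ᶠ q : NewtonMap d × Sphere in 𝓝[B.dom] f ×ˢ 𝓝 (x : Sphere),
      ‖localCoord (x : Sphere) (B.motionZero q.1 q.2) -
        localCoord (x : Sphere) (B.motionZero q.1 (x : Sphere)) - localCoord (x : Sphere) q.2‖ ≤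
      ε * ‖localCoord (x : Sphere) q.2‖ := by
  obtain ⟨U, F, hU, hψU, hFf, hFd, hFc, hF⟩ := B.exists_motionZero_eq hf ha hc
  have hxU : x ∈ U := hx ▸ hψU w hw
  obtain ⟨R, hR, hRU⟩ := Metric.nhds_basis_closedBall.mem_iff.1 (hU.mem_nhds hxU)
  obtain ⟨ε₀, hε₀, hε₀R, η₀, hη₀, hclose⟩ := exists_deriv_close (F₀ := id) (u₀ := x) hR hε
    differentiableOn_id
  simp only [deriv_id, id] at hclose
  have hev : ∀ᶠ g in 𝓝[B.dom] f, ∀ u ∈ closedBall x R, ‖F g u - u‖ ≤ η₀ := by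
    refine eventually_forall_compact (isCompact_closedBall x R) fun u hu => ?_
    have h1 : ContinuousWithinAt (fun q : NewtonMap d × ℂ => F q.1 q.2 - q.2)
        (B.dom ×ˢ closedBall x R) (f, u) :=
      ((hFc (f, u) ⟨hf, hRU hu⟩).mono (prod_mono_right hRU)).sub continuousWithinAt_snd
    have h2 := h1.norm
    rw [ContinuousWithinAt, nhdsWithin_prod_eq] at h2
    simp only [hFf u (hRU hu), sub_self, norm_zero] at h2
    exact h2.eventually (ge_mem_nhds hη₀)
  have hnear : ∀ᶠ z in 𝓝 (x : Sphere), z ∈ ((↑) : ℂ → Sphere) '' ball x ε₀ :=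
    ((OnePoint.isOpenEmbedding_coe (X := ℂ)).isOpenMap _ isOpen_ball).mem_nhds
      ⟨x, mem_ball_self hε₀, rfl⟩
  filter_upwards [(hev.and self_mem_nhdsWithin).prod_inl _, hnear.prod_inr _] with q hq1 hq2
  obtain ⟨y, hy, hyq⟩ := hq2
  have hsub : ball x R ⊆ U := Metric.ball_subset_closedBall.trans hRU
  have hcs : closedBall x ε₀ ⊆ ball x R := closedBall_subset_ball hε₀R
  have h1 := hclose (F q.1) ((hFd q.1 hq1.2).mono hsub)
    (fun u hu => hq1.1 u (ball_subset_closedBall hu))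
  have h2 := norm_sub_sub_mul_le (F := F q.1) (c := 1) (fun u hu =>
    (hFd q.1 hq1.2).differentiableAt (hU.mem_nhds (hsub (hcs hu)))) h1
    (ball_subset_closedBall hy) (Metric.mem_closedBall_self hε₀.le)
  rw [← hyq, hF q.1 y (hsub (hcs (ball_subset_closedBall hy))), hF q.1 x hxU]
  simp only [localCoord_coe_coe]
  rw [one_mul] at h2
  convert h2 using 2
  ring

lemma motionZero_self (hd : 3 ≤ d) (B : BottcherSystem f)
    (hf : f ∈ B.dom) {z : Sphere} (hz : z ∈ newtonGraphZero f.1) : B.motionZero f z = z := by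
  rw [B.newtonGraphZero_eq hd hf] at hz
  rcases hz with rfl | h
  · exact B.motionZero_infty f
  · simp only [mem_iUnion] at h
    obtain ⟨p, hp, r, hr, rfl⟩ := h
    exact B.motionZero_ray hf f hp hr

lemma image_motionZero (hd : 3 ≤ d) (B : BottcherSystem f)
    (hf : f ∈ B.dom) {g : NewtonMap d} (hg : g ∈ B.dom) :
    B.motionZero g '' newtonGraphZero f.1 = newtonGraphZero g.1 := by
  rw [B.newtonGraphZero_eq hd hf, B.newtonGraphZero_eq hd hg, image_insert_eq, B.motionZero_infty,
    image_iUnion₂]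
  congr 1
  refine iUnion₂_congr fun p hp => ?_
  rw [image_image]
  exact image_congr fun r hr => B.motionZero_ray hf g hp hr

/-- The motion of the Newton graph of level zero. -/
lemma graphMotion (hd : 3 ≤ d) (B : BottcherSystem f)
    (hf : f ∈ B.dom) : GraphMotion f (newtonGraphZero f.1) B.dom B.motionZero where
  closed := (B.isCompact_newtonGraphZero hd hf).isClosed
  mem := hf
  infty_mem := mem_insert _ _
  maps := by
    rw [B.newtonGraphZero_eq hd hf]
    rintro z (rfl | h)
    · exact Or.inl f.map_infty
    · right
      simp only [mem_iUnion] at h ⊢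
      obtain ⟨p, hp, r, hr, rfl⟩ := h
      have := B.two_le p.1 hp.1 hp.2.1
      exact ⟨p, hp, _, ⟨pow_nonneg hr.1 _, pow_lt_one₀ hr.1 hr.2 (by omega)⟩,
        (B.apply_ray hf hp hr).symm⟩
  cont := B.continuousOn_motionZero hd hf
  base := fun z hz => B.motionZero_self hd hf hz
  infty := fun g _ => B.motionZero_infty g
  inj := by
    intro g hg z hz z' hz' h
    rw [B.newtonGraphZero_eq hd hf] at hz hz'
    rcases hz with rfl | hz <;> rcases hz' with rfl | hz'
    · rfl
    · simp only [mem_iUnion] at hz'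
      obtain ⟨p, hp, r, hr, rfl⟩ := hz'
      rw [B.motionZero_infty, B.motionZero_ray hf g hp hr] at h
      exact absurd h.symm (B.ray_ne_infty p g r)
    · simp only [mem_iUnion] at hz
      obtain ⟨p, hp, r, hr, rfl⟩ := hz
      rw [B.motionZero_infty, B.motionZero_ray hf g hp hr] at h
      exact absurd h (B.ray_ne_infty p g r)
    · simp only [mem_iUnion] at hz hz'
      obtain ⟨p, hp, r, hr, rfl⟩ := hz
      obtain ⟨p', hp', r', hr', rfl⟩ := hz'
      rw [B.motionZero_ray hf g hp hr, B.motionZero_ray hf g hp' hr'] at h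
      obtain ⟨h1, h2⟩ := B.ψ_inj hg hp.1 hp.2.1 hp'.1 hp'.2.1 (ofReal_mul_mem_ball hp.2.2.1 hr)
        (ofReal_mul_mem_ball hp'.2.2.1 hr') (OnePoint.coe_injective h)
      rw [ray, ray, h1, h2]
  equiv := by
    intro g hg z hz
    rw [B.newtonGraphZero_eq hd hf] at hz
    rcases hz with rfl | hz
    · rw [f.map_infty, B.motionZero_infty, g.map_infty]
    · simp only [mem_iUnion] at hz
      obtain ⟨p, hp, r, hr, rfl⟩ := hz
      have := B.two_le p.1 hp.1 hp.2.1
      rw [B.motionZero_ray hf g hp hr, B.apply_ray hg hp hr, B.apply_ray hf hp hr,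
        B.motionZero_ray hf g hp ⟨pow_nonneg hr.1 _, pow_lt_one₀ hr.1 hr.2 (by omega)⟩]
  conf := by
    intro v hv ε hε
    have hv' := hv
    rw [B.newtonGraphZero_eq hd hf] at hv'
    rcases hv' with rfl | hv'
    · have hex : ∀ p : ℂ × ℂ, ∃ s : ℝ, p ∈ B.index → 0 < s ∧ s < 1 ∧
          ∀ᶠ g in 𝓝[B.dom] f, ∀ r ∈ Ico s 1,
          ‖localCoord ∞ (B.ray p g r) - localCoord ∞ (B.ray p f r)‖ ≤
            ε * ‖localCoord ∞ (B.ray p f r)‖ := by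
        intro p
        by_cases hp : p ∈ B.index
        · obtain ⟨s, hs⟩ := B.eventually_ray_ratio hd hf hp hε
          exact ⟨s, fun _ => hs⟩
        · exact ⟨0, fun h => absurd h hp⟩
      choose s hs using hex
      have h1 := (B.finite_index.eventually_all).2 fun p hp => (hs p hp).2.2
      filter_upwards [h1.prod_inl _, (B.eventually_far hd hf (s := s)
        fun p hp => (hs p hp).2.1).prod_inr _] with q hq1 hq2
      rw [B.motionZero_infty, localCoord_self, sub_zero]
      rcases hq2 with h | ⟨p, hp, r, hr, hr0, h⟩
      · rw [h, B.motionZero_infty, localCoord_self]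
        simp
      · rw [h, B.motionZero_ray hf _ hp ⟨hr0, hr.2⟩]
        exact hq1 p hp r hr
    · simp only [mem_iUnion] at hv'
      obtain ⟨p, hp, r, hr, rfl⟩ := hv'
      exact (B.conf_motionZero_coe hf hp.1 hp.2.1 (ofReal_mul_mem_ball hp.2.2.1 hr) hε rfl).filter_mono
        (Filter.prod_mono_right _ nhdsWithin_le_nhds)
  deg := by
    intro v hv
    rw [B.newtonGraphZero_eq hd hf] at hv
    rcases hv with rfl | hv
    · refine Filter.Eventually.of_forall fun g => ?_
      rw [B.motionZero_infty, localDegree_infty hd, localDegree_infty hd]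
    · simp only [mem_iUnion] at hv
      obtain ⟨p, hp, r, hr, rfl⟩ := hv
      filter_upwards [self_mem_nhdsWithin] with g hg
      rw [B.motionZero_ray hf g hp hr]
      have hval : ∀ g' ∈ B.dom, localDegree g'.1 (B.ray p g' r) = if r = 0 then B.m p.1 else 1 := by
        intro g' hg'
        obtain ⟨hB, h0, hdeg⟩ := B.bottcher p.1 hp.1 hp.2.1 g' hg'.1 hg'.2
        have hm := B.two_le p.1 hp.1 hp.2.1
        split_ifs with h
        · rw [ray, h, Complex.ofReal_zero, zero_mul, h0, hdeg]
        · have hζ0 : p.2 ≠ 0 := by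
            intro h0
            have := hp.2.2.1
            rw [h0, norm_zero] at this
            exact zero_ne_one this
          have hw := ofReal_mul_mem_ball hp.2.2.1 hr
          have hw0 : (r : ℂ) * p.2 ≠ 0 := mul_ne_zero (by exact_mod_cast h) hζ0
          exact localDegree_eq_one hd g' (hB.not_critical hm le_rfl
            (by rw [h0]; exact B.root_mem hp.1 (B.mem_N hg')) hg'.2
            (pow_mem_ball_zero (by omega) le_rfl hw) (pow_ne_zero _ hw0) (hB.2.2 _ hw))
      rw [hval g hg, hval f hf]

end BottcherSystem

/-! ### Lifting a motion near a point -/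

/-- Uniform factorization near a point `z` at the points where the local degree is not smaller
than that of `f` at `z`. -/
lemma exists_uniform_factor (hd : 3 ≤ d) (f : NewtonMap d) (z : Sphere) :
    ∃ (δ : ℕ) (A₀ : ℂ → ℂ), 1 ≤ δ ∧ localDegree f.1 z = δ ∧ AnalyticAt ℂ A₀ 0 ∧ A₀ 0 ≠ 0 ∧
      (∀ᶠ t in 𝓝 (0 : ℂ), f.1 (localParam z t) ∈ chartDom (f.1 z) ∧
        locRep f.1 z (f.1 z) t = t ^ δ * A₀ t) ∧
      ∀ η > 0, ∃ r > 0, ∃ κ > 0, κ < r ∧ ∀ᶠ g : NewtonMap d in 𝓝 f,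
        (∀ t ∈ ball (0 : ℂ) r, g.1 (localParam z t) ∈ chartDom (f.1 z)) ∧
        ∀ τ : ℂ, ‖τ‖ ≤ κ → (z = ∞ → τ = 0) →
          (f.1 z = ∞ → g.1 (localParam z τ) = ∞) →
          localDegree f.1 z ≤ localDegree g.1 (localParam z τ) →
          ∃ A : ℂ → ℂ, DifferentiableOn ℂ A (ball 0 r) ∧
            (∀ t ∈ ball (0 : ℂ) r, locRep g.1 z (f.1 z) t - locRep g.1 z (f.1 z) τ =
              (t - τ) ^ δ * A t) ∧
            ∀ t ∈ ball (0 : ℂ) r, ‖A t - A₀ 0‖ ≤ η := by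
  obtain ⟨δ, hδ, hdeg, A₀, hA₀, hA₀0, hev⟩ := exists_locRep_factor hd f z
  have h0 : f.1 (localParam z 0) ∈ chartDom (f.1 z) := by
    rw [localParam_zero]; exact mem_chartDom_self _
  have hopen : IsOpen {t : ℂ | f.1 (localParam z t) ∈ chartDom (f.1 z)} :=
    (isOpen_chartDom _).preimage (f.1.continuous.comp (continuous_localParam z))
  have hd1 : ∀ᶠ t in 𝓝 (0 : ℂ), f.1 (localParam z t) ∈ chartDom (f.1 z) := hopen.mem_nhds h0
  refine ⟨δ, A₀, hδ, hdeg, hA₀, hA₀0, hd1.and hev, fun η hη => ?_⟩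
  obtain ⟨R₁, hR₁, hR₁s⟩ := Metric.eventually_nhds_iff_ball.1 hev
  obtain ⟨R, hR, hRR₁, hRg⟩ := exists_locRep_radius hd f (z := z) (v := f.1 z) (t₀ := 0) h0 hR₁
  obtain ⟨r, hr, hrR, κ, hκ, hκr, hFL⟩ := exists_factor_of_order hR
    (hRg 1 one_pos).self_of_nhds.1 hδ hA₀.continuousAt
    (fun t ht => hR₁s t (ball_subset_ball hRR₁ ht)) hη
  refine ⟨r, hr, κ, hκ, hκr, ?_⟩
  filter_upwards [hRg κ hκ] with g hg
  have hdom : ∀ t ∈ ball (0 : ℂ) r, g.1 (localParam z t) ∈ chartDom (f.1 z) := fun t ht =>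
    (hg.2 t (ball_subset_ball hrR.le ht)).1
  refine ⟨hdom, fun τ hτ hz hv hle => ?_⟩
  refine hFL _ hg.1 (fun t ht => (hg.2 t ht).2) τ hτ ?_
  rw [← localDegree_eq_order hz (fun h => by rw [h]; exact hv h)
    (hdom τ (by rw [mem_ball_zero_iff]; linarith)), ← hdeg]
  exact hle

lemma eventually_localParam {z : Sphere} {P : Sphere → Prop} :
    (∀ᶠ x in 𝓝 z, P x) ↔ ∀ᶠ t in 𝓝 (0 : ℂ), P (localParam z t) := by
  rw [nhds_eq_map_localParam]; exact Filter.eventually_map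

/-- Near a point of the same local degree as for `f`, a nearby map takes its value only once. -/
lemma eventually_eq_of_apply_eq (hd : 3 ≤ d) (f : NewtonMap d) (z : Sphere) :
    ∀ᶠ q : NewtonMap d × Sphere × Sphere in 𝓝 f ×ˢ (𝓝 z ×ˢ 𝓝 z),
      (z = ∞ → q.2.1 = ∞) →
      (f.1 z = ∞ → q.1.1 q.2.1 = ∞) →
      localDegree f.1 z ≤ localDegree q.1.1 q.2.1 → q.1.1 q.2.2 = q.1.1 q.2.1 →
      q.2.2 = q.2.1 := by
  obtain ⟨δ, A₀, hδ, hdeg, hA₀, hA₀0, -, hfac⟩ := exists_uniform_factor hd f z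
  have hA₀n : 0 < ‖A₀ 0‖ := norm_pos_iff.2 hA₀0
  obtain ⟨r, hr, κ, hκ, hκr, hev⟩ := hfac (‖A₀ 0‖ / 2) (by positivity)
  have h1 : localParam z '' ball 0 κ ∈ 𝓝 z := image_ball_mem_nhds z hκ
  have h2 : ∀ᶠ q : Sphere × Sphere in 𝓝 z ×ˢ 𝓝 z, q.1 ∈ localParam z '' ball 0 κ ∧
      q.2 ∈ localParam z '' ball 0 κ := Filter.prod_mem_prod h1 h1
  filter_upwards [hev.prod_inl _, h2.prod_inr _] with q hq1 hq2
  obtain ⟨g, x, x'⟩ := q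
  obtain ⟨⟨τ, hτ, rfl⟩, ⟨t, ht, rfl⟩⟩ := hq2
  intro hz hv hle heq
  simp only at hz hv hle heq hq1 ⊢
  rw [mem_ball_zero_iff] at hτ ht
  have hz' : z = ∞ → τ = 0 := fun h => by
    have h3 := hz h
    rw [← localCoord_localParam z τ, h3, h, localCoord_self]
  obtain ⟨A, -, hA, hAb⟩ := hq1.2 τ hτ.le hz' hv hle
  have htr : t ∈ ball (0 : ℂ) r := by rw [mem_ball_zero_iff]; linarith
  have h4 := hA t htr
  rw [locRep, locRep, heq, sub_self] at h4
  have h5 := hAb t htr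
  have h6 : A t ≠ 0 := by
    intro h0
    rw [h0, zero_sub, norm_neg] at h5
    linarith
  have h7 := (mul_eq_zero.1 h4.symm).resolve_right h6
  rw [sub_eq_zero.1 ((pow_eq_zero_iff (by omega)).1 h7)]

lemma deriv_locRep_ne_zero (hd : 3 ≤ d) (f : NewtonMap d) {z : Sphere}
    (hz : z ∉ criticalPoints f.1) : deriv (locRep f.1 z (f.1 z)) 0 ≠ 0 := by
  have han := analyticAt_locRep_zero hd f z
  have h1 := han.analyticOrderAt_deriv_add_one
  simp only [locRep_zero, sub_zero] at h1
  rw [← localDegree_eq, localDegree_eq_one hd f hz] at h1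
  rw [← han.deriv.analyticOrderAt_eq_zero]
  by_contra hcon
  have h2 := Order.one_le_iff_ne_zero.2 hcon
  have h3 : (1 : ℕ∞) + 1 ≤ analyticOrderAt (deriv (locRep f.1 z (f.1 z))) 0 + 1 := by gcongr
  rw [h1] at h3
  exact absurd h3 (by norm_num)

/-- Nearby maps are injective near a noncritical point. -/
lemma eventually_injective (hd : 3 ≤ d) (f : NewtonMap d) {z : Sphere}
    (hz : z ∉ criticalPoints f.1) :
    ∀ᶠ q : NewtonMap d × Sphere × Sphere in 𝓝 f ×ˢ (𝓝 z ×ˢ 𝓝 z),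
      q.1.1 q.2.2 = q.1.1 q.2.1 → q.2.2 = q.2.1 := by
  have h0 : f.1 (localParam z 0) ∈ chartDom (f.1 z) := by
    rw [localParam_zero]; exact mem_chartDom_self _
  obtain ⟨R, hR, -, hRg⟩ := exists_locRep_radius hd f (z := z) (v := f.1 z) (t₀ := 0) h0 one_pos
  obtain ⟨ε₀, hε₀, hε₀R, ⟨η₀, hη₀, hinj⟩, -⟩ := exists_simple_zero hR
    (hRg 1 one_pos).self_of_nhds.1 (locRep_zero _ _) (deriv_locRep_ne_zero hd f hz)
  have h1 : localParam z '' ball 0 ε₀ ∈ 𝓝 z := image_ball_mem_nhds z hε₀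
  have h2 : ∀ᶠ q : Sphere × Sphere in 𝓝 z ×ˢ 𝓝 z, q.1 ∈ localParam z '' ball 0 ε₀ ∧
      q.2 ∈ localParam z '' ball 0 ε₀ := Filter.prod_mem_prod h1 h1
  filter_upwards [(hRg η₀ hη₀).prod_inl _, h2.prod_inr _] with q hq1 hq2
  obtain ⟨g, x, x'⟩ := q
  obtain ⟨⟨τ, hτ, rfl⟩, ⟨t, ht, rfl⟩⟩ := hq2
  intro heq
  simp only at heq hq1 ⊢
  have := (hinj _ hq1.1 (fun u hu => (hq1.2 u hu).2)).1 (ball_subset_closedBall ht)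
    (ball_subset_closedBall hτ) (by rw [locRep, locRep, heq])
  rw [this]

/-- Critical points are isolated. -/
lemma eventually_not_critical (hd : 3 ≤ d) (f : NewtonMap d) (z : Sphere) :
    ∀ᶠ x in 𝓝 z, x ≠ z → x ∉ criticalPoints f.1 := by
  rw [eventually_localParam]
  have han := analyticAt_locRep_zero hd f z
  have hne : ∀ᶠ t in 𝓝[≠] (0 : ℂ), deriv (locRep f.1 z (f.1 z)) t ≠ 0 := by
    rcases han.deriv.eventually_eq_zero_or_eventually_ne_zero with h | h
    · exfalso
      have h1 := han.analyticOrderAt_deriv_add_one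
      simp only [locRep_zero, sub_zero] at h1
      rw [analyticOrderAt_eq_top.2 h, ← localDegree_eq] at h1
      exact localDegree_ne_top hd f z (by rw [← h1]; rfl)
    · exact h
  have hdom : ∀ᶠ t in 𝓝 (0 : ℂ), f.1 (localParam z t) ∈ chartDom (f.1 z) := by
    have hopen : IsOpen {t : ℂ | f.1 (localParam z t) ∈ chartDom (f.1 z)} :=
      (isOpen_chartDom _).preimage (f.1.continuous.comp (continuous_localParam z))
    exact hopen.mem_nhds (by rw [mem_ofPred_eq, localParam_zero]; exact mem_chartDom_self _)
  have hval : ∀ᶠ t in 𝓝[≠] (0 : ℂ), f.1 (localParam z t) ≠ f.1 z := by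
    have := frequently_apply_ne hd f z (f.1 z)
    rwa [localCoord_self] at this
  rw [eventually_nhdsWithin_iff] at hne hval
  filter_upwards [hne, hdom, hval] with t ht1 ht2 ht3 htz
  have ht0 : t ≠ 0 := by
    rintro rfl
    exact htz (localParam_zero z)
  by_cases hz : z = ∞
  · -- at infinity the coordinate is not a translation, so pass to the affine coordinate
    subst hz
    rw [localParam_infty_of_ne ht0] at ht2 ht3 ⊢
    rw [f.map_infty] at ht2 ht3
    have hfin : f.1 ((t⁻¹ : ℂ) : Sphere) ≠ ∞ := ht3 ht0
    rw [mem_criticalPoints_iff_deriv hd f hfin]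
    have h1 := ht1 ht0
    rw [f.map_infty] at h1
    intro hder
    apply h1
    have hfr : finRep f.1 t⁻¹ ≠ 0 := by
      intro h0
      rw [← coe_finRep hfin, h0] at ht2
      exact (mem_chartDom_infty.1 ht2) rfl
    have hloc : locRep f.1 ∞ ∞ =ᶠ[𝓝 t] fun s => (finRep f.1 s⁻¹)⁻¹ := by
      have hc : ContinuousAt (fun s : ℂ => f.1 ((s⁻¹ : ℂ) : Sphere)) t :=
        ContinuousAt.comp (g := fun x : ℂ => f.1 (x : Sphere)) (f := fun s : ℂ => s⁻¹)
          (f.1.continuous.comp OnePoint.continuous_coe).continuousAt (continuousAt_inv₀ ht0)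
      filter_upwards [hc.eventually (isOpen_ne.mem_nhds hfin), isOpen_ne.mem_nhds ht0] with s hs hs0
      rw [locRep, localParam_infty_of_ne hs0, ← coe_finRep hs]
      rfl
    rw [hloc.deriv_eq]
    have hd1 : HasDerivAt (finRep f.1) 0 t⁻¹ := by
      have := (analyticAt_finRep hd f hfin).differentiableAt.hasDerivAt
      rwa [hder] at this
    have hd2 : HasDerivAt (fun s => finRep f.1 s⁻¹) (0 * _) t :=
      HasDerivAt.comp (h := fun s : ℂ => s⁻¹) t hd1 (hasDerivAt_inv ht0)
    have hd3 := hd2.fun_inv hfr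
    rw [hd3.deriv]
    simp
  · by_cases hv : f.1 z = ∞
    · -- near a pole the values are finite and the coordinate at infinity is `w ↦ w⁻¹`
      obtain ⟨b, rfl⟩ := OnePoint.ne_infty_iff_exists.1 hz
      have hfin : f.1 ((b + t : ℂ) : Sphere) ≠ ∞ := by
        have := ht3 ht0
        rwa [localParam_coe, hv] at this
      rw [localParam_coe, mem_criticalPoints_iff_deriv hd f hfin]
      intro hder
      apply ht1 ht0
      rw [hv] at ht2 ⊢
      have hfr : finRep f.1 (b + t) ≠ 0 := by
        intro h0
        rw [localParam_coe, ← coe_finRep hfin, h0] at ht2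
        exact (mem_chartDom_infty.1 ht2) rfl
      have hloc : locRep f.1 (b : Sphere) ∞ =ᶠ[𝓝 t] fun s => (finRep f.1 (b + s))⁻¹ := by
        have hc : ContinuousAt (fun s : ℂ => f.1 ((b + s : ℂ) : Sphere)) t :=
          (f.1.continuous.comp (OnePoint.continuous_coe.comp
            (by fun_prop : Continuous fun s : ℂ => b + s))).continuousAt
        filter_upwards [hc.eventually (isOpen_ne.mem_nhds hfin)] with s hs
        rw [locRep, localParam_coe, ← coe_finRep hs]
        rfl
      rw [hloc.deriv_eq]
      have hd1 : HasDerivAt (finRep f.1) 0 (b + t) := by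
        have := (analyticAt_finRep hd f hfin).differentiableAt.hasDerivAt
        rwa [hder] at this
      have hd2 : HasDerivAt (fun s => finRep f.1 (b + s)) (0 * 1) t :=
        HasDerivAt.comp (h := fun s : ℂ => b + s) t hd1 ((hasDerivAt_id t).const_add b)
      rw [(hd2.fun_inv hfr).deriv]
      simp
    · intro hcrit
      have hcrit : (2 : ℕ∞) ≤ localDegree f.1 (localParam z t) := hcrit
      have han' := analyticAt_locRep hd f ht2
      rw [localDegree_eq_order (fun h => absurd h hz) (fun h => absurd h hv) ht2,
        ← han'.analyticOrderAt_deriv_add_one,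
        han'.deriv.analyticOrderAt_eq_zero.2 (ht1 ht0)] at hcrit
      exact absurd hcrit (by norm_num)

lemma eventually_ne_of_tendsto {P Y : Type*} [TopologicalSpace Y] [T2Space Y] {l : Filter P}
    {u v : P → Y} {a b : Y} (hu : Tendsto u l (𝓝 a)) (hv : Tendsto v l (𝓝 b))
    (h : a ≠ b) : ∀ᶠ p in l, u p ≠ v p :=
  (hu.prodMk_nhds hv).eventually ((isOpen_ne_fun continuous_fst continuous_snd).mem_nhds h)

/-- The position of the moved point `z` for maps near `f`: a continuous solution `x = c g` of
`g x = H g (f z)` that keeps the local degree of `f` at `z`. -/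
structure LiftCenter (f : NewtonMap d) (𝒢 : Set (NewtonMap d))
    (H : NewtonMap d → Sphere → Sphere) (z : Sphere) (c : NewtonMap d → Sphere)
    (N : Set (NewtonMap d)) : Prop where
  mem : N ∈ 𝓝[𝒢] f
  sub : N ⊆ 𝒢
  cont : ContinuousOn c N
  base : c f = z
  apply : ∀ g ∈ N, g.1 (c g) = H g (f.1 z)
  deg : ∀ g ∈ N, localDegree g.1 (c g) = localDegree f.1 z
  infty : z = ∞ → ∀ g ∈ N, c g = ∞

namespace GraphMotion

lemma continuousWithinAt_base (M : GraphMotion f X 𝒢 H) {v : Sphere} (hv : v ∈ X) :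
    Tendsto (fun q : NewtonMap d × Sphere => H q.1 q.2) (𝓝[𝒢] f ×ˢ 𝓝[X] v) (𝓝 v) := by
  have := M.cont (f, v) ⟨M.mem, hv⟩
  rw [ContinuousWithinAt, nhdsWithin_prod_eq] at this
  change Tendsto _ _ (𝓝 (H f v)) at this
  rw [M.base v hv] at this
  exact this

lemma tendsto_apply {X : Set Sphere} (z : Sphere) :
    Tendsto f.1 (𝓝[f.1 ⁻¹' X] z) (𝓝[X] (f.1 z)) :=
  f.1.continuous.continuousWithinAt.tendsto_nhdsWithin fun _ h => h

lemma continuousOn_apply (M : GraphMotion f X 𝒢 H) {v : Sphere} (hv : v ∈ X) :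
    ContinuousOn (fun g => H g v) 𝒢 :=
  M.cont.comp (f := fun g => (g, v)) (by fun_prop) fun _ hg => ⟨hg, hv⟩

/-- Solutions with the right local degree near `z` form a lift center. -/
lemma exists_center (hd : 3 ≤ d) (M : GraphMotion f X 𝒢 H)
    {z : Sphere} (hz : f.1 z ∈ X)
    (hc : ∀ U ∈ 𝓝 z, ∀ᶠ g : NewtonMap d in 𝓝[𝒢] f, ∃ x ∈ U, (z = ∞ → x = ∞) ∧
      g.1 x = H g (f.1 z) ∧ localDegree g.1 x = localDegree f.1 z) :
    ∃ c N, LiftCenter f 𝒢 H z c N := by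
  obtain ⟨N₁, hN₁, U₂, hU₂, hiso⟩ := Filter.mem_prod_iff.1 (eventually_eq_of_apply_eq hd f z)
  obtain ⟨U₁, hU₁, U₁', hU₁', hUU⟩ := Filter.mem_prod_iff.1 hU₂
  obtain ⟨R, hR, hRs⟩ := Metric.nhds_basis_closedBall.mem_iff.1
    (show localParam z ⁻¹' (U₁ ∩ U₁') ∈ 𝓝 0 from by
      have := (continuous_localParam z).continuousAt (x := 0)
      rw [ContinuousAt, localParam_zero] at this
      exact this (Filter.inter_mem hU₁ hU₁'))
  set K := localParam z '' closedBall 0 R with hK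
  have hKc : IsCompact K := isCompact_image_closedBall z R
  have hKm : K ∈ 𝓝 z := image_closedBall_mem_nhds z hR
  have hKs : K ⊆ U₁ ∩ U₁' := by
    rintro _ ⟨t, ht, rfl⟩
    exact hRs ht
  have hN := hc K hKm
  set N := {g : NewtonMap d | g ∈ 𝒢 ∧ g ∈ N₁ ∧ ∃ x ∈ K, (z = ∞ → x = ∞) ∧
      g.1 x = H g (f.1 z) ∧ localDegree g.1 x = localDegree f.1 z} with hNdef
  have hNm : N ∈ 𝓝[𝒢] f := by
    filter_upwards [hN, self_mem_nhdsWithin, nhdsWithin_le_nhds hN₁] with g h1 h2 h3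
      using ⟨h2, h3, h1⟩
  have hfN : f ∈ N := mem_of_mem_nhdsWithin M.mem hNm
  set c : NewtonMap d → Sphere := fun g => Function.extend (fun g : N => g.1)
    (fun g => g.2.2.2.choose) (fun _ => z) g
  have hcN : ∀ g ∈ N, c g ∈ K ∧ (z = ∞ → c g = ∞) ∧
      g.1 (c g) = H g (f.1 z) ∧ localDegree g.1 (c g) = localDegree f.1 z := by
    intro g hg
    have h1 : c g = hg.2.2.choose :=
      Subtype.val_injective.extend_apply (fun g : N => g.2.2.2.choose) (fun _ => z) ⟨g, hg⟩
    rw [h1]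
    exact hg.2.2.choose_spec
  have huniq : ∀ g ∈ N, ∀ x ∈ K, g.1 x = H g (f.1 z) → x = c g := by
    intro g hg x hx hgx
    obtain ⟨h1, h2, h3, h4⟩ := hcN g hg
    refine hiso (mk_mem_prod hg.2.1 (hUU (mk_mem_prod (hKs h1).1 (hKs hx).2)) :
      (g, c g, x) ∈ N₁ ×ˢ U₂) h2 (fun hv => ?_) h4.ge (by rw [hgx, h3])
    change g.1 (c g) = _
    rw [h3, hv, M.infty g hg.1]
  refine ⟨c, N, hNm, fun g hg => hg.1, fun g hg => ?_, ?_, fun g hg => (hcN g hg).2.2.1,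
    fun g hg => (hcN g hg).2.2.2, fun h g hg => (hcN g hg).2.1 h⟩
  · refine tendsto_of_compact_unique hKc (eventually_mem_nhdsWithin.mono fun g hg => (hcN g hg).1)
      fun y hy hne => ?_
    have h1 : g.1 y ≠ H g (f.1 z) := fun h => hne (huniq g hg y hy h)
    have h2 : Tendsto (fun q : NewtonMap d × Sphere => q.1.1 q.2) (𝓝[N] g ×ˢ 𝓝 y)
        (𝓝 (g.1 y)) :=
      (continuous_newton_eval.tendsto (g, y)).mono_left (by
        rw [nhds_prod_eq]; exact Filter.prod_mono_left _ nhdsWithin_le_nhds)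
    have h3 : Tendsto (fun q : NewtonMap d × Sphere => H q.1 (f.1 z)) (𝓝[N] g ×ˢ 𝓝 y)
        (𝓝 (H g (f.1 z))) :=
      ((M.continuousOn_apply hz).mono (fun g hg => hg.1) g hg).tendsto.comp Filter.tendsto_fst
    have h4 : ∀ᶠ g' in 𝓝[N] g, g' ∈ N := eventually_mem_nhdsWithin
    filter_upwards [eventually_ne_of_tendsto h2 h3 h1, h4.prod_inl _] with q hq hq' heq
    apply hq
    rw [← heq, (hcN q.1 hq').2.2.1]
  · exact (huniq f hfN z (mem_of_mem_nhds hKm) (M.base _ hz).symm).symm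

end GraphMotion

/-- The defining relation of the lift near `z`: the moved point `x` of `z'` is a solution of
`g x = H g (f z')` whose displacement from the center is relatively close to that of `z'` from
`z`. -/
def LiftRel (H : NewtonMap d → Sphere → Sphere) (f : NewtonMap d) (z : Sphere)
    (c : NewtonMap d → Sphere) (ε : ℝ) (g : NewtonMap d) (z' x : Sphere) : Prop :=
  x ∈ chartDom z ∧ ‖localCoord z x - localCoord z (c g) - localCoord z z'‖ ≤ ε * ‖localCoord z z'‖ ∧
    g.1 x = H g (f.1 z')

lemma LiftRel.mono {H : NewtonMap d → Sphere → Sphere} {z : Sphere}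
    {c : NewtonMap d → Sphere} {ε ε' : ℝ} (hε : ε ≤ ε') {g : NewtonMap d} {z' x : Sphere}
    (h : LiftRel H f z c ε g z' x) : LiftRel H f z c ε' g z' x :=
  ⟨h.1, h.2.1.trans (by gcongr), h.2.2⟩

namespace LiftCenter

lemma tendsto (M : GraphMotion f X 𝒢 H) {z : Sphere}
    {c : NewtonMap d → Sphere} {N : Set (NewtonMap d)} (C : LiftCenter f 𝒢 H z c N) :
    Tendsto c (𝓝[𝒢] f) (𝓝 z) := by
  have h1 := C.cont f (mem_of_mem_nhdsWithin M.mem C.mem)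
  rw [ContinuousWithinAt, C.base] at h1
  exact h1.mono_left (nhdsWithin_le_iff.2 C.mem)

/-- In the local coordinates the relation amounts to a perturbed power equation, which has exactly
one solution; conversely all solutions of `g x = H g y` near `z` arise in this way. -/
lemma exists_liftRel (hd : 3 ≤ d) (M : GraphMotion f X 𝒢 H)
    {z : Sphere} (hz : f.1 z ∈ X) {c : NewtonMap d → Sphere} {N : Set (NewtonMap d)}
    (C : LiftCenter f 𝒢 H z c N) :
    ∃ ε₀ > 0, ε₀ < 1 ∧
      (∀ ε > 0, ε ≤ ε₀ → ∀ᶠ q : NewtonMap d × Sphere in 𝓝[𝒢] f ×ˢ 𝓝[f.1 ⁻¹' X] z,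
        ∃! x, LiftRel H f z c ε q.1 q.2 x) ∧
      ∀ W ∈ 𝓝 z, ∀ᶠ q : NewtonMap d × Sphere in 𝓝[𝒢] f ×ˢ 𝓝 z, ∀ y ∈ X, q.1.1 q.2 = H q.1 y →
        ∃ z' ∈ W, f.1 z' = y ∧ LiftRel H f z c ε₀ q.1 z' q.2 := by
  obtain ⟨δ, A₀, hδ, hdeg, hA₀, hA₀0, hev, hfac⟩ := exists_uniform_factor hd f z
  obtain ⟨ε₀, hε₀, hε₀1, hPL⟩ := exists_power_lift hδ hA₀0
  have hA₀n : 0 < ‖A₀ 0‖ := norm_pos_iff.2 hA₀0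
  have hδ0 : δ ≠ 0 := by omega
  have hcl := C.tendsto M
  have hτ : Tendsto (fun g => localCoord z (c g)) (𝓝[𝒢] f) (𝓝 0) :=
    (tendsto_localCoord z).comp hcl
  have hcdom : ∀ᶠ g in 𝓝[𝒢] f, c g ∈ chartDom z :=
    hcl.eventually ((isOpen_chartDom z).mem_nhds (mem_chartDom_self z))
  have hN : ∀ᶠ g in 𝓝[𝒢] f, g ∈ N := C.mem
  have h𝒢 : ∀ᶠ g in 𝓝[𝒢] f, g ∈ 𝒢 := eventually_mem_nhdsWithin
  -- the value at the center in the coordinate at `f z`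
  have hωeq : ∀ g ∈ N, c g ∈ chartDom z → locRep g.1 z (f.1 z) (localCoord z (c g)) =
      localCoord (f.1 z) (H g (f.1 z)) := by
    intro g hg hcg
    rw [locRep, localParam_localCoord hcg, C.apply g hg]
  -- motions of points near `f z` stay in the chart
  have hHdom : ∀ᶠ q : NewtonMap d × Sphere in 𝓝[𝒢] f ×ˢ 𝓝[X] (f.1 z),
      H q.1 q.2 ∈ chartDom (f.1 z) :=
    (M.continuousWithinAt_base hz).eventually ((isOpen_chartDom _).mem_nhds (mem_chartDom_self _))
  refine ⟨ε₀, hε₀, hε₀1, fun ε hε hεε₀ => ?_, fun W hW => ?_⟩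
  · obtain ⟨η, hη, hPL⟩ := hPL ε hε hεε₀
    obtain ⟨r, hr, κ, hκ, hκr, hg⟩ := hfac η hη
    have hconf := M.conf (f.1 z) hz (η / (2 * (‖A₀ 0‖ + η))) (by positivity)
    have hpull : Tendsto (fun q : NewtonMap d × Sphere => (q.1, f.1 q.2))
        (𝓝[𝒢] f ×ˢ 𝓝[f.1 ⁻¹' X] z) (𝓝[𝒢] f ×ˢ 𝓝[X] (f.1 z)) :=
      Filter.Tendsto.prodMap (Filter.tendsto_id (x := 𝓝[𝒢] f)) (GraphMotion.tendsto_apply z)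
    have hA₀c : ∀ᶠ t in 𝓝 (0 : ℂ), ‖A₀ t - A₀ 0‖ ≤ η / 2 := by
      have := hA₀.continuousAt.eventually (closedBall_mem_nhds (A₀ 0) (half_pos hη))
      filter_upwards [this] with t ht using by rwa [dist_eq_norm] at ht
    have hs0 : ∀ᶠ t in 𝓝 (0 : ℂ), ‖t‖ < (r - κ) / 4 := by
      have := ball_mem_nhds (0 : ℂ) (show 0 < (r - κ) / 4 by linarith)
      filter_upwards [this] with t ht using mem_ball_zero_iff.1 ht
    have hs := (tendsto_localCoord z).eventually (hev.and (hA₀c.and hs0))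
    have hs' : ∀ᶠ z' in 𝓝[f.1 ⁻¹' X] z, z' ∈ chartDom z :=
      nhdsWithin_le_nhds ((isOpen_chartDom z).mem_nhds (mem_chartDom_self z))
    have hτκ : ∀ᶠ g in 𝓝[𝒢] f, ‖localCoord z (c g)‖ < κ := by
      have := hτ.eventually (ball_mem_nhds (0 : ℂ) hκ)
      filter_upwards [this] with g hg using mem_ball_zero_iff.1 hg
    filter_upwards [hpull.eventually hconf, hpull.eventually hHdom,
      (hs.filter_mono nhdsWithin_le_nhds).prod_inr _, hs'.prod_inr _,
      (hτκ.and (hcdom.and (hN.and h𝒢))).prod_inl _,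
      (hg.filter_mono nhdsWithin_le_nhds).prod_inl _] with q hq1 hq2 hq3 hq4 hq5 hq6
    obtain ⟨g, z'⟩ := q
    simp only at hq1 hq2 hq3 hq4 hq5 hq6 ⊢
    obtain ⟨⟨hfs, hfs'⟩, hAs, hsr⟩ := hq3
    obtain ⟨hτκ, hcd, hgN, hg𝒢⟩ := hq5
    obtain ⟨hgdom, hgfac⟩ := hq6
    obtain ⟨A, hAd, hAf, hAη⟩ := hgfac (localCoord z (c g)) hτκ.le
      (fun h => by rw [C.infty h g hgN, h]; rfl)
      (fun h => by rw [localParam_localCoord hcd, C.apply g hgN, h, M.infty g hg𝒢])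
      (by rw [localParam_localCoord hcd, C.deg g hgN])
    rw [hωeq g hgN hcd] at hAf
    set τ := localCoord z (c g) with hτdef
    set s := localCoord z z' with hsdef
    rw [localParam_localCoord hq4] at hfs
    have hfs'' : localCoord (f.1 z) (f.1 z') = s ^ δ * A₀ s := by
      rw [← hfs', locRep, localParam_localCoord hq4]
    rw [hfs''] at hq1
    set β := localCoord (f.1 z) (H g (f.1 z')) with hβ
    set ω := localCoord (f.1 z) (H g (f.1 z)) with hω
    -- solutions of the equation in the coordinates
    have hiff : ∀ t ∈ ball (0 : ℂ) r, g.1 (localParam z t) = H g (f.1 z') ↔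
        (t - τ) ^ δ * A t = β - ω := by
      intro t ht
      rw [← hAf t ht, sub_left_inj, locRep]
      exact ⟨fun h => by rw [h], fun h => localCoord_injOn _ (hgdom t ht) hq2 h⟩
    have hball : ∀ t : ℂ, ‖t - τ - s‖ ≤ ε * ‖s‖ → t ∈ ball (0 : ℂ) r := by
      intro t ht
      rw [mem_ball_zero_iff]
      have h1 : ‖t‖ ≤ ‖t - τ - s‖ + ‖τ‖ + ‖s‖ := by
        calc ‖t‖ = ‖(t - τ - s) + τ + s‖ := by congr 1; ring
          _ ≤ _ := (norm_add_le _ _).trans (by gcongr; exact norm_add_le _ _)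
      nlinarith [norm_nonneg s]
    by_cases hs0 : s = 0
    · have hz' : z' = z := (localCoord_eq_zero_iff hq4).1 hs0
      refine ⟨c g, ⟨hcd, ?_, ?_⟩, fun x hx => ?_⟩
      · rw [← hτdef, ← hsdef, hs0]; simp
      · rw [C.apply g hgN, hz']
      · obtain ⟨hx1, hx2, -⟩ := hx
        rw [← hτdef, ← hsdef, hs0, norm_zero, mul_zero, sub_zero] at hx2
        exact localCoord_injOn z hx1 hcd (sub_eq_zero.1 (norm_le_zero_iff.1 hx2))
    · have hsδ : s ^ δ ≠ 0 := pow_ne_zero _ hs0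
      have hB : ‖(β - ω) / s ^ δ - A₀ 0‖ ≤ η := by
        have hAs' : ‖A₀ s‖ ≤ ‖A₀ 0‖ + η := by
          have := norm_le_insert' (A₀ s) (A₀ 0)
          linarith
        have h1 : ‖(β - ω) / s ^ δ - A₀ s‖ ≤ η / 2 := by
          have h2 : (β - ω) / s ^ δ - A₀ s = (β - ω - s ^ δ * A₀ s) / s ^ δ := by
            field_simp
          rw [h2, norm_div, div_le_iff₀ (norm_pos_iff.2 hsδ)]
          refine hq1.trans ?_
          rw [norm_mul]
          calc η / (2 * (‖A₀ 0‖ + η)) * (‖s ^ δ‖ * ‖A₀ s‖)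
              ≤ η / (2 * (‖A₀ 0‖ + η)) * (‖s ^ δ‖ * (‖A₀ 0‖ + η)) := by gcongr
            _ = η / 2 * ‖s ^ δ‖ := by field_simp
        calc ‖(β - ω) / s ^ δ - A₀ 0‖ = ‖((β - ω) / s ^ δ - A₀ s) + (A₀ s - A₀ 0)‖ := by
              congr 1; ring
          _ ≤ η / 2 + η / 2 := (norm_add_le _ _).trans (add_le_add h1 hAs)
          _ = η := by ring
      obtain ⟨u, ⟨hu1, hu2⟩, hu3⟩ := hPL A r τ s _ hAd hAη (by linarith) hB
      rw [mem_closedBall_iff_norm] at hu1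
      have hball' : ‖(τ + s * u) - τ - s‖ ≤ ε * ‖s‖ := by
        calc ‖(τ + s * u) - τ - s‖ = ‖s * (u - 1)‖ := by congr 1; ring
          _ ≤ ε * ‖s‖ := by rw [norm_mul, mul_comm]; gcongr
      refine ⟨localParam z (τ + s * u), ⟨mem_chartDom_localParam _ _, ?_, ?_⟩, fun x hx => ?_⟩
      · rw [localCoord_localParam]; exact hball'
      · rw [hiff _ (hball _ hball'), add_sub_cancel_left, mul_pow, mul_assoc, hu2]
        field_simp
      · obtain ⟨hx1, hx2, hx3⟩ := hx
        rw [← hτdef, ← hsdef] at hx2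
        set t := localCoord z x with ht
        rw [← localParam_localCoord hx1, ← ht] at hx3 ⊢
        rw [hiff t (hball t hx2)] at hx3
        have hut : s * ((t - τ) / s) = t - τ := by field_simp
        have h4 : (t - τ) / s = u := by
          refine hu3 _ ⟨?_, ?_⟩
          · rw [mem_closedBall_iff_norm]
            have : (t - τ) / s - 1 = (t - τ - s) / s := by field_simp
            rw [this, norm_div, div_le_iff₀ (norm_pos_iff.2 hs0)]
            exact hx2
          · rw [hut, add_sub_cancel, ← hx3, div_pow, div_mul_eq_mul_div]
        rw [← h4, hut]
        congr 1
        ring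
  · obtain ⟨η, hη, hPL⟩ := hPL (ε₀ / 2) (by positivity) (by linarith)
    obtain ⟨r, hr, κ, hκ, hκr, hg⟩ := hfac (η / 2) (by positivity)
    set ε' := min (1 / 2) (η / (4 * (‖A₀ 0‖ + η))) with hε'
    have hε'pos : 0 < ε' := by positivity
    have hconf := M.conf (f.1 z) hz ε' hε'pos
    have hydom : ∀ᶠ y in 𝓝[X] (f.1 z), y ∈ chartDom (f.1 z) :=
      nhdsWithin_le_nhds ((isOpen_chartDom _).mem_nhds (mem_chartDom_self _))
    obtain ⟨𝒩, h𝒩, V, hV, hconfV⟩ :=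
      Filter.mem_prod_iff.1 (hconf.and (hHdom.and (hydom.prod_inr _)))
    obtain ⟨V₀, hV₀, hV₀o⟩ := mem_nhdsWithin_iff_exists_mem_nhds_inter.1 hV
    -- only points `y` near `f z` can be involved
    have hnear : ∀ᶠ q : NewtonMap d × Sphere in 𝓝[𝒢] f ×ˢ 𝓝 z, ∀ y ∈ X \ interior V₀,
        q.1.1 q.2 ≠ H q.1 y := by
      refine eventually_forall_compact
        (M.closed.isCompact.diff isOpen_interior) fun y hy => ?_
      have h1 : Tendsto (fun p : (NewtonMap d × Sphere) × Sphere => p.1.1.1 p.1.2)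
          ((𝓝[𝒢] f ×ˢ 𝓝 z) ×ˢ 𝓝[X \ interior V₀] y) (𝓝 (f.1 z)) := by
        refine ((continuous_newton_eval.tendsto (f, z)).mono_left ?_).comp Filter.tendsto_fst
        rw [nhds_prod_eq]; exact Filter.prod_mono_left _ nhdsWithin_le_nhds
      have h2 : Tendsto (fun p : (NewtonMap d × Sphere) × Sphere => H p.1.1 p.2)
          ((𝓝[𝒢] f ×ˢ 𝓝 z) ×ˢ 𝓝[X \ interior V₀] y) (𝓝 y) :=
        (M.continuousWithinAt_base hy.1).comp
          ((Filter.tendsto_fst.comp Filter.tendsto_fst).prodMk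
            (Filter.tendsto_snd.mono_right (nhdsWithin_mono _ sdiff_subset)))
      refine eventually_ne_of_tendsto h1 h2 fun h => hy.2 ?_
      rw [← h]
      exact mem_interior_iff_mem_nhds.2 hV₀
    -- a disc on which `A₀` is close to its value at `0` and `f` is represented
    obtain ⟨R, hR, hRs⟩ := Metric.nhds_basis_ball.mem_iff.1
      (hev.and ((hA₀.eventually_analyticAt).and ((hA₀.continuousAt.eventually
        (closedBall_mem_nhds (A₀ 0) hη)).and
          ((continuous_localParam z).continuousAt (x := 0) |>.eventually
            (show W ∈ 𝓝 (localParam z 0) by rwa [localParam_zero])))))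
    have hmin : 0 < min R (r - κ) / 4 := by
      have : 0 < r - κ := by linarith
      positivity
    have hτκ : ∀ᶠ g in 𝓝[𝒢] f, ‖localCoord z (c g)‖ < min κ (min R (r - κ) / 4) := by
      have := hτ.eventually (ball_mem_nhds (0 : ℂ) (lt_min hκ hmin))
      filter_upwards [this] with g hg using mem_ball_zero_iff.1 hg
    have ht0 : ∀ᶠ x in 𝓝 z, ‖localCoord z x‖ < min R (r - κ) / 4 := by
      have := (tendsto_localCoord z).eventually (ball_mem_nhds (0 : ℂ) hmin)
      filter_upwards [this] with g hg using mem_ball_zero_iff.1 hg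
    have hxd : ∀ᶠ x in 𝓝 z, x ∈ chartDom z := (isOpen_chartDom z).mem_nhds (mem_chartDom_self z)
    filter_upwards [hnear, (ht0.and hxd).prod_inr _,
      (hτκ.and (hcdom.and (hN.and (h𝒢.and h𝒩)))).prod_inl _,
      (hg.filter_mono nhdsWithin_le_nhds).prod_inl _] with q hq1 hq2 hq3 hq4
    obtain ⟨g, x⟩ := q
    simp only at hq1 hq2 hq3 hq4 ⊢
    intro y hy hxy
    obtain ⟨htR, hxd⟩ := hq2
    obtain ⟨hτκ, hcd, hgN, hg𝒢, hg𝒩⟩ := hq3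
    obtain ⟨hgdom, hgfac⟩ := hq4
    have hyV : y ∈ V := hV₀o ⟨interior_subset (by
      by_contra hcon
      exact hq1 y ⟨hy, hcon⟩ hxy), hy⟩
    obtain ⟨hyc, -, hyd⟩ : ‖localCoord (f.1 z) (H g y) - localCoord (f.1 z) (H g (f.1 z)) -
        localCoord (f.1 z) y‖ ≤ ε' * ‖localCoord (f.1 z) y‖ ∧ H g y ∈ chartDom (f.1 z) ∧
        y ∈ chartDom (f.1 z) :=
      hconfV (mk_mem_prod hg𝒩 hyV : (g, y) ∈ 𝒩 ×ˢ V)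
    obtain ⟨A, hAd, hAf, hAη⟩ := hgfac (localCoord z (c g)) (hτκ.trans_le (min_le_left _ _)).le
      (fun h => by rw [C.infty h g hgN, h]; rfl)
      (fun h => by rw [localParam_localCoord hcd, C.apply g hgN, h, M.infty g hg𝒢])
      (by rw [localParam_localCoord hcd, C.deg g hgN])
    rw [hωeq g hgN hcd] at hAf
    have hτR := hτκ.trans_le (min_le_right _ _)
    have hminR : min R (r - κ) ≤ R := min_le_left _ _
    have hminr : min R (r - κ) ≤ r - κ := min_le_right _ _
    unfold LiftRel
    set τ := localCoord z (c g) with hτdef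
    set t := localCoord z x with htdef
    set b := localCoord (f.1 z) y with hb
    have htr : t ∈ ball (0 : ℂ) r := by rw [mem_ball_zero_iff]; linarith
    have hAt := hAf t htr
    rw [locRep, htdef, localParam_localCoord hxd, hxy, ← htdef] at hAt
    rw [hAt] at hyc
    have hε'2 : ε' ≤ 1 / 2 := min_le_left _ _
    by_cases htτ : t = τ
    · -- then `y` is the value at the center
      rw [htτ, sub_self, zero_pow hδ0, zero_mul, zero_sub, norm_neg] at hyc
      have hb0 : b = 0 := by
        rw [← norm_le_zero_iff]
        nlinarith [norm_nonneg b]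
      have hyv : y = f.1 z := (localCoord_eq_zero_iff hyd).1 hb0
      refine ⟨z, mem_of_mem_nhds hW, hyv.symm, hxd, ?_, by rw [hxy, hyv]⟩
      rw [htτ]
      simp
    · have hs0 : t - τ ≠ 0 := sub_ne_zero.2 htτ
      have hsδ : (t - τ) ^ δ ≠ 0 := pow_ne_zero _ hs0
      have hAtη := hAη t htr
      have hB1 : ‖A t - b / (t - τ) ^ δ‖ ≤ ε' * ‖b / (t - τ) ^ δ‖ := by
        have h1 : A t - b / (t - τ) ^ δ = ((t - τ) ^ δ * A t - b) / (t - τ) ^ δ := by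
          field_simp
        rw [h1, norm_div, norm_div, ← mul_div_assoc]
        gcongr
      set B := b / (t - τ) ^ δ with hBdef
      have hB2 : ‖B‖ ≤ 2 * (‖A₀ 0‖ + η) := by
        have h1 := norm_le_insert (A t) B
        have h2 : ‖B‖ ≤ ‖A t‖ + ‖A t - B‖ := by
          calc ‖B‖ = ‖A t - (A t - B)‖ := by congr 1; ring
            _ ≤ _ := norm_sub_le _ _
        have h3 := norm_le_insert' (A t) (A₀ 0)
        nlinarith [norm_nonneg B]
      have hB3 : ‖B - A₀ 0‖ ≤ η := by
        have h1 : ε' * ‖B‖ ≤ η / 2 := by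
          calc ε' * ‖B‖ ≤ η / (4 * (‖A₀ 0‖ + η)) * (2 * (‖A₀ 0‖ + η)) := by
                gcongr
                exact min_le_right _ _
            _ = η / 2 := by field_simp; norm_num
        calc ‖B - A₀ 0‖ = ‖(A t - A₀ 0) - (A t - B)‖ := by congr 1; ring
          _ ≤ η / 2 + η / 2 := (norm_sub_le _ _).trans (add_le_add hAtη (hB1.trans h1))
          _ = η := by ring
      have hsR : ‖t - τ‖ < R / 2 := by
        have := norm_sub_le t τ
        linarith
      obtain ⟨u, ⟨hu1, hu2⟩, -⟩ := hPL A₀ R 0 (t - τ) B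
        (fun p hp => (hRs hp).2.1.differentiableAt.differentiableWithinAt)
        (fun p hp => by
          have := (hRs hp).2.2.1
          rwa [dist_eq_norm] at this)
        (by rw [norm_zero]; linarith) hB3
      rw [mem_closedBall_iff_norm] at hu1
      rw [zero_add] at hu2
      set σ := (t - τ) * u with hσ
      have hσs : ‖t - τ - σ‖ ≤ ε₀ / 2 * ‖t - τ‖ := by
        calc ‖t - τ - σ‖ = ‖(t - τ) * (u - 1)‖ := by rw [← norm_neg]; congr 1; rw [hσ]; ring
          _ ≤ _ := by rw [norm_mul, mul_comm]; gcongr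
      have hsσ : ‖t - τ‖ ≤ 2 * ‖σ‖ := by
        have h1 : ‖t - τ‖ ≤ ‖t - τ - σ‖ + ‖σ‖ := by
          calc ‖t - τ‖ = ‖(t - τ - σ) + σ‖ := by congr 1; ring
            _ ≤ _ := norm_add_le _ _
        nlinarith [norm_nonneg (t - τ)]
      have hσR : σ ∈ ball (0 : ℂ) R := by
        rw [mem_ball_zero_iff]
        have h1 : ‖σ‖ ≤ ‖t - τ - σ‖ + ‖t - τ‖ := by
          calc ‖σ‖ = ‖(t - τ) - (t - τ - σ)‖ := by congr 1; ring
            _ ≤ _ := (norm_sub_le _ _).trans (by rw [add_comm])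
        nlinarith [norm_nonneg (t - τ)]
      obtain ⟨⟨hσd, hσf⟩, -, -, hσW⟩ := hRs hσR
      have hfσ : f.1 (localParam z σ) = y := by
        refine localCoord_injOn _ hσd hyd ?_
        change locRep f.1 z (f.1 z) σ = b
        rw [hσf, hσ, mul_pow, mul_assoc, hu2, hBdef]
        field_simp
      refine ⟨localParam z σ, hσW, hfσ, hxd, ?_, by rw [hfσ, hxy]⟩
      rw [localCoord_localParam]
      nlinarith [norm_nonneg σ]

end LiftCenter

/-- A local lift of the motion near `z`, through the center `c`. -/
structure LocalLift (f : NewtonMap d) (X : Set Sphere) (𝒢 : Set (NewtonMap d))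
    (H : NewtonMap d → Sphere → Sphere) (z : Sphere) (c : NewtonMap d → Sphere)
    (T : NewtonMap d → Sphere → Sphere) : Prop where
  center : ∀ᶠ g in 𝓝[𝒢] f, T g z = c g
  apply : ∀ᶠ q : NewtonMap d × Sphere in 𝓝[𝒢] f ×ˢ 𝓝[f.1 ⁻¹' X] z,
    q.1.1 (T q.1 q.2) = H q.1 (f.1 q.2)
  conf : ∀ ε > 0, ∀ᶠ q : NewtonMap d × Sphere in 𝓝[𝒢] f ×ˢ 𝓝[f.1 ⁻¹' X] z,
    ‖localCoord z (T q.1 q.2) - localCoord z (c q.1) - localCoord z q.2‖ ≤ ε * ‖localCoord z q.2‖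
  base : ∀ᶠ z' in 𝓝[f.1 ⁻¹' X] z, T f z' = z'
  inj : ∀ᶠ q : NewtonMap d × Sphere × Sphere in
    𝓝[𝒢] f ×ˢ (𝓝[f.1 ⁻¹' X] z ×ˢ 𝓝[f.1 ⁻¹' X] z), T q.1 q.2.1 = T q.1 q.2.2 → q.2.1 = q.2.2
  surj : ∀ W ∈ 𝓝 z, ∀ᶠ q : NewtonMap d × Sphere in 𝓝[𝒢] f ×ˢ 𝓝 z, ∀ y ∈ X,
    q.1.1 q.2 = H q.1 y → ∃ z' ∈ W, f.1 z' = y ∧ q.2 = T q.1 z'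
  unique : ∃ ε > 0, ∀ᶠ q : NewtonMap d × Sphere in 𝓝[𝒢] f ×ˢ 𝓝[f.1 ⁻¹' X] z, ∀ x,
    LiftRel H f z c ε q.1 q.2 x → x = T q.1 q.2
  cont : ∃ N ∈ 𝓝[𝒢] f, ∃ K ∈ 𝓝 z, ContinuousOn (Function.uncurry T) (N ×ˢ (K ∩ f.1 ⁻¹' X))

/-- The local lift sends `z'` to the unique solution of `LiftRel`. Its properties all come from this
uniqueness, its continuity because `LiftRel` is a closed relation. -/
lemma LiftCenter.exists_localLift (hd : 3 ≤ d) (M : GraphMotion f X 𝒢 H)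
    {z : Sphere} (hz : f.1 z ∈ X) {c : NewtonMap d → Sphere} {N : Set (NewtonMap d)}
    (C : LiftCenter f 𝒢 H z c N) : ∃ T, LocalLift f X 𝒢 H z c T := by
  obtain ⟨ε₀, hε₀, hε₀1, hex, hsurj⟩ := C.exists_liftRel hd M hz
  classical
  set T : NewtonMap d → Sphere → Sphere := fun g z' =>
    if h : ∃ x, LiftRel H f z c ε₀ g z' x then h.choose else z' with hT
  have hTspec : ∀ g z', (∃ x, LiftRel H f z c ε₀ g z' x) → LiftRel H f z c ε₀ g z' (T g z') := by
    intro g z' h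
    simp only [hT, dif_pos h]
    exact h.choose_spec
  have hTeq : ∀ g z' x, (∃! x, LiftRel H f z c ε₀ g z' x) → LiftRel H f z c ε₀ g z' x →
      x = T g z' := fun g z' x h hx => h.unique hx (hTspec g z' h.exists)
  have hE := hex ε₀ hε₀ le_rfl
  have hpure : ∀ {β : Type} {l : Filter β} {P : NewtonMap d × β → Prop},
      (∀ᶠ q in 𝓝[𝒢] f ×ˢ l, P q) → ∀ᶠ b in l, P (f, b) := by
    intro β l P h
    exact ((Filter.tendsto_const_pure.mono_right (pure_le_nhdsWithin M.mem)).prodMk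
      Filter.tendsto_id).eventually h
  have hFz : z ∈ f.1 ⁻¹' X := hz
  have hRel : ∀ ε > 0, ε ≤ ε₀ → ∀ᶠ q : NewtonMap d × Sphere in 𝓝[𝒢] f ×ˢ 𝓝[f.1 ⁻¹' X] z,
      LiftRel H f z c ε q.1 q.2 (T q.1 q.2) := by
    intro ε hε hle
    filter_upwards [hex ε hε hle, hE] with q hq1 hq2
    obtain ⟨x, hx⟩ := hq1.exists
    rwa [← hTeq _ _ _ hq2 (hx.mono hle)]
  have hconf : ∀ ε > 0, ∀ᶠ q : NewtonMap d × Sphere in 𝓝[𝒢] f ×ˢ 𝓝[f.1 ⁻¹' X] z,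
      ‖localCoord z (T q.1 q.2) - localCoord z (c q.1) - localCoord z q.2‖ ≤
        ε * ‖localCoord z q.2‖ := by
    intro ε hε
    filter_upwards [hRel (min ε ε₀) (lt_min hε hε₀) (min_le_right _ _)] with q hq
    exact (hq.mono (min_le_left _ _)).2.1
  have hdomz : ∀ᶠ z' in 𝓝[f.1 ⁻¹' X] z, z' ∈ chartDom z :=
    nhdsWithin_le_nhds ((isOpen_chartDom z).mem_nhds (mem_chartDom_self z))
  refine ⟨T, ?_, (hRel ε₀ hε₀ le_rfl).mono fun q hq => hq.2.2, hconf, ?_, ?_, ?_,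
    ⟨ε₀, hε₀, hE.mono fun q hq x hx => hTeq _ _ _ hq hx⟩, ?_⟩
  · have h1 : ∀ᶠ g in 𝓝[𝒢] f, LiftRel H f z c ε₀ g z (T g z) :=
      (Filter.tendsto_id.prodMk (Filter.tendsto_const_pure.mono_right
        (pure_le_nhdsWithin hFz))).eventually (hRel ε₀ hε₀ le_rfl)
    have h2 : ∀ᶠ g in 𝓝[𝒢] f, c g ∈ chartDom z :=
      (C.tendsto M).eventually ((isOpen_chartDom z).mem_nhds (mem_chartDom_self z))
    filter_upwards [h1, h2] with g hg hcg
    have := hg.2.1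
    rw [localCoord_self, norm_zero, mul_zero, sub_zero] at this
    exact localCoord_injOn z hg.1 hcg (sub_eq_zero.1 (norm_le_zero_iff.1 this))
  · filter_upwards [hpure hE, hdomz, self_mem_nhdsWithin] with z' h1 h2 h3
    refine (hTeq f z' z' h1 ⟨h2, ?_, (M.base _ h3).symm⟩).symm
    rw [C.base, localCoord_self, sub_zero, sub_self, norm_zero]
    positivity
  · -- equal images force relatively close coordinates, hence equality by uniqueness for `f`
    have h1 := hRel (ε₀ / 8) (by positivity) (by linarith)
    have h𝒢 : ∀ᶠ g in 𝓝[𝒢] f, g ∈ 𝒢 := eventually_mem_nhdsWithin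
    have hX : ∀ᶠ z' in 𝓝[f.1 ⁻¹' X] z, z' ∈ f.1 ⁻¹' X := eventually_mem_nhdsWithin
    have h2 := (hpure hE).and (hdomz.and hX)
    have hp1 : Tendsto (fun q : NewtonMap d × Sphere × Sphere => (q.1, q.2.1))
        (𝓝[𝒢] f ×ˢ (𝓝[f.1 ⁻¹' X] z ×ˢ 𝓝[f.1 ⁻¹' X] z)) (𝓝[𝒢] f ×ˢ 𝓝[f.1 ⁻¹' X] z) :=
      Filter.tendsto_fst.prodMk (Filter.tendsto_fst.comp Filter.tendsto_snd)
    have hp2 : Tendsto (fun q : NewtonMap d × Sphere × Sphere => (q.1, q.2.2))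
        (𝓝[𝒢] f ×ˢ (𝓝[f.1 ⁻¹' X] z ×ˢ 𝓝[f.1 ⁻¹' X] z)) (𝓝[𝒢] f ×ˢ 𝓝[f.1 ⁻¹' X] z) :=
      Filter.tendsto_fst.prodMk (Filter.tendsto_snd.comp Filter.tendsto_snd)
    filter_upwards [hp1.eventually h1, hp2.eventually h1, hp1.eventually (h2.prod_inr _),
      hp2.eventually (h2.prod_inr _), h𝒢.prod_inl _] with q hq1 hq2 hq3 hq4 hq5
    obtain ⟨g, z₁, z₂⟩ := q
    simp only at hq1 hq2 hq3 hq4 hq5 ⊢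
    intro heq
    have hfz : f.1 z₁ = f.1 z₂ := by
      refine M.inj g hq5 hq3.2.2 hq4.2.2 ?_
      rw [← hq1.2.2, ← hq2.2.2, heq]
    have hz₁ : z₁ = T f z₁ := by
      refine hTeq f z₁ z₁ hq3.1 ⟨hq3.2.1, ?_, (M.base _ hq3.2.2).symm⟩
      rw [C.base, localCoord_self, sub_zero, sub_self, norm_zero]
      positivity
    rw [hz₁]
    refine (hTeq f z₁ z₂ hq3.1 ⟨hq4.2.1, ?_, by rw [← hfz, M.base _ hq3.2.2]⟩).symm
    rw [C.base, localCoord_self, sub_zero]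
    have e1 := hq1.2.1
    have e2 := hq2.2.1
    rw [heq] at e1
    set s₁ := localCoord z z₁
    set s₂ := localCoord z z₂
    set w := localCoord z (T g z₂) - localCoord z (c g)
    have e3 : ‖s₂ - s₁‖ ≤ ‖w - s₁‖ + ‖w - s₂‖ := by
      calc ‖s₂ - s₁‖ = ‖(w - s₁) - (w - s₂)‖ := by congr 1; ring
        _ ≤ _ := norm_sub_le _ _
    have e4 : ‖s₂‖ ≤ ‖s₁‖ + ‖s₂ - s₁‖ := norm_le_insert' s₂ s₁
    have e5 : ε₀ * ‖s₂‖ ≤ ε₀ * ‖s₁‖ + ε₀ * ‖s₂ - s₁‖ := by rw [← mul_add]; gcongr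
    have e6 : ε₀ * ‖s₂ - s₁‖ ≤ ‖s₂ - s₁‖ := mul_le_of_le_one_left (norm_nonneg _) hε₀1.le
    have e7 := mul_nonneg hε₀.le (norm_nonneg s₁)
    linarith
  · intro W hW
    obtain ⟨N₁, hN₁, V, hV, hNV⟩ := Filter.mem_prod_iff.1 hE
    obtain ⟨V₀, hV₀, hV₀V⟩ := mem_nhdsWithin_iff_exists_mem_nhds_inter.1 hV
    have h1 : ∀ᶠ g in 𝓝[𝒢] f, g ∈ N₁ := hN₁
    filter_upwards [hsurj (W ∩ V₀) (Filter.inter_mem hW hV₀), h1.prod_inl _] with q hq hq1 y hy hqy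
    obtain ⟨z', hz', hfz', hrel⟩ := hq y hy hqy
    refine ⟨z', hz'.1, hfz', hTeq _ _ _ ?_ hrel⟩
    exact hNV (mk_mem_prod hq1 (hV₀V ⟨hz'.2, by rw [mem_preimage, hfz']; exact hy⟩) :
      (q.1, z') ∈ N₁ ×ˢ V)
  · obtain ⟨N₁, hN₁, V, hV, hNV⟩ := Filter.mem_prod_iff.1 hE
    obtain ⟨V₀, hV₀, hV₀V⟩ := mem_nhdsWithin_iff_exists_mem_nhds_inter.1 hV
    have hτ : ∀ᶠ g in 𝓝[𝒢] f, ‖localCoord z (c g)‖ ≤ 1 ∧ c g ∈ chartDom z := by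
      have h1 := ((tendsto_localCoord z).comp (C.tendsto M)).eventually
        (closedBall_mem_nhds (0 : ℂ) one_pos)
      have h2 : ∀ᶠ g in 𝓝[𝒢] f, c g ∈ chartDom z :=
        (C.tendsto M).eventually ((isOpen_chartDom z).mem_nhds (mem_chartDom_self z))
      filter_upwards [h1, h2] with g h1 h2
      exact ⟨by simpa using h1, h2⟩
    refine ⟨N₁ ∩ N ∩ {g | ‖localCoord z (c g)‖ ≤ 1 ∧ c g ∈ chartDom z},
      Filter.inter_mem (Filter.inter_mem hN₁ C.mem) hτ,
      V₀ ∩ localParam z '' closedBall 0 1,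
      Filter.inter_mem hV₀ (image_closedBall_mem_nhds z one_pos), ?_⟩
    set S := (N₁ ∩ N ∩ {g | ‖localCoord z (c g)‖ ≤ 1 ∧ c g ∈ chartDom z}) ×ˢ
      (V₀ ∩ localParam z '' closedBall 0 1 ∩ f.1 ⁻¹' X) with hS
    have hSE : ∀ q ∈ S, ∃! x, LiftRel H f z c ε₀ q.1 q.2 x := by
      rintro ⟨g, z'⟩ ⟨⟨⟨h1, h2⟩, h3⟩, ⟨h4, h5⟩, h6⟩
      exact hNV (mk_mem_prod h1 (hV₀V ⟨h4, h6⟩) : (g, z') ∈ N₁ ×ˢ V)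
    have hSs : ∀ q ∈ S, q.2 ∈ chartDom z ∧ ‖localCoord z q.2‖ ≤ 1 := by
      rintro ⟨g, z'⟩ ⟨-, ⟨-, ⟨t, ht, rfl⟩⟩, -⟩
      exact ⟨mem_chartDom_localParam _ _, by simpa using ht⟩
    have hSK : ∀ q ∈ S, T q.1 q.2 ∈ localParam z '' closedBall 0 3 := by
      intro q hq
      obtain ⟨h1, h2, -⟩ := hTspec _ _ (hSE q hq).exists
      refine ⟨_, ?_, localParam_localCoord h1⟩
      rw [mem_closedBall_zero_iff]
      have h3 := hq.1.2.1
      have h4 := (hSs q hq).2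
      set t := localCoord z (T q.1 q.2)
      set τ := localCoord z (c q.1)
      set s := localCoord z q.2
      calc ‖t‖ = ‖(t - τ - s) + τ + s‖ := by congr 1; ring
        _ ≤ ‖t - τ - s‖ + ‖τ‖ + ‖s‖ := (norm_add_le _ _).trans (by gcongr; exact norm_add_le _ _)
        _ ≤ 3 := by nlinarith
    intro q₀ hq₀
    refine tendsto_of_compact_unique (isCompact_image_closedBall z 3)
      (eventually_mem_nhdsWithin.mono hSK) fun y hy hne => ?_
    have hyd : y ∈ chartDom z := by
      obtain ⟨t, -, rfl⟩ := hy
      exact mem_chartDom_localParam _ _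
    have hSmem : ∀ᶠ q in 𝓝[S] q₀, q ∈ S := eventually_mem_nhdsWithin
    -- the relation is closed in all its variables
    have hnot : ¬ LiftRel H f z c ε₀ q₀.1 q₀.2 y := fun h => hne (hTeq _ _ _ (hSE q₀ hq₀) h)
    have hc : Tendsto (fun q : NewtonMap d × Sphere => localCoord z (c q.1)) (𝓝[S] q₀)
        (𝓝 (localCoord z (c q₀.1))) := by
      refine (continuousAt_localCoord hq₀.1.2.2).tendsto.comp ?_
      refine (C.cont q₀.1 hq₀.1.1.2).tendsto.comp ?_
      exact continuous_fst.continuousWithinAt.tendsto_nhdsWithin fun q hq => hq.1.1.2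
    have hs : Tendsto (fun q : NewtonMap d × Sphere => localCoord z q.2) (𝓝[S] q₀)
        (𝓝 (localCoord z q₀.2)) :=
      (continuousAt_localCoord (hSs q₀ hq₀).1).tendsto.comp
        (continuous_snd.tendsto q₀ |>.mono_left nhdsWithin_le_nhds)
    have hy' : Tendsto (localCoord z) (𝓝 y) (𝓝 (localCoord z y)) :=
      continuousAt_localCoord hyd
    have hg : Tendsto (fun p : (NewtonMap d × Sphere) × Sphere => p.1.1.1 p.2)
        (𝓝[S] q₀ ×ˢ 𝓝 y) (𝓝 (q₀.1.1 y)) :=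
      (continuous_newton_eval.tendsto (q₀.1, y)).comp ((((continuous_fst.tendsto q₀).mono_left
        nhdsWithin_le_nhds).comp Filter.tendsto_fst).prodMk_nhds Filter.tendsto_snd)
    have hH : Tendsto (fun q : NewtonMap d × Sphere => H q.1 (f.1 q.2)) (𝓝[S] q₀)
        (𝓝 (H q₀.1 (f.1 q₀.2))) := by
      have h0 := (M.cont (q₀.1, f.1 q₀.2) ⟨C.sub hq₀.1.1.2, hq₀.2.2⟩).tendsto
      refine h0.comp (f := fun q : NewtonMap d × Sphere => (q.1, f.1 q.2)) ?_
      refine ContinuousWithinAt.tendsto_nhdsWithin (f := fun q : NewtonMap d × Sphere =>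
        (q.1, f.1 q.2)) ?_ fun q hq => ⟨C.sub hq.1.1.2, hq.2.2⟩
      exact (continuous_fst.prodMk (f.1.continuous.comp continuous_snd)).continuousWithinAt
    by_cases hval : q₀.1.1 y = H q₀.1 (f.1 q₀.2)
    · have hlt : ε₀ * ‖localCoord z q₀.2‖ <
          ‖localCoord z y - localCoord z (c q₀.1) - localCoord z q₀.2‖ := by
        by_contra hcon
        exact hnot ⟨hyd, not_lt.1 hcon, hval⟩
      have h1 : Tendsto (fun p : (NewtonMap d × Sphere) × Sphere =>
          ε₀ * ‖localCoord z p.1.2‖) (𝓝[S] q₀ ×ˢ 𝓝 y) (𝓝 (ε₀ * ‖localCoord z q₀.2‖)) :=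
        ((hs.comp Filter.tendsto_fst).norm).const_mul _
      have h2 : Tendsto (fun p : (NewtonMap d × Sphere) × Sphere =>
          ‖localCoord z p.2 - localCoord z (c p.1.1) - localCoord z p.1.2‖) (𝓝[S] q₀ ×ˢ 𝓝 y)
          (𝓝 ‖localCoord z y - localCoord z (c q₀.1) - localCoord z q₀.2‖) :=
        (((hy'.comp Filter.tendsto_snd).sub (hc.comp Filter.tendsto_fst)).sub
          (hs.comp Filter.tendsto_fst)).norm
      filter_upwards [h1.eventually_lt h2 hlt, hSmem.prod_inl _] with p hp hpS heq
      refine hp.not_ge ?_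
      rw [← heq]
      exact (hTspec _ _ (hSE p.1 hpS).exists).2.1
    · filter_upwards [eventually_ne_of_tendsto hg (hH.comp Filter.tendsto_fst) hval,
        hSmem.prod_inl _] with p hp hpS heq
      apply hp
      rw [← heq]
      exact (hTspec _ _ (hSE p.1 hpS).exists).2.2

namespace LocalLift

/-- A local lift on a closed neighbourhood without further critical points. -/
lemma exists_closed_nhds (hd : 3 ≤ d)
    {z : Sphere} {c : NewtonMap d → Sphere} {T : NewtonMap d → Sphere → Sphere}
    (L : LocalLift f X 𝒢 H z c T) :
    ∃ K ∈ 𝓝 z, IsClosed K ∧ (∀ z₀ ∈ K, z₀ ≠ z → z₀ ∉ criticalPoints f.1) ∧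
      (∀ z₀ ∈ K ∩ f.1 ⁻¹' X, T f z₀ = z₀) ∧
      ∃ N ∈ 𝓝[𝒢] f, ContinuousOn (Function.uncurry T) (N ×ˢ (K ∩ f.1 ⁻¹' X)) ∧
        ∀ g ∈ N, ∀ z₀ ∈ K ∩ f.1 ⁻¹' X, g.1 (T g z₀) = H g (f.1 z₀) := by
  obtain ⟨N₁, hN₁, K₁, hK₁, hcont⟩ := L.cont
  obtain ⟨N₂, hN₂, V₂, hV₂, happ⟩ := Filter.mem_prod_iff.1 L.apply
  obtain ⟨K₂, hK₂, hK₂V⟩ := mem_nhdsWithin_iff_exists_mem_nhds_inter.1 hV₂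
  obtain ⟨K₃, hK₃, hK₃V⟩ := mem_nhdsWithin_iff_exists_mem_nhds_inter.1 L.base
  have hcrit := eventually_not_critical hd f z
  obtain ⟨K, ⟨hK, hKc⟩, hKs⟩ := (closed_nhds_basis z).mem_iff.1
    (Filter.inter_mem (Filter.inter_mem hK₁ hK₂) (Filter.inter_mem hK₃ hcrit))
  refine ⟨K, hK, hKc, fun z₀ hz₀ => (hKs hz₀).2.2, fun z₀ hz₀ => hK₃V ⟨(hKs hz₀.1).2.1, hz₀.2⟩,
    N₁ ∩ N₂, Filter.inter_mem hN₁ hN₂, hcont.mono (prod_mono inter_subset_left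
      (inter_subset_inter_left _ fun z₀ hz₀ => (hKs hz₀).1.1)), fun g hg z₀ hz₀ => ?_⟩
  exact happ (mk_mem_prod hg.2 (hK₂V ⟨(hKs hz₀.1).1.2, hz₀.2⟩) : (g, z₀) ∈ N₂ ×ˢ V₂)

end LocalLift

namespace GraphMotion

/-- Local lifts glue to a map that agrees with each of them near the base point: away from the
critical points, nearby preimages of the same point coincide. -/
lemma exists_glued (hd : 3 ≤ d) (M : GraphMotion f X 𝒢 H)
    {Y : Set Sphere} (hY : IsClosed Y) (hYX : Y ⊆ f.1 ⁻¹' X)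
    {c : Sphere → NewtonMap d → Sphere} {T : Sphere → NewtonMap d → Sphere → Sphere}
    (L : ∀ z ∈ Y, LocalLift f X 𝒢 H z (c z) (T z)) :
    ∃ H' : NewtonMap d → Sphere → Sphere, (∀ z ∈ Y, H' f z = z) ∧ ∀ z ∈ Y,
      ∀ᶠ q : NewtonMap d × Sphere in 𝓝[𝒢] f ×ˢ 𝓝[Y] z, H' q.1 q.2 = T z q.1 q.2 := by
  have hdata := fun z : Y => (L z z.2).exists_closed_nhds hd
  choose K hK hKc hcrit hbase N hN hcont happ using hdata
  have htend : ∀ (z : Y) (z₀ : Sphere), z₀ ∈ K z ∩ f.1 ⁻¹' X →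
      Tendsto (fun q : NewtonMap d × Sphere => T z q.1 q.2)
        (𝓝[𝒢] f ×ˢ 𝓝[K z ∩ f.1 ⁻¹' X] z₀) (𝓝 z₀) := by
    intro z z₀ hz₀
    have h1 := hcont z (f, z₀) ⟨mem_of_mem_nhdsWithin M.mem (hN z), hz₀⟩
    rw [ContinuousWithinAt, nhdsWithin_prod_eq] at h1
    change Tendsto _ _ (𝓝 (T z f z₀)) at h1
    rw [hbase z z₀ hz₀] at h1
    exact h1.mono_left (Filter.prod_mono_left _ (nhdsWithin_le_iff.2 (hN z)))
  -- two local lifts agree near every common point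
  have hagree : ∀ (z : Y) (z₀ : Y), (z₀ : Sphere) ∈ K z →
      ∀ᶠ q : NewtonMap d × Sphere in 𝓝[𝒢] f ×ˢ 𝓝[Y] z₀.1, q.2 ∈ K z →
        T z q.1 q.2 = T z₀ q.1 q.2 := by
    intro z z₀ hz₀
    by_cases heq : z₀ = z
    · subst heq
      exact Filter.Eventually.of_forall fun q _ => rfl
    have hnc := hcrit z z₀ hz₀ (fun h => heq (Subtype.ext h))
    have hF : (z₀ : Sphere) ∈ f.1 ⁻¹' X := hYX z₀.2
    have hKz₀ : (z₀ : Sphere) ∈ K z₀ := mem_of_mem_nhds (hK z₀)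
    have hle : 𝓝[K z ∩ K z₀ ∩ f.1 ⁻¹' X] z₀.1 ≤ 𝓝[K z ∩ f.1 ⁻¹' X] z₀.1 :=
      nhdsWithin_mono _ fun x hx => ⟨hx.1.1, hx.2⟩
    have hle' : 𝓝[K z ∩ K z₀ ∩ f.1 ⁻¹' X] z₀.1 ≤ 𝓝[K z₀ ∩ f.1 ⁻¹' X] z₀.1 :=
      nhdsWithin_mono _ fun x hx => ⟨hx.1.2, hx.2⟩
    have h1 := (htend z z₀ ⟨hz₀, hF⟩).mono_left (Filter.prod_mono_right (𝓝[𝒢] f) hle)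
    have h2 := (htend z₀ z₀ ⟨hKz₀, hF⟩).mono_left (Filter.prod_mono_right (𝓝[𝒢] f) hle')
    have h3 : Tendsto (fun q : NewtonMap d × Sphere => q.1)
        (𝓝[𝒢] f ×ˢ 𝓝[K z ∩ K z₀ ∩ f.1 ⁻¹' X] z₀.1) (𝓝 f) :=
      Filter.tendsto_fst.mono_right nhdsWithin_le_nhds
    have h4 := (h3.prodMk (h1.prodMk h2)).eventually (eventually_injective hd f hnc)
    have hN' : ∀ᶠ g in 𝓝[𝒢] f, g ∈ N z ∧ g ∈ N z₀ := Filter.inter_mem (hN z) (hN z₀)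
    have hm : ∀ᶠ z' in 𝓝[K z ∩ K z₀ ∩ f.1 ⁻¹' X] z₀.1, z' ∈ K z ∩ K z₀ ∩ f.1 ⁻¹' X :=
      eventually_mem_nhdsWithin
    have h5 : ∀ᶠ q : NewtonMap d × Sphere in 𝓝[𝒢] f ×ˢ 𝓝[K z ∩ K z₀ ∩ f.1 ⁻¹' X] z₀.1,
        T z q.1 q.2 = T z₀ q.1 q.2 := by
      filter_upwards [h4, hN'.prod_inl _, hm.prod_inr _] with q hq1 hq2 hq3
      refine (hq1 ?_).symm
      rw [happ z q.1 hq2.1 q.2 ⟨hq3.1.1, hq3.2⟩, happ z₀ q.1 hq2.2 q.2 ⟨hq3.1.2, hq3.2⟩]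
    obtain ⟨U, hU, V, hV, hUV⟩ := Filter.mem_prod_iff.1 h5
    obtain ⟨V₀, hV₀, hV₀V⟩ := mem_nhdsWithin_iff_exists_mem_nhds_inter.1 hV
    have hU' : ∀ᶠ g in 𝓝[𝒢] f, g ∈ U := hU
    have hV' : ∀ᶠ z' in 𝓝[Y] z₀.1, z' ∈ V₀ ∩ K z₀ ∩ Y :=
      Filter.inter_mem (nhdsWithin_le_nhds (Filter.inter_mem hV₀ (hK z₀))) self_mem_nhdsWithin
    filter_upwards [hU'.prod_inl _, hV'.prod_inr _] with q hq1 hq2 hq3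
    exact hUV (mk_mem_prod hq1 (hV₀V ⟨hq2.1.1, ⟨hq3, hq2.1.2⟩, hYX hq2.2⟩) : q ∈ U ×ˢ V)
  obtain ⟨t, ht⟩ := hY.isCompact.elim_nhds_subcover' (fun z hz => K ⟨z, hz⟩) fun z hz => hK ⟨z, hz⟩
  have hcov : ∀ z ∈ Y, ∃ i ∈ t, z ∈ K i := by
    intro z hz
    obtain ⟨i, hi, hzi⟩ := mem_iUnion₂.1 (ht hz)
    exact ⟨i, hi, hzi⟩
  classical
  refine ⟨fun g z => if h : z ∈ Y then T (hcov z h).choose g z else z, fun z hz => ?_,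
    fun z₀ hz₀ => ?_⟩
  · obtain ⟨-, h2⟩ := (hcov z hz).choose_spec
    simp only [dif_pos hz]
    exact hbase _ z ⟨h2, hYX hz⟩
  · have h1 : ∀ᶠ q : NewtonMap d × Sphere in 𝓝[𝒢] f ×ˢ 𝓝[Y] z₀, ∀ i ∈ t, q.2 ∈ K i →
        T i q.1 q.2 = T z₀ q.1 q.2 := by
      rw [Filter.eventually_all_finset]
      intro i _
      by_cases hi : z₀ ∈ K i
      · exact hagree i ⟨z₀, hz₀⟩ hi
      · have h2 : ∀ᶠ z' in 𝓝[Y] z₀, z' ∉ K i :=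
          nhdsWithin_le_nhds ((hKc i).isOpen_compl.mem_nhds hi)
        exact (h2.prod_inr _).mono fun q hq hq' => absurd hq' hq
    have h2 : ∀ᶠ z' in 𝓝[Y] z₀, z' ∈ Y := eventually_mem_nhdsWithin
    filter_upwards [h1, h2.prod_inr _] with q hq1 hq2
    simp only [dif_pos hq2]
    obtain ⟨h3, h4⟩ := (hcov q.2 hq2).choose_spec
    exact hq1 _ h3 h4

/-- A motion of `X` lifts to a motion of the closed and relatively open part `Y` of the preimage
of `X`, as soon as the points of `Y` can be followed with their local degrees. -/
lemma lift (hd : 3 ≤ d) (M : GraphMotion f X 𝒢 H)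
    {Y O O' : Set Sphere} (hY : IsClosed Y) (hYX : Y ⊆ f.1 ⁻¹' X) (hXY : X ⊆ Y)
    (hO : IsOpen O) (hO' : IsOpen O') (hYO : Y ⊆ O) (hYO' : f.1 ⁻¹' X \ Y ⊆ O')
    (hdisj : Disjoint O O')
    (hC : ∀ z ∈ Y, ∃ c N, LiftCenter f 𝒢 H z c N) :
    ∃ 𝒢' ⊆ 𝒢, 𝒢' ∈ 𝓝[𝒢] f ∧ ∃ H', GraphMotion f Y 𝒢' H' ∧
      (∀ g ∈ 𝒢', ∀ x ∈ X, H' g x = H g x) ∧ (∀ g ∈ 𝒢', H' g '' Y ⊆ O) ∧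
      ∀ g ∈ 𝒢', ∀ x, g.1 x ∈ H g '' X → x ∈ H' g '' Y ∨ x ∈ O' := by
  choose! c N C using hC
  have hL : ∀ z ∈ Y, ∃ T, LocalLift f X 𝒢 H z (c z) T := fun z hz =>
    (C z hz).exists_localLift hd M (hYX hz)
  choose! T L using hL
  obtain ⟨H', hbase, hH'⟩ := M.exists_glued hd hY hYX L
  have hmono : ∀ z₀, 𝓝[𝒢] f ×ˢ 𝓝[Y] z₀ ≤ 𝓝[𝒢] f ×ˢ 𝓝[f.1 ⁻¹' X] z₀ := fun z₀ =>
    Filter.prod_mono_right _ (nhdsWithin_mono _ hYX)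
  have hmono' : ∀ z₀, 𝓝[𝒢] f ×ˢ 𝓝[X] z₀ ≤ 𝓝[𝒢] f ×ˢ 𝓝[Y] z₀ := fun z₀ =>
    Filter.prod_mono_right _ (nhdsWithin_mono _ hXY)
  have h𝒢 : ∀ᶠ g in 𝓝[𝒢] f, g ∈ 𝒢 := eventually_mem_nhdsWithin
  -- continuity
  have hcont : ∃ 𝒩 ∈ 𝓝[𝒢] f, ContinuousOn (Function.uncurry H') (𝒩 ×ˢ Y) := by
    have h1 : ∀ᶠ 𝒩 in (𝓝[𝒢] f).smallSets, ∀ z ∈ Y, ∀ g ∈ 𝒩,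
        ContinuousWithinAt (Function.uncurry H') (𝒩 ×ˢ Y) (g, z) := by
      refine eventually_forall_compact hY.isCompact fun z₀ hz₀ => ?_
      obtain ⟨N₁, hN₁, V, hV, hNV⟩ := Filter.mem_prod_iff.1 (hH' z₀ hz₀)
      obtain ⟨N₂, hN₂, K, hK, hNK⟩ := (L z₀ hz₀).cont
      obtain ⟨V₀, hV₀, hV₀V⟩ := mem_nhdsWithin_iff_exists_mem_nhds_inter.1 hV
      have h2 : ∀ᶠ 𝒩 in (𝓝[𝒢] f).smallSets, 𝒩 ⊆ N₁ ∩ N₂ :=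
        Filter.eventually_smallSets.2 ⟨_, Filter.inter_mem hN₁ hN₂, fun t ht => ht⟩
      have h3 : ∀ᶠ z in 𝓝[Y] z₀, z ∈ Y ∧ z ∈ interior (V₀ ∩ K) :=
        Filter.inter_mem self_mem_nhdsWithin (nhdsWithin_le_nhds
          (interior_mem_nhds.2 (Filter.inter_mem hV₀ hK)))
      filter_upwards [h2.prod_inl _, h3.prod_inr _] with q hq1 hq2 g hg
      obtain ⟨𝒩, z⟩ := q
      simp only at hq1 hq2 hg ⊢
      have hsub : interior (V₀ ∩ K) ⊆ V₀ ∩ K := interior_subset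
      have h4 : ContinuousOn (Function.uncurry H') (𝒩 ×ˢ (interior (V₀ ∩ K) ∩ Y)) := by
        refine (hNK.mono (prod_mono (hq1.trans inter_subset_right)
          fun x hx => ⟨(hsub hx.1).2, hYX hx.2⟩)).congr fun q hq => ?_
        exact hNV (mk_mem_prod (hq1 hq.1).1 (hV₀V ⟨(hsub hq.2.1).1, hq.2.2⟩) : q ∈ N₁ ×ˢ V)
      refine (h4 (g, z) ⟨hg, hq2.2, hq2.1⟩).mono_of_mem_nhdsWithin ?_
      rw [nhdsWithin_prod_eq]
      exact Filter.prod_mem_prod self_mem_nhdsWithin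
        (Filter.inter_mem (nhdsWithin_le_nhds (isOpen_interior.mem_nhds hq2.2))
          self_mem_nhdsWithin)
    obtain ⟨𝒩, h𝒩, h⟩ := Filter.eventually_smallSets.1 h1
    exact ⟨𝒩, h𝒩, fun q hq => h 𝒩 subset_rfl q.2 hq.2 q.1 hq.1⟩
  obtain ⟨𝒩, h𝒩, hcont⟩ := hcont
  have htend : ∀ z₀ ∈ Y, Tendsto (fun q : NewtonMap d × Sphere => H' q.1 q.2)
      (𝓝[𝒢] f ×ˢ 𝓝[Y] z₀) (𝓝 z₀) := by
    intro z₀ hz₀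
    have h1 := hcont (f, z₀) ⟨mem_of_mem_nhdsWithin M.mem h𝒩, hz₀⟩
    rw [ContinuousWithinAt, nhdsWithin_prod_eq] at h1
    change Tendsto _ _ (𝓝 (H' f z₀)) at h1
    rw [hbase z₀ hz₀] at h1
    exact h1.mono_left (Filter.prod_mono_left _ (nhdsWithin_le_iff.2 h𝒩))
  have hcenter : ∀ z₀ ∈ Y, ∀ᶠ g in 𝓝[𝒢] f, H' g z₀ = c z₀ g := by
    intro z₀ hz₀
    have h1 : ∀ᶠ g in 𝓝[𝒢] f, H' g z₀ = T z₀ g z₀ :=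
      (Filter.tendsto_id.prodMk (Filter.tendsto_const_pure.mono_right
        (pure_le_nhdsWithin hz₀))).eventually (hH' z₀ hz₀)
    filter_upwards [h1, (L z₀ hz₀).center] with g h1 h2 using h1.trans h2
  have happ : ∀ᶠ g in 𝓝[𝒢] f, ∀ z ∈ Y, g.1 (H' g z) = H g (f.1 z) := by
    refine eventually_forall_compact hY.isCompact fun z₀ hz₀ => ?_
    filter_upwards [hH' z₀ hz₀, hmono z₀ (L z₀ hz₀).apply] with q hq1 hq2
    rw [hq1]
    exact hq2
  -- agreement with the given motion
  have hext : ∀ᶠ g in 𝓝[𝒢] f, ∀ x ∈ X, H' g x = H g x := by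
    refine eventually_forall_compact M.closed.isCompact fun z₀ hz₀ => ?_
    have hz₀Y := hXY hz₀
    obtain ⟨ε, hε, huniq⟩ := (L z₀ hz₀Y).unique
    -- both the center and the given motion solve the equation at `z₀`, the former with full multiplicity
    have hcz : ∀ᶠ g in 𝓝[𝒢] f, H g z₀ = c z₀ g := by
      have h1 : Tendsto (fun g => H g z₀) (𝓝[𝒢] f) (𝓝 z₀) :=
        (M.continuousWithinAt_base hz₀).comp (Filter.tendsto_id.prodMk
          (Filter.tendsto_const_pure.mono_right (pure_le_nhdsWithin hz₀)))
      have h2 : Tendsto (fun g : NewtonMap d => g) (𝓝[𝒢] f) (𝓝 f) :=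
        Filter.tendsto_id.mono_right nhdsWithin_le_nhds
      have hNc : ∀ᶠ g in 𝓝[𝒢] f, g ∈ N z₀ := (C z₀ hz₀Y).mem
      filter_upwards [(h2.prodMk (((C z₀ hz₀Y).tendsto M).prodMk h1)).eventually
        (eventually_eq_of_apply_eq hd f z₀), hNc] with g hg hgN
      have hg𝒢 := (C z₀ hz₀Y).sub hgN
      refine hg (fun h => (C z₀ hz₀Y).infty h g hgN) (fun h => ?_) ((C z₀ hz₀Y).deg g hgN).ge ?_
      · rw [(C z₀ hz₀Y).apply g hgN, h, M.infty g hg𝒢]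
      · rw [(C z₀ hz₀Y).apply g hgN, M.equiv g hg𝒢 z₀ hz₀]
    have hHd : ∀ᶠ q : NewtonMap d × Sphere in 𝓝[𝒢] f ×ˢ 𝓝[X] z₀, H q.1 q.2 ∈ chartDom z₀ :=
      (M.continuousWithinAt_base hz₀).eventually
        ((isOpen_chartDom z₀).mem_nhds (mem_chartDom_self z₀))
    have hX : ∀ᶠ x in 𝓝[X] z₀, x ∈ X := eventually_mem_nhdsWithin
    filter_upwards [hmono' z₀ (hH' z₀ hz₀Y), hmono' z₀ (hmono z₀ huniq), M.conf z₀ hz₀ ε hε, hHd,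
      hcz.prod_inl _, hX.prod_inr _, h𝒢.prod_inl _] with q hq1 hq2 hq3 hq4 hq5 hq6 hq7
    rw [hq1]
    refine (hq2 _ ⟨hq4, ?_, M.equiv _ hq7 _ hq6⟩).symm
    rw [← hq5]
    exact hq3
  have hinj : ∀ᶠ g in 𝓝[𝒢] f, ∀ p ∈ Y ×ˢ Y, H' g p.1 = H' g p.2 → p.1 = p.2 := by
    refine eventually_forall_compact (hY.isCompact.prod hY.isCompact) fun p hp => ?_
    obtain ⟨z₁, z₂⟩ := p
    obtain ⟨hz₁, hz₂⟩ := hp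
    simp only at hz₁ hz₂
    rw [nhdsWithin_prod_eq]
    have hp1 : Tendsto (fun q : NewtonMap d × Sphere × Sphere => (q.1, q.2.1))
        (𝓝[𝒢] f ×ˢ (𝓝[Y] z₁ ×ˢ 𝓝[Y] z₂)) (𝓝[𝒢] f ×ˢ 𝓝[Y] z₁) :=
      Filter.tendsto_fst.prodMk (Filter.tendsto_fst.comp Filter.tendsto_snd)
    have hp2 : Tendsto (fun q : NewtonMap d × Sphere × Sphere => (q.1, q.2.2))
        (𝓝[𝒢] f ×ˢ (𝓝[Y] z₁ ×ˢ 𝓝[Y] z₂)) (𝓝[𝒢] f ×ˢ 𝓝[Y] z₂) :=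
      Filter.tendsto_fst.prodMk (Filter.tendsto_snd.comp Filter.tendsto_snd)
    by_cases heq : z₁ = z₂
    · subst heq
      have hle : 𝓝[𝒢] f ×ˢ (𝓝[Y] z₁ ×ˢ 𝓝[Y] z₁) ≤
          𝓝[𝒢] f ×ˢ (𝓝[f.1 ⁻¹' X] z₁ ×ˢ 𝓝[f.1 ⁻¹' X] z₁) :=
        Filter.prod_mono_right _ (Filter.prod_mono (nhdsWithin_mono _ hYX) (nhdsWithin_mono _ hYX))
      filter_upwards [hp1.eventually (hH' z₁ hz₁), hp2.eventually (hH' z₁ hz₁),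
        hle (L z₁ hz₁).inj] with q hq1 hq2 hq3 hq4
      rw [hq1, hq2] at hq4
      exact hq3 hq4
    · filter_upwards [eventually_ne_of_tendsto ((htend z₁ hz₁).comp hp1)
        ((htend z₂ hz₂).comp hp2) heq] with q hq hq'
      exact absurd hq' hq
  have himg : ∀ᶠ g in 𝓝[𝒢] f, ∀ z ∈ Y, H' g z ∈ O :=
    eventually_forall_compact hY.isCompact fun z₀ hz₀ =>
      (htend z₀ hz₀).eventually (hO.mem_nhds (hYO hz₀))
  have hsurj : ∀ᶠ g in 𝓝[𝒢] f, ∀ x ∈ (univ : Set Sphere), ∀ y ∈ X, g.1 x = H g y →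
      x ∈ H' g '' Y ∨ x ∈ O' := by
    refine eventually_forall_compact isCompact_univ fun x₀ _ => ?_
    rw [nhdsWithin_univ]
    -- solutions near a point of `Y` are lifts, those near the rest of the preimage lie in `O'`, and
    -- there are none near the other points
    by_cases hx₀ : f.1 x₀ ∈ X
    · by_cases hx₀Y : x₀ ∈ Y
      · obtain ⟨N₁, hN₁, V, hV, hNV⟩ := Filter.mem_prod_iff.1 (hH' x₀ hx₀Y)
        obtain ⟨V₀, hV₀, hV₀V⟩ := mem_nhdsWithin_iff_exists_mem_nhds_inter.1 hV
        have hN₁' : ∀ᶠ g in 𝓝[𝒢] f, g ∈ N₁ := hN₁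
        filter_upwards [(L x₀ hx₀Y).surj (V₀ ∩ O) (Filter.inter_mem hV₀
          (hO.mem_nhds (hYO hx₀Y))), hN₁'.prod_inl _] with q hq1 hq2 y hy hqy
        obtain ⟨z', hz', hfz', hqz'⟩ := hq1 y hy hqy
        have hz'Y : z' ∈ Y := by
          by_contra hcon
          exact disjoint_left.1 hdisj hz'.2 (hYO' ⟨by rw [mem_preimage, hfz']; exact hy, hcon⟩)
        refine Or.inl ⟨z', hz'Y, ?_⟩
        rw [hqz']
        exact hNV (mk_mem_prod hq2 (hV₀V ⟨hz'.1, hz'Y⟩) : (q.1, z') ∈ N₁ ×ˢ V)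
      · have h1 : ∀ᶠ x in 𝓝 x₀, x ∈ O' := hO'.mem_nhds (hYO' ⟨hx₀, hx₀Y⟩)
        exact (h1.prod_inr _).mono fun q hq y _ _ => Or.inr hq
    · have h1 : ∀ᶠ q : NewtonMap d × Sphere in 𝓝[𝒢] f ×ˢ 𝓝 x₀, ∀ y ∈ X,
          q.1.1 q.2 ≠ H q.1 y := by
        refine eventually_forall_compact M.closed.isCompact fun y hy => ?_
        have h1 : Tendsto (fun p : (NewtonMap d × Sphere) × Sphere => p.1.1.1 p.1.2)
            ((𝓝[𝒢] f ×ˢ 𝓝 x₀) ×ˢ 𝓝[X] y) (𝓝 (f.1 x₀)) := by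
          refine ((continuous_newton_eval.tendsto (f, x₀)).mono_left ?_).comp Filter.tendsto_fst
          rw [nhds_prod_eq]; exact Filter.prod_mono_left _ nhdsWithin_le_nhds
        have h2 : Tendsto (fun p : (NewtonMap d × Sphere) × Sphere => H p.1.1 p.2)
            ((𝓝[𝒢] f ×ˢ 𝓝 x₀) ×ˢ 𝓝[X] y) (𝓝 y) :=
          (M.continuousWithinAt_base hy).comp
            ((Filter.tendsto_fst.comp Filter.tendsto_fst).prodMk Filter.tendsto_snd)
        exact eventually_ne_of_tendsto h1 h2 fun h => hx₀ (h ▸ hy)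
      exact h1.mono fun q hq y hy hqy => absurd hqy (hq y hy)
  obtain ⟨𝒰, h𝒰, h𝒰'⟩ : ∃ 𝒰 ∈ 𝓝[𝒢] f, ∀ g ∈ 𝒰, g ∈ 𝒢 ∧ g ∈ 𝒩 ∧
      (∀ z ∈ Y, g.1 (H' g z) = H g (f.1 z)) ∧ (∀ x ∈ X, H' g x = H g x) ∧
      (∀ p ∈ Y ×ˢ Y, H' g p.1 = H' g p.2 → p.1 = p.2) ∧ (∀ z ∈ Y, H' g z ∈ O) ∧
      (∀ x ∈ (univ : Set Sphere), ∀ y ∈ X, g.1 x = H g y → x ∈ H' g '' Y ∨ x ∈ O') :=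
    ⟨_, Filter.inter_mem self_mem_nhdsWithin (Filter.inter_mem h𝒩 (Filter.inter_mem happ
      (Filter.inter_mem hext (Filter.inter_mem hinj (Filter.inter_mem himg hsurj))))),
      fun g hg => ⟨hg.1, hg.2.1, hg.2.2.1, hg.2.2.2.1, hg.2.2.2.2.1, hg.2.2.2.2.2.1,
        hg.2.2.2.2.2.2⟩⟩
  have hnhds : 𝓝[𝒰] f = 𝓝[𝒢] f :=
    le_antisymm (nhdsWithin_mono _ fun g hg => (h𝒰' g hg).1) (nhdsWithin_le_iff.2 h𝒰)
  refine ⟨𝒰, fun g hg => (h𝒰' g hg).1, h𝒰, H', ?_, fun g hg => (h𝒰' g hg).2.2.2.1, ?_, ?_⟩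
  · refine ⟨hY, mem_of_mem_nhdsWithin M.mem h𝒰, hXY M.infty_mem, fun z hz => hXY (hYX hz),
      hcont.mono (prod_mono (fun g hg => (h𝒰' g hg).2.1) subset_rfl), hbase, fun g hg => ?_,
      fun g hg z₁ hz₁ z₂ hz₂ h => (h𝒰' g hg).2.2.2.2.1 (z₁, z₂) ⟨hz₁, hz₂⟩ h,
      fun g hg z hz => ?_, fun v hv ε hε => ?_, fun v hv => ?_⟩
    · rw [(h𝒰' g hg).2.2.2.1 _ M.infty_mem, M.infty g (h𝒰' g hg).1]
    · rw [(h𝒰' g hg).2.2.1 z hz, (h𝒰' g hg).2.2.2.1 _ (hYX hz)]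
    · rw [hnhds]
      filter_upwards [hH' v hv, hmono v ((L v hv).conf ε hε), (hcenter v hv).prod_inl _]
        with q hq1 hq2 hq3
      rw [hq1, hq3]
      exact hq2
    · rw [hnhds]
      have hNc : ∀ᶠ g in 𝓝[𝒢] f, g ∈ N v := (C v hv).mem
      filter_upwards [hcenter v hv, hNc] with g hg1 hg2
      rw [hg1, (C v hv).deg g hg2]
  · rintro g hg _ ⟨z, hz, rfl⟩
    exact (h𝒰' g hg).2.2.2.2.2.1 z hz
  · rintro g hg x ⟨y, hy, hyx⟩
    exact (h𝒰' g hg).2.2.2.2.2.2 x (mem_univ x) y hy hyx.symm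

end GraphMotion

/-! ### Components of preimages -/

lemma newtonGraph_zero (hd : 3 ≤ d) (B : BottcherSystem f)
    {g : NewtonMap d} (hg : g ∈ B.dom) : newtonGraph g.1 0 = newtonGraphZero g.1 := by
  rw [newtonGraph]
  exact (B.isPreconnected_newtonGraphZero hd hg).connectedComponentIn (Or.inl rfl)

lemma infty_mem_iterate_preimage (g : NewtonMap d) (n : ℕ) :
    ∞ ∈ g.1^[n] ⁻¹' newtonGraphZero g.1 := by
  rw [mem_preimage, Function.iterate_fixed g.map_infty n]
  exact Or.inl rfl

lemma infty_mem_newtonGraph (g : NewtonMap d) (n : ℕ) :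
    ∞ ∈ newtonGraph g.1 n :=
  mem_connectedComponentIn (infty_mem_iterate_preimage g n)

/-- The graph of level `n + 1` is a component of the preimage of the graph of level `n`, because `g`
maps a connected set through `∞` to a connected set through `∞`. -/
lemma newtonGraph_succ (g : NewtonMap d) (n : ℕ) :
    newtonGraph g.1 (n + 1) =
      connectedComponentIn (g.1 ⁻¹' newtonGraph g.1 n) ∞ := by
  refine subset_antisymm ?_ ?_
  · refine isPreconnected_connectedComponentIn.subset_connectedComponentIn
      (infty_mem_newtonGraph g (n + 1)) ?_
    rw [← image_subset_iff]
    refine (isPreconnected_connectedComponentIn.image _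
      g.1.continuous.continuousOn).subset_connectedComponentIn
      ⟨_, infty_mem_newtonGraph g (n + 1), g.map_infty⟩ ?_
    rintro _ ⟨z, hz, rfl⟩
    have := connectedComponentIn_subset _ _ hz
    rwa [mem_preimage, Function.iterate_succ_apply] at this
  · refine connectedComponentIn_mono _ fun z hz => ?_
    have := connectedComponentIn_subset _ _ (mem_preimage.1 hz)
    rwa [mem_preimage, Function.iterate_succ_apply]

lemma newtonGraph_subset_succ (g : NewtonMap d) (n : ℕ) :
    newtonGraph g.1 n ⊆ newtonGraph g.1 (n + 1) := by
  rw [newtonGraph_succ]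
  exact isPreconnected_connectedComponentIn.subset_connectedComponentIn
    (infty_mem_newtonGraph g n) (mapsTo_newtonGraph g n)

lemma isClosed_connectedComponentIn {α : Type*} [TopologicalSpace α] {F : Set α} (hF : IsClosed F)
    (x : α) : IsClosed (connectedComponentIn F x) := by
  by_cases hx : x ∈ F
  · rw [connectedComponentIn_eq_image hx]
    exact hF.isClosedEmbedding_subtypeVal.isClosedMap _ isClosed_connectedComponent
  · rw [connectedComponentIn_eq_empty hx]
    exact isClosed_empty

/-- A component of a closed set can be separated from finitely many points outside it by a
relatively open and closed part of the set. -/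
lemma exists_separation_component {α : Type*} [TopologicalSpace α] [CompactSpace α] [T2Space α]
    {F : Set α} (hF : IsClosed F) {x : α} (hx : x ∈ F) {A : Set α} (hA : A.Finite) :
    ∃ Y O O' : Set α, IsClosed Y ∧ Y ⊆ F ∧ connectedComponentIn F x ⊆ Y ∧
      (∀ a ∈ A, a ∈ Y → a ∈ connectedComponentIn F x) ∧ IsOpen O ∧ IsOpen O' ∧ Y ⊆ O ∧
      F \ Y ⊆ O' ∧ Disjoint O O' := by
  have : CompactSpace F := isCompact_iff_compactSpace.1 hF.isCompact
  rw [connectedComponentIn_eq_image hx]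
  have hsep : ∀ a : α, ∃ Z : Set F, IsClopen Z ∧ connectedComponent ⟨x, hx⟩ ⊆ Z ∧
      (a ∈ ((↑) : F → α) '' Z → a ∈ ((↑) : F → α) '' connectedComponent (⟨x, hx⟩ : F)) := by
    intro a
    by_cases ha : ∃ h : a ∈ F, (⟨a, h⟩ : F) ∉ connectedComponent (⟨x, hx⟩ : F)
    · obtain ⟨haF, hac⟩ := ha
      rw [connectedComponent_eq_iInter_isClopen, mem_iInter] at hac
      push Not at hac
      obtain ⟨⟨Z, hZ, hxZ⟩, haZ⟩ := hac
      refine ⟨Z, hZ, hZ.connectedComponent_subset hxZ, ?_⟩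
      rintro ⟨y, hy, rfl⟩
      exact absurd hy haZ
    · push Not at ha
      refine ⟨univ, isClopen_univ, subset_univ _, ?_⟩
      rintro ⟨y, -, rfl⟩
      exact ⟨y, ha y.2, rfl⟩
  choose Z hZ hxZ hZa using hsep
  set W : Set F := ⋂ a ∈ A, Z a with hW
  have hWc : IsClopen W := hA.isClopen_biInter fun a _ => hZ a
  have hemb := hF.isClosedEmbedding_subtypeVal
  have hY : IsClosed (((↑) : F → α) '' W) := hemb.isClosedMap _ hWc.isClosed
  have hY' : IsClosed (((↑) : F → α) '' Wᶜ) := hemb.isClosedMap _ hWc.compl.isClosed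
  have hdisj : Disjoint (((↑) : F → α) '' W) (((↑) : F → α) '' Wᶜ) :=
    (disjoint_image_iff Subtype.val_injective).2 disjoint_compl_right
  obtain ⟨O, O', hO, hO', hYO, hYO', hOO⟩ := normal_separation hY hY' hdisj
  refine ⟨_, O, O', hY, by rintro _ ⟨y, -, rfl⟩; exact y.2, ?_, fun a ha haY => ?_, hO, hO', hYO,
    ?_, hOO⟩
  · exact image_mono (subset_iInter₂ fun a _ => hxZ a)
  · exact hZa a (image_mono (biInter_subset_of_mem ha) haY)
  · rintro y ⟨hyF, hy⟩
    exact hYO' ⟨⟨y, hyF⟩, fun h => hy ⟨_, h, rfl⟩, rfl⟩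

/-- Critical points are isolated and the sphere is compact. -/
lemma finite_criticalPoints (hd : 3 ≤ d) (f : NewtonMap d) :
    (criticalPoints f.1).Finite := by
  obtain ⟨t, -, ht⟩ := isCompact_univ.elim_nhds_subcover
    (fun z : Sphere => {x | x ≠ z → x ∉ criticalPoints f.1})
    fun z _ => eventually_not_critical hd f z
  refine t.finite_toSet.subset fun x hx => ?_
  obtain ⟨z, hz, hxz⟩ := mem_iUnion₂.1 (ht (mem_univ x))
  by_contra hcon
  exact hxz (fun h => hcon (h ▸ hz)) hx

namespace GraphMotion

lemma restrict (M : GraphMotion f X 𝒢 H) {S : Set Sphere}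
    (hS : IsClosed S) (hSX : S ⊆ X) (hinf : ∞ ∈ S) (hmaps : MapsTo f.1 S S) :
    GraphMotion f S 𝒢 H :=
  ⟨hS, M.mem, hinf, hmaps, M.cont.mono (prod_mono subset_rfl hSX), fun z hz => M.base z (hSX hz),
    M.infty, fun g hg => (M.inj g hg).mono hSX, fun g hg z hz => M.equiv g hg z (hSX hz),
    fun v hv ε hε => Filter.prod_mono_right _ (nhdsWithin_mono _ hSX) (M.conf v (hSX hv) ε hε),
    fun v hv => M.deg v (hSX hv)⟩

/-- A lifted motion carries the component of the preimage onto the corresponding component: the latter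
cannot leave the open set `O` without meeting the complement of the disjoint sets `O` and `O'`, so
it lies in the image of `Y` and can be pulled back by the inverse of the motion. -/
lemma image_component {Y O O' : Set Sphere} {H' : NewtonMap d → Sphere → Sphere}
    (M' : GraphMotion f Y 𝒢 H') (hYX : Y ⊆ f.1 ⁻¹' X)
    (hSY : connectedComponentIn (f.1 ⁻¹' X) ∞ ⊆ Y)
    (hO : IsOpen O) (hO' : IsOpen O') (hdisj : Disjoint O O') {g : NewtonMap d} (hg : g ∈ 𝒢)
    (hext : ∀ x ∈ X, H' g x = H g x) (himg : H' g '' Y ⊆ O)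
    (hsurj : ∀ x, g.1 x ∈ H g '' X → x ∈ H' g '' Y ∨ x ∈ O') :
    H' g '' connectedComponentIn (f.1 ⁻¹' X) ∞ =
      connectedComponentIn (g.1 ⁻¹' (H g '' X)) ∞ := by
  have hinfX : ∞ ∈ X := by
    have := hYX M'.infty_mem
    rwa [mem_preimage, f.map_infty] at this
  have hinfS : ∞ ∈ connectedComponentIn (f.1 ⁻¹' X) ∞ :=
    mem_connectedComponentIn (hYX M'.infty_mem)
  have hinf : ∞ ∈ g.1 ⁻¹' (H g '' X) := by
    refine ⟨∞, hinfX, ?_⟩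
    rw [← hext _ hinfX, M'.infty g hg, g.map_infty]
  have hcg : ContinuousOn (H' g) Y :=
    M'.cont.comp (f := fun z => (g, z)) (by fun_prop) fun z hz => ⟨hg, hz⟩
  refine subset_antisymm ?_ ?_
  · refine (isPreconnected_connectedComponentIn.image _
      (hcg.mono hSY)).subset_connectedComponentIn ⟨_, hinfS, M'.infty g hg⟩ ?_
    rintro _ ⟨z, hz, rfl⟩
    have hzX : f.1 z ∈ X := hYX (hSY hz)
    exact ⟨f.1 z, hzX, by rw [M'.equiv g hg z (hSY hz), hext _ hzX]⟩
  · set C := connectedComponentIn (g.1 ⁻¹' (H g '' X)) ∞ with hC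
    have hCpre : IsPreconnected C := isPreconnected_connectedComponentIn
    have hinfC : ∞ ∈ C := mem_connectedComponentIn hinf
    have hCsub : ∀ x ∈ C, x ∈ H' g '' Y ∨ x ∈ O' := fun x hx => by
      have hx' : x ∈ g.1 ⁻¹' (H g '' X) := connectedComponentIn_subset _ _ hx
      exact hsurj x hx'
    have hCO : C ⊆ O := by
      refine hCpre.subset_left_of_subset_union hO hO' hdisj
        (fun x hx => (hCsub x hx).imp_left fun h => himg h) ⟨_, hinfC, himg ?_⟩
      exact ⟨_, M'.infty_mem, M'.infty g hg⟩
    have hCY : C ⊆ H' g '' Y := fun x hx => (hCsub x hx).resolve_right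
      (disjoint_left.1 hdisj (hCO hx))
    have : CompactSpace Y := isCompact_iff_compactSpace.1 M'.closed.isCompact
    have hemb : IsClosedEmbedding (Y.domRestrict (H' g)) :=
      (continuousOn_iff_continuous_domRestrict.1 hcg).isClosedEmbedding
        (injOn_iff_injective.1 (M'.inj g hg))
    have himC : Y.domRestrict (H' g) '' (Y.domRestrict (H' g) ⁻¹' C) = C := by
      rw [image_preimage_eq_iff, range_domRestrict]
      exact hCY
    have hpre : IsPreconnected (Y.domRestrict (H' g) ⁻¹' C) := by
      rw [← hemb.isInducing.isPreconnected_image, himC]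
      exact hCpre
    have hsub : ((↑) : Y → Sphere) '' (Y.domRestrict (H' g) ⁻¹' C) ⊆
        connectedComponentIn (f.1 ⁻¹' X) ∞ := by
      refine (hpre.image _ continuous_subtype_val.continuousOn).subset_connectedComponentIn
        ⟨⟨_, M'.infty_mem⟩, ?_, rfl⟩ ?_
      · rw [mem_preimage, domRestrict_apply, M'.infty g hg]
        exact hinfC
      · rintro _ ⟨y, -, rfl⟩
        exact hYX y.2
    intro x hx
    obtain ⟨y, hy, rfl⟩ := hCY hx
    exact ⟨y, hsub ⟨⟨y, hy⟩, hx, rfl⟩, rfl⟩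

end GraphMotion

/-! ### Julia points -/

lemma finite_iterate_fiber (hd : 3 ≤ d) (g : NewtonMap d) (n : ℕ) (w : Sphere) :
    (g.1^[n] ⁻¹' {w}).Finite := by
  induction n with
  | zero => exact finite_singleton w
  | succ n ih =>
    rw [Function.iterate_succ, preimage_comp]
    exact ih.preimage' fun b _ => finite_fiber hd g b

/-- The preimages of the repelling fixed point `∞` are Julia points: on a normal neighbourhood of
such a point all late iterates would stay near `∞`. -/
lemma mem_juliaSet_of_iterate (hd : 3 ≤ d) (f : NewtonMap d) {n : ℕ} {z : Sphere}
    (hz : f.1^[n] z = ∞) : z ∈ juliaSet f.1 := by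
  rintro ⟨U, hU, hzU, hcomp⟩
  obtain ⟨R, c, C, μ, hR, hc, -, hrep⟩ := exists_repelling hd f
  have hrep := hrep.self_of_nhds
  have hinfm : ∀ m, n ≤ m → f.1^[m] z = ∞ := by
    intro m hm
    obtain ⟨j, rfl⟩ := Nat.exists_eq_add_of_le' hm
    rw [Function.iterate_add_apply, hz, Function.iterate_fixed f.map_infty]
  have : LocallyCompactSpace U := hU.locallyCompactSpace
  set K := closure (range fun n : ℕ => (iter f.1 n).restrict U) ∩
    {φ : C(U, Sphere) | φ ⟨z, hzU⟩ = ∞} with hK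
  have hKc : IsCompact K := hcomp.inter_right
    (isClosed_singleton.preimage
    (by fun_prop : Continuous fun φ : C(U, Sphere) => φ ⟨z, hzU⟩))
  have h1 : ∀ᶠ x in 𝓝 (⟨z, hzU⟩ : U), ∀ φ ∈ K,
      φ x ∈ localParam ∞ '' closedBall 0 R := by
    refine eventually_forall_compact hKc fun φ hφ => ?_
    have h2 : Tendsto (fun q : U × C(U, Sphere) => q.2 q.1) (𝓝 ⟨z, hzU⟩ ×ˢ 𝓝[K] φ)
        (𝓝 ∞) := by
      have h3 : Continuous fun q : U × C(U, Sphere) => q.2 q.1 := by fun_prop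
      have h4 := h3.tendsto (⟨z, hzU⟩, φ)
      rw [nhds_prod_eq, show φ ⟨z, hzU⟩ = ∞ from hφ.2] at h4
      exact h4.mono_left (Filter.prod_mono_right _ nhdsWithin_le_nhds)
    exact h2.eventually (image_closedBall_mem_nhds _ hR)
  have h2 : ∀ᶠ x in 𝓝 z, ∀ m, n ≤ m →
      f.1^[m] x ∈ localParam ∞ '' closedBall 0 R := by
    have h3 : ∀ᶠ x : U in 𝓝 (⟨z, hzU⟩ : U), ∀ m, n ≤ m →
        f.1^[m] (x : Sphere) ∈ localParam ∞ '' closedBall 0 R :=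
      h1.mono fun x hx m hm => hx _ ⟨subset_closure ⟨m, rfl⟩, hinfm m hm⟩
    rw [nhds_subtype_eq_comap, Filter.eventually_comap] at h3
    filter_upwards [h3, hU.mem_nhds hzU] with x hx hxU using hx ⟨x, hxU⟩ rfl
  have h3 : ∀ᶠ x in 𝓝 z, f.1^[n] x = ∞ := by
    filter_upwards [h2] with x hx
    by_contra hne
    set t : ℕ → ℂ := fun j => localCoord ∞ (f.1^[n + j] x) with ht
    have hmem : ∀ j, t j ∈ closedBall (0 : ℂ) R ∧
        localParam ∞ (t j) = f.1^[n + j] x := by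
      intro j
      obtain ⟨s, hs, hsx⟩ := hx (n + j) (by omega)
      have : t j = s := by rw [ht]; simp only; rw [← hsx, localCoord_localParam]
      rw [this]
      exact ⟨hs, hsx⟩
    have hgrow : ∀ j, c ^ j * ‖t 0‖ ≤ ‖t j‖ := by
      intro j
      induction j with
      | zero => simp
      | succ j ih =>
        have h4 := (hrep (t j) (hmem j).1).2.1
        rw [locRep, (hmem j).2, ← Function.iterate_succ_apply' f.1] at h4
        calc c ^ (j + 1) * ‖t 0‖ = c * (c ^ j * ‖t 0‖) := by ring
          _ ≤ c * ‖t j‖ := by gcongr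
          _ ≤ _ := h4
    have ht0 : 0 < ‖t 0‖ := by
      rw [norm_pos_iff]
      intro h0
      have h4 := (hmem 0).2
      rw [h0, localParam_zero] at h4
      exact hne h4.symm
    obtain ⟨j, hj⟩ := pow_unbounded_of_one_lt (R / ‖t 0‖) hc
    rw [div_lt_iff₀ ht0] at hj
    have h5 := mem_closedBall_zero_iff.1 (hmem j).1
    linarith [hgrow j]
  rw [eventually_localParam] at h3
  refine infinite_of_mem_nhds (0 : ℂ) h3 ?_
  exact (finite_iterate_fiber hd f n ∞).preimage (localParam_injective z).injOn

namespace GraphMotion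

/-! ### Following points of the preimage -/

/-- Near a point of the graph, the maps near `f` and their iterates take the value at the moved
point only once. -/
lemma eventually_eq_of_iterate_eq (hd : 3 ≤ d) (M : GraphMotion f X 𝒢 H) (n : ℕ)
    {v : Sphere} (hv : v ∈ X) : ∀ᶠ q : NewtonMap d × Sphere in 𝓝[𝒢] f ×ˢ 𝓝 v,
      q.1.1^[n] q.2 = q.1.1^[n] (H q.1 v) → q.2 = H q.1 v := by
  induction n generalizing v with
  | zero => exact Filter.Eventually.of_forall fun q h => h
  | succ n ih =>
    have h1 : Tendsto (fun q : NewtonMap d × Sphere => (q.1, q.1.1 q.2))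
        (𝓝[𝒢] f ×ˢ 𝓝 v) (𝓝[𝒢] f ×ˢ 𝓝 (f.1 v)) := by
      refine Filter.tendsto_fst.prodMk ((continuous_newton_eval.tendsto (f, v)).mono_left ?_)
      rw [nhds_prod_eq]
      exact Filter.prod_mono_left _ nhdsWithin_le_nhds
    have h2 : Tendsto (fun g => H g v) (𝓝[𝒢] f) (𝓝 v) :=
      (M.continuousWithinAt_base hv).comp (Filter.tendsto_id.prodMk
        (Filter.tendsto_const_pure.mono_right (pure_le_nhdsWithin hv)))
    have h3 : Tendsto (fun q : NewtonMap d × Sphere => (q.1, H q.1 v, q.2))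
        (𝓝[𝒢] f ×ˢ 𝓝 v) (𝓝 f ×ˢ (𝓝 v ×ˢ 𝓝 v)) :=
      (Filter.tendsto_fst.mono_right nhdsWithin_le_nhds).prodMk
        ((h2.comp Filter.tendsto_fst).prodMk Filter.tendsto_snd)
    have h𝒢 : ∀ᶠ g in 𝓝[𝒢] f, g ∈ 𝒢 := eventually_mem_nhdsWithin
    filter_upwards [h1.eventually (ih (M.maps hv)), h3.eventually (eventually_eq_of_apply_eq hd f v),
      h𝒢.prod_inl _, (M.deg v hv).prod_inl _] with q hq1 hq2 hq3 hq4 heq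
    have hequiv := M.equiv q.1 hq3 v hv
    rw [Function.iterate_succ_apply, Function.iterate_succ_apply, hequiv] at heq
    refine hq2 (fun h => ?_) (fun h => ?_) hq4.ge ((hq1 heq).trans hequiv.symm)
    · rw [h, M.infty _ hq3]
    · rw [hequiv, h, M.infty _ hq3]

lemma tendsto_const (M : GraphMotion f X 𝒢 H) {v : Sphere} (hv : v ∈ X) :
    Tendsto (fun g => H g v) (𝓝[𝒢] f) (𝓝 v) :=
  (M.continuousWithinAt_base hv).comp (Filter.tendsto_id.prodMk
    (Filter.tendsto_const_pure.mono_right (pure_le_nhdsWithin hv)))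

lemma iterate_equiv (M : GraphMotion f X 𝒢 H) {g : NewtonMap d} (hg : g ∈ 𝒢)
    (n : ℕ) {x : Sphere} (hx : x ∈ X) : g.1^[n] (H g x) = H g (f.1^[n] x) := by
  induction n generalizing x with
  | zero => rfl
  | succ n ih =>
    rw [Function.iterate_succ_apply, Function.iterate_succ_apply, M.equiv g hg x hx, ih (M.maps hx)]

/-- Solutions in a compact neighbourhood that isolates `z` in its fibre converge to `z`. -/
lemma eventually_exists_of_isolated (M : GraphMotion f X 𝒢 H)
    {z : Sphere} (hz : f.1 z ∈ X) {K : Set Sphere} (hK : IsClosed K)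
    (hKi : ∀ x ∈ K, f.1 x = f.1 z → x = z)
    (hex : ∀ g ∈ 𝒢, ∃ x ∈ K, g.1 x = H g (f.1 z) ∧ localDegree g.1 x = localDegree f.1 z)
    {U : Set Sphere} (hU : U ∈ 𝓝 z) : ∀ᶠ g : NewtonMap d in 𝓝[𝒢] f, ∃ x ∈ U,
      g.1 x = H g (f.1 z) ∧ localDegree g.1 x = localDegree f.1 z := by
  choose! x hxK hx hxd using hex
  have h𝒢 : ∀ᶠ g in 𝓝[𝒢] f, g ∈ 𝒢 := eventually_mem_nhdsWithin
  have h1 : Tendsto x (𝓝[𝒢] f) (𝓝 z) := by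
    refine tendsto_of_compact_unique hK.isCompact (h𝒢.mono hxK) fun y hy hne => ?_
    have h2 : Tendsto (fun q : NewtonMap d × Sphere => q.1.1 q.2) (𝓝[𝒢] f ×ˢ 𝓝 y)
        (𝓝 (f.1 y)) := by
      refine (continuous_newton_eval.tendsto (f, y)).mono_left ?_
      rw [nhds_prod_eq]
      exact Filter.prod_mono_left _ nhdsWithin_le_nhds
    filter_upwards [eventually_ne_of_tendsto h2 ((M.tendsto_const hz).comp Filter.tendsto_fst)
      fun h => hne (hKi y hy h), h𝒢.prod_inl _] with q hq hq𝒢 heq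
    exact hq (by rw [← heq, hx _ hq𝒢]; rfl)
  filter_upwards [h1.eventually hU, h𝒢] with g hg hg𝒢 using ⟨x g, hg, hx g hg𝒢, hxd g hg𝒢⟩

/-- A point can be followed with its local degree if all critical points near it keep being mapped
to the moved point of its image. -/
lemma eventually_exists_apply_eq (hd : 3 ≤ d) (M : GraphMotion f X 𝒢 H)
    {z : Sphere} (hzi : z ≠ ∞) (hz : f.1 z ∈ X) {ρ : ℝ} (hρ : 0 < ρ)
    (hcrit : ∀ᶠ g in 𝓝[𝒢] f, ∀ t ∈ ball (0 : ℂ) ρ, deriv (locRep g.1 z (f.1 z)) t = 0 →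
      g.1 (localParam z t) = H g (f.1 z)) {U : Set Sphere} (hU : U ∈ 𝓝 z) :
    ∀ᶠ g : NewtonMap d in 𝓝[𝒢] f, ∃ x ∈ U, g.1 x = H g (f.1 z) ∧
      localDegree g.1 x = localDegree f.1 z := by
  obtain ⟨δ, hδ, hdeg, A₀, hA₀, hA₀0, hev⟩ := exists_locRep_factor hd f z
  have h0 : f.1 (localParam z 0) ∈ chartDom (f.1 z) := by
    rw [localParam_zero]; exact mem_chartDom_self _
  obtain ⟨R, hR, -, hRg⟩ := exists_locRep_radius hd f (z := z) (v := f.1 z) (t₀ := 0) h0 one_pos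
  obtain ⟨ρ', hρ', hρ'ρ, hρU⟩ := exists_image_ball_subset hU (lt_min hρ hR)
  have hρ'R : ρ' ≤ R := hρ'ρ.trans (min_le_right _ _)
  obtain ⟨κ, hκ, hFC⟩ := exists_multiple_point hR (hRg 1 one_pos).self_of_nhds.1 hδ hA₀ hA₀0 hev
    hρ' hρ'R
  have hω : ∀ᶠ g in 𝓝[𝒢] f, H g (f.1 z) ∈ chartDom (f.1 z) ∧
      ‖localCoord (f.1 z) (H g (f.1 z))‖ ≤ κ := by
    have h1 := ((tendsto_localCoord (f.1 z)).comp (M.tendsto_const hz)).eventually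
      (closedBall_mem_nhds (0 : ℂ) hκ)
    have h2 : ∀ᶠ g in 𝓝[𝒢] f, H g (f.1 z) ∈ chartDom (f.1 z) :=
      (M.tendsto_const hz).eventually ((isOpen_chartDom _).mem_nhds (mem_chartDom_self _))
    filter_upwards [h1, h2] with g h1 h2
    exact ⟨h2, by simpa using h1⟩
  have h𝒢 : ∀ᶠ g in 𝓝[𝒢] f, g ∈ 𝒢 := eventually_mem_nhdsWithin
  filter_upwards [hω, hcrit, (hRg κ hκ).filter_mono nhdsWithin_le_nhds, h𝒢] with g hgω hgc hg hg𝒢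
  have hsub : ball (0 : ℂ) ρ' ⊆ ball 0 R := ball_subset_ball hρ'R
  obtain ⟨τ, hτ, hτω, hτδ⟩ := hFC _ hg.1 (fun t ht => (hg.2 t ht).2) _ hgω.2 fun t ht hder => by
    rw [locRep, hgc t (ball_subset_ball (hρ'ρ.trans (min_le_left _ _)) ht) hder]
  have hτd := (hg.2 τ (hsub hτ)).1
  have hgτ : g.1 (localParam z τ) = H g (f.1 z) := localCoord_injOn _ hτd hgω.1 hτω
  refine ⟨localParam z τ, hρU ⟨τ, hτ, rfl⟩, hgτ, ?_⟩
  rw [hdeg, ← hτδ, ← hτω]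
  exact localDegree_eq_order (fun h => absurd h hzi)
    (fun h => by rw [hgτ, h, M.infty g hg𝒢]) hτd

/-- Noncritical points of the preimage can be followed. -/
lemma eventually_exists_of_not_critical (hd : 3 ≤ d) (M : GraphMotion f X 𝒢 H)
    {z : Sphere} (hzi : z ≠ ∞) (hz : f.1 z ∈ X) (hnc : z ∉ criticalPoints f.1)
    {U : Set Sphere} (hU : U ∈ 𝓝 z) : ∀ᶠ g : NewtonMap d in 𝓝[𝒢] f, ∃ x ∈ U,
      g.1 x = H g (f.1 z) ∧ localDegree g.1 x = localDegree f.1 z := by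
  have h0 : f.1 (localParam z 0) ∈ chartDom (f.1 z) := by
    rw [localParam_zero]; exact mem_chartDom_self _
  obtain ⟨R, hR, -, hRg⟩ := exists_locRep_radius hd f (z := z) (v := f.1 z) (t₀ := 0) h0 one_pos
  obtain ⟨ε₀, hε₀, -, ⟨η₀, hη₀, hinj⟩, -⟩ := exists_simple_zero hR
    (hRg 1 one_pos).self_of_nhds.1 (locRep_zero _ _) (deriv_locRep_ne_zero hd f hnc)
  refine M.eventually_exists_apply_eq hd hzi hz hε₀ ?_ hU
  filter_upwards [(hRg η₀ hη₀).filter_mono nhdsWithin_le_nhds] with g hg t ht hder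
  exact absurd hder ((hinj _ hg.1 fun u hu => (hg.2 u hu).2).2 t (ball_subset_closedBall ht))

/-- Critical points in the roots-basin can be followed: being eventually mapped to the center of an
immediate basin forces the critical points of nearby maps to be mapped to the graph. -/
lemma eventually_exists_of_root (hd : 3 ≤ d) (M : GraphMotion f X 𝒢 H)
    (B : BottcherSystem f) (h𝒢 : 𝒢 ⊆ B.dom) {n : ℕ} {z : Sphere} (hz : f.1 z ∈ X) {a : ℂ}
    (ha : a ∈ B.Z) (hac : (a : Sphere) ∈ criticalPoints f.1) (hza : f.1^[n] (f.1 z) = (a : Sphere))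
    {U : Set Sphere} (hU : U ∈ 𝓝 z) : ∀ᶠ g : NewtonMap d in 𝓝[𝒢] f, ∃ x ∈ U,
      g.1 x = H g (f.1 z) ∧ localDegree g.1 x = localDegree f.1 z := by
  have hinf : ∀ x : Sphere, (∃ m, f.1^[m] x = (a : Sphere)) → x ≠ ∞ := by
    rintro x ⟨m, hm⟩ rfl
    rw [Function.iterate_fixed f.map_infty] at hm
    exact OnePoint.infty_ne_coe _ hm
  have hvi : f.1 z ≠ ∞ := hinf _ ⟨n, hza⟩
  have hzi : z ≠ ∞ := hinf _ ⟨n + 1, hza⟩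
  have hmapsn : ∀ m, ∀ x ∈ X, f.1^[m] x ∈ X := fun m x hx => M.maps.iterate m hx
  have haX : (a : Sphere) ∈ X := hza ▸ hmapsn n _ hz
  have hdisc : ((↑) : ℂ → Sphere) '' closedBall a (B.ε a) ∈ 𝓝 (a : Sphere) :=
    OnePoint.isOpenEmbedding_coe.isOpenMap.image_mem_nhds
      (closedBall_mem_nhds a (B.ε_pos a))
  -- the moved root is a root
  have hHa : ∀ᶠ g in 𝓝[𝒢] f, H g a = (B.α a g : Sphere) := by
    have h1 : ∀ᶠ g in 𝓝[𝒢] f, g ∈ 𝒢 := eventually_mem_nhdsWithin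
    filter_upwards [(M.tendsto_const haX).eventually hdisc, h1] with g hg hg𝒢
    obtain ⟨x, hx, hxH⟩ := hg
    have hfa : f.1 a = (a : Sphere) :=
      (show (a : Sphere) ∈ rootPoints f.1 from B.rootPoints_eq ▸ ⟨a, ha, rfl⟩).2
    have hfix := M.equiv g hg𝒢 a haX
    rw [hfa, ← hxH] at hfix
    rw [← hxH, B.eq_of_fixed ha (B.mem_N (h𝒢 hg𝒢)) hx hfix]
  have hdom : ∀ᶠ x in 𝓝 z, x ∈ chartDom z := (isOpen_chartDom z).mem_nhds (mem_chartDom_self z)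
  have hcont : ∀ m, Tendsto (fun q : NewtonMap d × Sphere => q.1.1^[m] q.2)
      (𝓝[𝒢] f ×ˢ 𝓝 z) (𝓝 (f.1^[m] z)) := by
    intro m
    refine ((continuous_newton_iterate m).tendsto (f, z)).mono_left ?_
    rw [nhds_prod_eq]
    exact Filter.prod_mono_left _ nhdsWithin_le_nhds
  have hpull : Tendsto (fun q : NewtonMap d × Sphere => (q.1, q.1.1 q.2))
      (𝓝[𝒢] f ×ˢ 𝓝 z) (𝓝[𝒢] f ×ˢ 𝓝 (f.1 z)) := Filter.tendsto_fst.prodMk (hcont 1)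
  have h1 : ∀ᶠ g in 𝓝[𝒢] f, g ∈ 𝒢 := eventually_mem_nhdsWithin
  have hmain : ∀ᶠ q : NewtonMap d × Sphere in 𝓝[𝒢] f ×ˢ 𝓝 z, q.2 ∈ criticalPoints q.1.1 →
      q.1.1 q.2 = H q.1 (f.1 z) := by
    filter_upwards [(hcont (n + 1)).eventually (by rwa [Function.iterate_succ_apply, hza]),
      hpull.eventually (M.eventually_eq_of_iterate_eq hd n hz), h1.prod_inl _, hHa.prod_inl _]
      with q hq1 hq2 hq3 hq4 hcrit
    obtain ⟨g, x⟩ := q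
    simp only at hq1 hq2 hq3 hq4 hcrit ⊢
    obtain ⟨y, hy, hyx⟩ := hq1
    have hgdom := h𝒢 hq3
    have hgN := B.mem_N hgdom
    have hroot := B.root_mem ha hgN
    obtain ⟨hB, hB0, -⟩ := B.bottcher a ha hac g hgdom.1 hgdom.2
    have hyb := B.basin a ha g hgN y hy
    have hxb : x ∈ rootsBasin g.1 :=
      immediateBasin_subset_rootsBasin hroot (n + 1) (by rw [← hyx]; exact hyb)
    obtain ⟨m, hm⟩ := hgdom.2 x hxb hcrit
    rw [← hB0, ← hB.image_eq_immediateBasin (B.two_le a ha hac)] at hyb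
    obtain ⟨w, hw, hwy⟩ := hyb
    have hw0 : w = 0 := by
      refine hB.eq_zero_of_iterate_root (B.two_le a ha hac) hw (n := m) ?_
      change g.1^[m] ((fun w : ℂ => ((B.ψ a g w : ℂ) : Sphere)) w) ∈ _
      rw [hwy, hyx, ← Function.iterate_add_apply, add_comm, Function.iterate_add_apply,
        Function.iterate_fixed hm.2]
      exact hm
    refine hq2 ?_
    rw [M.iterate_equiv hq3 n hz, hza, hq4, ← hB0, ← Function.iterate_succ_apply, ← hyx, ← hwy, hw0]
  have hchart : ∀ᶠ q : NewtonMap d × Sphere in 𝓝[𝒢] f ×ˢ 𝓝 z, q.1.1 q.2 ∈ chartDom (f.1 z) :=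
    (hcont 1).eventually ((isOpen_chartDom _).mem_nhds (mem_chartDom_self _))
  obtain ⟨N, hN, V, hV, hNV⟩ := Filter.mem_prod_iff.1 (hmain.and hchart)
  obtain ⟨ρ, hρ, -, hρV⟩ := exists_image_ball_subset hV one_pos
  refine M.eventually_exists_apply_eq hd hzi hz hρ ?_ hU
  filter_upwards [hN] with g hg t ht hder
  obtain ⟨hcr, hch⟩ := hNV (mk_mem_prod hg (hρV ⟨t, ht, rfl⟩) : (g, localParam z t) ∈ N ×ˢ V)
  refine hcr ?_
  have han := analyticAt_locRep hd g hch
  change (2 : ℕ∞) ≤ localDegree g.1 (localParam z t)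
  rw [localDegree_eq_order (fun h => absurd h hzi) (fun h => absurd h hvi) hch,
    ← han.analyticOrderAt_deriv_add_one]
  have h2 := Order.one_le_iff_ne_zero.2 (mt han.deriv.analyticOrderAt_eq_zero.1 (not_not.2 hder))
  calc (2 : ℕ∞) = 1 + 1 := by norm_num
    _ ≤ _ := by gcongr

end GraphMotion

/-! ### Induction on the level -/

/-- A continuous marking over `Λ` of the Julia critical points of `f` in the Newton graph of level
`k`, which keeps the local degrees and the relation of being eventually mapped to `∞`. -/
structure JuliaMarking (f : NewtonMap d) (k : ℕ) (Λ : Set (NewtonMap d))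
    (γ : Sphere → NewtonMap d → Sphere) : Prop where
  cont : ∀ c ∈ graphJuliaCritical f.1 k, ContinuousOn (γ c) Λ
  base : ∀ c ∈ graphJuliaCritical f.1 k, γ c f = c
  deg : ∀ c ∈ graphJuliaCritical f.1 k, ∀ g ∈ Λ, localDegree g.1 (γ c g) = localDegree f.1 c
  infty : ∀ c ∈ graphJuliaCritical f.1 k, ∀ n : ℕ, f.1^[n] c = ∞ → ∀ g ∈ Λ,
    g.1^[n] (γ c g) = ∞

lemma JuliaMarking.of_succ {k : ℕ} {Λ : Set (NewtonMap d)}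
    {γ : Sphere → NewtonMap d → Sphere} (h : JuliaMarking f (k + 1) Λ γ) : JuliaMarking f k Λ γ := by
  have hsub : graphJuliaCritical f.1 k ⊆ graphJuliaCritical f.1 (k + 1) := fun c hc =>
    ⟨newtonGraph_subset_succ f k hc.1, hc.2⟩
  exact ⟨fun c hc => h.cont c (hsub hc), fun c hc => h.base c (hsub hc),
    fun c hc => h.deg c (hsub hc), fun c hc => h.infty c (hsub hc)⟩

lemma GraphMotion.mono_family {X : Set Sphere}
    {𝒢 𝒢' : Set (NewtonMap d)} {H : NewtonMap d → Sphere → Sphere} (M : GraphMotion f X 𝒢 H)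
    (h : 𝒢' ⊆ 𝒢) (hf : f ∈ 𝒢') : GraphMotion f X 𝒢' H :=
  ⟨M.closed, hf, M.infty_mem, M.maps, M.cont.mono (prod_mono h subset_rfl), M.base,
    fun g hg => M.infty g (h hg), fun g hg => M.inj g (h hg), fun g hg => M.equiv g (h hg),
    fun v hv ε hε => Filter.prod_mono_left _ (nhdsWithin_mono _ h) (M.conf v hv ε hε),
    fun v hv => nhdsWithin_mono _ h (M.deg v hv)⟩

/-- The critical points of the graph of level `n` are eventually mapped to `∞` or to a
superattracting root. -/
lemma BottcherSystem.iterate_critical (hd : 3 ≤ d)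
    (B : BottcherSystem f) (hf : f ∈ B.dom) {n : ℕ} {z : Sphere} (hz : z ∈ newtonGraph f.1 n)
    (hcrit : z ∈ criticalPoints f.1) : f.1^[n] z = ∞ ∨
      ∃ a ∈ B.Z, (a : Sphere) ∈ criticalPoints f.1 ∧ f.1^[n] z = (a : Sphere) := by
  have hz0 : z ∈ f.1^[n] ⁻¹' newtonGraphZero f.1 := connectedComponentIn_subset _ _ hz
  rw [mem_preimage, B.newtonGraphZero_eq hd hf] at hz0
  refine hz0.imp_right fun h => ?_
  obtain ⟨p, hp, r, hr, hray⟩ := mem_iUnion₂.1 h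
  obtain ⟨hB, hB0, -⟩ := B.bottcher p.1 hp.1 hp.2.1 f hf.1 hf.2
  have hm := B.two_le p.1 hp.1 hp.2.1
  have hw := ofReal_mul_mem_ball hp.2.2.1 hr
  have hα := B.α_self hp.1
  have hroot : (p.1 : Sphere) ∈ rootPoints f.1 := B.rootPoints_eq ▸ ⟨p.1, hp.1, rfl⟩
  have hmem : f.1^[n] z ∈ immediateBasin f.1 (p.1 : Sphere) := by
    rw [← hray, ← hα, ← hB0, ← hB.image_eq_immediateBasin hm]
    exact ⟨_, hw, rfl⟩
  obtain ⟨j, hj⟩ := hf.2 z (immediateBasin_subset_rootsBasin hroot n hmem) hcrit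
  -- the centre is the only point of the basin that reaches a root
  have hw0 := hB.eq_zero_of_iterate_root hm hw (n := j) (by
    change f.1^[j] (B.ray p f r) ∈ _
    rw [hray, ← Function.iterate_add_apply, add_comm, Function.iterate_add_apply,
      Function.iterate_fixed hj.2]
    exact hj)
  refine ⟨p.1, hp.1, hp.2.1, ?_⟩
  rw [← hray]
  change ((B.ψ p.1 f _ : ℂ) : Sphere) = _
  rw [hw0, hB0, hα]

/-- The point `c` is isolated in the iterated preimage of `∞`, which is finite. -/
lemma exists_isolating_nhds (hd : 3 ≤ d) (f : NewtonMap d) (n : ℕ) (c : Sphere) :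
    ∃ K ∈ 𝓝 c, IsClosed K ∧ ∀ x ∈ K, f.1^[n] x = ∞ → x = c := by
  have hfin := (finite_iterate_fiber hd f n ∞).subset
    (sdiff_subset (t := {c}))
  obtain ⟨K, ⟨hK, hKc⟩, hKs⟩ := (closed_nhds_basis c).mem_iff.1
    (hfin.isClosed.isOpen_compl.mem_nhds (fun h => h.2 rfl))
  refine ⟨K, hK, hKc, fun x hx hxi => ?_⟩
  by_contra hne
  exact hKs hx ⟨hxi, hne⟩

/-- A marked point that is eventually mapped to `∞` stays near the critical point over a connected
set of maps, and its image is the moved image of the critical point. -/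
lemma GraphMotion.eventually_marking (hd : 3 ≤ d) (M : GraphMotion f X 𝒢 H)
    {n : ℕ} {c : Sphere} (hc : f.1 c ∈ X) (hci : f.1^[n + 1] c = ∞) {K : Set Sphere}
    (hK : K ∈ 𝓝 c) (hKc : IsClosed K)
    (hKi : ∀ x ∈ K, f.1^[n + 1] x = ∞ → x = c) :
    ∃ N ∈ 𝓝 f, ∀ Λ ⊆ N ∩ 𝒢, IsPreconnected Λ → f ∈ Λ → ∀ γ : NewtonMap d → Sphere,
      ContinuousOn γ Λ → γ f = c → (∀ g ∈ Λ, g.1^[n + 1] (γ g) = ∞) →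
      ∀ g ∈ Λ, γ g ∈ K ∧ g.1 (γ g) = H g (f.1 c) := by
  have hcont : ∀ x, Tendsto (fun q : NewtonMap d × Sphere => q.1.1^[n + 1] q.2)
      (𝓝 f ×ˢ 𝓝 x) (𝓝 (f.1^[n + 1] x)) := by
    intro x
    rw [← nhds_prod_eq]
    exact (continuous_newton_iterate (n + 1)).tendsto (f, x)
  have hfr : ∀ᶠ g in 𝓝 f, ∀ x ∈ frontier K, g.1^[n + 1] x ≠ ∞ := by
    refine eventually_forall_compact isClosed_frontier.isCompact fun x hx => ?_
    have hne : f.1^[n + 1] x ≠ ∞ := fun h => by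
      obtain rfl := hKi x (hKc.frontier_subset hx) h
      exact hx.2 (mem_interior_iff_mem_nhds.2 hK)
    exact ((hcont x).mono_left (Filter.prod_mono_right _ nhdsWithin_le_nhds)).eventually
      (isOpen_ne.mem_nhds hne)
  have happ : ∀ᶠ g in 𝓝[𝒢] f, ∀ x ∈ K, g.1^[n + 1] x = ∞ →
      g.1 x = H g (f.1 c) := by
    refine eventually_forall_compact hKc.isCompact fun x hx => ?_
    by_cases hxc : x = c
    · subst hxc
      have h𝒢 : ∀ᶠ g in 𝓝[𝒢] f, g ∈ 𝒢 := eventually_mem_nhdsWithin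
      have hpull : Tendsto (fun q : NewtonMap d × Sphere => (q.1, q.1.1 q.2))
          (𝓝[𝒢] f ×ˢ 𝓝[K] x) (𝓝[𝒢] f ×ˢ 𝓝 (f.1 x)) := by
        refine Filter.tendsto_fst.prodMk ((continuous_newton_eval.tendsto (f, x)).mono_left ?_)
        rw [nhds_prod_eq]
        exact Filter.prod_mono nhdsWithin_le_nhds nhdsWithin_le_nhds
      filter_upwards [hpull.eventually (M.eventually_eq_of_iterate_eq hd n hc), h𝒢.prod_inl _]
        with q hq hq𝒢 hqi
      refine hq ?_
      rw [← Function.iterate_succ_apply, hqi, M.iterate_equiv hq𝒢 n hc,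
        ← Function.iterate_succ_apply, hci, M.infty _ hq𝒢]
    · have hne : f.1^[n + 1] x ≠ ∞ := fun h => hxc (hKi x hx h)
      filter_upwards [((hcont x).mono_left (Filter.prod_mono nhdsWithin_le_nhds
        nhdsWithin_le_nhds)).eventually (isOpen_ne.mem_nhds hne)] with q hq hq'
      exact absurd hq' hq
  obtain ⟨U, hU, hU𝒢⟩ := mem_nhdsWithin_iff_exists_mem_nhds_inter.1 happ
  refine ⟨_, Filter.inter_mem hfr hU, fun Λ hΛ hΛc hfΛ γ hγ hγf hγi => ?_⟩
  have himg : IsPreconnected (γ '' Λ) := hΛc.image _ hγ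
  have hsub : γ '' Λ ⊆ interior K := by
    refine himg.subset_left_of_subset_union isOpen_interior hKc.isOpen_compl
      (disjoint_left.2 fun x hx hx' => hx' (interior_subset hx)) ?_
      ⟨c, ⟨f, hfΛ, hγf⟩, mem_interior_iff_mem_nhds.2 hK⟩
    rintro _ ⟨g, hg, rfl⟩
    by_contra hcon
    rw [mem_union, not_or, notMem_compl_iff] at hcon
    refine (hΛ hg).1.1 (γ g) ?_ (hγi g hg)
    rw [hKc.frontier_eq]
    exact ⟨hcon.2, hcon.1⟩
  intro g hg
  have hgK : γ g ∈ K := interior_subset (hsub ⟨g, hg, rfl⟩)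
  exact ⟨hgK, hU𝒢 ⟨(hΛ hg).1.2, (hΛ hg).2⟩ (γ g) hgK (hγi g hg)⟩

/-- A motion of the Newton graph of level `k` over a family of maps that contains every small
connected family with a marking of the Julia critical points. -/
lemma exists_graphMotion (hd : 3 ≤ d) (hf : RootsBasinPCF f.1)
    (B : BottcherSystem f) (k : ℕ) :
    ∃ 𝒢 H, GraphMotion f (newtonGraph f.1 k) 𝒢 H ∧ 𝒢 ⊆ B.dom ∧
      (∀ g ∈ 𝒢, H g '' newtonGraph f.1 k = newtonGraph g.1 k) ∧
      ∃ N ∈ 𝓝 f, ∀ Λ ⊆ N, IsPreconnected Λ → f ∈ Λ → (∀ g ∈ Λ, RootsBasinPCF g.1) →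
        ∀ γ, JuliaMarking f k Λ γ → Λ ⊆ 𝒢 := by
  have hfB := B.self_mem_dom hf
  induction k with
  | zero =>
    refine ⟨B.dom, B.motionZero, ?_, subset_rfl, fun g hg => ?_, B.N', B.N'_mem,
      fun Λ hΛ _ _ hpcf _ _ g hg => ⟨hΛ hg, hpcf g hg⟩⟩
    · rw [newtonGraph_zero hd B hfB]
      exact B.graphMotion hd hfB
    · rw [newtonGraph_zero hd B hfB, newtonGraph_zero hd B hg]
      exact B.image_motionZero hd hfB hg
  | succ k ih =>
    obtain ⟨𝒢, H, M, h𝒢B, himg, N, hN, hNΛ⟩ := ih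
    have hA := finite_criticalPoints hd f
    obtain ⟨Y, O, O', hY, hYX, hSY, hAY, hO, hO', hYO, hYO', hOO⟩ :=
      exists_separation_component (M.closed.preimage f.1.continuous)
        (show ∞ ∈ f.1 ⁻¹' newtonGraph f.1 k from by
          rw [mem_preimage, f.map_infty]; exact M.infty_mem) hA
    rw [← newtonGraph_succ] at hSY hAY
    choose K hK hKc hKi using exists_isolating_nhds hd f (k + 1)
    set A : Set Sphere := {c | c ∈ criticalPoints f.1 ∧ c ∈ newtonGraph f.1 (k + 1) ∧
      f.1^[k + 1] c = ∞} with hAdef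
    have hAfin : A.Finite := hA.subset fun c hc => hc.1
    have hAX : ∀ c ∈ A, f.1 c ∈ newtonGraph f.1 k := fun c hc => hYX (hSY hc.2.1)
    -- the maps for which the critical points eventually mapped to `∞` persist
    set 𝒢₁ : Set (NewtonMap d) := {g | g ∈ 𝒢 ∧ ∀ c ∈ A, ∃ x ∈ K c, g.1 x = H g (f.1 c) ∧
      localDegree g.1 x = localDegree f.1 c} with h𝒢₁
    have hf𝒢₁ : f ∈ 𝒢₁ := ⟨M.mem, fun c hc => ⟨c, mem_of_mem_nhds (hK c),
      (M.base _ (hAX c hc)).symm, rfl⟩⟩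
    have M₁ := M.mono_family (fun g hg => hg.1 : 𝒢₁ ⊆ 𝒢) hf𝒢₁
    have hcenter : ∀ z ∈ Y, ∃ c N, LiftCenter f 𝒢₁ H z c N := by
      intro z hz
      refine M₁.exists_center hd (hYX hz) fun U hU => ?_
      by_cases hzi : z = ∞
      · have h1 : ∀ᶠ g in 𝓝[𝒢₁] f, g ∈ 𝒢₁ := eventually_mem_nhdsWithin
        filter_upwards [h1] with g hg
        subst hzi
        refine ⟨∞, mem_of_mem_nhds hU, fun _ => rfl, ?_, ?_⟩
        · rw [g.map_infty, f.map_infty, M₁.infty g hg]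
        · rw [localDegree_infty hd, localDegree_infty hd]
      suffices h : ∀ᶠ g : NewtonMap d in 𝓝[𝒢₁] f, ∃ x ∈ U, g.1 x = H g (f.1 z) ∧
          localDegree g.1 x = localDegree f.1 z by
        filter_upwards [h] with g ⟨x, hx, hgx⟩ using ⟨x, hx, fun h => absurd h hzi, hgx⟩
      by_cases hcrit : z ∈ criticalPoints f.1
      · have hzS := hAY z hcrit hz
        obtain hzinf | ⟨a, ha, hac, hza⟩ := B.iterate_critical hd hfB hzS hcrit
        · exact M₁.eventually_exists_of_isolated (hYX hz) (hKc z) (fun x hx hfx => hKi z x hx (by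
              rw [Function.iterate_succ_apply, hfx, ← Function.iterate_succ_apply, hzinf]))
            (fun g hg => hg.2 z ⟨hcrit, hzS, hzinf⟩) hU
        · exact M₁.eventually_exists_of_root hd B (fun g hg => h𝒢B hg.1) (hYX hz) ha hac hza hU
      · exact M₁.eventually_exists_of_not_critical hd hzi (hYX hz) hcrit hU
    have hXY : newtonGraph f.1 k ⊆ Y := (newtonGraph_subset_succ f k).trans hSY
    obtain ⟨𝒢', h𝒢'sub, h𝒢', H', M', hext, himgO, hsurj⟩ :=
      M₁.lift hd hY hYX hXY hO hO' hYO hYO' hOO hcenter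
    have hclosed : IsClosed (newtonGraph f.1 (k + 1)) := by
      rw [newtonGraph_succ]
      exact isClosed_connectedComponentIn (M.closed.preimage f.1.continuous) _
    obtain ⟨U, hU, hU𝒢⟩ := mem_nhdsWithin_iff_exists_mem_nhds_inter.1 h𝒢'
    -- over a connected set of maps the marked points stay near the critical points of `f`
    have hmark := fun c (hc : c ∈ A) =>
      M.eventually_marking hd (hAX c hc) hc.2.2 (hK c) (hKc c) (hKi c)
    choose! V hV hVΛ using hmark
    refine ⟨𝒢', H', M'.restrict hclosed hSY (infty_mem_newtonGraph f _) (mapsTo_newtonGraph f _),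
      fun g hg => h𝒢B (h𝒢'sub hg).1, fun g hg => ?_, N ∩ (U ∩ ⋂ c ∈ A, V c),
      Filter.inter_mem hN (Filter.inter_mem hU ((Filter.biInter_mem hAfin).2 hV)),
      fun Λ hΛ hΛc hfΛ hpcf γ hγ g hg => ?_⟩
    · have h1 := M'.image_component hYX (by rwa [← newtonGraph_succ]) hO hO' hOO hg (hext g hg)
        (himgO g hg) (hsurj g hg)
      rwa [himg g (h𝒢'sub hg).1, ← newtonGraph_succ, ← newtonGraph_succ] at h1
    · have hΛ𝒢 : Λ ⊆ 𝒢 := hNΛ Λ (fun g hg => (hΛ hg).1) hΛc hfΛ hpcf γ hγ.of_succ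
      refine hU𝒢 ⟨(hΛ hg).2.1, hΛ𝒢 hg, fun c hc => ?_⟩
      have hcJ : c ∈ graphJuliaCritical f.1 (k + 1) :=
        ⟨hc.2.1, mem_juliaSet_of_iterate hd f hc.2.2, hc.1⟩
      obtain ⟨h1, h2⟩ := hVΛ c hc Λ (fun g hg => ⟨mem_iInter₂.1 (hΛ hg).2.2 c hc, hΛ𝒢 hg⟩) hΛc hfΛ
        (γ c) (hγ.cont c hcJ) (hγ.base c hcJ) (hγ.infty c hcJ _ hc.2.2) g hg
      exact ⟨γ c g, h1, h2, hγ.deg c hcJ g hg⟩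

theorem proposition3p1 (d : ℕ) (hd : 3 ≤ d) (f : NewtonMap d) (hf : RootsBasinPCF f.1) (k : ℕ) :
    ∃ N ∈ 𝓝 f, ∀ (Λ : Set (NewtonMap d)) (hfΛ : f ∈ Λ), IsConnected Λ → Λ ⊆ N →
      (∀ g ∈ Λ, RootsBasinPCF g.1) →
      ∀ γ : graphJuliaCritical f.1 k → Λ → ℂ,
        (∀ c, Continuous (γ c)) →
        (∀ c, (γ c ⟨f, hfΛ⟩ : Sphere) = c) →
        (∀ c, ∀ g : Λ, localDegree g.1.1 (γ c g : Sphere) = localDegree f.1 c) →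
        (∀ c₁ c₂ : graphJuliaCritical f.1 k, ∀ n : ℕ, f.1^[n] (c₁ : Sphere) = c₂ →
          ∀ g : Λ, g.1.1^[n] (γ c₁ g : Sphere) = (γ c₂ g : Sphere)) →
        (∀ c : graphJuliaCritical f.1 k, ∀ n : ℕ, f.1^[n] (c : Sphere) = OnePoint.infty →
          ∀ g : Λ, g.1.1^[n] (γ c g : Sphere) = OnePoint.infty) →
        ∃ h : Λ × newtonGraph f.1 k → Sphere, Continuous h ∧
          ∀ g : Λ, Function.Injective (fun z => h (g, z)) ∧
            range (fun z => h (g, z)) = newtonGraph g.1.1 k ∧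
            ∀ z, h (g, graphMap f k z) = g.1.1 (h (g, z)) := by
  obtain ⟨B⟩ := exists_bottcherSystem hd f
  obtain ⟨𝒢, H, M, -, himg, N, hN, hNΛ⟩ := exists_graphMotion hd hf B k
  refine ⟨N, hN, fun Λ hfΛ hΛ hΛN hpcf γ hγc hγf hγd _ hγi => ?_⟩
  -- extended by constants, the marking becomes a function on the whole sphere and the whole space
  classical
  set Γ : Sphere → NewtonMap d → Sphere := fun c g =>
    if h : c ∈ graphJuliaCritical f.1 k ∧ g ∈ Λ then (γ ⟨c, h.1⟩ ⟨g, h.2⟩ : Sphere) else c with hΓ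
  have hΓeq : ∀ (c : Sphere) (hc : c ∈ graphJuliaCritical f.1 k) (g : NewtonMap d) (hg : g ∈ Λ),
      Γ c g = (γ ⟨c, hc⟩ ⟨g, hg⟩ : Sphere) := fun c hc g hg => dif_pos ⟨hc, hg⟩
  have hΛ𝒢 : Λ ⊆ 𝒢 := by
    refine hNΛ Λ hΛN hΛ.isPreconnected hfΛ hpcf Γ ⟨fun c hc => ?_, fun c hc => ?_,
      fun c hc g hg => ?_, fun c hc n hn g hg => ?_⟩
    · rw [continuousOn_iff_continuous_domRestrict]
      refine (OnePoint.continuous_coe.comp (hγc ⟨c, hc⟩)).congr fun g => ?_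
      exact (hΓeq c hc g g.2).symm
    · rw [hΓeq c hc f hfΛ, hγf]
    · rw [hΓeq c hc g hg]
      exact hγd ⟨c, hc⟩ ⟨g, hg⟩
    · rw [hΓeq c hc g hg]
      exact hγi ⟨c, hc⟩ n hn ⟨g, hg⟩
  refine ⟨fun q => H q.1 q.2, ?_, fun g => ⟨fun z₁ z₂ h => ?_, ?_, fun z => ?_⟩⟩
  · exact M.cont.comp_continuous (f := fun q : Λ × newtonGraph f.1 k => (q.1.1, q.2.1))
      (by fun_prop) fun q => ⟨hΛ𝒢 q.1.2, q.2.2⟩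
  · exact Subtype.ext (M.inj g (hΛ𝒢 g.2) z₁.2 z₂.2 h)
  · rw [← himg g (hΛ𝒢 g.2), image_eq_range]
  · exact (M.equiv g (hΛ𝒢 g.2) z z.2).symm
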